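/- **Setting.** Let $c\colon\{0,1,2,3\}^2\to\mathbb R$ and let $\Gamma\subset\mathbb R^2$ be the tropical $(3,3)$-curve given as the corner locus of $F(p)=\max_{m}\,(c_m+\langle m,p\rangle)$. For $p\in\mathbb R^2$ let $p^\vee$ be the set of exponents $m$ attaining the maximum at $p$; edges and vertices of $\Gamma$ are dual to edges and polygons of the Newton subdivision. Assume $\Gamma$ is smooth, i.e. its Newton subdivision is a unimodular triangulation of $[0,3]^2$ (the edge lengths are arbitrary). A tropical $(1,1)$-curve $\Lambda$ is encoded by $(v_0,\ell)\in\mathbb R^2\times\mathbb R$: with $v_0=(x,y)$ and $v_1=(x+\ell,y+|\ell|)$, it is the union of the edge $[v_0,v_1]$ and four legs. For $\ell>0$ the legs point west and south from $v_0$, and east and north from $v_1$; for $\ell<0$ they point east and south from $v_0$, and west and north from $v_1$; for $\ell=0$ all four start at $v_0=v_1$ and $\Lambda$ is called 4-valent. The stable intersection multiplicity at $p$ is the sum of the outgoing slopes at $p$ of $F|_\Lambda$ (with respect to primitive integer directions). $\Lambda$ is *tritangent* to $\Gamma$ if the connected components of $\Lambda\cap\Gamma$ have total multiplicities $(2,2,2)$,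 $(2,4)$ or $(6)$. A *tritangent class* $\Omega$ is a connected component of the set of tritangent $(v_0,\ell)\in\mathbb R^3$. Fix any finite polyhedral complex structure on $\Omega$ that is compatible with $\Gamma$: for each cell $\mathcal C$ and each $k\in\{0,1\}$, $v_k^\vee$ is constant on the relative interior of $\mathcal C$. The *bounded complex* $\Omega^b$ consists of those cells whose relative interior contains no $(v_0,\ell)$ satisfying one of the following: * $\ell>0$ and $v_0^\vee=\{(0,0)\}$; or $\ell>0$ and $v_1^\vee=\{(3,3)\}$; or $\ell<0$ and $v_0^\vee=\{(3,0)\}$; or $\ell<0$ and $v_1^\vee=\{(0,3)\}$; * $\ell>0$, $\{(1,0),(0,1)\}\subseteq v_0^\vee$ and $(0,2),(1,1),(2,0)\notin v_0^\vee$; * $\ell>0$, $\{(2,3),(3,2)\}\subseteq v_1^\vee$ and $(1,3),(2,2),(3,1)\notin v_1^\vee$; * $\ell<0$, $\{(2,0),(3,1)\}\subseteq v_0^\vee$ and $(1,0),(2,1),(3,2)\notin v_0^\vee$; * $\ell<0$, $\{(0,2),(1,3)\}\subseteq v_1^\vee$ and $(0,1),(1,2),(2,3)\notin v_1^\vee$.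 $\dim\Omega^b$ is the maximal dimension of its cells. A property holds for *generic* members of a cell $\mathcal C$ if it holds on the relative interior of $\mathcal C$ outside finitely many affine subspaces not containing $\mathcal C$. The dihedral group $D_4$ acts on pairs $(\Gamma,\Lambda)$ by the coordinate swap and the reflections $x\mapsto-x$, $y\mapsto-y$ of the plane (and the corresponding symmetries of $\{0,1,2,3\}^2$). **Tangency types.** Let $\Lambda$ have $\ell\ge0$. Its arms are its open legs $W,S$ (at $v_0$), $E,N$ (at $v_1$) and its open edge $D$ (at both vertices). A component $K$ of $\Lambda\cap\Gamma$ is a tangency of type * $1_a$ (type (1a)): $K=\{P\}$, $P$ in the arm $a$ and in the relative interior of an edge of $\Gamma$, multiplicity 2; * $2_a$ (type (2a)): the same with $P$ a vertex of $\Gamma$; * $3c_a$ (type (3c); (3cc) if $a=D$): $K$ is a segment contained in the arm $a$ with two distinct end points that are vertices of $\Gamma$, multiplicity 2; * $3a_a^k$ (type (3a); (3ac) if $a=D$): $v_k$ lies in the relative interior of an edge of $\Gamma$ and $K=[v_k,A]$ with $A$ a vertex of $\Gamma$ in the arm $a$ at $v_k$, multiplicity 2; * $3aa$: $K=[v_0,v_1]$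 with both $v_0,v_1$ in relative interiors of edges of $\Gamma$, multiplicity 2; * $4a^k$: $K=\{v_k\}$ with $v_k$ in the relative interior of an edge of $\Gamma$ of slope $-1$, multiplicity 2; * $4b^k$: $K=\{v_k\}$ with $v_k$ in the relative interior of an edge of $\Gamma$, multiplicity 4; * $5a^k$: $K=\{v_k\}$, $v_k$ is a vertex of $\Gamma$, and the star of $\Gamma$ at $v_k$ is minus that of a slope-one $\Lambda$ at $v_k$ ($v_0^\vee=\{m,m-e_1,m-e_2\}$, resp. $v_1^\vee=\{m,m+e_1,m+e_2\}$), multiplicity 2; * $6a_a^k$: $v_k$ is a vertex of $\Gamma$ on an edge of slope $-1$ and $K$ is the closed leg $\overline a$ of $\Lambda$ at $v_k$, multiplicity 2; * $3f^k$: $v_k$ is a vertex of $\Gamma$ and $K$ is the union of three segments from $v_k$ to vertices of $\Gamma$, one in each of the three arms at $v_k$, multiplicity 4; * $8$: $v_0,v_1$ are vertices of $\Gamma$ and $K$ is the union of $[v_0,v_1]$ and four segments along the four legs, each from the vertex of $\Lambda$ to a vertex of $\Gamma$ in the open leg, multiplicity 6. **Theorem.** Suppose $\dim\Omega^b\le2$.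 (1) Let $\mathcal C$ be a cell of $\Omega^b$ with $\dim\mathcal C=\dim\Omega^b$. Then, along the relative interior of $\mathcal C$, the vertices of $\Lambda$ move in one of the five ways (i)–(v) below, and every generic member of $\mathcal C$ is, up to $D_4$-symmetry, a curve $\Lambda$ with $\ell>0$ whose components of $\Lambda\cap\Gamma$ are given by one of the lists of tangencies under that item, or, in case (v), possibly a 4-valent $\Lambda$ with tangencies $4a^0,\,3c_S,\,3c_W$. Write $G_1=\{3a^1_E,3a^1_N,4a^1\}$, $G_0=\{3a^0_W,3a^0_S,4a^0\}$, $T_1=G_1\cup\{5a^1,6a^1_E,6a^1_N\}$, $T_0=G_0\cup\{5a^0,6a^0_W,6a^0_S\}$ and $U=T_1\cup\{3c_E,3c_N\}$. (i) $\dim\mathcal C=2$; for some $k$ the vertex $v_k$ determines the curve and sweeps an open set of $\mathbb R^2$: $(1_S,1_D,3c_E)$; $(1_S,1_D,3c_N)$; $(1_S,1_E,3a^0_W)$; $(1_S,4b^1)$; $(1_S,1_W,t)$, $t\in G_1$; $(1_S,t,3a^1_E)$, $t\in\{1_E,2_E,3c_E\}$. (ii) $\dim\mathcal C=2$; both vertices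 move independently along segments in the direction of the edge of $\Lambda$: $(1_S,3aa,1_E)$; $(1_S,3c_D,1_E)$; $(1_S,3c_D,1_N)$; $(1_S,3a^0_D,1_E)$; $(1_S,3a^0_D,1_N)$. (iii) $\dim\mathcal C=1$; both vertices move along segments, and each determines the other: $(3c_S,1_D,3c_E)$; $(3c_S,1_D,3c_N)$; $(1_S,3c_E,3a^0_W)$; $(3c_S,4b^1)$; $(1_S,3c_W,t)$, $t\in G_1$; $(t,3c_E,3a^0_S)$, $t\in\{1_S,2_S,3c_S\}$; $(s,1_D,t)$, $s\in G_0$, $t\in G_1$. (iv) $\dim\mathcal C=1$; one vertex is fixed and the other moves in the direction of the edge of $\Lambda$: $(1_S,3aa,3c_E)$; $(1_S,3c_E,3a^1_N)$; $(1_S,3f^1)$; $(1_S,t,3a^1_D)$, $t\in\{3c_E,3c_N\}$; $(1_S,3c_D,t)$, $t\in U$; $(1_S,3a^0_D,t)$, $t\in U$. (v) $\dim\mathcal C=0$: $(3c_S,3aa,3c_E)$; $(3c_S,3c_E,3a^0_W)$; $(3c_S,3f^1)$; $(8)$; $(3f^0,t)$, $t\in T_1$; $(3c_S,3c_W,t)$,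 $t\in T_1$; $(3c_S,3c_D,t)$, $t\in U$; $(3c_S,3a^0_D,t)$, $t\in U$; $(s,3c_D,t)$, $s\in T_0$, $t\in T_1$. (2) If $\dim\Omega^b=0$ and a member $\Lambda$ of $\Omega^b$ is 4-valent, then $\Lambda\cap\Gamma$ has exactly three components: its vertex, of multiplicity 2 and lying in the relative interior of an edge $e$ of $\Gamma$ of slope $\pm1$ (type (4a')), and two tangencies of type $3c$ on two different legs (type (3c')), both in the same open half-plane bounded by the line spanned by $e$. -/

import Mathlib

open Set Filter Topology

noncomputable section

namespace TropTritangent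

/-! ### Tropical curves of bidegree (3,3) (max convention) -/

/-- The tropical plane `ℝ²`. -/
abbrev Plane := ℝ × ℝ

/-- Exponents `(i, j)` with `0 ≤ i, j ≤ 3`: the lattice points of the square of side three. -/
abbrev Expo := Fin 4 × Fin 4

/-- A lattice point as an integer vector. -/
def Expo.toInt (m : Expo) : ℤ × ℤ := ((m.1 : ℤ), (m.2 : ℤ))

/-- An integer vector as a vector of the plane. -/
def toPlane (r : ℤ × ℤ) : Plane := ((r.1 : ℝ), (r.2 : ℝ))

/-- The value of the tropical monomial with exponent `m` at the point `p`. -/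
def monomial (c : Expo → ℝ) (m : Expo) (p : Plane) : ℝ :=
  c m + (m.1 : ℝ) * p.1 + (m.2 : ℝ) * p.2

open Classical in
/-- The exponents at which the maximum `max_m (c m + ⟨m, p⟩)` is attained: the lattice points of
the cell `p^∨` of the Newton subdivision dual to `p`. -/
def dualCell (c : Expo → ℝ) (p : Plane) : Finset Expo :=
  Finset.univ.filter fun m => ∀ m', monomial c m' p ≤ monomial c m p

theorem dualCell_nonempty (c : Expo → ℝ) (p : Plane) : (dualCell c p).Nonempty := by
  obtain ⟨m, -, hm⟩ := Finset.exists_max_image (Finset.univ : Finset Expo)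
    (fun m => monomial c m p) Finset.univ_nonempty
  exact ⟨m, by simpa [dualCell] using fun a b => hm (a, b) (Finset.mem_univ _)⟩

/-- The tropical curve `Γ`: the corner locus of `p ↦ max_m (c m + ⟨m, p⟩)`. Points of `Γ` in the
relative interior of an edge have two elements in their dual cell; for smooth `Γ`, vertices have
three. -/
def curve (c : Expo → ℝ) : Set Plane := {p | 2 ≤ (dualCell c p).card}

/-- `Γ` is smooth: its Newton subdivision is a unimodular triangulation of the square, that is,
every dual cell has at most three lattice points, and if there are three, they span a triangle of
area one half. -/
def IsSmooth (c : Expo → ℝ) : Prop :=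
  ∀ p, (dualCell c p).card ≤ 3 ∧
    ∀ m ∈ dualCell c p, ∀ m' ∈ dualCell c p, ∀ m'' ∈ dualCell c p,
      m ≠ m' → m ≠ m'' → m' ≠ m'' →
      |(m'.toInt.1 - m.toInt.1) * (m''.toInt.2 - m.toInt.2) -
        (m'.toInt.2 - m.toInt.2) * (m''.toInt.1 - m.toInt.1)| = 1

/-! ### Tropical curves of bidegree (1,1) -/

/-- A (1,1)-curve `Λ` is recorded by the pair `(v₀, ℓ)` of its lowest vertex and the signed length
of its bounded edge. -/
abbrev Param := Plane × ℝ

/-- The vertices `v₀` and `v₁ = (x + ℓ, y + |ℓ|)` of `Λ`. -/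
def vertex (q : Param) : Fin 2 → Plane :=
  ![q.1, (q.1.1 + q.2, q.1.2 + |q.2|)]

/-- The five pieces of `Λ` attached to its vertices: four unbounded legs and the bounded edge. -/
inductive Arm
  | west | south | east | north | diag
  deriving DecidableEq

/-- The direction of a leg. -/
def Arm.dir : Arm → Plane
  | .west => (-1, 0)
  | .south => (0, -1)
  | .east => (1, 0)
  | .north => (0, 1)
  | .diag => (0, 0)

/-- The vertex at which a leg is attached. For `ℓ > 0` the legs at `v₀` point west and south and
those at `v₁` point east and north; for `ℓ < 0` the legs at `v₀` point east and south and those at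
`v₁` point west and north. -/
def armBase (q : Param) : Arm → Plane
  | .west => if 0 ≤ q.2 then vertex q 0 else vertex q 1
  | .south => vertex q 0
  | .east => if 0 ≤ q.2 then vertex q 1 else vertex q 0
  | .north => vertex q 1
  | .diag => vertex q 0

/-- The relative interior of a leg, or of the bounded edge. -/
def armInterior (q : Param) : Arm → Set Plane
  | .diag => openSegment ℝ (vertex q 0) (vertex q 1)
  | a => {p | ∃ t : ℝ, 0 < t ∧ p = armBase q a + t • a.dir}

/-- A closed leg. -/
def leg (q : Param) (a : Arm) : Set Plane := {p | ∃ t : ℝ, 0 ≤ t ∧ p = armBase q a + t • a.dir}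

/-- The (1,1)-curve `Λ` as a subset of the plane. -/
def lam (q : Param) : Set Plane :=
  leg q .west ∪ leg q .south ∪ leg q .east ∪ leg q .north ∪ segment ℝ (vertex q 0) (vertex q 1)

/-! ### Stable intersections and tritangents -/

/-- The primitive integer vectors that can be directions of `Λ`. -/
def directions : Finset (ℤ × ℤ) :=
  {(1, 0), (-1, 0), (0, 1), (0, -1), (1, 1), (-1, -1), (1, -1), (-1, 1)}

open Classical in
/-- The multiplicity at `p` of the stable intersection of `Λ` and `Γ`: the sum of the slopes at `p`
of the restriction of the tropical polynomial of `Γ` to `Λ`, over the primitive directions of `Λ`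
outgoing from `p`. (The slope in direction `r` is `max ⟨m, r⟩` over the cell dual to `p`.) -/
def multAt (c : Expo → ℝ) (q : Param) (p : Plane) : ℤ :=
  ∑ r ∈ directions.filter (fun r => ∀ᶠ t in 𝓝[>] (0 : ℝ), p + t • toPlane r ∈ lam q),
    (dualCell c p).sup' (dualCell_nonempty c p)
      (fun m => m.toInt.1 * r.1 + m.toInt.2 * r.2)

/-- The connected components of `Λ ∩ Γ`. -/
def components (c : Expo → ℝ) (q : Param) : Set (Set Plane) :=
  {K | ∃ p ∈ lam q ∩ curve c, K = connectedComponentIn (lam q ∩ curve c) p}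

/-- The total stable intersection multiplicity on a set `K`. -/
def mult (c : Expo → ℝ) (q : Param) (K : Set Plane) : ℤ := ∑ᶠ p ∈ K, multAt c q p

/-- `Λ` is tritangent to `Γ`: the components of `Λ ∩ Γ` have stable intersection multiplicities
`2, 2, 2`, or `2, 4`, or `6`. -/
def IsTritangent (c : Expo → ℝ) (q : Param) : Prop :=
  ∃ S : Finset (Set Plane), (S : Set (Set Plane)) = components c q ∧
    (S.val.map (mult c q) = {2, 2, 2} ∨ S.val.map (mult c q) = {2, 4} ∨
      S.val.map (mult c q) = {6})

/-- The tritangent class of `q₀`: the connected component of the set of tritangents. -/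
def tritangentClass (c : Expo → ℝ) (q₀ : Param) : Set Param :=
  connectedComponentIn {q | IsTritangent c q} q₀

/-! ### Polyhedral structures and the bounded complex -/

/-- A set of the form `{x | f₁ x ≤ b₁, …, fₙ x ≤ bₙ}`. -/
def IsPolyhedron (P : Set Param) : Prop :=
  ∃ S : Finset ((Param →ₗ[ℝ] ℝ) × ℝ), P = {x | ∀ s ∈ S, s.1 x ≤ s.2}

/-- A polyhedral complex with support `Ω` that is compatible with `Γ`: along the relative interior
of each cell, each vertex of `Λ` stays in one cell of the subdivision of the plane by `Γ`. -/
structure PolyStructure (c : Expo → ℝ) (Ω : Set Param) where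
  cells : Set (Set Param)
  finite : cells.Finite
  polyhedron : ∀ C ∈ cells, IsPolyhedron C
  nonempty : ∀ C ∈ cells, C.Nonempty
  face_mem : ∀ C ∈ cells, ∀ F : Set Param, F.Nonempty → IsExposed ℝ C F → F ∈ cells
  inter_face : ∀ C ∈ cells, ∀ D ∈ cells, (C ∩ D).Nonempty →
    IsExposed ℝ C (C ∩ D) ∧ IsExposed ℝ D (C ∩ D)
  union_eq : ⋃₀ cells = Ω
  compatible : ∀ C ∈ cells, ∀ q ∈ intrinsicInterior ℝ C, ∀ q' ∈ intrinsicInterior ℝ C,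
    ∀ k, dualCell c (vertex q k) = dualCell c (vertex q' k)

/-- The dimension of a cell. -/
def cellDim (C : Set Param) : ℕ := Module.finrank ℝ (vectorSpan ℝ C)

/-- The members of a tritangent class that lie in its unbounded part. -/
def InUnboundedPart (c : Expo → ℝ) (q : Param) : Prop :=
  (0 < q.2 ∧ dualCell c (vertex q 0) = {(0, 0)}) ∨
  (0 < q.2 ∧ dualCell c (vertex q 1) = {(3, 3)}) ∨
  (q.2 < 0 ∧ dualCell c (vertex q 0) = {(3, 0)}) ∨
  (q.2 < 0 ∧ dualCell c (vertex q 1) = {(0, 3)}) ∨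
  (0 < q.2 ∧ {(1, 0), (0, 1)} ⊆ dualCell c (vertex q 0) ∧
    Disjoint (dualCell c (vertex q 0)) {(0, 2), (1, 1), (2, 0)}) ∨
  (0 < q.2 ∧ {(2, 3), (3, 2)} ⊆ dualCell c (vertex q 1) ∧
    Disjoint (dualCell c (vertex q 1)) {(1, 3), (2, 2), (3, 1)}) ∨
  (q.2 < 0 ∧ {(2, 0), (3, 1)} ⊆ dualCell c (vertex q 0) ∧
    Disjoint (dualCell c (vertex q 0)) {(1, 0), (2, 1), (3, 2)}) ∨
  (q.2 < 0 ∧ {(0, 2), (1, 3)} ⊆ dualCell c (vertex q 1) ∧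
    Disjoint (dualCell c (vertex q 1)) {(0, 1), (1, 2), (2, 3)})

/-- The bounded complex `Ω^b`: the cells whose relative interior does not meet the unbounded
part. -/
def PolyStructure.bounded {c : Expo → ℝ} {Ω : Set Param} (X : PolyStructure c Ω) :
    Set (Set Param) :=
  {C ∈ X.cells | ¬ ∃ q ∈ intrinsicInterior ℝ C, InUnboundedPart c q}

/-- The dimension of the bounded complex. -/
def PolyStructure.boundedDim {c : Expo → ℝ} {Ω : Set Param} (X : PolyStructure c Ω) : ℕ :=
  sSup (cellDim '' X.bounded)

/-- A property of generic members of a cell `C`: it holds on the relative interior of `C` away from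
finitely many affine subspaces that do not contain `C`. -/
def Generically (C : Set Param) (P : Param → Prop) : Prop :=
  ∃ S : Set (AffineSubspace ℝ Param), S.Finite ∧ (∀ A ∈ S, ¬ C ⊆ (A : Set Param)) ∧
    ∀ q ∈ intrinsicInterior ℝ C, (∀ A ∈ S, q ∉ A) → P q

/-! ### Vertex movements -/

/-- The five possible movements of the vertices of `Λ` along a cell. -/
inductive Movement
  | ball | independent | dependent | oneFixed | rigid

/-- The vertices of `Λ` move along the relative interior of `C` in the given way. -/
def MovesBy (C : Set Param) : Movement → Prop
  -- one vertex moves on an open set of the plane and determines the other one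
  | .ball => cellDim C = 2 ∧ ∃ k, InjOn (fun q => vertex q k) (intrinsicInterior ℝ C) ∧
      IsOpen ((fun q => vertex q k) '' intrinsicInterior ℝ C)
  -- both vertices move independently along segments parallel to the edge of `Λ`
  | .independent => cellDim C = 2 ∧ ∃ u : Plane, (u = (1, 1) ∨ u = (1, -1)) ∧
      (∀ q ∈ intrinsicInterior ℝ C, ∀ q' ∈ intrinsicInterior ℝ C, ∀ k,
        ∃ t : ℝ, vertex q' k = vertex q k + t • u) ∧
      ∀ q ∈ intrinsicInterior ℝ C, ∃ ε > 0, ∀ a b : ℝ, |a| < ε → |b| < ε →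
        ∃ q' ∈ intrinsicInterior ℝ C,
          vertex q' 0 = vertex q 0 + a • u ∧ vertex q' 1 = vertex q 1 + b • u
  -- both vertices move along segments, each of them determining the other one
  | .dependent => cellDim C = 1 ∧ ∀ k, InjOn (fun q => vertex q k) (intrinsicInterior ℝ C)
  -- one vertex is fixed, the other one moves along a segment parallel to the edge of `Λ`
  | .oneFixed => cellDim C = 1 ∧ ∃ u : Plane, (u = (1, 1) ∨ u = (1, -1)) ∧ ∃ k l, k ≠ l ∧
      ∀ q ∈ intrinsicInterior ℝ C, ∀ q' ∈ intrinsicInterior ℝ C,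
        vertex q' k = vertex q k ∧ ∃ t : ℝ, vertex q' l = vertex q l + t • u
  -- both vertices are fixed
  | .rigid => cellDim C = 0

/-! ### Local tangencies -/

/-- Types of local tangencies, for `Λ` in normal position, that is, with an edge of slope one or
with a single vertex. Here `0` and `1` stand for the lower and the upper vertex of `Λ`. -/
inductive Tangency
  -- (1a)
  | point (a : Arm)
  -- (2a)
  | pointAtVertex (a : Arm)
  -- (3c), (3cc)
  | interiorEdge (a : Arm)
  -- (3a), (3ac)
  | overhang (k : Fin 2) (a : Arm)
  -- (3aa)
  | wholeEdge
  -- (4a) diagonal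
  | crossing (k : Fin 2)
  -- (4b)
  | crossingFour (k : Fin 2)
  -- (5a)
  | opposite (k : Fin 2)
  -- (6a) diagonal
  | commonRay (k : Fin 2) (a : Arm)
  -- (3f)
  | tripod (k : Fin 2)
  -- (8)
  | tree

/-- The arms of `Λ` at each of its vertices when the edge has slope one. -/
def armsAt : Fin 2 → Finset Arm :=
  ![{.west, .south, .diag}, {.east, .north, .diag}]

/-- The component `K` of `Λ ∩ Γ` is a local tangency of the given type. -/
def Realizes (c : Expo → ℝ) (q : Param) : Tangency → Set Plane → Prop
  -- `Λ` and `Γ` meet transversally with multiplicity two in the relative interiors of an arm and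
  -- of an edge
  | .point a, K => mult c q K = 2 ∧
      ∃ P ∈ armInterior q a, K = {P} ∧ (dualCell c P).card = 2
  -- isolated intersection of multiplicity two of the relative interior of an arm with a vertex
  | .pointAtVertex a, K => mult c q K = 2 ∧
      ∃ P ∈ armInterior q a, K = {P} ∧ (dualCell c P).card = 3
  -- a bounded edge of `Γ` in the relative interior of an arm
  | .interiorEdge a, K => mult c q K = 2 ∧
      ∃ A ∈ armInterior q a, ∃ B ∈ armInterior q a, A ≠ B ∧
        (dualCell c A).card = 3 ∧ (dualCell c B).card = 3 ∧ K = segment ℝ A B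
  -- a vertex of `Λ` lies in the relative interior of an edge of `Γ`, and the arm leaves `Γ` at an
  -- end of this edge
  | .overhang k a, K => mult c q K = 2 ∧ a ∈ armsAt k ∧ (dualCell c (vertex q k)).card = 2 ∧
      ∃ A ∈ armInterior q a, (dualCell c A).card = 3 ∧ K = segment ℝ (vertex q k) A
  -- the edge of `Λ` lies in the relative interior of an edge of `Γ`
  | .wholeEdge, K => mult c q K = 2 ∧ (∀ k, (dualCell c (vertex q k)).card = 2) ∧
      K = segment ℝ (vertex q 0) (vertex q 1)
  -- a vertex of `Λ` lies in the relative interior of an edge of `Γ` of slope minus one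
  | .crossing k, K => mult c q K = 2 ∧ K = {vertex q k} ∧
      ∃ m m' : Expo, dualCell c (vertex q k) = {m, m'} ∧ m'.toInt = m.toInt + (1, 1)
  -- a vertex of `Λ` lies in the relative interior of an edge of `Γ`, with multiplicity four
  | .crossingFour k, K => mult c q K = 4 ∧ K = {vertex q k} ∧ (dualCell c (vertex q k)).card = 2
  -- a vertex of `Λ` is a vertex of `Γ`, and the stars of the two curves are opposite to each other
  | .opposite k, K => mult c q K = 2 ∧ K = {vertex q k} ∧
      ∃ m m' m'' : Expo, dualCell c (vertex q k) = {m, m', m''} ∧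
        m'.toInt = m.toInt + (![(-1, 0), (1, 0)] : Fin 2 → ℤ × ℤ) k ∧
        m''.toInt = m.toInt + (![(0, -1), (0, 1)] : Fin 2 → ℤ × ℤ) k
  -- a vertex of `Λ` is a vertex of `Γ` on an edge of slope minus one, and a leg of `Λ` at it is
  -- also a leg of `Γ`
  | .commonRay k a, K => mult c q K = 2 ∧ a ∈ armsAt k ∧ a ≠ .diag ∧
      (dualCell c (vertex q k)).card = 3 ∧ K = leg q a ∧
      ∃ m ∈ dualCell c (vertex q k), ∃ m' ∈ dualCell c (vertex q k),
        m'.toInt = m.toInt + (1, 1)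
  -- a vertex of `Λ` is a vertex of `Γ` with the same star, and its three edges in `Γ` are bounded
  -- and lie in the arms of `Λ`
  | .tripod k, K => mult c q K = 4 ∧ (dualCell c (vertex q k)).card = 3 ∧
      ∃ A : Arm → Plane, (∀ a ∈ armsAt k, A a ∈ armInterior q a ∧ (dualCell c (A a)).card = 3) ∧
        K = ⋃ a ∈ armsAt k, segment ℝ (vertex q k) (A a)
  -- the edge of `Λ` is an edge of `Γ`, and the other four edges of `Γ` at its ends are bounded and
  -- lie in the legs of `Λ`
  | .tree, K => mult c q K = 6 ∧ (∀ k, (dualCell c (vertex q k)).card = 3) ∧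
      ∃ A : Arm → Plane, (∀ a, a ≠ .diag →
          A a ∈ armInterior q a ∧ (dualCell c (A a)).card = 3) ∧
        K = segment ℝ (vertex q 0) (vertex q 1) ∪
          ⋃ a : {a : Arm // a ≠ .diag}, segment ℝ (armBase q a) (A a)

/-- The components of `Λ ∩ Γ` are local tangencies of the types listed in `L`. -/
def HasConfiguration (c : Expo → ℝ) (q : Param) (L : List Tangency) : Prop :=
  ∃ Ks : List (Set Plane), Ks.Nodup ∧ (∀ K, K ∈ Ks ↔ K ∈ components c q) ∧
    List.Forall₂ (Realizes c q) L Ks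

/-! ### The table of configurations -/

/-- Tangencies of multiplicity two at the upper vertex: (3a), (4a) diagonal. -/
def genericTop : List Tangency := [.overhang 1 .east, .overhang 1 .north, .crossing 1]

/-- Tangencies of multiplicity two at the lower vertex: (3a), (4a) diagonal. -/
def genericBottom : List Tangency := [.overhang 0 .west, .overhang 0 .south, .crossing 0]

/-- Tangencies of multiplicity two at the upper vertex: (3a), (4a) diagonal, (5a), (6a) diagonal. -/
def allTop : List Tangency :=
  genericTop ++ [.opposite 1, .commonRay 1 .east, .commonRay 1 .north]

/-- Tangencies of multiplicity two at the lower vertex: (3a), (4a) diagonal, (5a), (6a) diagonal. -/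
def allBottom : List Tangency :=
  genericBottom ++ [.opposite 0, .commonRay 0 .west, .commonRay 0 .south]

/-- Type (3c) on a leg at the upper vertex. -/
def edgeTop : List Tangency := [.interiorEdge .east, .interiorEdge .north]

/-- Tangencies of multiplicity two in the interior of a given arm. -/
def interiorAny (a : Arm) : List Tangency := [.point a, .pointAtVertex a, .interiorEdge a]

/-- The trivalent configurations, for an edge of slope one, for each of the five movements. -/
def table : Movement → List (List Tangency)
  | .ball =>
      [[.point .south, .point .diag, .interiorEdge .east],
       [.point .south, .point .diag, .interiorEdge .north],
       [.point .south, .point .east, .overhang 0 .west],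
       [.point .south, .crossingFour 1]] ++
      genericTop.map (fun t => [.point .south, .point .west, t]) ++
      (interiorAny .east).map (fun t => [.point .south, t, .overhang 1 .east])
  | .independent =>
      [[.point .south, .wholeEdge, .point .east],
       [.point .south, .interiorEdge .diag, .point .east],
       [.point .south, .interiorEdge .diag, .point .north],
       [.point .south, .overhang 0 .diag, .point .east],
       [.point .south, .overhang 0 .diag, .point .north]]
  | .dependent =>
      [[.interiorEdge .south, .point .diag, .interiorEdge .east],
       [.interiorEdge .south, .point .diag, .interiorEdge .north],
       [.point .south, .interiorEdge .east, .overhang 0 .west],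
       [.interiorEdge .south, .crossingFour 1]] ++
      genericTop.map (fun t => [.point .south, .interiorEdge .west, t]) ++
      (interiorAny .south).map (fun t => [t, .interiorEdge .east, .overhang 0 .south]) ++
      genericBottom.flatMap (fun s => genericTop.map (fun t => [s, .point .diag, t]))
  | .oneFixed =>
      [[.point .south, .wholeEdge, .interiorEdge .east],
       [.point .south, .interiorEdge .east, .overhang 1 .north],
       [.point .south, .tripod 1]] ++
      edgeTop.map (fun t => [.point .south, t, .overhang 1 .diag]) ++
      (edgeTop ++ allTop).map (fun t => [.point .south, .interiorEdge .diag, t]) ++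
      (edgeTop ++ allTop).map (fun t => [.point .south, .overhang 0 .diag, t])
  | .rigid =>
      [[.interiorEdge .south, .wholeEdge, .interiorEdge .east],
       [.interiorEdge .south, .interiorEdge .east, .overhang 0 .west],
       [.interiorEdge .south, .tripod 1],
       [.tree]] ++
      allTop.map (fun t => [.tripod 0, t]) ++
      allTop.map (fun t => [.interiorEdge .south, .interiorEdge .west, t]) ++
      (edgeTop ++ allTop).map (fun t => [.interiorEdge .south, .interiorEdge .diag, t]) ++
      (edgeTop ++ allTop).map (fun t => [.interiorEdge .south, .overhang 0 .diag, t]) ++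
      allBottom.flatMap (fun s => allTop.map (fun t => [s, .interiorEdge .diag, t]))

/-- The only configuration with `Λ` four-valent: (4a') at the vertex along an edge of slope minus
one, and (3c') on the two legs pointing south and west. It belongs to the rigid movement. -/
def fourValentEntry : List Tangency :=
  [.crossing 0, .interiorEdge .south, .interiorEdge .west]

/-- The configuration of `(Γ, Λ)` is in the table, for `Λ` in normal position. -/
def InTable (c : Expo → ℝ) (q : Param) (π : Movement) : Prop :=
  (0 < q.2 ∧ ∃ L ∈ table π, HasConfiguration c q L) ∨
  (π = .rigid ∧ q.2 = 0 ∧ HasConfiguration c q fourValentEntry)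

/-! ### The action of the dihedral group -/

/-- An element of the dihedral group of order eight: a swap of the coordinates (or not), followed by
reflections in the coordinate directions (or not). -/
structure Sym where
  swap : Bool
  flipX : Bool
  flipY : Bool

/-- The action on the plane. -/
def Sym.onPlane (g : Sym) (p : Plane) : Plane :=
  let r := if g.swap then p.swap else p
  (if g.flipX then -r.1 else r.1, if g.flipY then -r.2 else r.2)

/-- The action on the lattice points of the square. -/
def Sym.onExpo (g : Sym) (m : Expo) : Expo :=
  let r := if g.swap then m.swap else m
  (if g.flipX then r.1.rev else r.1, if g.flipY then r.2.rev else r.2)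

/-- Up to symmetry, the configuration of `(Γ, Λ)` is in the table. -/
def InTableUpToSymmetry (c : Expo → ℝ) (q : Param) (π : Movement) : Prop :=
  ∃ (g : Sym) (c' : Expo → ℝ) (q' : Param), (∀ m, c' (g.onExpo m) = c m) ∧
    lam q' = g.onPlane '' lam q ∧ InTable c' q' π

/-- A type (4a') tangency at the vertex of the four-valent curve `Λ`, which lies in the relative
interior of an edge of `Γ` of slope `±1`, and type (3c') tangencies on two legs, all of whose points
lie on the same side of the line spanned by that edge. -/
def FourValentConfiguration (c : Expo → ℝ) (q : Param) : Prop :=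
  ∃ K₁ K₂ : Set Plane, ∃ a b : Arm, a ≠ .diag ∧ b ≠ .diag ∧ a ≠ b ∧
    components c q = {{vertex q 0}, K₁, K₂} ∧ mult c q {vertex q 0} = 2 ∧
    Realizes c q (.interiorEdge a) K₁ ∧ Realizes c q (.interiorEdge b) K₂ ∧
    ∃ m m' : Expo, dualCell c (vertex q 0) = {m, m'} ∧
      |m'.toInt.1 - m.toInt.1| = 1 ∧ |m'.toInt.2 - m.toInt.2| = 1 ∧
      ∀ p ∈ K₁ ∪ K₂,
        0 < ((m'.toInt.1 - m.toInt.1 : ℤ) : ℝ) * (p.1 - (vertex q 0).1) +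
          ((m'.toInt.2 - m.toInt.2 : ℤ) : ℝ) * (p.2 - (vertex q 0).2)

end TropTritangent

end

noncomputable section

namespace TropTritangent

variable {c : Expo → ℝ} {q : Param}

/-! ### Restriction of the tropical polynomial to lines -/

/-! Along an arm of Λ the tropical polynomial F is convex and piecewise linear with integer slopes,
and the stable multiplicity at an inner point of the arm is the change of slope there. Cutting Λ at
a point P outside Γ splits Λ ∩ Γ into two unions of components, and by telescoping the multiplicity
on one side is a constant minus the slope of F at P. Hence tritangency is a parity condition on the
slopes outside Γ: on a leg they have the parity of the slope at infinity, and on an edge of slope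
one they are even (`IsTritangent.parity`, for ℓ ≥ 0). Conversely, for ℓ > 0 the parity condition
makes the multiplicity of every component even; these multiplicities are positive with sum six, so
only (2,2,2), (2,4) and (6) remain (`Parity.isTritangent`). The case ℓ < 0 follows by the reflection
x ↦ -x, under which even slopes along the edge become odd.

Parity leaves little room. The slope grows by at most three along a leg and, away from the unbounded
part, by at most two along the edge. Where a line leaves an edge of a smooth Γ that it has followed,
the slope jumps by exactly one. So an open arm meets Γ in overlaps with edges of Γ at the vertices
of Λ and in at most one crossing of multiplicity two, which is a point inside an edge of Γ, a vertex
of Γ, or a bounded edge of Γ (`exists_legShape`, `exists_diagShape`). The types of all tangencies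
can therefore be read off from the two dual cells at v₀ and v₁ and one status per arm, which leaves
finitely many patterns (`HasStatuses.hasConfiguration`).

Let q be a generic point of a cell C of maximal dimension in the bounded complex, and let V be the
tangent space of C. Two kinds of information confine V. From below: a direction in which the curve
stays tritangent and outside the unbounded part lies in V, because the nearby curves lie in a
bounded cell that contains C and hence has the same span (`PolyStructure.mem_vectorSpan`). Such
directions are found by a sufficient criterion: an exponent of the wrong parity cannot become the
only dominant one as long as a second exponent keeps up with it (`HasStatuses.eventually`). From
above: the dual cells of both vertices are constant along C, and at a generic point an arm through a
vertex of Γ cannot move sideways along C; both facts give linear forms that vanish on V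
(`Local.eval_eq_zero`). For each pattern the kernel computation `isListed_all` shows that either the
two kinds of information contradict each other, or the tangencies are in the table for every
movement which they permit, up to the symmetries that preserve slope one.

If one curve in the relative interior of a cell is four-valent, then all of them are
(`PolyStructure.eq_zero_of_eq_zero`). In a cell of maximal dimension no direction that opens an edge
can then keep the curve tritangent, and the computation `isFourValent_all` leaves only a vertex on
an edge of slope ±1 together with bounded edges of Γ on the two legs on one side. The vertices of Γ
on these legs fix both coordinates of the vertex of Λ, so the cell is a point. This gives the
four-valent entry of the rigid case and the second statement. -/

/-- The slope of a monomial in an integer direction. -/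
def slope (r : ℤ × ℤ) (m : Expo) : ℤ := m.toInt.1 * r.1 + m.toInt.2 * r.2

/-- The outgoing slope of the tropical polynomial in a direction. -/
def topSlope (c : Expo → ℝ) (p : Plane) (r : ℤ × ℤ) : ℤ :=
  (dualCell c p).sup' (dualCell_nonempty c p) (slope r)

/-- The incoming slope of the tropical polynomial in a direction. -/
def lowSlope (c : Expo → ℝ) (p : Plane) (r : ℤ × ℤ) : ℤ :=
  (dualCell c p).inf' (dualCell_nonempty c p) (slope r)

/-- The change of slope at a point of a line. -/
def width (c : Expo → ℝ) (p : Plane) (r : ℤ × ℤ) : ℤ := topSlope c p r - lowSlope c p r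

/-- The point at time `t` of the line through `p` with velocity `r`. -/
def line (p : Plane) (r : ℤ × ℤ) (t : ℝ) : Plane := p + t • toPlane r

theorem line_zero (p : Plane) (r : ℤ × ℤ) : line p r 0 = p := by simp [line]

theorem line_line (p : Plane) (r : ℤ × ℤ) (s t : ℝ) : line (line p r s) r t = line p r (s + t) := by
  simp [line, add_smul, add_assoc]

theorem toPlane_neg (r : ℤ × ℤ) : toPlane (-r) = -toPlane r := by
  ext <;> simp [toPlane]

theorem line_neg (p : Plane) (r : ℤ × ℤ) (t : ℝ) : line p (-r) t = line p r (-t) := by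
  simp [line, toPlane_neg]

theorem slope_neg (r : ℤ × ℤ) (m : Expo) : slope (-r) m = -slope r m := by
  simp [slope]; ring

theorem mem_dualCell {p : Plane} {m : Expo} :
    m ∈ dualCell c p ↔ ∀ m', monomial c m' p ≤ monomial c m p := by
  simp [dualCell]

theorem monomial_line (c : Expo → ℝ) (m : Expo) (p : Plane) (r : ℤ × ℤ) (t : ℝ) :
    monomial c m (line p r t) = monomial c m p + t * slope r m := by
  simp [monomial, line, slope, toPlane, Expo.toInt]; ring

theorem monomial_eq_of_mem {p : Plane} {m m' : Expo} (h : m ∈ dualCell c p)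
    (h' : m' ∈ dualCell c p) : monomial c m p = monomial c m' p :=
  le_antisymm (mem_dualCell.1 h' m) (mem_dualCell.1 h m')

theorem mem_dualCell_of_eq {p : Plane} {m m' : Expo} (h : m ∈ dualCell c p)
    (h' : monomial c m p = monomial c m' p) : m' ∈ dualCell c p :=
  mem_dualCell.2 fun n => h' ▸ mem_dualCell.1 h n

theorem slope_le_topSlope {p : Plane} {m : Expo} (h : m ∈ dualCell c p)
    (r : ℤ × ℤ) : slope r m ≤ topSlope c p r := Finset.le_sup' (slope r) h

theorem lowSlope_le_slope {p : Plane} {m : Expo} (h : m ∈ dualCell c p)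
    (r : ℤ × ℤ) : lowSlope c p r ≤ slope r m := Finset.inf'_le (slope r) h

theorem exists_slope_eq_topSlope (c : Expo → ℝ) (p : Plane) (r : ℤ × ℤ) :
    ∃ m ∈ dualCell c p, slope r m = topSlope c p r := by
  obtain ⟨m, hm, h⟩ := Finset.exists_mem_eq_sup' (dualCell_nonempty c p) (slope r)
  exact ⟨m, hm, h.symm⟩

theorem exists_slope_eq_lowSlope (c : Expo → ℝ) (p : Plane) (r : ℤ × ℤ) :
    ∃ m ∈ dualCell c p, slope r m = lowSlope c p r := by
  obtain ⟨m, hm, h⟩ := Finset.exists_mem_eq_inf' (dualCell_nonempty c p) (slope r)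
  exact ⟨m, hm, h.symm⟩

theorem lowSlope_le_topSlope (c : Expo → ℝ) (p : Plane) (r : ℤ × ℤ) :
    lowSlope c p r ≤ topSlope c p r := by
  obtain ⟨m, hm, h⟩ := exists_slope_eq_lowSlope c p r
  exact h ▸ slope_le_topSlope hm r

theorem width_nonneg (c : Expo → ℝ) (p : Plane) (r : ℤ × ℤ) : 0 ≤ width c p r :=
  sub_nonneg.2 (lowSlope_le_topSlope c p r)

theorem topSlope_neg (c : Expo → ℝ) (p : Plane) (r : ℤ × ℤ) :
    topSlope c p (-r) = -lowSlope c p r := by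
  obtain ⟨m, hm, h⟩ := exists_slope_eq_lowSlope c p r
  obtain ⟨n, hn, h'⟩ := exists_slope_eq_topSlope c p (-r)
  have h1 := slope_le_topSlope hm (-r)
  have h2 := lowSlope_le_slope hn r
  rw [slope_neg] at h1 h'
  omega

theorem lowSlope_neg (c : Expo → ℝ) (p : Plane) (r : ℤ × ℤ) :
    lowSlope c p (-r) = -topSlope c p r := by
  have := topSlope_neg c p (-r)
  rw [neg_neg] at this
  omega

theorem width_neg (c : Expo → ℝ) (p : Plane) (r : ℤ × ℤ) : width c p (-r) = width c p r := by
  simp only [width, topSlope_neg, lowSlope_neg]; ring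

/-- At an inner point of an arm the outgoing directions are `r` and `-r`, so this identifies the
stable multiplicity with the change of slope. -/
theorem width_eq_add (c : Expo → ℝ) (p : Plane) (r : ℤ × ℤ) :
    width c p r = topSlope c p r + topSlope c p (-r) := by
  rw [topSlope_neg]; rfl

theorem slope_eq_of_width_eq_zero {p : Plane} {r : ℤ × ℤ} (h : width c p r = 0)
    {m : Expo} (hm : m ∈ dualCell c p) : slope r m = topSlope c p r := by
  have h1 := slope_le_topSlope hm r
  have h2 := lowSlope_le_slope hm r
  unfold width at h
  omega

theorem width_pos_of_slope_lt {p : Plane} {r : ℤ × ℤ} {m m' : Expo}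
    (hm : m ∈ dualCell c p) (hm' : m' ∈ dualCell c p) (h : slope r m < slope r m') :
    0 < width c p r := by
  have h1 := slope_le_topSlope hm' r
  have h2 := lowSlope_le_slope hm r
  unfold width
  omega

theorem mem_curve_of_ne {p : Plane} {m m' : Expo}
    (hm : m ∈ dualCell c p) (hm' : m' ∈ dualCell c p) (h : m ≠ m') : p ∈ curve c :=
  Finset.one_lt_card.2 ⟨m, hm, m', hm', h⟩

theorem mem_curve_of_width_ne_zero {p : Plane} {r : ℤ × ℤ}
    (h : width c p r ≠ 0) : p ∈ curve c := by
  obtain ⟨m, hm, h1⟩ := exists_slope_eq_topSlope c p r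
  obtain ⟨n, hn, h2⟩ := exists_slope_eq_lowSlope c p r
  refine mem_curve_of_ne hm hn ?_
  rintro rfl
  apply h
  unfold width
  omega

theorem notMem_curve_iff {p : Plane} :
    p ∉ curve c ↔ ∃ m, dualCell c p = {m} := by
  have := (dualCell_nonempty c p).card_pos
  rw [← Finset.card_eq_one]
  simp only [curve, Set.mem_ofPred_eq]
  omega

/-- The set of exponents which are dominant at `p` and on the line just after `p`. -/
def rightFace (c : Expo → ℝ) (p : Plane) (r : ℤ × ℤ) : Finset Expo :=
  (dualCell c p).filter fun m => slope r m = topSlope c p r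

theorem mem_rightFace {p : Plane} {r : ℤ × ℤ} {m : Expo} :
    m ∈ rightFace c p r ↔ m ∈ dualCell c p ∧ slope r m = topSlope c p r := by
  simp [rightFace]

theorem rightFace_nonempty (c : Expo → ℝ) (p : Plane) (r : ℤ × ℤ) :
    (rightFace c p r).Nonempty := by
  obtain ⟨m, hm, h⟩ := exists_slope_eq_topSlope c p r
  exact ⟨m, mem_rightFace.2 ⟨hm, h⟩⟩

theorem rightFace_subset (c : Expo → ℝ) (p : Plane) (r : ℤ × ℤ) :
    rightFace c p r ⊆ dualCell c p := Finset.filter_subset _ _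

/-- If `m` lost the maximum before time `u`, some steeper exponent would have caught up with it. At
the first such time both attain the maximum with different slopes, so the width there is positive.
-/
theorem mem_dualCell_line_of_rightFace {p : Plane} {r : ℤ × ℤ} {t : ℝ}
    (h : ∀ u ∈ Ioo 0 t, width c (line p r u) r = 0) {u : ℝ} (hu : u ∈ Ioo 0 t) {m : Expo}
    (hm : m ∈ rightFace c p r) : m ∈ dualCell c (line p r u) := by
  classical
  obtain ⟨hm, hs⟩ := mem_rightFace.1 hm
  by_contra hcon
  rw [mem_dualCell] at hcon
  push Not at hcon
  obtain ⟨m', hm'⟩ := hcon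
  have key : ∀ n : Expo, monomial c n p ≤ monomial c m p := mem_dualCell.1 hm
  -- `B` collects the exponents steeper than `m`, and `β n` is the time at which `n` catches up with
  -- `m`. The minimum of `β` over `B` is the contradictory breakpoint.
  let B : Finset Expo := Finset.univ.filter fun n => slope r m < slope r n
  let β : Expo → ℝ := fun n => (monomial c m p - monomial c n p) / (slope r n - slope r m)
  have hβ : ∀ n ∈ B, β n * (slope r n - slope r m) = monomial c m p - monomial c n p := by
    intro n hn
    have : (slope r m : ℝ) < slope r n := by exact_mod_cast (Finset.mem_filter.1 hn).2
    exact div_mul_cancel₀ _ (by linarith)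
  have hm'B : m' ∈ B := by
    refine Finset.mem_filter.2 ⟨Finset.mem_univ _, ?_⟩
    rw [monomial_line, monomial_line] at hm'
    have := key m'
    by_contra hle
    have hle' : (slope r m' : ℝ) ≤ slope r m := by exact_mod_cast not_lt.1 hle
    nlinarith [hu.1]
  obtain ⟨n, hnB, hn⟩ := Finset.exists_min_image B β ⟨m', hm'B⟩
  have pos : ∀ n ∈ B, (0 : ℝ) < slope r n - slope r m := by
    intro n hn
    have : (slope r m : ℝ) < slope r n := by exact_mod_cast (Finset.mem_filter.1 hn).2
    linarith
  have hβn : β n < u := by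
    refine lt_of_le_of_lt (hn m' hm'B) ?_
    rw [div_lt_iff₀ (pos m' hm'B)]
    rw [monomial_line, monomial_line] at hm'
    linarith
  have hβ0 : 0 < β n := by
    apply div_pos _ (pos n hnB)
    refine sub_pos.2 (lt_of_le_of_ne (key n) fun heq => ?_)
    have := slope_le_topSlope (mem_dualCell_of_eq hm heq.symm) r
    have := (Finset.mem_filter.1 hnB).2
    omega
  have hmβ : m ∈ dualCell c (line p r (β n)) := by
    refine mem_dualCell.2 fun k => ?_
    rw [monomial_line, monomial_line]
    by_cases hk : slope r m < slope r k
    · have hkB : k ∈ B := Finset.mem_filter.2 ⟨Finset.mem_univ _, hk⟩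
      have := mul_le_mul_of_nonneg_right (hn k hkB) (pos k hkB).le
      have := hβ k hkB
      nlinarith
    · have hk' : (slope r k : ℝ) ≤ slope r m := by exact_mod_cast not_lt.1 hk
      nlinarith [key k]
  have hnβ : n ∈ dualCell c (line p r (β n)) := by
    refine mem_dualCell_of_eq hmβ ?_
    rw [monomial_line, monomial_line]
    have := hβ n hnB
    linarith
  have := h _ ⟨hβ0, hβn.trans hu.2⟩
  have := width_pos_of_slope_lt hmβ hnβ (Finset.mem_filter.1 hnB).2
  omega

/-- Zero width at time `u` forces every dominant exponent to share its slope with the right face;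
equality of the values at `u` is then carried back to `p`. -/
theorem dualCell_line_of_width_eq_zero {p : Plane} {r : ℤ × ℤ} {t : ℝ}
    (h : ∀ u ∈ Ioo 0 t, width c (line p r u) r = 0) {u : ℝ} (hu : u ∈ Ioo 0 t) :
    dualCell c (line p r u) = rightFace c p r := by
  ext m
  refine ⟨fun hm => ?_, mem_dualCell_line_of_rightFace h hu⟩
  obtain ⟨n, hn⟩ := rightFace_nonempty c p r
  have hn' := mem_dualCell_line_of_rightFace h hu hn
  have h1 := slope_eq_of_width_eq_zero (h u hu) hm
  have h2 := slope_eq_of_width_eq_zero (h u hu) hn'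
  have h3 := monomial_eq_of_mem hm hn'
  rw [mem_rightFace] at hn ⊢
  rw [monomial_line, monomial_line, h1, h2] at h3
  exact ⟨mem_dualCell_of_eq hn.1 (by linarith), by omega⟩

/-- Without changes of slope between two times, the dual cell is constant. -/
theorem dualCell_line_eq_rightFace {p : Plane} {r : ℤ × ℤ} {s t : ℝ}
    (h : ∀ u ∈ Ioo s t, width c (line p r u) r = 0) {u : ℝ} (hu : u ∈ Ioo s t) :
    dualCell c (line p r u) = rightFace c (line p r s) r := by
  have := dualCell_line_of_width_eq_zero (c := c) (p := line p r s) (r := r) (t := t - s)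
    (u := u - s) (by
      intro v hv
      rw [line_line]
      exact h _ ⟨by linarith [hv.1], by linarith [hv.2]⟩) ⟨by linarith [hu.1], by linarith [hu.2]⟩
  rwa [line_line, add_sub_cancel] at this

theorem dualCell_line_eq_leftFace {p : Plane} {r : ℤ × ℤ} {s t : ℝ}
    (h : ∀ u ∈ Ioo s t, width c (line p r u) r = 0) {u : ℝ} (hu : u ∈ Ioo s t) :
    dualCell c (line p r u) = rightFace c (line p r t) (-r) := by
  have := dualCell_line_eq_rightFace (c := c) (p := p) (r := -r) (s := -t) (t := -s) (u := -u) (by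
      intro v hv
      rw [line_neg, width_neg]
      exact h _ ⟨by linarith [hv.2], by linarith [hv.1]⟩) ⟨by linarith [hu.2], by linarith [hu.1]⟩
  simpa [line_neg] using this

/-- At a breakpoint two exponents of different slopes have equal value, so the time is a quotient
determined by the pair, and there are finitely many pairs. -/
theorem finite_width_ne_zero (c : Expo → ℝ) (p : Plane) (r : ℤ × ℤ) :
    {u : ℝ | width c (line p r u) r ≠ 0}.Finite := by
  refine (Set.finite_range fun x : Expo × Expo =>
    (monomial c x.1 p - monomial c x.2 p) / (slope r x.2 - slope r x.1)).subset ?_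
  intro u hu
  obtain ⟨m, hm, h1⟩ := exists_slope_eq_topSlope c (line p r u) r
  obtain ⟨n, hn, h2⟩ := exists_slope_eq_lowSlope c (line p r u) r
  have hne : (slope r n : ℝ) - slope r m ≠ 0 := by
    intro h0
    apply hu
    have : slope r n = slope r m := by exact_mod_cast sub_eq_zero.1 h0
    unfold width
    omega
  refine ⟨(m, n), ?_⟩
  have h3 := monomial_eq_of_mem hm hn
  rw [monomial_line, monomial_line] at h3
  rw [div_eq_iff hne]
  linarith

theorem exists_pos_width_eq_zero (c : Expo → ℝ) (p : Plane) (r : ℤ × ℤ) (s : ℝ) :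
    ∃ ε > 0, ∀ u ∈ Ioo s (s + ε), width c (line p r u) r = 0 := by
  have hf : ({u : ℝ | width c (line p r u) r ≠ 0} \ {s}).Finite :=
    (finite_width_ne_zero c p r).subset diff_subset
  have := hf.isClosed.isOpen_compl.mem_nhds (x := s) (by simp)
  obtain ⟨ε, hε, h⟩ := Metric.mem_nhds_iff.1 this
  refine ⟨ε, hε, fun u hu => ?_⟩
  have : u ∈ Metric.ball s ε := by
    rw [Metric.mem_ball, Real.dist_eq, abs_of_pos (by linarith [hu.1])]
    linarith [hu.2]
  by_contra hw
  exact h this ⟨hw, by simpa using hu.1.ne'⟩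

theorem exists_pos_dualCell_eq_rightFace (c : Expo → ℝ) (p : Plane) (r : ℤ × ℤ) :
    ∃ ε > 0, ∀ u ∈ Ioo 0 ε, dualCell c (line p r u) = rightFace c p r := by
  obtain ⟨ε, hε, h⟩ := exists_pos_width_eq_zero c p r 0
  refine ⟨ε, hε, fun u hu => ?_⟩
  rw [zero_add] at h
  exact dualCell_line_of_width_eq_zero h hu

theorem topSlope_of_dualCell_eq_rightFace {p p' : Plane} {r : ℤ × ℤ}
    (h : dualCell c p' = rightFace c p r) : topSlope c p' r = topSlope c p r := by
  obtain ⟨m, hm, h1⟩ := exists_slope_eq_topSlope c p' r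
  rw [h] at hm
  rw [← h1, (mem_rightFace.1 hm).2]

theorem lowSlope_of_dualCell_eq_rightFace {p p' : Plane} {r : ℤ × ℤ}
    (h : dualCell c p' = rightFace c p r) : lowSlope c p' r = topSlope c p r := by
  obtain ⟨m, hm, h1⟩ := exists_slope_eq_lowSlope c p' r
  rw [h] at hm
  rw [← h1, (mem_rightFace.1 hm).2]

/-- The dual cell of the midpoint is at once the right face at `s` and the left face at `t`. -/
theorem lowSlope_eq_topSlope {p : Plane} {r : ℤ × ℤ} {s t : ℝ} (hst : s < t)
    (h : ∀ u ∈ Ioo s t, width c (line p r u) r = 0) :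
    lowSlope c (line p r t) r = topSlope c (line p r s) r := by
  have hu : (s + t) / 2 ∈ Ioo s t := ⟨by linarith, by linarith⟩
  have h1 := topSlope_of_dualCell_eq_rightFace (dualCell_line_eq_rightFace h hu)
  have h2 := lowSlope_of_dualCell_eq_rightFace (dualCell_line_eq_leftFace h hu)
  rw [lowSlope_neg, topSlope_neg] at h2
  omega

/-- The slopes at two points of a line differ by the sum of the changes of slope in between. -/
theorem finsum_width_Ioo (c : Expo → ℝ) (p : Plane) (r : ℤ × ℤ) {s t : ℝ} (hst : s < t) :
    ∑ᶠ u ∈ Ioo s t, width c (line p r u) r =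
      lowSlope c (line p r t) r - topSlope c (line p r s) r := by
  set J := {u : ℝ | width c (line p r u) r ≠ 0} with hJ
  have hJf : J.Finite := finite_width_ne_zero c p r
  -- Induction on the number of breakpoints: splitting at one of them leaves fewer in each half, and
  -- its own width bridges the two telescoping sums.
  induction hn : (Ioo s t ∩ J).ncard using Nat.strong_induction_on generalizing s t with
  | _ n ih =>
  by_cases hemp : ∃ u ∈ Ioo s t, u ∈ J
  · obtain ⟨u, hu, huJ⟩ := hemp
    have hfin : (Ioo s t ∩ J).Finite := hJf.subset inter_subset_right
    have e : Ioo s t = (Ioo s u ∪ {u}) ∪ Ioo u t := by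
      ext x
      simp only [mem_Ioo, mem_union, mem_singleton_iff]
      constructor
      · rintro ⟨h1, h2⟩
        rcases lt_trichotomy x u with h | h | h <;> tauto
      · rintro ((⟨h1, h2⟩ | rfl) | ⟨h1, h2⟩)
        · exact ⟨h1, h2.trans hu.2⟩
        · exact hu
        · exact ⟨hu.1.trans h1, h2⟩
    have sup : ∀ S : Set ℝ, (S ∩ Function.support fun u => width c (line p r u) r).Finite :=
      fun S => hJf.subset fun x hx => hx.2
    have i1 := ih (Ioo s u ∩ J).ncard (by
      rw [← hn]
      apply Set.ncard_lt_ncard _ hfin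
      refine ⟨fun x hx => ⟨⟨hx.1.1, hx.1.2.trans hu.2⟩, hx.2⟩, fun hsub => ?_⟩
      exact lt_irrefl _ (hsub ⟨hu, huJ⟩).1.2) hu.1 rfl
    have i2 := ih (Ioo u t ∩ J).ncard (by
      rw [← hn]
      apply Set.ncard_lt_ncard _ hfin
      refine ⟨fun x hx => ⟨⟨hu.1.trans hx.1.1, hx.1.2⟩, hx.2⟩, fun hsub => ?_⟩
      exact lt_irrefl _ (hsub ⟨hu, huJ⟩).1.1) hu.2 rfl
    rw [e, finsum_mem_union' _ (sup _) (sup _), finsum_mem_union' _ (sup _) (sup _),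
      finsum_mem_singleton, i1, i2, width]
    · ring
    · rw [Set.disjoint_singleton_right]; exact fun h => lt_irrefl _ h.2
    · rw [Set.disjoint_left]
      rintro x (hx | hx) hx'
      · exact lt_asymm hx.2 hx'.1
      · exact lt_irrefl _ (hx ▸ hx'.1)
  · push Not at hemp
    have h0 : ∀ u ∈ Ioo s t, width c (line p r u) r = 0 := fun u hu => by
      simpa [hJ] using hemp u hu
    rw [finsum_mem_congr rfl h0, lowSlope_eq_topSlope hst h0]
    simp

theorem topSlope_le_lowSlope (c : Expo → ℝ) (p : Plane) (r : ℤ × ℤ) {s t : ℝ} (hst : s < t) :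
    topSlope c (line p r s) r ≤ lowSlope c (line p r t) r := by
  have := finsum_width_Ioo c p r hst
  have h2 : 0 ≤ ∑ᶠ u ∈ Ioo s t, width c (line p r u) r :=
    finsum_nonneg fun u => finsum_nonneg fun _ => width_nonneg c _ r
  omega

/-! ### Maximal intervals of a line inside the curve, and the parity of the slope change along them
-/

theorem continuous_monomial (c : Expo → ℝ) (m : Expo) : Continuous (monomial c m) := by
  unfold monomial; fun_prop

theorem continuous_line (p : Plane) (r : ℤ × ℤ) : Continuous (line p r) := by
  unfold line; fun_prop

theorem isClosed_curve (c : Expo → ℝ) : IsClosed (curve c) := by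
  have e : curve c = ⋃ x ∈ {x : Expo × Expo | x.1 ≠ x.2},
      ({p | ∀ n, monomial c n p ≤ monomial c x.1 p} ∩
        {p | ∀ n, monomial c n p ≤ monomial c x.2 p}) := by
    ext p
    simp only [← mem_dualCell]
    constructor
    · intro h
      obtain ⟨m, hm, n, hn, hne⟩ := Finset.one_lt_card.1 h
      exact mem_iUnion₂.2 ⟨(m, n), hne, hm, hn⟩
    · intro h
      obtain ⟨⟨m, n⟩, hne, hm, hn⟩ := mem_iUnion₂.1 h
      exact mem_curve_of_ne hm hn hne
  rw [e]
  have hcl : ∀ m, IsClosed {p | ∀ n, monomial c n p ≤ monomial c m p} := by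
    intro m
    rw [ofPred_forall]
    exact isClosed_iInter fun n => isClosed_le (continuous_monomial c n) (continuous_monomial c m)
  exact Set.Finite.isClosed_biUnion (Set.toFinite _) fun x _ => (hcl _).inter (hcl _)

theorem two_le_card_of_mem_curve {p : Plane} (h : p ∈ curve c) :
    2 ≤ (dualCell c p).card := h

theorem rightFace_card_pos (c : Expo → ℝ) (p : Plane) (r : ℤ × ℤ) :
    1 ≤ (rightFace c p r).card := (rightFace_nonempty c p r).card_pos

/-- Just after the last point of a maximal interval in the curve, the slope has the parity which
the complement of the curve prescribes. -/
theorem even_topSlope_of_last {p : Plane} {r : ℤ × ℤ} {s T : ℝ} {e : ℤ} (hs : s < T)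
    (hpar : ∀ t ∈ Ioo s T, line p r t ∉ curve c → Even (topSlope c (line p r t) r + e))
    (hlast : ∀ y ∈ Ioo s T, ∃ z ∈ Ioc s y, line p r z ∉ curve c) :
    Even (topSlope c (line p r s) r + e) := by
  obtain ⟨ε, hε, h⟩ := exists_pos_dualCell_eq_rightFace c (line p r s) r
  have hy : min (s + ε / 2) ((s + T) / 2) ∈ Ioo s T :=
    ⟨lt_min (by linarith) (by linarith), (min_le_right _ _).trans_lt (by linarith)⟩
  obtain ⟨z, hz, hzc⟩ := hlast _ hy
  have hz' : z - s ∈ Ioo 0 ε := by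
    have := hz.2.trans (min_le_left _ _)
    exact ⟨by linarith [hz.1], by linarith⟩
  have h1 := h _ hz'
  rw [line_line, add_sub_cancel] at h1
  rw [← topSlope_of_dualCell_eq_rightFace h1]
  exact hpar z ⟨hz.1, hz.2.trans_lt hy.2⟩ hzc

/-- Obtained from `even_topSlope_of_last` by reversing the line. Outside the curve the incoming and
outgoing slopes agree, and the sign introduced by the reversal does not affect parity. -/
theorem even_lowSlope_of_first {p : Plane} {r : ℤ × ℤ} {s T : ℝ} {e : ℤ}
    (hs : s < T)
    (hpar : ∀ t ∈ Ioo s T, line p r t ∉ curve c → Even (topSlope c (line p r t) r + e))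
    (hfirst : ∀ y ∈ Ioo s T, ∃ z ∈ Ico y T, line p r z ∉ curve c) :
    Even (lowSlope c (line p r T) r + e) := by
  have := even_topSlope_of_last (c := c) (p := p) (r := -r) (s := -T) (T := -s) (e := e)
    (by linarith) (by
      intro t ht hc
      rw [line_neg] at hc ⊢
      have h1 := hpar (-t) ⟨by linarith [ht.2], by linarith [ht.1]⟩ hc
      have h2 : width c (line p r (-t)) r = 0 := by
        by_contra hw
        exact hc (mem_curve_of_width_ne_zero hw)
      unfold width at h2
      rw [topSlope_neg]
      have : topSlope c (line p r (-t)) r = lowSlope c (line p r (-t)) r := by omega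
      rw [this] at h1
      obtain ⟨k, hk⟩ := h1
      exact ⟨e - k, by omega⟩) (by
      intro y hy
      obtain ⟨z, hz, hzc⟩ := hfirst (-y) ⟨by linarith [hy.2], by linarith [hy.1]⟩
      exact ⟨-z, ⟨by linarith [hz.2], by linarith [hz.1]⟩, by rwa [line_neg, neg_neg]⟩)
  rw [line_neg, neg_neg, topSlope_neg] at this
  obtain ⟨k, hk⟩ := this
  exact ⟨e - k, by omega⟩

/-- Times just above the infimum lie in `I`, hence in the curve; the curve is closed, so it also
contains the point at the infimum, and saturation puts the infimum into `I`. -/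
theorem sInf_mem_of_saturated {p : Plane} {r : ℤ × ℤ} {T : ℝ}
    {I : Set ℝ} (hI : I ⊆ Icc 0 T) (hne : I.Nonempty) (hcurve : ∀ t ∈ I, line p r t ∈ curve c)
    (hconn : I.OrdConnected)
    (hsat : ∀ x ∈ I, ∀ y ∈ Icc 0 T, (∀ z ∈ uIcc x y, line p r z ∈ curve c) → y ∈ I) :
    sInf I ∈ I := by
  have hbdd : BddBelow I := ⟨0, fun x hx => (hI hx).1⟩
  obtain ⟨x, hx⟩ := hne
  have hle : sInf I ≤ x := csInf_le hbdd hx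
  by_contra hcon
  have hlt : sInf I < x := lt_of_le_of_ne hle fun h => hcon (h ▸ hx)
  have hin : Ioc (sInf I) x ⊆ I := by
    intro z hz
    obtain ⟨y, hy, hyz⟩ := exists_lt_of_csInf_lt ⟨x, hx⟩ hz.1
    exact hconn.out hy hx ⟨hyz.le, hz.2⟩
  have hcl : sInf I ∈ closure (Ioc (sInf I) x) := by
    rw [closure_Ioc hlt.ne]; exact ⟨le_rfl, hle⟩
  have hpre : IsClosed (line p r ⁻¹' curve c) := (isClosed_curve c).preimage (continuous_line p r)
  have hα : line p r (sInf I) ∈ curve c :=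
    closure_minimal (fun z hz => hcurve z (hin hz)) hpre hcl
  refine hcon (hsat x hx _ ⟨le_csInf ⟨x, hx⟩ fun y hy => (hI hy).1, hle.trans (hI hx).2⟩ ?_)
  intro z hz
  rw [uIcc_of_ge hle] at hz
  rcases hz.1.eq_or_lt with h | h
  · exact h ▸ hα
  · exact hcurve z (hin ⟨h, hz.2⟩)

theorem sSup_mem_of_saturated {p : Plane} {r : ℤ × ℤ} {T : ℝ}
    {I : Set ℝ} (hI : I ⊆ Icc 0 T) (hne : I.Nonempty) (hcurve : ∀ t ∈ I, line p r t ∈ curve c)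
    (hconn : I.OrdConnected)
    (hsat : ∀ x ∈ I, ∀ y ∈ Icc 0 T, (∀ z ∈ uIcc x y, line p r z ∈ curve c) → y ∈ I) :
    sSup I ∈ I := by
  have hbdd : BddAbove I := ⟨T, fun x hx => (hI hx).2⟩
  obtain ⟨x, hx⟩ := hne
  have hle : x ≤ sSup I := le_csSup hbdd hx
  by_contra hcon
  have hlt : x < sSup I := lt_of_le_of_ne hle fun h => hcon (h ▸ hx)
  have hin : Ico x (sSup I) ⊆ I := by
    intro z hz
    obtain ⟨y, hy, hyz⟩ := exists_lt_of_lt_csSup ⟨x, hx⟩ hz.2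
    exact hconn.out hx hy ⟨hz.1, hyz.le⟩
  have hcl : sSup I ∈ closure (Ico x (sSup I)) := by
    rw [closure_Ico hlt.ne]; exact ⟨hle, le_rfl⟩
  have hpre : IsClosed (line p r ⁻¹' curve c) := (isClosed_curve c).preimage (continuous_line p r)
  have hα : line p r (sSup I) ∈ curve c :=
    closure_minimal (fun z hz => hcurve z (hin hz)) hpre hcl
  refine hcon (hsat x hx _ ⟨(hI hx).1.trans hle, csSup_le ⟨x, hx⟩ fun y hy => (hI hy).2⟩ ?_)
  intro z hz
  rw [uIcc_of_le hle] at hz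
  rcases hz.2.eq_or_lt with h | h
  · exact h ▸ hα
  · exact hcurve z (hin ⟨hz.1, h⟩)

theorem finite_inter_support_width (c : Expo → ℝ) (p : Plane) (r : ℤ × ℤ) (S : Set ℝ) :
    (S ∩ Function.support fun u => width c (line p r u) r).Finite :=
  (finite_width_ne_zero c p r).subset fun _ hx => hx.2

theorem finsum_width_Ioc (c : Expo → ℝ) (p : Plane) (r : ℤ × ℤ) {s t : ℝ} (hst : s < t) :
    ∑ᶠ u ∈ Ioc s t, width c (line p r u) r =
      topSlope c (line p r t) r - topSlope c (line p r s) r := by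
  rw [← Ioo_union_right hst, finsum_mem_union' (by simp) (finite_inter_support_width ..)
    (finite_inter_support_width ..), finsum_width_Ioo c p r hst, finsum_mem_singleton, width]
  ring

theorem finsum_width_Icc (c : Expo → ℝ) (p : Plane) (r : ℤ × ℤ) {s t : ℝ} (hst : s ≤ t) :
    ∑ᶠ u ∈ Icc s t, width c (line p r u) r =
      topSlope c (line p r t) r - lowSlope c (line p r s) r := by
  rcases hst.eq_or_lt with rfl | hst
  · simp [width]
  · rw [← Ioc_union_left hst.le, finsum_mem_union' (by simp) (finite_inter_support_width ..)
      (finite_inter_support_width ..), finsum_width_Ioc c p r hst, finsum_mem_singleton, width]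
    ring

theorem finsum_width_Ico (c : Expo → ℝ) (p : Plane) (r : ℤ × ℤ) {s t : ℝ} (hst : s < t) :
    ∑ᶠ u ∈ Ico s t, width c (line p r u) r =
      lowSlope c (line p r t) r - lowSlope c (line p r s) r := by
  rw [← Ioo_union_left hst, finsum_mem_union' (by simp) (finite_inter_support_width ..)
    (finite_inter_support_width ..), finsum_width_Ioo c p r hst, finsum_mem_singleton, width]
  ring

/-- Parity of the total change of slope along a maximal interval in the curve. -/
theorem even_finsum_width {p : Plane} {r : ℤ × ℤ} {T : ℝ} {e : ℤ} (hT : 0 < T)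
    {I : Set ℝ} (hI : I ⊆ Icc 0 T) (hcurve : ∀ t ∈ I, line p r t ∈ curve c)
    (hconn : I.OrdConnected)
    (hsat : ∀ x ∈ I, ∀ y ∈ Icc 0 T, (∀ z ∈ uIcc x y, line p r z ∈ curve c) → y ∈ I)
    (hpar : ∀ t ∈ Ioo 0 T, line p r t ∉ curve c → Even (topSlope c (line p r t) r + e)) :
    Even ((∑ᶠ t ∈ I ∩ Ioo 0 T, width c (line p r t) r) +
      (∑ᶠ t ∈ I ∩ {0}, (topSlope c (line p r t) r + e)) +
      ∑ᶠ t ∈ I ∩ {T}, (lowSlope c (line p r t) r + e)) := by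
  rcases I.eq_empty_or_nonempty with rfl | hne
  · simp
  have hα := sInf_mem_of_saturated hI hne hcurve hconn hsat
  have hβ := sSup_mem_of_saturated hI hne hcurve hconn hsat
  set α := sInf I
  set β := sSup I
  have hbelow : ∀ x ∈ I, α ≤ x := fun x hx => csInf_le ⟨0, fun x hx => (hI hx).1⟩ hx
  have habove : ∀ x ∈ I, x ≤ β := fun x hx => le_csSup ⟨T, fun x hx => (hI hx).2⟩ hx
  have hIeq : I = Icc α β := by
    ext x
    exact ⟨fun hx => ⟨hbelow x hx, habove x hx⟩, fun hx => hconn.out hα hβ hx⟩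
  have hα0 := (hI hα).1
  have hβT := (hI hβ).2
  have hαβ := hbelow β hβ
  -- Saturation prevents the line from staying in the curve on any interval after `β`, so there are
  -- points outside the curve arbitrarily close to `β`.
  have hright : β < T → Even (topSlope c (line p r β) r + e) := by
    intro h
    refine even_topSlope_of_last h (fun t ht => hpar t ⟨by linarith [ht.1], ht.2⟩) ?_
    intro y hy
    by_contra hcon
    push Not at hcon
    have := habove y (hsat β hβ y ⟨by linarith [hy.1], hy.2.le⟩ fun z hz => by
      rw [uIcc_of_le hy.1.le] at hz
      rcases hz.1.eq_or_lt with h | h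
      · exact h ▸ hcurve β hβ
      · exact hcon z ⟨h, hz.2⟩)
    linarith [hy.1]
  have hleft : 0 < α → Even (lowSlope c (line p r α) r + e) := by
    intro h
    refine even_lowSlope_of_first h (fun t ht => hpar t ⟨ht.1, by linarith [ht.2]⟩) ?_
    intro y hy
    by_contra hcon
    push Not at hcon
    have := hbelow y (hsat α hα y ⟨hy.1.le, by linarith [hy.2]⟩ fun z hz => by
      rw [uIcc_of_ge hy.2.le] at hz
      rcases hz.2.eq_or_lt with h | h
      · exact h ▸ hcurve α hα
      · exact hcon z ⟨hz.1, h⟩)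
    linarith [hy.2]
  -- If both ends of `I` are inner points, the slopes before and after have the parity of `e`, so
  -- their difference is even. At an end of `[0, T]` contained in `I` no outer slope is available;
  -- the boundary term in the statement takes its place.
  rcases hα0.eq_or_lt with h0 | h0 <;> rcases hβT.eq_or_lt with h1 | h1
  · have e1 : I ∩ Ioo 0 T = Ioo 0 T := inter_eq_right.2 fun x hx => by
      rw [hIeq, ← h0, h1]; exact ⟨hx.1.le, hx.2.le⟩
    have e2 : I ∩ {0} = {0} := inter_eq_right.2 (by simpa [h0] using hα)
    have e3 : I ∩ {T} = {T} := inter_eq_right.2 (by simpa [← h1] using hβ)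
    rw [e1, e2, e3, finsum_mem_singleton, finsum_mem_singleton, finsum_width_Ioo c p r hT]
    exact ⟨lowSlope c (line p r T) r + e, by ring⟩
  · have e2 : I ∩ {0} = {0} := inter_eq_right.2 (by simpa [h0] using hα)
    have e3 : I ∩ {T} = ∅ := by
      ext x; simp only [mem_inter_iff, mem_singleton_iff, mem_empty_iff_false, iff_false, not_and]
      rintro hx rfl
      linarith [habove x hx]
    rw [e2, e3, finsum_mem_singleton, finsum_mem_empty]
    have e1 : I ∩ Ioo 0 T = Ioc 0 β := by
      ext x
      rw [hIeq, ← h0]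
      simp only [mem_inter_iff, mem_Icc, mem_Ioo, mem_Ioc]
      constructor
      · tauto
      · rintro ⟨h2, h3⟩; exact ⟨⟨h2.le, h3⟩, h2, h3.trans_lt h1⟩
    rw [e1]
    rcases (hI hβ).1.eq_or_lt with h2 | h2
    · rw [← h2]; simpa [← h2] using hright h1
    · rw [finsum_width_Ioc c p r h2]
      have := hright h1
      ring_nf at this ⊢
      exact this
  · have e2 : I ∩ {0} = ∅ := by
      ext x; simp only [mem_inter_iff, mem_singleton_iff, mem_empty_iff_false, iff_false, not_and]
      rintro hx rfl
      linarith [hbelow _ hx]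
    have e3 : I ∩ {T} = {T} := inter_eq_right.2 (by simpa [← h1] using hβ)
    rw [e2, e3, finsum_mem_singleton, finsum_mem_empty]
    have e1 : I ∩ Ioo 0 T = Ico α T := by
      ext x
      rw [hIeq, h1]
      simp only [mem_inter_iff, mem_Icc, mem_Ioo, mem_Ico]
      constructor
      · tauto
      · rintro ⟨h2, h3⟩; exact ⟨⟨h2, h3.le⟩, h0.trans_le h2, h3⟩
    rw [e1]
    rcases (hI hα).2.eq_or_lt with h2 | h2
    · rw [h2]; simpa [h2] using hleft h0
    · rw [finsum_width_Ico c p r h2]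
      obtain ⟨k, hk⟩ := hleft h0
      exact ⟨lowSlope c (line p r T) r + e - k, by linarith⟩
  · have e2 : I ∩ {0} = ∅ := by
      ext x; simp only [mem_inter_iff, mem_singleton_iff, mem_empty_iff_false, iff_false, not_and]
      rintro hx rfl
      linarith [hbelow _ hx]
    have e3 : I ∩ {T} = ∅ := by
      ext x; simp only [mem_inter_iff, mem_singleton_iff, mem_empty_iff_false, iff_false, not_and]
      rintro hx rfl
      linarith [habove x hx]
    have e1 : I ∩ Ioo 0 T = Icc α β := by
      rw [← hIeq]
      refine inter_eq_left.2 fun x hx => ?_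
      exact ⟨h0.trans_le (hbelow x hx), (habove x hx).trans_lt h1⟩
    rw [e1, e2, e3, finsum_mem_empty, finsum_mem_empty, finsum_width_Icc c p r hαβ]
    obtain ⟨k, hk⟩ := hleft h0
    obtain ⟨l, hl⟩ := hright h1
    exact ⟨l - k, by linarith⟩

/-- The slope of the tropical polynomial far out in a direction. -/
def endSlope (r : ℤ × ℤ) : ℤ := (Finset.univ : Finset Expo).sup' Finset.univ_nonempty (slope r)

theorem topSlope_le_endSlope (c : Expo → ℝ) (p : Plane) (r : ℤ × ℤ) :
    topSlope c p r ≤ endSlope r :=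
  Finset.sup'_mono _ (Finset.subset_univ _) _

/-- Beyond the last breakpoint the slope is constant. It has to be the maximal one, since an
exponent of larger slope would eventually overtake the dominant one. -/
theorem exists_tail (c : Expo → ℝ) (p : Plane) (r : ℤ × ℤ) :
    ∃ T > 0, ∀ t ≥ T, width c (line p r t) r = 0 ∧ topSlope c (line p r t) r = endSlope r ∧
      lowSlope c (line p r t) r = endSlope r := by
  obtain ⟨B, hB⟩ := (finite_width_ne_zero c p r).bddAbove
  have hT : ∀ t > B, width c (line p r t) r = 0 := fun t ht => by
    by_contra h
    exact absurd (hB h) (not_le.2 ht)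
  have hconst : ∀ s t, B < s → s < t → lowSlope c (line p r t) r = topSlope c (line p r s) r :=
    fun s t hs hst => lowSlope_eq_topSlope hst fun u hu => hT u (hs.trans hu.1)
  refine ⟨max (B + 1) 1, lt_max_of_lt_right one_pos, fun t ht => ?_⟩
  have htB : B < t := by linarith [le_max_left (B + 1) 1]
  have hw := hT t htB
  suffices h : topSlope c (line p r t) r = endSlope r by
    refine ⟨hw, h, ?_⟩
    unfold width at hw
    omega
  refine le_antisymm (topSlope_le_endSlope c _ r) ?_
  by_contra hlt
  push Not at hlt
  obtain ⟨M, -, hM⟩ := Finset.exists_mem_eq_sup' (Finset.univ_nonempty (α := Expo)) (slope r)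
  obtain ⟨m, hm, hms⟩ := exists_slope_eq_topSlope c (line p r t) r
  have hM' : slope r m < slope r M := by
    rw [hms]; exact hlt.trans_eq hM
  have hM1 : (1 : ℝ) ≤ slope r M - slope r m := by
    have : (slope r m : ℝ) + 1 ≤ slope r M := by exact_mod_cast hM'
    linarith
  -- The slopes of `M` and `m` differ by at least one, so after a time exceeding the initial lead of
  -- `m` the exponent `M` is ahead; `k + 1` is such a time, and it is also later than `t`.
  set k := max 0 (monomial c m p - monomial c M p) + t with hk
  have hmem : ∀ u > t, m ∈ dualCell c (line p r u) := by
    intro u hu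
    have h1 := dualCell_line_eq_rightFace (c := c) (p := p) (r := r) (s := t) (t := u + 1) (u := u)
      (fun v hv => hT v (htB.trans hv.1)) ⟨hu, by linarith⟩
    rw [h1]
    exact mem_rightFace.2 ⟨hm, hms⟩
  have htk : t < k + 1 := by linarith [le_max_left 0 (monomial c m p - monomial c M p)]
  have hB1 := (le_max_right (B + 1) 1).trans ht
  have := mem_dualCell.1 (hmem (k + 1) htk) M
  rw [monomial_line, monomial_line] at this
  have h2 := le_max_right 0 (monomial c m p - monomial c M p)
  have h3 : 0 < k + 1 := by linarith
  nlinarith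

theorem finsum_width_Ioi (c : Expo → ℝ) (p : Plane) (r : ℤ × ℤ) (s : ℝ) :
    ∑ᶠ u ∈ Ioi s, width c (line p r u) r = endSlope r - topSlope c (line p r s) r := by
  obtain ⟨T, -, hT⟩ := exists_tail c p r
  have h1 : s < max (s + 1) T := lt_max_of_lt_left (by linarith)
  rw [← Ioo_union_Ici_eq_Ioi h1, finsum_mem_union' _ (finite_inter_support_width ..)
    (finite_inter_support_width ..), finsum_width_Ioo c p r h1,
    (hT _ (le_max_right _ _)).2.2, finsum_mem_congr (g := fun _ => (0 : ℤ))
      (rfl : Ici (max (s + 1) T) = _) fun u hu =>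
      (hT u ((le_max_right (s + 1) T).trans hu)).1]
  · simp
  · rw [Set.disjoint_left]
    exact fun x hx hx' => absurd hx' (not_le.2 hx.2)

/-! ### Smooth curves along a line -/

/-- Integer vectors one of whose coordinates is a unit. -/
def IsUnitDir (r : ℤ × ℤ) : Prop := IsUnit r.1 ∨ IsUnit r.2

/-- Two exponents of a triangle with the same slope: the third one differs by one. -/
theorem abs_slope_sub_eq_one (hc : IsSmooth c) {p : Plane} {r : ℤ × ℤ}
    (hr : IsUnitDir r) {m m' m'' : Expo} (hm : m ∈ dualCell c p) (hm' : m' ∈ dualCell c p)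
    (hm'' : m'' ∈ dualCell c p) (h1 : m ≠ m') (h2 : m ≠ m'') (h3 : m' ≠ m'')
    (hs : slope r m = slope r m') : |slope r m'' - slope r m| = 1 := by
  have hdet := (hc p).2 m hm m' hm' m'' hm'' h1 h2 h3
  rw [← Int.isUnit_iff_abs_eq] at hdet ⊢
  unfold slope at hs ⊢
  set a := m.toInt
  set b := m'.toInt
  set d := m''.toInt
  rcases hr with hr | hr
  -- Since `b - a` is orthogonal to `r`, a coordinate of `b - a` times the slope difference equals,
  -- up to sign, a coordinate of `r` times the determinant. With that coordinate of `r` a unit, the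
  -- product is a unit, and hence so is the slope difference.
  · refine isUnit_of_mul_isUnit_right (x := -(b.2 - a.2)) ?_
    have e : -(b.2 - a.2) * (d.1 * r.1 + d.2 * r.2 - (a.1 * r.1 + a.2 * r.2)) =
        r.1 * ((b.1 - a.1) * (d.2 - a.2) - (b.2 - a.2) * (d.1 - a.1)) := by
      linear_combination (d.2 - a.2) * hs
    rw [e]
    exact hr.mul hdet
  · refine isUnit_of_mul_isUnit_right (x := (b.1 - a.1)) ?_
    have e : (b.1 - a.1) * (d.1 * r.1 + d.2 * r.2 - (a.1 * r.1 + a.2 * r.2)) =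
        r.2 * ((b.1 - a.1) * (d.2 - a.2) - (b.2 - a.2) * (d.1 - a.1)) := by
      linear_combination -(d.1 - a.1) * hs
    rw [e]
    exact hr.mul hdet

theorem card_dualCell_le (hc : IsSmooth c) (p : Plane) : (dualCell c p).card ≤ 3 :=
  (hc p).1

/-- The slope changes between `s` and `t`, so the finite set of breakpoints in between is nonempty;
its minimum is taken. -/
theorem exists_first_jump {p : Plane} {r : ℤ × ℤ} {s t : ℝ} (hst : s < t)
    (h : topSlope c (line p r s) r < lowSlope c (line p r t) r) :
    ∃ τ ∈ Ioo s t, (∀ u ∈ Ioo s τ, width c (line p r u) r = 0) ∧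
      0 < width c (line p r τ) r ∧ lowSlope c (line p r τ) r = topSlope c (line p r s) r := by
  have hne : (Ioo s t ∩ {u | width c (line p r u) r ≠ 0}).Nonempty := by
    by_contra hcon
    rw [Set.not_nonempty_iff_eq_empty] at hcon
    have := lowSlope_eq_topSlope hst (c := c) (p := p) (r := r) fun u hu => by
      by_contra hw
      exact (hcon ▸ (⟨hu, hw⟩ : u ∈ Ioo s t ∩ _) : u ∈ (∅ : Set ℝ))
    omega
  have hfin : (Ioo s t ∩ {u | width c (line p r u) r ≠ 0}).Finite :=
    (finite_width_ne_zero c p r).subset inter_subset_right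
  obtain ⟨τ, hτ, hmin⟩ := hfin.exists_minimal hne
  have h0 : ∀ u ∈ Ioo s τ, width c (line p r u) r = 0 := by
    intro u hu
    by_contra hw
    have := hmin (y := u) ⟨⟨hu.1, hu.2.trans hτ.1.2⟩, hw⟩ hu.2.le
    exact absurd hu.2 (not_lt.2 this)
  exact ⟨τ, hτ.1, h0, lt_of_le_of_ne (width_nonneg ..) (Ne.symm hτ.2),
    lowSlope_eq_topSlope hτ.1.1 h0⟩

/-- By convexity the slopes increase along the line; equal slopes at the two ends leave no room for
a change in between. -/
theorem width_eq_zero_of_lowSlope_eq {p : Plane} {r : ℤ × ℤ} {s t : ℝ}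
    (h : lowSlope c (line p r t) r = topSlope c (line p r s) r) :
    ∀ u ∈ Ioo s t, width c (line p r u) r = 0 := by
  intro u hu
  have h1 := topSlope_le_lowSlope c p r hu.1
  have h2 := topSlope_le_lowSlope c p r hu.2
  have h3 := lowSlope_le_topSlope c (line p r u) r
  unfold width
  omega

theorem dualCell_const_of_lowSlope_eq {p : Plane} {r : ℤ × ℤ} {s t : ℝ}
    (h : lowSlope c (line p r t) r = topSlope c (line p r s) r) :
    ∀ u ∈ Ioo s t, dualCell c (line p r u) = rightFace c (line p r s) r := fun _ hu =>
  dualCell_line_eq_rightFace (width_eq_zero_of_lowSlope_eq h) hu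

theorem notMem_curve_of_card_rightFace {p : Plane} {r : ℤ × ℤ} {s t : ℝ}
    (hcard : (rightFace c (line p r s) r).card = 1)
    (h : lowSlope c (line p r t) r = topSlope c (line p r s) r) :
    ∀ u ∈ Ioo s t, line p r u ∉ curve c := by
  intro u hu hcur
  have := two_le_card_of_mem_curve hcur
  rw [dualCell_const_of_lowSlope_eq h u hu] at this
  omega

theorem rightFace_subset_of_jump {p : Plane} {r : ℤ × ℤ} {s τ : ℝ} (hs : s < τ)
    (h0 : ∀ u ∈ Ioo s τ, width c (line p r u) r = 0) :
    rightFace c (line p r s) r = rightFace c (line p r τ) (-r) := by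
  have hu : (s + τ) / 2 ∈ Ioo s τ := ⟨by linarith, by linarith⟩
  rw [← dualCell_line_eq_rightFace h0 hu, ← dualCell_line_eq_leftFace h0 hu]

/-- An overlap of the line with an edge of a smooth curve ends at a vertex, beyond which the line
leaves the curve. -/
theorem exists_end_of_overlap (hc : IsSmooth c) {p : Plane} {r : ℤ × ℤ}
    (hr : IsUnitDir r) {s t : ℝ} (hst : s < t) (hcard : 2 ≤ (rightFace c (line p r s) r).card)
    (h : topSlope c (line p r s) r < lowSlope c (line p r t) r) :
    ∃ τ ∈ Ioo s t, (∀ u ∈ Ioo s τ, dualCell c (line p r u) = rightFace c (line p r s) r) ∧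
      rightFace c (line p r s) r ⊆ dualCell c (line p r τ) ∧ (dualCell c (line p r τ)).card = 3 ∧
      (rightFace c (line p r τ) r).card = 1 ∧
      lowSlope c (line p r τ) r = topSlope c (line p r s) r ∧
      topSlope c (line p r τ) r = topSlope c (line p r s) r + 1 := by
  obtain ⟨τ, hτ, h0, hw, hlow⟩ := exists_first_jump hst h
  have hsub := rightFace_subset_of_jump hτ.1 h0
  obtain ⟨m, hm, m', hm', hne⟩ := Finset.one_lt_card.1 hcard
  have hms := (mem_rightFace.1 hm).2
  have hms' := (mem_rightFace.1 hm').2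
  obtain ⟨n, hn, hns⟩ := exists_slope_eq_topSlope c (line p r τ) r
  have hmτ : m ∈ dualCell c (line p r τ) := by
    rw [hsub] at hm; exact (mem_rightFace.1 hm).1
  have hmτ' : m' ∈ dualCell c (line p r τ) := by
    rw [hsub] at hm'; exact (mem_rightFace.1 hm').1
  have hwτ : topSlope c (line p r τ) r - lowSlope c (line p r τ) r > 0 := hw
  have hmn : m ≠ n := by rintro rfl; omega
  have hmn' : m' ≠ n := by rintro rfl; omega
  -- Two exponents of equal slope persist up to the vertex and a third one is steeper there.
  -- Unimodularity of this triangle forces the jump to be exactly one, and no fourth exponent fits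
  -- into the dual cell.
  have habs := abs_slope_sub_eq_one hc hr hmτ hmτ' hn hne hmn hmn' (by omega)
  have htop : topSlope c (line p r τ) r = topSlope c (line p r s) r + 1 := by
    rcases abs_eq (by norm_num : (0 : ℤ) ≤ 1) |>.1 habs with h | h <;> omega
  have hthree : dualCell c (line p r τ) = {m, m', n} := by
    symm
    apply Finset.eq_of_subset_of_card_le
    · intro x hx
      simp only [Finset.mem_insert, Finset.mem_singleton] at hx
      rcases hx with rfl | rfl | rfl <;> assumption
    · rw [Finset.card_eq_three.2 ⟨m, m', n, hne, hmn, hmn', rfl⟩]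
      exact card_dualCell_le hc _
  refine ⟨τ, hτ, fun u hu => dualCell_line_eq_rightFace h0 hu, ?_, ?_, ?_, hlow, htop⟩
  · rw [hsub]; exact rightFace_subset _ _ _
  · rw [hthree]; exact Finset.card_eq_three.2 ⟨m, m', n, hne, hmn, hmn', rfl⟩
  · rw [Finset.card_eq_one]
    refine ⟨n, ?_⟩
    ext x
    rw [mem_rightFace, hthree, Finset.mem_singleton]
    simp only [Finset.mem_insert, Finset.mem_singleton]
    constructor
    · rintro ⟨rfl | rfl | rfl, hx⟩
      · omega
      · omega
      · rfl
    · rintro rfl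
      exact ⟨Or.inr (Or.inr rfl), hns⟩

/-- A point where the line crosses an edge of the curve with multiplicity two. -/
def IsEdgePoint (c : Expo → ℝ) (p : Plane) (r : ℤ × ℤ) : Prop :=
  (dualCell c p).card = 2 ∧ topSlope c p r = lowSlope c p r + 2

/-- A point where the line crosses the curve with multiplicity two at a vertex, and only there. -/
def IsVertexPoint (c : Expo → ℝ) (p : Plane) (r : ℤ × ℤ) : Prop :=
  ∃ m₁ m₂ m₃, dualCell c p = {m₁, m₂, m₃} ∧ m₁ ≠ m₂ ∧ m₁ ≠ m₃ ∧ m₂ ≠ m₃ ∧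
    slope r m₁ = lowSlope c p r ∧ slope r m₂ = lowSlope c p r + 1 ∧
    slope r m₃ = lowSlope c p r + 2 ∧ topSlope c p r = lowSlope c p r + 2

/-- Between times `α` and `β` the line runs along a bounded edge of the curve. -/
def IsEdgeSegment (c : Expo → ℝ) (p : Plane) (r : ℤ × ℤ) (h : ℤ) (α β : ℝ) : Prop :=
  α < β ∧ (dualCell c (line p r α)).card = 3 ∧ (dualCell c (line p r β)).card = 3 ∧
    lowSlope c (line p r α) r = h ∧ topSlope c (line p r β) r = h + 2 ∧
    ∃ m m', m ≠ m' ∧ slope r m = h + 1 ∧ slope r m' = h + 1 ∧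
      ∀ u ∈ Icc α β, m ∈ dualCell c (line p r u) ∧ m' ∈ dualCell c (line p r u)

/-- An increase of the slope by two, in agreement with the parity condition, is either due to a
single crossing or to a bounded edge along the line. -/
theorem crossing_of_slope_add_two (hc : IsSmooth c) {p : Plane} {r : ℤ × ℤ}
    (hr : IsUnitDir r) {s t : ℝ} (hst : s < t) (hcard : (rightFace c (line p r s) r).card = 1)
    (h : lowSlope c (line p r t) r = topSlope c (line p r s) r + 2)
    (hpar : ∀ u ∈ Ioo s t, line p r u ∉ curve c →
      Even (topSlope c (line p r u) r - topSlope c (line p r s) r)) :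
    (∃ α ∈ Ioo s t, {u ∈ Ioo s t | line p r u ∈ curve c} = {α} ∧
      lowSlope c (line p r α) r = topSlope c (line p r s) r ∧
      rightFace c (line p r s) r ⊆ dualCell c (line p r α) ∧
      rightFace c (line p r t) (-r) ⊆ dualCell c (line p r α) ∧
      (IsEdgePoint c (line p r α) r ∨ IsVertexPoint c (line p r α) r)) ∨
    ∃ α ∈ Ioo s t, ∃ β ∈ Ioo s t, {u ∈ Ioo s t | line p r u ∈ curve c} = Icc α β ∧
      IsEdgeSegment c p r (topSlope c (line p r s) r) α β := by
  obtain ⟨α, hα, h0, hw, hlow⟩ := exists_first_jump (c := c) (p := p) (r := r) hst (by omega)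
  have hnot : ∀ u ∈ Ioo s α, line p r u ∉ curve c :=
    notMem_curve_of_card_rightFace hcard hlow
  have hle : topSlope c (line p r α) r ≤ lowSlope c (line p r t) r := topSlope_le_lowSlope c p r hα.2
  have hw' : 0 < topSlope c (line p r α) r - lowSlope c (line p r α) r := hw
  have hαc : line p r α ∈ curve c := mem_curve_of_width_ne_zero hw.ne'
  obtain ⟨m₁, hm₁, hs₁⟩ := exists_slope_eq_lowSlope c (line p r α) r
  obtain ⟨m₃, hm₃, hs₃⟩ := exists_slope_eq_topSlope c (line p r α) r
  have hne13 : m₁ ≠ m₃ := by rintro rfl; omega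
  -- A first jump by two uses up the whole increase and yields an isolated crossing; a first jump by
  -- one opens a segment along an edge of the curve.
  have hcases : topSlope c (line p r α) r = topSlope c (line p r s) r + 2 ∨
      topSlope c (line p r α) r = topSlope c (line p r s) r + 1 := by omega
  rcases hcases with htop | htop
  · left
    -- A third exponent sharing the slope of `m₁` or `m₃` would, by unimodularity, reduce the jump
    -- to one; so its slope lies strictly in between.
    have hval : ∀ m ∈ dualCell c (line p r α), m ≠ m₁ → m ≠ m₃ →
        slope r m = topSlope c (line p r s) r + 1 := by
      intro m hm hne1 hne3
      have h1 := slope_le_topSlope hm r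
      have h2 := lowSlope_le_slope hm r
      by_contra hcon
      rcases (by omega : slope r m₁ = slope r m ∨ slope r m₃ = slope r m) with h3 | h3
      · have := abs_slope_sub_eq_one hc hr hm₁ hm hm₃ hne1.symm hne13 hne3 h3
        rcases abs_eq (by norm_num : (0 : ℤ) ≤ 1) |>.1 this with h | h <;> omega
      · have := abs_slope_sub_eq_one hc hr hm₃ hm hm₁ hne3.symm hne13.symm hne1 h3
        rcases abs_eq (by norm_num : (0 : ℤ) ≤ 1) |>.1 this with h | h <;> omega
    have hface : (rightFace c (line p r α) r).card = 1 := by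
      refine Finset.card_eq_one.2 ⟨m₃, Finset.eq_singleton_iff_unique_mem.2
        ⟨mem_rightFace.2 ⟨hm₃, hs₃⟩, fun x hx => ?_⟩⟩
      obtain ⟨hx, hxs⟩ := mem_rightFace.1 hx
      by_contra hne
      by_cases hx1 : x = m₁
      · subst hx1; omega
      · have := hval x hx hx1 hne; omega
    have hafter := notMem_curve_of_card_rightFace (t := t) hface (by omega)
    refine ⟨α, hα, ?_, hlow, ?_, ?_, ?_⟩
    · ext u
      simp only [mem_ofPred_eq, mem_singleton_iff]
      constructor
      · rintro ⟨hu, huc⟩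
        rcases lt_trichotomy u α with hlt | heq | hgt
        · exact absurd huc (hnot u ⟨hu.1, hlt⟩)
        · exact heq
        · exact absurd huc (hafter u ⟨hgt, hu.2⟩)
      · rintro rfl; exact ⟨hα, hαc⟩
    · rw [rightFace_subset_of_jump hα.1 h0]; exact rightFace_subset _ _ _
    · rw [← rightFace_subset_of_jump hα.2 (width_eq_zero_of_lowSlope_eq (by omega))]
      exact rightFace_subset _ _ _
    · have hc2 : 2 ≤ (dualCell c (line p r α)).card := hαc
      have hc3 := card_dualCell_le hc (line p r α)
      rcases (by omega : (dualCell c (line p r α)).card = 2 ∨ (dualCell c (line p r α)).card = 3)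
        with hcd | hcd
      · exact Or.inl ⟨hcd, by omega⟩
      · right
        have hss : ({m₁, m₃} : Finset Expo) ⊂ dualCell c (line p r α) := by
          refine Finset.ssubset_iff_subset_ne.2 ⟨?_, fun heq => ?_⟩
          · intro x hx
            simp only [Finset.mem_insert, Finset.mem_singleton] at hx
            rcases hx with rfl | rfl <;> assumption
          · rw [← heq, Finset.card_pair hne13] at hcd; omega
        obtain ⟨m₂, hm₂, hnot2⟩ := Finset.exists_of_ssubset hss
        simp only [Finset.mem_insert, Finset.mem_singleton, not_or] at hnot2
        refine ⟨m₁, m₂, m₃, ?_, Ne.symm hnot2.1, hne13, hnot2.2, hs₁, ?_, ?_, ?_⟩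
        · symm
          apply Finset.eq_of_subset_of_card_le
          · intro x hx
            simp only [Finset.mem_insert, Finset.mem_singleton] at hx
            rcases hx with rfl | rfl | rfl <;> assumption
          · rw [hcd, Finset.card_eq_three.2 ⟨m₁, m₂, m₃, Ne.symm hnot2.1, hne13, hnot2.2, rfl⟩]
        · have := hval m₂ hm₂ hnot2.1 hnot2.2; omega
        · omega
        · omega
  · right
    -- After a jump by one the slope has the wrong parity for a point outside the curve, so the line
    -- must run along an edge immediately after `α`.
    have hface : 2 ≤ (rightFace c (line p r α) r).card := by
      by_contra hcon
      have h1 := rightFace_card_pos c (line p r α) r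
      have hcard1 : (rightFace c (line p r α) r).card = 1 := by omega
      have := even_topSlope_of_last (c := c) (p := p) (r := r) (s := α) (T := t)
        (e := -topSlope c (line p r s) r) hα.2 (fun u hu hcu => by
          have := hpar u ⟨hα.1.trans hu.1, hu.2⟩ hcu
          rwa [sub_eq_add_neg] at this) (by
          intro y hy
          obtain ⟨ε, hε, hd⟩ := exists_pos_dualCell_eq_rightFace c (line p r α) r
          refine ⟨min y (α + ε / 2), ⟨lt_min hy.1 (by linarith), min_le_left _ _⟩, fun hcu => ?_⟩
          have hv : min y (α + ε / 2) - α ∈ Ioo 0 ε :=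
            ⟨sub_pos.2 (lt_min hy.1 (by linarith)), by linarith [min_le_right y (α + ε / 2)]⟩
          have := hd _ hv
          rw [line_line, add_sub_cancel] at this
          have h2 := two_le_card_of_mem_curve hcu
          rw [this] at h2
          omega)
      rw [htop] at this
      obtain ⟨k, hk⟩ := this
      omega
    obtain ⟨β, hβ, hmid, hsub, hβ3, hβ1, hβlow, hβtop⟩ :=
      exists_end_of_overlap hc hr hα.2 hface (by omega)
    have hafter := notMem_curve_of_card_rightFace (t := t) hβ1 (by omega)
    obtain ⟨m, hm, m', hm', hne⟩ := Finset.one_lt_card.1 hface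
    have hmd := mem_rightFace.1 hm
    have hmd' := mem_rightFace.1 hm'
    have hmem : ∀ u ∈ Icc α β, m ∈ dualCell c (line p r u) ∧ m' ∈ dualCell c (line p r u) := by
      intro u hu
      rcases hu.1.eq_or_lt with rfl | h1
      · exact ⟨hmd.1, hmd'.1⟩
      rcases hu.2.eq_or_lt with rfl | h2
      · exact ⟨hsub hm, hsub hm'⟩
      · rw [hmid u ⟨h1, h2⟩]; exact ⟨hm, hm'⟩
    refine ⟨α, hα, β, ⟨hα.1.trans hβ.1, hβ.2⟩, ?_, hβ.1, ?_, hβ3, hlow, by omega, m, m', hne,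
      by omega, by omega, hmem⟩
    · ext u
      simp only [mem_ofPred_eq]
      constructor
      · rintro ⟨hu, huc⟩
        refine ⟨?_, ?_⟩
        · by_contra hlt
          exact hnot u ⟨hu.1, not_le.1 hlt⟩ huc
        · by_contra hgt
          exact hafter u ⟨not_le.1 hgt, hu.2⟩ huc
      · intro hu
        exact ⟨⟨hα.1.trans_le hu.1, hu.2.trans_lt hβ.2⟩,
          mem_curve_of_ne (hmem u hu).1 (hmem u hu).2 hne⟩
    · have hc3 := card_dualCell_le hc (line p r α)
      have : 3 ≤ (dualCell c (line p r α)).card := by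
        have h1 : m₁ ≠ m := by rintro rfl; omega
        have h2 : m₁ ≠ m' := by rintro rfl; omega
        rw [← Finset.card_eq_three.2 ⟨m₁, m, m', h1, h2, hne, rfl⟩]
        apply Finset.card_le_card
        intro x hx
        simp only [Finset.mem_insert, Finset.mem_singleton] at hx
        rcases hx with rfl | rfl | rfl
        exacts [hm₁, hmd.1, hmd'.1]
      omega

/-! ### Curves with an edge of slope one -/

theorem vertex_zero (q : Param) : vertex q 0 = q.1 := rfl

theorem vertex_one (q : Param) : vertex q 1 = (q.1.1 + q.2, q.1.2 + |q.2|) := rfl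

theorem mem_segment_diag {x y l : ℝ} (hl : 0 ≤ l) {p : Plane} :
    p ∈ segment ℝ ((x, y) : Plane) (x + l, y + l) ↔
      p.2 - p.1 = y - x ∧ x ≤ p.1 ∧ p.1 ≤ x + l := by
  rw [segment_eq_image']
  constructor
  · rintro ⟨θ, ⟨h0, h1⟩, rfl⟩
    simp only [Prod.fst_add, Prod.snd_add, Prod.smul_fst, Prod.smul_snd, Prod.fst_sub,
      Prod.snd_sub, smul_eq_mul, add_sub_cancel_left]
    exact ⟨by ring, by nlinarith, by nlinarith⟩
  · rintro ⟨h1, h2, h3⟩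
    rcases hl.eq_or_lt with rfl | hl
    · exact ⟨0, by simp, by ext <;> simp <;> linarith⟩
    · refine ⟨(p.1 - x) / l, ⟨by apply div_nonneg <;> linarith, ?_⟩, ?_⟩
      · rw [div_le_one hl]; linarith
      · ext <;> simp [div_mul_cancel₀ _ hl.ne'] ; linarith

/-- Coordinates of the points of `Λ`. -/
theorem mem_lam (hl : 0 ≤ q.2) {p : Plane} :
    p ∈ lam q ↔ (p.2 = q.1.2 ∧ p.1 ≤ q.1.1) ∨ (p.1 = q.1.1 ∧ p.2 ≤ q.1.2) ∨
      (p.2 = q.1.2 + q.2 ∧ q.1.1 + q.2 ≤ p.1) ∨ (p.1 = q.1.1 + q.2 ∧ q.1.2 + q.2 ≤ p.2) ∨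
      (p.2 - p.1 = q.1.2 - q.1.1 ∧ q.1.1 ≤ p.1 ∧ p.1 ≤ q.1.1 + q.2) := by
  have hW : p ∈ leg q .west ↔ (p.2 = q.1.2 ∧ p.1 ≤ q.1.1) := by
    constructor
    · rintro ⟨t, ht, rfl⟩
      simp [armBase, hl, vertex, Arm.dir, ht]
    · rintro ⟨h1, h2⟩
      refine ⟨q.1.1 - p.1, by linarith, ?_⟩
      ext <;> simp [armBase, hl, vertex, Arm.dir, h1]
  have hS : p ∈ leg q .south ↔ (p.1 = q.1.1 ∧ p.2 ≤ q.1.2) := by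
    constructor
    · rintro ⟨t, ht, rfl⟩
      simp [armBase, vertex, Arm.dir, ht]
    · rintro ⟨h1, h2⟩
      refine ⟨q.1.2 - p.2, by linarith, ?_⟩
      ext <;> simp [armBase, vertex, Arm.dir, h1]
  have hE : p ∈ leg q .east ↔ (p.2 = q.1.2 + q.2 ∧ q.1.1 + q.2 ≤ p.1) := by
    constructor
    · rintro ⟨t, ht, rfl⟩
      simp [armBase, hl, vertex, Arm.dir, ht, abs_of_nonneg hl]
    · rintro ⟨h1, h2⟩
      refine ⟨p.1 - (q.1.1 + q.2), by linarith, ?_⟩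
      ext <;> simp [armBase, hl, vertex, Arm.dir, h1, abs_of_nonneg hl]
  have hN : p ∈ leg q .north ↔ (p.1 = q.1.1 + q.2 ∧ q.1.2 + q.2 ≤ p.2) := by
    constructor
    · rintro ⟨t, ht, rfl⟩
      simp [armBase, vertex, Arm.dir, ht, abs_of_nonneg hl]
    · rintro ⟨h1, h2⟩
      refine ⟨p.2 - (q.1.2 + q.2), by linarith, ?_⟩
      ext <;> simp [armBase, vertex, Arm.dir, h1, abs_of_nonneg hl]
  have hD : p ∈ segment ℝ (vertex q 0) (vertex q 1) ↔
      (p.2 - p.1 = q.1.2 - q.1.1 ∧ q.1.1 ≤ p.1 ∧ p.1 ≤ q.1.1 + q.2) := by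
    rw [vertex_zero, vertex_one, abs_of_nonneg hl]
    exact mem_segment_diag hl
  unfold lam
  rw [mem_union, mem_union, mem_union, mem_union, hW, hS, hE, hN, hD, or_assoc, or_assoc, or_assoc]

open Classical in
/-- The primitive directions of `Λ` outgoing from a point. -/
def outDirs (q : Param) (p : Plane) : Finset (ℤ × ℤ) :=
  directions.filter fun r => ∀ᶠ t in 𝓝[>] (0 : ℝ), p + t • toPlane r ∈ lam q

theorem multAt_eq (c : Expo → ℝ) (q : Param) (p : Plane) :
    multAt c q p = ∑ r ∈ outDirs q p, topSlope c p r := rfl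

theorem outDirs_eq {p : Plane} {S : Finset (ℤ × ℤ)} (hS : S ⊆ directions) {ε : ℝ}
    (hε : 0 < ε) (h : ∀ r ∈ directions, ∀ t, 0 < t → t < ε →
      (p + t • toPlane r ∈ lam q ↔ r ∈ S)) : outDirs q p = S := by
  ext r
  simp only [outDirs, Finset.mem_filter]
  have hev : ∀ᶠ t in 𝓝[>] (0 : ℝ), t ∈ Ioo 0 ε := Ioo_mem_nhdsGT hε
  constructor
  · rintro ⟨hr, h1⟩
    obtain ⟨t, ht, ht'⟩ := (hev.and h1).exists
    exact (h r hr t ht.1 ht.2).1 ht'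
  · intro hr
    exact ⟨hS hr, hev.mono fun t ht => (h r (hS hr) t ht.1 ht.2).2 hr⟩

theorem outDirs_lower (hl : 0 < q.2) :
    outDirs q q.1 = {(-1, 0), (0, -1), (1, 1)} := by
  refine outDirs_eq (by decide) hl fun r hr t h0 h1 => ?_
  rw [mem_lam hl.le]
  simp only [directions, Finset.mem_insert, Finset.mem_singleton] at hr
  rcases hr with rfl | rfl | rfl | rfl | rfl | rfl | rfl | rfl <;>
    simp [toPlane] <;> grind

theorem outDirs_upper (hl : 0 < q.2) :
    outDirs q (vertex q 1) = {(1, 0), (0, 1), (-1, -1)} := by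
  refine outDirs_eq (by decide) hl fun r hr t h0 h1 => ?_
  rw [mem_lam hl.le, vertex_one, abs_of_pos hl]
  simp only [directions, Finset.mem_insert, Finset.mem_singleton] at hr
  rcases hr with rfl | rfl | rfl | rfl | rfl | rfl | rfl | rfl <;>
    simp [toPlane] <;> grind

theorem outDirs_fourValent (hl : q.2 = 0) :
    outDirs q q.1 = {(-1, 0), (0, -1), (1, 0), (0, 1)} := by
  refine outDirs_eq (by decide) one_pos fun r hr t h0 h1 => ?_
  rw [mem_lam hl.ge]
  simp only [directions, Finset.mem_insert, Finset.mem_singleton] at hr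
  rcases hr with rfl | rfl | rfl | rfl | rfl | rfl | rfl | rfl <;>
    simp [toPlane, hl] <;> grind

/-- The direction of a leg, or of the edge of slope one, as an integer vector. -/
def Arm.idir : Arm → ℤ × ℤ
  | .west => (-1, 0)
  | .south => (0, -1)
  | .east => (1, 0)
  | .north => (0, 1)
  | .diag => (1, 1)

theorem Arm.toPlane_idir {a : Arm} (ha : a ≠ .diag) : toPlane a.idir = a.dir := by
  cases a <;> simp [toPlane, Arm.idir, Arm.dir] at ha ⊢

theorem outDirs_leg (hl : 0 ≤ q.2) {a : Arm} (ha : a ≠ .diag) {s : ℝ} (hs : 0 < s) :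
    outDirs q (line (armBase q a) a.idir s) = {a.idir, -a.idir} := by
  refine outDirs_eq (by cases a <;> decide) hs fun r hr t h0 h1 => ?_
  rw [mem_lam hl]
  simp only [directions, Finset.mem_insert, Finset.mem_singleton] at hr
  cases a
  case diag => exact absurd rfl ha
  all_goals
    rcases hr with rfl | rfl | rfl | rfl | rfl | rfl | rfl | rfl <;>
    simp [toPlane, line, Arm.idir, armBase, hl, vertex, abs_of_nonneg hl] <;> grind

theorem outDirs_diag {s : ℝ} (hs : 0 < s) (hs' : s < q.2) :
    outDirs q (line q.1 (1, 1) s) = {(1, 1), -(1, 1)} := by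
  have hl : 0 ≤ q.2 := (hs.trans hs').le
  refine outDirs_eq (by decide) (lt_min hs (sub_pos.2 hs')) fun r hr t h0 h1 => ?_
  have h2 := h1.trans_le (min_le_left _ _)
  have h3 := h1.trans_le (min_le_right _ _)
  rw [mem_lam hl]
  simp only [directions, Finset.mem_insert, Finset.mem_singleton] at hr
  rcases hr with rfl | rfl | rfl | rfl | rfl | rfl | rfl | rfl <;>
    simp [toPlane, line] <;> grind

theorem multAt_leg (c : Expo → ℝ) (hl : 0 ≤ q.2) {a : Arm} (ha : a ≠ .diag) {s : ℝ}
    (hs : 0 < s) : multAt c q (line (armBase q a) a.idir s) =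
      width c (line (armBase q a) a.idir s) a.idir := by
  rw [multAt_eq, outDirs_leg hl ha hs, width_eq_add, Finset.sum_pair]
  cases a <;> decide

theorem multAt_diag (c : Expo → ℝ) {s : ℝ} (hs : 0 < s) (hs' : s < q.2) :
    multAt c q (line q.1 (1, 1) s) = width c (line q.1 (1, 1) s) (1, 1) := by
  rw [multAt_eq, outDirs_diag hs hs', width_eq_add, Finset.sum_pair]
  decide

theorem multAt_lower (c : Expo → ℝ) (hl : 0 < q.2) :
    multAt c q q.1 = topSlope c q.1 (-1, 0) + topSlope c q.1 (0, -1) + topSlope c q.1 (1, 1) := by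
  rw [multAt_eq, outDirs_lower hl, Finset.sum_insert (by decide), Finset.sum_pair (by decide),
    add_assoc]

theorem multAt_upper (c : Expo → ℝ) (hl : 0 < q.2) :
    multAt c q (vertex q 1) = topSlope c (vertex q 1) (1, 0) + topSlope c (vertex q 1) (0, 1) +
      topSlope c (vertex q 1) (-1, -1) := by
  rw [multAt_eq, outDirs_upper hl, Finset.sum_insert (by decide), Finset.sum_pair (by decide),
    add_assoc]

theorem multAt_fourValent (c : Expo → ℝ) (hl : q.2 = 0) :
    multAt c q q.1 = topSlope c q.1 (-1, 0) + topSlope c q.1 (0, -1) + topSlope c q.1 (1, 0) +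
      topSlope c q.1 (0, 1) := by
  rw [multAt_eq, outDirs_fourValent hl, Finset.sum_insert (by decide),
    Finset.sum_insert (by decide), Finset.sum_pair (by decide)]
  ring

/-- A point of `Λ` is a vertex, or lies in a leg or in the edge. -/
theorem mem_lam_cases (hl : 0 ≤ q.2) {p : Plane} (hp : p ∈ lam q) :
    p = q.1 ∨ p = vertex q 1 ∨ (∃ a : Arm, a ≠ .diag ∧ ∃ t > 0, p = line (armBase q a) a.idir t) ∨
      ∃ t, 0 < t ∧ t < q.2 ∧ p = line q.1 (1, 1) t := by
  have key : ∀ {a : Arm}, a ≠ .diag → ∀ {t : ℝ}, 0 ≤ t → p = line (armBase q a) a.idir t →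
      p = q.1 ∨ p = vertex q 1 ∨
        (∃ a : Arm, a ≠ .diag ∧ ∃ t > 0, p = line (armBase q a) a.idir t) ∨
        ∃ t, 0 < t ∧ t < q.2 ∧ p = line q.1 (1, 1) t := by
    intro a ha t ht h
    rcases ht.eq_or_lt with rfl | ht
    · rw [line_zero] at h
      cases a <;> simp [armBase, hl, vertex_zero] at h <;> tauto
    · exact Or.inr (Or.inr (Or.inl ⟨a, ha, t, ht, h⟩))
  rcases (mem_lam hl).1 hp with h | h | h | h | h
  · refine key (a := .west) (by simp) (t := q.1.1 - p.1) (by linarith) ?_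
    ext <;> simp [line, toPlane, Arm.idir, armBase, hl, vertex, h.1]
  · refine key (a := .south) (by simp) (t := q.1.2 - p.2) (by linarith) ?_
    ext <;> simp [line, toPlane, Arm.idir, armBase, vertex, h.1]
  · refine key (a := .east) (by simp) (t := p.1 - (q.1.1 + q.2)) (by linarith) ?_
    ext <;> simp [line, toPlane, Arm.idir, armBase, hl, vertex, h.1, abs_of_nonneg hl]
  · refine key (a := .north) (by simp) (t := p.2 - (q.1.2 + q.2)) (by linarith) ?_
    ext <;> simp [line, toPlane, Arm.idir, armBase, vertex, h.1, abs_of_nonneg hl]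
  · have e : p = line q.1 (1, 1) (p.1 - q.1.1) := by
      ext <;> simp [line, toPlane]; linarith
    rcases h.2.1.eq_or_lt with h1 | h1
    · left; rw [e, h1]; simp [line]
    rcases h.2.2.eq_or_lt with h2 | h2
    · right; left
      rw [e, h2]
      ext <;> simp [line, toPlane, vertex_one, abs_of_nonneg hl]
    · exact Or.inr (Or.inr (Or.inr ⟨_, by linarith, by linarith, e⟩))

theorem line_mem_lam_leg (hl : 0 ≤ q.2) {a : Arm} (ha : a ≠ .diag) {t : ℝ}
    (ht : 0 ≤ t) : line (armBase q a) a.idir t ∈ lam q := by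
  rw [mem_lam hl]
  cases a
  case diag => exact absurd rfl ha
  all_goals simp [line, toPlane, Arm.idir, armBase, hl, vertex, ht, abs_of_nonneg hl]

theorem line_mem_lam_diag {t : ℝ} (ht : 0 ≤ t) (ht' : t ≤ q.2) :
    line q.1 (1, 1) t ∈ lam q := by
  rw [mem_lam (ht.trans ht')]
  simp [line, toPlane, ht, ht']

/-- The linear functional given by an integer vector. -/
def level (r : ℤ × ℤ) (p : Plane) : ℝ := r.1 * p.1 + r.2 * p.2

theorem continuous_level (r : ℤ × ℤ) : Continuous (level r) := by
  unfold level; fun_prop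

theorem level_line (r : ℤ × ℤ) (p : Plane) (t : ℝ) :
    level r (line p r t) = level r p + t * (r.1 ^ 2 + r.2 ^ 2) := by
  simp [level, line, toPlane]; ring

/-- In the direction of a leg all other parts of `Λ` lie at most as high as the base of the leg, so
each inner point of the leg is alone at its level. Cutting at a level therefore cuts `Λ` at a single
point. The same holds for the edge of slope one and the direction (1, 1). -/
theorem eq_line_of_level_leg (hl : 0 ≤ q.2) {a : Arm} (ha : a ≠ .diag) {t : ℝ}
    (ht : 0 < t) {p : Plane} (hp : p ∈ lam q)
    (h : level a.idir p = level a.idir (line (armBase q a) a.idir t)) :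
    p = line (armBase q a) a.idir t := by
  rw [mem_lam hl] at hp
  cases a
  case diag => exact absurd rfl ha
  all_goals
    simp [level, line, toPlane, Arm.idir, armBase, hl, vertex, abs_of_nonneg hl] at h
    ext <;> simp [line, toPlane, Arm.idir, armBase, hl, vertex, abs_of_nonneg hl] <;> grind

theorem eq_line_of_level_diag {t : ℝ} (ht : 0 < t) (ht' : t < q.2) {p : Plane}
    (hp : p ∈ lam q) (h : level (1, 1) p = level (1, 1) (line q.1 (1, 1) t)) :
    p = line q.1 (1, 1) t := by
  rw [mem_lam (ht.trans ht').le] at hp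
  simp [level, line, toPlane] at h
  ext <;> simp [line, toPlane] <;> grind

/-! ### Connected components of the intersection -/

theorem subset_of_mem_components {K : Set Plane}
    (hK : K ∈ components c q) : K ⊆ lam q ∩ curve c := by
  obtain ⟨p, -, rfl⟩ := hK
  exact connectedComponentIn_subset _ _

theorem isPreconnected_of_mem_components {K : Set Plane}
    (hK : K ∈ components c q) : IsPreconnected K := by
  obtain ⟨p, -, rfl⟩ := hK
  exact isPreconnected_connectedComponentIn

theorem nonempty_of_mem_components {K : Set Plane}
    (hK : K ∈ components c q) : K.Nonempty := by
  obtain ⟨p, hp, rfl⟩ := hK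
  exact ⟨p, mem_connectedComponentIn hp⟩

/-- Maximality of connected components, in the form used to enlarge a component by a segment that
touches it. -/
theorem subset_component {K S : Set Plane}
    (hK : K ∈ components c q) (hS : IsPreconnected S) (hSN : S ⊆ lam q ∩ curve c)
    (hne : (S ∩ K).Nonempty) : S ⊆ K := by
  obtain ⟨p, hp, rfl⟩ := hK
  obtain ⟨x, hxS, hxK⟩ := hne
  rw [connectedComponentIn_eq hxK]
  exact hS.subset_connectedComponentIn hxS hSN

theorem pairwiseDisjoint_components (c : Expo → ℝ) (q : Param) :
    (components c q).PairwiseDisjoint id := by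
  intro K hK K' hK' hne
  rw [Function.onFun, Set.disjoint_iff_inter_eq_empty, id, id]
  by_contra hcon
  have hn := Set.nonempty_iff_ne_empty.2 hcon
  exact hne (subset_antisymm
    (subset_component hK' (isPreconnected_of_mem_components hK) (subset_of_mem_components hK) hn)
    (subset_component hK (isPreconnected_of_mem_components hK') (subset_of_mem_components hK')
      (by rwa [inter_comm])))

theorem sUnion_components (c : Expo → ℝ) (q : Param) :
    ⋃₀ components c q = lam q ∩ curve c := by
  apply subset_antisymm
  · exact sUnion_subset fun K hK => subset_of_mem_components hK
  · exact fun p hp => ⟨_, ⟨p, hp, rfl⟩, mem_connectedComponentIn hp⟩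

/-- A segment of `Λ` which is recognised by the values of a linear functional. -/
structure IsArm (q : Param) (v : Plane) (r : ℤ × ℤ) (T : ℝ) : Prop where
  ne_zero : r ≠ 0
  mem_lam : ∀ t ∈ Icc 0 T, line v r t ∈ lam q
  eq_line : ∀ t ∈ Ioo 0 T, ∀ p ∈ lam q, level r p = level r (line v r t) → p = line v r t

theorem Arm.idir_ne_zero (a : Arm) : a.idir ≠ 0 := by cases a <;> decide

theorem isArm_leg (hl : 0 ≤ q.2) {a : Arm} (ha : a ≠ .diag) (T : ℝ) :
    IsArm q (armBase q a) a.idir T :=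
  ⟨a.idir_ne_zero, fun _ ht => line_mem_lam_leg hl ha ht.1,
    fun _ ht _ hp h => eq_line_of_level_leg hl ha ht.1 hp h⟩

theorem isArm_diag {T : ℝ} (hT : T ≤ q.2) : IsArm q q.1 (1, 1) T :=
  ⟨by decide, fun _ ht => line_mem_lam_diag ht.1 (ht.2.trans hT),
    fun _ ht _ hp h => eq_line_of_level_diag ht.1 (ht.2.trans_le hT) hp h⟩

theorem sq_add_sq_pos {r : ℤ × ℤ} (hr : r ≠ 0) : (0 : ℝ) < (r.1 : ℝ) ^ 2 + (r.2 : ℝ) ^ 2 := by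
  have : r.1 ≠ 0 ∨ r.2 ≠ 0 := by
    by_contra h
    push Not at h
    exact hr (Prod.ext h.1 h.2)
  rcases this with h | h <;> have h' := Int.cast_ne_zero (α := ℝ).2 h <;> positivity

theorem line_injective (v : Plane) {r : ℤ × ℤ} (hr : r ≠ 0) : Function.Injective (line v r) := by
  intro s t h
  have := congrArg (level r) h
  rw [level_line, level_line] at this
  have h2 := sq_add_sq_pos hr
  exact mul_right_cancel₀ h2.ne' (by linarith)

section ArmOfComponent

variable {v : Plane} {r : ℤ × ℤ} {T : ℝ} {K : Set Plane}

/-- The levels of the connected set `K` form an interval, and an inner point of the arm is the only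
point of `Λ` at its level; so `K` contains every arm point between two of its arm points. -/
theorem IsArm.ordConnected (h : IsArm q v r T) (hK : K ∈ components c q) :
    {t ∈ Icc 0 T | line v r t ∈ K}.OrdConnected := by
  refine ⟨fun x hx y hy z hz => ⟨⟨hx.1.1.trans hz.1, hz.2.trans hy.1.2⟩, ?_⟩⟩
  rcases hz.1.eq_or_lt with h1 | h1
  · exact h1 ▸ hx.2
  rcases hz.2.eq_or_lt with h2 | h2
  · exact h2 ▸ hy.2
  have hpre := (isPreconnected_of_mem_components hK).image _ (continuous_level r).continuousOn
  have hpos := sq_add_sq_pos h.ne_zero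
  have hmem := hpre.ordConnected.out (mem_image_of_mem _ hx.2) (mem_image_of_mem _ hy.2)
    (show level r (line v r z) ∈ _ by
      rw [level_line, level_line, level_line]
      constructor <;> nlinarith)
  obtain ⟨p, hp, hpe⟩ := hmem
  rw [← h.eq_line z ⟨hx.1.1.trans_lt h1, h2.trans_le hy.1.2⟩ p (subset_of_mem_components hK hp).1
    hpe]
  exact hp

/-- A stretch of the arm inside the curve which starts in `K` is connected, hence contained in the
same component. -/
theorem IsArm.saturated (h : IsArm q v r T) (hK : K ∈ components c q) :
    ∀ x ∈ {t ∈ Icc 0 T | line v r t ∈ K}, ∀ y ∈ Icc 0 T,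
      (∀ z ∈ uIcc x y, line v r z ∈ curve c) → y ∈ {t ∈ Icc 0 T | line v r t ∈ K} := by
  intro x hx y hy hz
  refine ⟨hy, ?_⟩
  have hpre : IsPreconnected (line v r '' uIcc x y) :=
    isPreconnected_uIcc.image _ (continuous_line v r).continuousOn
  refine subset_component hK hpre ?_ ⟨line v r x, mem_image_of_mem _ left_mem_uIcc, hx.2⟩
    (mem_image_of_mem _ right_mem_uIcc)
  rintro _ ⟨z, hzm, rfl⟩
  have : z ∈ Icc 0 T := (uIcc_subset_Icc hx.1 hy) hzm
  exact ⟨h.mem_lam z this, hz z hzm⟩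

theorem IsArm.curve (_ : IsArm q v r T) (hK : K ∈ components c q) :
    ∀ t ∈ {t ∈ Icc 0 T | line v r t ∈ K}, line v r t ∈ curve c :=
  fun _ ht => (subset_of_mem_components hK ht.2).2

theorem IsArm.even_finsum (h : IsArm q v r T) (hK : K ∈ components c q) (hT : 0 < T) {e : ℤ}
    (hpar : ∀ t ∈ Ioo 0 T, line v r t ∉ TropTritangent.curve c →
      Even (topSlope c (line v r t) r + e)) :
    Even ((∑ᶠ t ∈ {t ∈ Ioo 0 T | line v r t ∈ K}, width c (line v r t) r) +
      (∑ᶠ p ∈ K ∩ {v}, (topSlope c p r + e)) +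
      ∑ᶠ p ∈ K ∩ {line v r T}, (lowSlope c p r + e)) := by
  have := even_finsum_width (c := c) (p := v) (r := r) (e := e) hT
    (I := {t ∈ Icc 0 T | line v r t ∈ K}) (fun t ht => ht.1)
    (h.curve hK) (h.ordConnected hK) (h.saturated hK) hpar
  have e1 : {t ∈ Icc 0 T | line v r t ∈ K} ∩ Ioo 0 T = {t ∈ Ioo 0 T | line v r t ∈ K} := by
    ext t
    simp only [mem_inter_iff, mem_ofPred_eq]
    exact ⟨fun h => ⟨h.2, h.1.2⟩, fun h => ⟨⟨Ioo_subset_Icc_self h.1, h.2⟩, h.1⟩⟩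
  have e2 : ∀ t₀ ∈ Icc 0 T, ∀ f : Plane → ℤ,
      ∑ᶠ t ∈ {t ∈ Icc 0 T | line v r t ∈ K} ∩ {t₀}, f (line v r t) =
        ∑ᶠ p ∈ K ∩ {line v r t₀}, f p := by
    intro t₀ ht₀ f
    by_cases hm : line v r t₀ ∈ K
    · rw [inter_eq_right.2 (singleton_subset_iff.2 (show t₀ ∈ {t ∈ Icc 0 T | line v r t ∈ K} from
        ⟨ht₀, hm⟩)), inter_eq_right.2 (singleton_subset_iff.2 hm), finsum_mem_singleton,
        finsum_mem_singleton]
    · have h1 : {t ∈ Icc 0 T | line v r t ∈ K} ∩ {t₀} = ∅ := by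
        ext x
        simp only [mem_inter_iff, mem_ofPred_eq, mem_singleton_iff, mem_empty_iff_false, iff_false]
        rintro ⟨hx, rfl⟩
        exact hm hx.2
      rw [h1, inter_singleton_eq_empty.2 hm, finsum_mem_empty, finsum_mem_empty]
  rw [e1, e2 0 ⟨le_rfl, hT.le⟩ (fun p => topSlope c p r + e),
    e2 T ⟨hT.le, le_rfl⟩ (fun p => lowSlope c p r + e), line_zero] at this
  exact this

/-- Consider the first time at which the arm is in `K`. If it is positive and the width vanishes
there, all dominant exponents stay dominant a little earlier; the curve then extends backwards along
the arm, against minimality. -/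
theorem IsArm.exists_width_pos (h : IsArm q v r T) (hK : K ∈ components c q) {t : ℝ}
    (ht : t ∈ Icc 0 T) (htK : line v r t ∈ K) :
    v ∈ K ∨ ∃ s, 0 < s ∧ s ≤ t ∧ line v r s ∈ K ∧ 0 < width c (line v r s) r := by
  have hα := sInf_mem_of_saturated (I := {t ∈ Icc 0 T | line v r t ∈ K}) (fun t ht => ht.1)
    ⟨t, ht, htK⟩ (h.curve hK) (h.ordConnected hK) (h.saturated hK)
  have hle : sInf {t ∈ Icc 0 T | line v r t ∈ K} ≤ t := csInf_le ⟨0, fun x hx => hx.1.1⟩ ⟨ht, htK⟩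
  have hbelow : ∀ x ∈ {t ∈ Icc 0 T | line v r t ∈ K}, sInf {t ∈ Icc 0 T | line v r t ∈ K} ≤ x :=
    fun x hx => csInf_le ⟨0, fun x hx => hx.1.1⟩ hx
  set α := sInf {t ∈ Icc 0 T | line v r t ∈ K}
  rcases hα.1.1.eq_or_lt with h0 | h0
  · left; rw [← line_zero v r, h0]; exact hα.2
  refine Or.inr ⟨α, h0, hle, hα.2, lt_of_le_of_ne (width_nonneg ..) fun hw => ?_⟩
  have hcur := h.curve hK α hα
  obtain ⟨ε, hε, hd⟩ := exists_pos_dualCell_eq_rightFace c (line v r α) (-r)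
  have hface : rightFace c (line v r α) (-r) = dualCell c (line v r α) := by
    refine Finset.filter_true_of_mem fun m hm => ?_
    exact slope_eq_of_width_eq_zero (by rw [width_neg]; exact hw.symm) hm
  have hmax : max 0 (α - ε / 2) < α := max_lt h0 (by linarith)
  have := hbelow (max 0 (α - ε / 2)) (h.saturated hK α hα _
    ⟨le_max_left _ _, hmax.le.trans hα.1.2⟩ fun z hz => by
      rw [uIcc_of_ge hmax.le] at hz
      rcases hz.2.eq_or_lt with h1 | h1
      · exact h1 ▸ hcur
      have h2 := hd (α - z) ⟨by linarith, by linarith [(le_max_right 0 (α - ε / 2)).trans hz.1]⟩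
      rw [line_neg, line_line, hface] at h2
      have h3 : α + -(α - z) = z := by ring
      rw [h3] at h2
      have := two_le_card_of_mem_curve hcur
      rw [← h2] at this
      exact this)
  exact absurd hmax (not_lt.2 this)

end ArmOfComponent

/-! ### Sums of multiplicities -/

theorem finite_multAt_ne_zero (c : Expo → ℝ) (hl : 0 ≤ q.2) :
    (lam q ∩ Function.support (multAt c q)).Finite := by
  have hfin : ({q.1, vertex q 1} ∪ (⋃ a ∈ ({.west, .south, .east, .north} : Set Arm),
      line (armBase q a) a.idir '' {t | width c (line (armBase q a) a.idir t) a.idir ≠ 0}) ∪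
      line q.1 (1, 1) '' {t | width c (line q.1 (1, 1) t) (1, 1) ≠ 0} : Set Plane).Finite := by
    refine ((Set.toFinite _).union (Set.Finite.biUnion (Set.toFinite _) fun a _ => ?_)).union ?_
    · exact (finite_width_ne_zero c _ _).image _
    · exact (finite_width_ne_zero c _ _).image _
  refine hfin.subset ?_
  rintro p ⟨hp, hs⟩
  rw [Function.mem_support] at hs
  rcases mem_lam_cases hl hp with rfl | rfl | ⟨a, ha, t, ht, rfl⟩ | ⟨t, h0, h1, rfl⟩
  · simp
  · simp
  · left; right
    rw [multAt_leg c hl ha ht] at hs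
    refine mem_iUnion₂.2 ⟨a, ?_, t, hs, rfl⟩
    cases a <;> simp at ha ⊢
  · right
    rw [multAt_diag c h0 h1] at hs
    exact ⟨t, hs, rfl⟩

theorem mult_union (c : Expo → ℝ) (hl : 0 ≤ q.2) {K K' : Set Plane} (hK : K ⊆ lam q)
    (hK' : K' ⊆ lam q) (hd : Disjoint K K') : mult c q (K ∪ K') = mult c q K + mult c q K' :=
  finsum_mem_union' hd ((finite_multAt_ne_zero c hl).subset (inter_subset_inter_left _ hK))
    ((finite_multAt_ne_zero c hl).subset (inter_subset_inter_left _ hK'))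

theorem mult_biUnion (c : Expo → ℝ) (hl : 0 ≤ q.2) (S : Finset (Set Plane))
    (hS : ∀ K ∈ S, K ⊆ lam q) (hd : (S : Set (Set Plane)).PairwiseDisjoint id) :
    mult c q (⋃ K ∈ S, K) = ∑ K ∈ S, mult c q K := by
  classical
  induction S using Finset.induction_on with
  | empty => simp [mult]
  | insert K S hK ih =>
    rw [Finset.set_biUnion_insert, mult_union c hl (hS K (by simp))
      (iUnion₂_subset fun K' hK' => hS K' (by simp [hK'])), Finset.sum_insert hK,
      ih (fun K' h => hS K' (by simp [h])) (hd.subset (by simp))]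
    rw [Set.disjoint_iUnion₂_right]
    intro K' hK'
    exact hd (by simp) (by simp [hK']) (by rintro rfl; exact hK hK')

theorem mult_leg (c : Expo → ℝ) (hl : 0 ≤ q.2) {a : Arm} (ha : a ≠ .diag) {I : Set ℝ}
    (hI : I ⊆ Ioi 0) : mult c q (line (armBase q a) a.idir '' I) =
      ∑ᶠ t ∈ I, width c (line (armBase q a) a.idir t) a.idir := by
  rw [mult, finsum_mem_image (line_injective _ a.idir_ne_zero).injOn]
  exact finsum_mem_congr rfl fun t ht => multAt_leg c hl ha (hI ht)

theorem mult_diag (c : Expo → ℝ) {I : Set ℝ} (hI : I ⊆ Ioo 0 q.2) :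
    mult c q (line q.1 (1, 1) '' I) = ∑ᶠ t ∈ I, width c (line q.1 (1, 1) t) (1, 1) := by
  rw [mult, finsum_mem_image (line_injective _ (by decide)).injOn]
  exact finsum_mem_congr rfl fun t ht => multAt_diag c (hI ht).1 (hI ht).2

/-- The part of `K` in the interior of a leg. -/
def legPart (q : Param) (a : Arm) (K : Set Plane) : Set ℝ :=
  {t ∈ Ioi 0 | line (armBase q a) a.idir t ∈ K}

/-- The part of `K` in the interior of the edge. -/
def diagPart (q : Param) (K : Set Plane) : Set ℝ := {t ∈ Ioo 0 q.2 | line q.1 (1, 1) t ∈ K}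

theorem mult_inter_singleton (c : Expo → ℝ) (q : Param) (K : Set Plane) (p : Plane) :
    mult c q (K ∩ {p}) = ∑ᶠ x ∈ K ∩ {p}, multAt c q x := rfl

/-- The multiplicity of a set is the sum of the multiplicities of its parts. -/
theorem mult_eq_sum (c : Expo → ℝ) (hl : 0 < q.2) {K : Set Plane} (hK : K ⊆ lam q) :
    mult c q K = (∑ᶠ p ∈ K ∩ {q.1}, multAt c q p) + (∑ᶠ p ∈ K ∩ {vertex q 1}, multAt c q p) +
      ((∑ᶠ t ∈ legPart q .west K, width c (line (armBase q .west) Arm.west.idir t) Arm.west.idir) +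
      (∑ᶠ t ∈ legPart q .south K,
        width c (line (armBase q .south) Arm.south.idir t) Arm.south.idir) +
      (∑ᶠ t ∈ legPart q .east K, width c (line (armBase q .east) Arm.east.idir t) Arm.east.idir) +
      (∑ᶠ t ∈ legPart q .north K,
        width c (line (armBase q .north) Arm.north.idir t) Arm.north.idir)) +
      ∑ᶠ t ∈ diagPart q K, width c (line q.1 (1, 1) t) (1, 1) := by
  have hl' := hl.le
  have hsub : ∀ a, a ≠ .diag → line (armBase q a) a.idir '' legPart q a K ⊆ lam q := by
    rintro a ha _ ⟨t, ht, rfl⟩; exact hK ht.2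
  have hsubD : line q.1 (1, 1) '' diagPart q K ⊆ lam q := by
    rintro _ ⟨t, ht, rfl⟩; exact hK ht.2
  have e : K = (K ∩ {q.1}) ∪ ((K ∩ {vertex q 1}) ∪
      (line (armBase q .west) Arm.west.idir '' legPart q .west K ∪
      (line (armBase q .south) Arm.south.idir '' legPart q .south K ∪
      (line (armBase q .east) Arm.east.idir '' legPart q .east K ∪
      (line (armBase q .north) Arm.north.idir '' legPart q .north K ∪
      line q.1 (1, 1) '' diagPart q K))))) := by
    apply subset_antisymm
    · intro p hp
      rcases mem_lam_cases hl' (hK hp) with rfl | rfl | ⟨a, ha, t, ht, rfl⟩ | ⟨t, h0, h1, rfl⟩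
      · exact Or.inl ⟨hp, rfl⟩
      · exact Or.inr (Or.inl ⟨hp, rfl⟩)
      · cases a
        · exact Or.inr (Or.inr (Or.inl ⟨t, ⟨ht, hp⟩, rfl⟩))
        · exact Or.inr (Or.inr (Or.inr (Or.inl ⟨t, ⟨ht, hp⟩, rfl⟩)))
        · exact Or.inr (Or.inr (Or.inr (Or.inr (Or.inl ⟨t, ⟨ht, hp⟩, rfl⟩))))
        · exact Or.inr (Or.inr (Or.inr (Or.inr (Or.inr (Or.inl ⟨t, ⟨ht, hp⟩, rfl⟩)))))
        · exact absurd rfl ha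
      · exact Or.inr (Or.inr (Or.inr (Or.inr (Or.inr (Or.inr ⟨t, ⟨⟨h0, h1⟩, hp⟩, rfl⟩)))))
    · rintro p (⟨h, -⟩ | ⟨h, -⟩ | ⟨t, ht, rfl⟩ | ⟨t, ht, rfl⟩ | ⟨t, ht, rfl⟩ | ⟨t, ht, rfl⟩ |
        ⟨t, ht, rfl⟩)
      exacts [h, h, ht.2, ht.2, ht.2, ht.2, ht.2]
  have hw := hsub .west (by simp)
  have hs := hsub .south (by simp)
  have he := hsub .east (by simp)
  have hn := hsub .north (by simp)
  have h1 : K ∩ {vertex q 1} ⊆ lam q := fun p hp => hK hp.1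
  have h0 : K ∩ {q.1} ⊆ lam q := fun p hp => hK hp.1
  conv_lhs => rw [e]
  rw [mult_union c hl' h0, mult_union c hl' h1, mult_union c hl' hw, mult_union c hl' hs,
    mult_union c hl' he, mult_union c hl' hn, mult_leg c hl' (by simp) fun t ht => ht.1,
    mult_leg c hl' (by simp) fun t ht => ht.1, mult_leg c hl' (by simp) fun t ht => ht.1,
    mult_leg c hl' (by simp) fun t ht => ht.1, mult_diag c fun t ht => ht.1,
    mult_inter_singleton, mult_inter_singleton]
  · ring
  all_goals
    simp only [union_subset_iff, Set.disjoint_left, mem_union, mem_inter_iff, mem_singleton_iff,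
      mem_image, legPart, diagPart, mem_ofPred_eq, mem_Ioi, mem_Ioo]
    first
    | exact hsubD
    | exact ⟨hn, hsubD⟩
    | exact ⟨he, hn, hsubD⟩
    | exact ⟨hs, he, hn, hsubD⟩
    | exact ⟨hw, hs, he, hn, hsubD⟩
    | exact ⟨h1, hw, hs, he, hn, hsubD⟩
    | skip
  all_goals
    first
    | rintro p ⟨-, rfl⟩
    | rintro p ⟨t, ⟨ht, -⟩, rfl⟩
    simp [line, toPlane, Arm.idir, armBase, hl', vertex, abs_of_pos hl, Prod.ext_iff] <;> grind

/-! ### Tritangency as a parity condition -/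

/-- Outside the curve, the slopes along the arms of `Λ` have the parity of the slope at infinity,
and those along the edge are even for an edge of slope one and odd for an edge of slope minus
one. -/
structure Parity (c : Expo → ℝ) (q : Param) : Prop where
  leg : ∀ a : Arm, a ≠ .diag → ∀ t : ℝ, 0 ≤ t → ∀ m,
    dualCell c (line (armBase q a) a.idir t) = {m} → Even (slope a.idir m + endSlope a.idir)
  diag_pos : 0 < q.2 → ∀ t ∈ Icc 0 q.2, ∀ m,
    dualCell c (line q.1 (1, 1) t) = {m} → Even (slope (1, 1) m)
  diag_neg : q.2 < 0 → ∀ t ∈ Icc 0 (-q.2), ∀ m,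
    dualCell c (line q.1 (-1, 1) t) = {m} → Odd (slope (-1, 1) m)

theorem topSlope_of_singleton {p : Plane} {m : Expo} (h : dualCell c p = {m})
    (r : ℤ × ℤ) : topSlope c p r = slope r m := by
  obtain ⟨n, hn, hs⟩ := exists_slope_eq_topSlope c p r
  rw [h, Finset.mem_singleton] at hn
  rw [← hs, hn]

/-- Outside the curve a single exponent is dominant, and its slopes add up to zero because `Λ` is
balanced at `p`. -/
theorem multAt_eq_zero (hl : 0 < q.2) {p : Plane} (hp : p ∈ lam q)
    (hc : p ∉ curve c) : multAt c q p = 0 := by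
  obtain ⟨m, hm⟩ := notMem_curve_iff.1 hc
  have hw : ∀ r, width c p r = 0 := fun r => by
    by_contra h; exact hc (mem_curve_of_width_ne_zero h)
  rcases mem_lam_cases hl.le hp with rfl | rfl | ⟨a, ha, t, ht, rfl⟩ | ⟨t, h0, h1, rfl⟩
  · rw [multAt_lower c hl]
    simp only [topSlope_of_singleton hm, slope]; ring
  · rw [multAt_upper c hl]
    simp only [topSlope_of_singleton hm, slope]; ring
  · rw [multAt_leg c hl.le ha ht, hw]
  · rw [multAt_diag c h0 h1, hw]

theorem finsum_inter_singleton_congr {α : Type*} {K : Set α} {p : α} {f g : α → ℤ}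
    (h : f p = g p) : ∑ᶠ x ∈ K ∩ {p}, f x = ∑ᶠ x ∈ K ∩ {p}, g x :=
  finsum_mem_congr rfl fun x hx => by rw [mem_singleton_iff.1 hx.2, h]

theorem endSlope_values : endSlope (-1, 0) = 0 ∧ endSlope (0, -1) = 0 ∧ endSlope (1, 0) = 3 ∧
    endSlope (0, 1) = 3 := by decide

/-! ### Equivalence of tritangency and parity for an edge of slope one -/

section Transversal


/-- A union of components has even multiplicity if all components have. -/
theorem even_mult_of_isClopen (hl : 0 ≤ q.2) (ht : IsTritangent c q) {K : Set Plane}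
    (hK : K ⊆ lam q ∩ curve c)
    (hcl : ∀ K' ∈ components c q, K' ⊆ K ∨ Disjoint K' K) : Even (mult c q K) := by
  classical
  obtain ⟨S, hS, hm⟩ := ht
  have heven : ∀ K' ∈ S, Even (mult c q K') := by
    intro K' hK'
    have : mult c q K' ∈ S.val.map (mult c q) := Multiset.mem_map_of_mem _ hK'
    rcases hm with h | h | h <;> rw [h] at this <;> simp at this
    · rw [this]; decide
    · rcases this with h | h <;> rw [h] <;> decide
    · rw [this]; decide
  have hmem : ∀ K', K' ∈ S ↔ K' ∈ components c q := fun K' => by rw [← hS]; rfl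
  have e : K = ⋃ K' ∈ S.filter fun K' => K' ⊆ K, K' := by
    apply subset_antisymm
    · intro p hp
      have hp' : p ∈ ⋃₀ components c q := by rw [sUnion_components]; exact hK hp
      obtain ⟨K', hK', hpK'⟩ := hp'
      have : K' ⊆ K := (hcl K' hK').resolve_right fun h => Set.disjoint_left.1 h hpK' hp
      exact mem_biUnion (by simpa [hmem] using ⟨hK', this⟩) hpK'
    · exact iUnion₂_subset fun K' hK' => (Finset.mem_filter.1 hK').2
  rw [e, mult_biUnion c hl]
  · exact Finset.even_sum _ fun K' hK' => heven K' (Finset.mem_filter.1 hK').1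
  · intro K' hK'
    exact (subset_of_mem_components ((hmem K').1 (Finset.mem_filter.1 hK').1)).trans
      inter_subset_left
  · exact (pairwiseDisjoint_components c q).subset fun K' hK' =>
      (hmem K').1 (Finset.mem_filter.1 hK').1

/-- No component crosses a level that misses `Λ ∩ Γ`, so the part above this level is a union of
components, each of even multiplicity. -/
theorem even_mult_level (hl : 0 ≤ q.2) (ht : IsTritangent c q) (r : ℤ × ℤ) {s : ℝ}
    (hs : ∀ p ∈ lam q ∩ curve c, level r p ≠ s) :
    Even (mult c q {p ∈ lam q ∩ curve c | s < level r p}) := by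
  refine even_mult_of_isClopen hl ht (fun p hp => hp.1) fun K hK => ?_
  by_cases h : ∃ p ∈ K, s < level r p
  · left
    obtain ⟨p, hp, hps⟩ := h
    intro x hx
    refine ⟨subset_of_mem_components hK hx, ?_⟩
    by_contra hcon
    have hpre := (isPreconnected_of_mem_components hK).image _ (continuous_level r).continuousOn
    obtain ⟨y, hy, hys⟩ := hpre.ordConnected.out (mem_image_of_mem _ hx) (mem_image_of_mem _ hp)
      (show s ∈ Icc _ _ from ⟨not_lt.1 hcon, hps.le⟩)
    exact hs y (subset_of_mem_components hK hy) hys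
  · right
    rw [Set.disjoint_left]
    exact fun p hp hp' => h ⟨p, hp, hp'.2⟩

/-- The part of `Λ ∩ Γ` beyond the cut lies on the leg, and its multiplicity telescopes to the slope
at infinity minus the slope of `m`. -/
theorem IsTritangent.even_slope_leg (hl : 0 ≤ q.2) (ht : IsTritangent c q) {a : Arm}
    (ha : a ≠ .diag) {t : ℝ} (h0 : 0 < t) {m : Expo}
    (hm : dualCell c (line (armBase q a) a.idir t) = {m}) :
    Even (slope a.idir m + endSlope a.idir) := by
  set v := armBase q a
  have hpos := sq_add_sq_pos a.idir_ne_zero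
  have hnot : line v a.idir t ∉ curve c := notMem_curve_iff.2 ⟨m, hm⟩
  have heven := even_mult_level hl ht a.idir (s := level a.idir (line v a.idir t)) (by
    rintro p ⟨hp, hpc⟩ hlev
    exact hnot (eq_line_of_level_leg hl ha h0 hp hlev ▸ hpc))
  have e : {p ∈ lam q ∩ curve c | level a.idir (line v a.idir t) < level a.idir p} =
      line v a.idir '' {u ∈ Ioi t | line v a.idir u ∈ curve c} := by
    ext p
    constructor
    · rintro ⟨⟨hp, hpc⟩, hlev⟩
      set n := ((a.idir.1 : ℝ) ^ 2 + (a.idir.2 : ℝ) ^ 2)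
      have hu : level a.idir p =
          level a.idir (line v a.idir ((level a.idir p - level a.idir v) / n)) := by
        rw [level_line, div_mul_cancel₀ _ hpos.ne']; ring
      have htu : t < (level a.idir p - level a.idir v) / n := by
        rw [lt_div_iff₀ hpos]
        rw [level_line] at hlev
        linarith
      have := eq_line_of_level_leg hl ha (h0.trans htu) hp hu
      exact ⟨_, ⟨htu, this ▸ hpc⟩, this.symm⟩
    · rintro ⟨u, ⟨hu, huc⟩, rfl⟩
      refine ⟨⟨line_mem_lam_leg hl ha (h0.trans hu).le, huc⟩, ?_⟩
      rw [level_line, level_line]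
      have : t < u := hu
      nlinarith
  have hsum : ∑ᶠ u ∈ {u ∈ Ioi t | line v a.idir u ∈ curve c}, width c (line v a.idir u) a.idir =
      ∑ᶠ u ∈ Ioi t, width c (line v a.idir u) a.idir := by
    exact finsum_mem_inter_support_eq' _ _ _ fun u hu =>
      ⟨fun h => h.1, fun h => ⟨h, mem_curve_of_width_ne_zero hu⟩⟩
  rw [e, mult_leg c hl ha (fun u hu => h0.trans hu.1), hsum, finsum_width_Ioi,
    topSlope_of_singleton hm] at heven
  obtain ⟨k, hk⟩ := heven
  exact ⟨endSlope a.idir - k, by omega⟩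

theorem exists_small_of_singleton {p : Plane} {m : Expo} (h : dualCell c p = {m})
    (r : ℤ × ℤ) : ∃ ε > 0, ∀ u ∈ Ioo 0 ε, dualCell c (line p r u) = {m} := by
  obtain ⟨ε, hε, hd⟩ := exists_pos_dualCell_eq_rightFace c p r
  refine ⟨ε, hε, fun u hu => ?_⟩
  rw [hd u hu, rightFace, h, Finset.filter_eq_self]
  intro x hx
  rw [Finset.mem_singleton.1 hx, topSlope_of_singleton h]

theorem IsTritangent.parity_leg (hl : 0 ≤ q.2) (ht : IsTritangent c q) {a : Arm}
    (ha : a ≠ .diag) {t : ℝ} (h0 : 0 ≤ t) {m : Expo}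
    (hm : dualCell c (line (armBase q a) a.idir t) = {m}) :
    Even (slope a.idir m + endSlope a.idir) := by
  rcases h0.eq_or_lt with rfl | h0
  · rw [line_zero] at hm
    obtain ⟨ε, hε, h⟩ := exists_small_of_singleton hm a.idir
    exact ht.even_slope_leg hl ha (half_pos hε) (h _ ⟨half_pos hε, by linarith⟩)
  · exact ht.even_slope_leg hl ha h0 hm

theorem vertex_one_eq_line (hl : 0 ≤ q.2) : vertex q 1 = line q.1 (1, 1) q.2 := by
  ext <;> simp [vertex_one, line, toPlane, abs_of_nonneg hl]

/-- The part of `Λ ∩ Γ` above the cut has multiplicity 6 minus the slope of `m`: the contributions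
of the edge and of the two upper legs telescope, the slopes at the upper vertex cancel, and each of
the two legs ends with slope 3. -/
theorem IsTritangent.even_slope_diag (hl : 0 < q.2) (ht : IsTritangent c q)
    {t : ℝ} (h0 : 0 < t) (h1 : t < q.2) {m : Expo} (hm : dualCell c (line q.1 (1, 1) t) = {m}) :
    Even (slope (1, 1) m) := by
  have hnot : line q.1 (1, 1) t ∉ curve c := notMem_curve_iff.2 ⟨m, hm⟩
  have heven := even_mult_level hl.le ht (1, 1) (s := level (1, 1) (line q.1 (1, 1) t)) (by
    rintro p ⟨hp, hpc⟩ hlev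
    exact hnot (eq_line_of_level_diag h0 h1 hp hlev ▸ hpc))
  set K := {p ∈ lam q ∩ curve c | level (1, 1) (line q.1 (1, 1) t) < level (1, 1) p} with hKdef
  have hK : K ⊆ lam q := fun p hp => hp.1.1
  have lev : ∀ p : Plane, level (1, 1) p = p.1 + p.2 := fun p => by simp [level]
  have hll := hl.le
  rw [mult_eq_sum c hl hK] at heven
  have hsum : ∀ v r (I J : Set ℝ), (∀ u, u ∈ I → u ∈ J) →
      (∀ u ∈ J, line v r u ∈ curve c → u ∈ I) →
      ∑ᶠ u ∈ I, width c (line v r u) r = ∑ᶠ u ∈ J, width c (line v r u) r := by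
    intro v r I J h1 h2
    exact finsum_mem_inter_support_eq' _ _ _ fun u hu =>
      ⟨fun h => h1 u h, fun h => h2 u h (mem_curve_of_width_ne_zero hu)⟩
  have hv0 : K ∩ {q.1} = ∅ := by
    ext p
    simp only [mem_inter_iff, mem_singleton_iff, mem_empty_iff_false, iff_false]
    rintro ⟨⟨-, h⟩, rfl⟩
    rw [lev, lev] at h
    simp [line, toPlane] at h
    linarith
  have hW : legPart q .west K = ∅ := by
    ext u
    simp only [mem_empty_iff_false, iff_false]
    rintro ⟨hu, -, h⟩
    rw [lev, lev] at h
    simp [line, toPlane, Arm.idir, armBase, hll, vertex] at h hu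
    linarith
  have hS : legPart q .south K = ∅ := by
    ext u
    simp only [mem_empty_iff_false, iff_false]
    rintro ⟨hu, -, h⟩
    rw [lev, lev] at h
    simp [line, toPlane, Arm.idir, armBase, vertex] at h hu
    linarith
  have hE := hsum (armBase q .east) Arm.east.idir (legPart q .east K) (Ioi 0) (fun u hu => hu.1) (by
    intro u hu huc
    have hu' : 0 < u := hu
    refine ⟨hu, ⟨line_mem_lam_leg hll (by simp) hu'.le, huc⟩, ?_⟩
    rw [lev, lev]
    simp [line, toPlane, Arm.idir, armBase, hll, vertex, abs_of_pos hl]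
    linarith)
  have hN := hsum (armBase q .north) Arm.north.idir (legPart q .north K) (Ioi 0)
    (fun u hu => hu.1) (by
    intro u hu huc
    have hu' : 0 < u := hu
    refine ⟨hu, ⟨line_mem_lam_leg hll (by simp) hu'.le, huc⟩, ?_⟩
    rw [lev, lev]
    simp [line, toPlane, Arm.idir, armBase, vertex, abs_of_pos hl]
    linarith)
  have hD := hsum q.1 (1, 1) (diagPart q K) (Ioo t q.2) (by
    rintro u ⟨hu, -, h⟩
    rw [lev, lev] at h
    simp [line, toPlane] at h
    exact ⟨by linarith, hu.2⟩) (by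
    intro u hu huc
    refine ⟨⟨h0.trans hu.1, hu.2⟩, ⟨line_mem_lam_diag (h0.trans hu.1).le hu.2.le, huc⟩, ?_⟩
    rw [lev, lev]
    simp [line, toPlane]
    linarith [hu.1])
  have hv1 : ∑ᶠ p ∈ K ∩ {vertex q 1}, multAt c q p = multAt c q (vertex q 1) := by
    have hlam : vertex q 1 ∈ lam q := by
      rw [vertex_one_eq_line hll]; exact line_mem_lam_diag hll le_rfl
    by_cases hcur : vertex q 1 ∈ curve c
    · have : vertex q 1 ∈ K := by
        refine ⟨⟨hlam, hcur⟩, ?_⟩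
        rw [lev, lev, vertex_one_eq_line hll]
        simp [line, toPlane]
        linarith
      rw [inter_eq_right.2 (singleton_subset_iff.2 this), finsum_mem_singleton]
    · rw [multAt_eq_zero hl hlam hcur, inter_singleton_eq_empty.2 fun h => hcur h.1.2,
        finsum_mem_empty]
  rw [hv0, hW, hS, hE, hN, hD, hv1, multAt_upper c hl, finsum_width_Ioi, finsum_width_Ioi,
    finsum_width_Ioo c _ _ h1, line_zero, line_zero, topSlope_of_singleton hm,
    ← vertex_one_eq_line hll] at heven
  have hb : armBase q .east = vertex q 1 := by simp [armBase, hll]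
  have hb' : armBase q .north = vertex q 1 := by simp [armBase]
  have hneg := topSlope_neg c (vertex q 1) (1, 1)
  obtain ⟨-, -, hE3, hN3⟩ := endSlope_values
  simp only [finsum_mem_empty, hb, hb', Arm.idir, hE3, hN3] at heven
  have hneg' : topSlope c (vertex q 1) (-1, -1) = -lowSlope c (vertex q 1) (1, 1) := hneg
  rw [hneg'] at heven
  obtain ⟨k, hk⟩ := heven
  exact ⟨3 - k, by omega⟩

theorem IsTritangent.parity (hl : 0 ≤ q.2) (ht : IsTritangent c q) : Parity c q where
  leg _ ha _ h0 _ hm := ht.parity_leg hl ha h0 hm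
  diag_neg h := absurd h (not_lt.2 hl)
  diag_pos h := by
    intro t ht' m hm
    rcases ht'.1.eq_or_lt with rfl | h0
    · rw [line_zero] at hm
      obtain ⟨ε, hε, hd⟩ := exists_small_of_singleton hm (1, 1)
      have hpos : 0 < min (ε / 2) (q.2 / 2) := lt_min (by linarith) (by linarith)
      have h2 := min_le_right (ε / 2) (q.2 / 2)
      exact ht.even_slope_diag h hpos (by linarith)
        (hd _ ⟨hpos, by linarith [min_le_left (ε / 2) (q.2 / 2)]⟩)
    rcases ht'.2.eq_or_lt with rfl | h1
    · obtain ⟨ε, hε, hd⟩ := exists_small_of_singleton hm (-(1, 1))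
      have hpos : 0 < min (ε / 2) (q.2 / 2) := lt_min (by linarith) (by linarith)
      have h2 := min_le_right (ε / 2) (q.2 / 2)
      have := hd _ ⟨hpos, by linarith [min_le_left (ε / 2) (q.2 / 2)]⟩
      rw [line_neg, line_line] at this
      exact ht.even_slope_diag h (by linarith) (by linarith) this
    · exact ht.even_slope_diag h h0 h1 hm

/-! The converse. -/

theorem Parity.even_leg (hP : Parity c q) {a : Arm} (ha : a ≠ .diag) {t : ℝ} (ht : 0 ≤ t)
    (hc : line (armBase q a) a.idir t ∉ curve c) :
    Even (topSlope c (line (armBase q a) a.idir t) a.idir + endSlope a.idir) := by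
  obtain ⟨m, hm⟩ := notMem_curve_iff.1 hc
  rw [topSlope_of_singleton hm]
  exact hP.leg a ha t ht m hm

theorem Parity.even_diag (hP : Parity c q) (hl : 0 < q.2) {t : ℝ} (ht : t ∈ Icc 0 q.2)
    (hc : line q.1 (1, 1) t ∉ curve c) : Even (topSlope c (line q.1 (1, 1) t) (1, 1)) := by
  obtain ⟨m, hm⟩ := notMem_curve_iff.1 hc
  rw [topSlope_of_singleton hm]
  exact hP.diag_pos hl t ht m hm

/-- The share of a component on an open leg is even up to a correction at the base point. The
corrections of all arms are balanced against the multiplicities of the vertices in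
`Parity.even_mult`. -/
theorem Parity.even_legPart (hP : Parity c q) (hl : 0 ≤ q.2) {K : Set Plane}
    (hK : K ∈ components c q) {a : Arm} (ha : a ≠ .diag) :
    Even ((∑ᶠ t ∈ legPart q a K, width c (line (armBase q a) a.idir t) a.idir) +
      ∑ᶠ p ∈ K ∩ {armBase q a}, (topSlope c p a.idir + endSlope a.idir)) := by
  obtain ⟨T, hT, htail⟩ := exists_tail c (armBase q a) a.idir
  have h1 := (isArm_leg hl ha T).even_finsum hK hT (e := endSlope a.idir)
    fun t ht hc => hP.even_leg ha ht.1.le hc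
  have h2 : ∑ᶠ t ∈ legPart q a K, width c (line (armBase q a) a.idir t) a.idir =
      ∑ᶠ t ∈ {t ∈ Ioo 0 T | line (armBase q a) a.idir t ∈ K},
        width c (line (armBase q a) a.idir t) a.idir := by
    refine finsum_mem_inter_support_eq' _ _ _ fun t hw => ⟨?_, ?_⟩
    · rintro ⟨h, hk⟩
      refine ⟨⟨h, ?_⟩, hk⟩
      by_contra hcon
      exact hw (htail t (not_lt.1 hcon)).1
    · rintro ⟨h, hk⟩
      exact ⟨h.1, hk⟩
  rw [h2]
  -- At time `T` the slope has already reached `endSlope`, so the boundary term there is twice an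
  -- integer.
  have h3 : Even (∑ᶠ p ∈ K ∩ {line (armBase q a) a.idir T},
      (lowSlope c p a.idir + endSlope a.idir)) := by
    rw [finsum_inter_singleton_congr (g := fun _ => 2 * endSlope a.idir) (by
      rw [(htail T le_rfl).2.2]; ring)]
    by_cases hm : line (armBase q a) a.idir T ∈ K
    · rw [inter_eq_right.2 (singleton_subset_iff.2 hm), finsum_mem_singleton]
      exact even_two_mul _
    · rw [inter_singleton_eq_empty.2 hm, finsum_mem_empty]
      exact Even.zero
  exact (Int.even_add.1 h1).2 h3

theorem finsum_inter_singleton (K : Set Plane) (p : Plane) (f : Plane → ℤ) [Decidable (p ∈ K)] :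
    ∑ᶠ x ∈ K ∩ {p}, f x = if p ∈ K then f p else 0 := by
  split_ifs with h
  · rw [inter_eq_right.2 (singleton_subset_iff.2 h), finsum_mem_singleton]
  · rw [inter_singleton_eq_empty.2 h, finsum_mem_empty]

/-- Modulo two, the corrections of the arms at a vertex add up to the multiplicity of that vertex:
the lower legs and the edge have offset 0, and the offsets 3 of the two upper legs cancel. So the
total is even whichever vertices belong to `K`. -/
theorem Parity.even_mult (hP : Parity c q) (hl : 0 < q.2) {K : Set Plane}
    (hK : K ∈ components c q) : Even (mult c q K) := by
  classical
  have hll := hl.le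
  have hsub : K ⊆ lam q := (subset_of_mem_components hK).trans inter_subset_left
  have hW := hP.even_legPart hll hK (a := .west) (by simp)
  have hS := hP.even_legPart hll hK (a := .south) (by simp)
  have hE := hP.even_legPart hll hK (a := .east) (by simp)
  have hN := hP.even_legPart hll hK (a := .north) (by simp)
  have hD := (isArm_diag (q := q) le_rfl).even_finsum hK hl (e := 0) fun t ht hc => by
    rw [add_zero]; exact hP.even_diag hl (Ioo_subset_Icc_self ht) hc
  rw [mult_eq_sum c hl hsub]
  have bW : armBase q .west = q.1 := by simp [armBase, hll, vertex_zero]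
  have bS : armBase q .south = q.1 := by simp [armBase, vertex_zero]
  have bE : armBase q .east = vertex q 1 := by simp [armBase, hll]
  have bN : armBase q .north = vertex q 1 := by simp [armBase]
  obtain ⟨hW0, hS0, hE3, hN3⟩ := endSlope_values
  rw [← vertex_one_eq_line hll] at hD
  simp only [finsum_inter_singleton] at hW hS hE hN hD ⊢
  simp only [bW, bS, bE, bN, Arm.idir, hW0, hS0, hE3, hN3] at hW hS hE hN ⊢
  rw [multAt_lower c hl, multAt_upper c hl]
  have hneg : topSlope c (vertex q 1) (-1, -1) = -lowSlope c (vertex q 1) (1, 1) :=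
    topSlope_neg c (vertex q 1) (1, 1)
  rw [hneg]
  have hd : {t | t ∈ Ioo 0 q.2 ∧ line q.1 (1, 1) t ∈ K} = diagPart q K := rfl
  rw [hd] at hD
  generalize (∑ᶠ t ∈ legPart q .west K, width c (line q.1 (-1, 0) t) (-1, 0)) = xW at *
  generalize (∑ᶠ t ∈ legPart q .south K, width c (line q.1 (0, -1) t) (0, -1)) = xS at *
  generalize (∑ᶠ t ∈ legPart q .east K, width c (line (vertex q 1) (1, 0) t) (1, 0)) = xE at *
  generalize (∑ᶠ t ∈ legPart q .north K, width c (line (vertex q 1) (0, 1) t) (0, 1)) = xN at *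
  generalize (∑ᶠ t ∈ diagPart q K, width c (line q.1 (1, 1) t) (1, 1)) = xD at *
  obtain ⟨kW, hW⟩ := hW
  obtain ⟨kS, hS⟩ := hS
  obtain ⟨kE, hE⟩ := hE
  obtain ⟨kN, hN⟩ := hN
  obtain ⟨kD, hD⟩ := hD
  by_cases h0 : q.1 ∈ K <;> by_cases h1 : vertex q 1 ∈ K <;>
    simp only [h0, h1, if_true, if_false] at * <;> rw [Int.even_iff] <;> omega

/-! ### Positivity and total of the multiplicities -/

theorem multAt_nonneg (hl : 0 < q.2) {p : Plane} (hp : p ∈ lam q) : 0 ≤ multAt c q p := by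
  have hv : ∀ p : Plane, ∀ r₁ r₂ r₃ : ℤ × ℤ, r₁ + r₂ + r₃ = 0 →
      0 ≤ topSlope c p r₁ + topSlope c p r₂ + topSlope c p r₃ := by
    intro p r₁ r₂ r₃ h
    obtain ⟨m, hm⟩ := dualCell_nonempty c p
    have h1 := slope_le_topSlope hm r₁
    have h2 := slope_le_topSlope hm r₂
    have h3 := slope_le_topSlope hm r₃
    have h4 : slope r₁ m + slope r₂ m + slope r₃ m = 0 := by
      have e1 : r₁.1 + r₂.1 + r₃.1 = 0 := congrArg Prod.fst h
      have e2 : r₁.2 + r₂.2 + r₃.2 = 0 := congrArg Prod.snd h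
      unfold slope
      linear_combination m.toInt.1 * e1 + m.toInt.2 * e2
    omega
  rcases mem_lam_cases hl.le hp with rfl | rfl | ⟨a, ha, t, ht, rfl⟩ | ⟨t, h0, h1, rfl⟩
  · rw [multAt_lower c hl]; exact hv _ _ _ _ (by decide)
  · rw [multAt_upper c hl]; exact hv _ _ _ _ (by decide)
  · rw [multAt_leg c hl.le ha ht]; exact width_nonneg ..
  · rw [multAt_diag c h0 h1]; exact width_nonneg ..

theorem Expo.toInt_injective : Function.Injective Expo.toInt := by
  rintro ⟨a, b⟩ ⟨a', b'⟩ h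
  simp only [Expo.toInt, Prod.mk.injEq, Nat.cast_inj, Fin.val_inj] at h
  exact Prod.ext h.1 h.2

/-- The slopes of each dominant exponent in the three outgoing directions add up to zero. If the
maxima also added up to zero, two distinct dominant exponents would have the same slopes in these
directions, which span the plane. -/
theorem multAt_vertex_pos (hl : 0 < q.2) {p : Plane} (hp : p = q.1 ∨ p = vertex q 1)
    (hc : p ∈ curve c) : 0 < multAt c q p := by
  have hv : ∀ ε : ℤ, (ε = 1 ∨ ε = -1) →
      0 < topSlope c p (-ε, 0) + topSlope c p (0, -ε) + topSlope c p (ε, ε) := by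
    intro ε hε
    obtain ⟨m, hm, m', hm', hne⟩ := Finset.one_lt_card.1 (show 1 < _ from hc)
    have a1 := slope_le_topSlope hm (-ε, 0)
    have a2 := slope_le_topSlope hm (0, -ε)
    have a3 := slope_le_topSlope hm (ε, ε)
    have b1 := slope_le_topSlope hm' (-ε, 0)
    have b2 := slope_le_topSlope hm' (0, -ε)
    have b3 := slope_le_topSlope hm' (ε, ε)
    by_contra hcon
    apply hne
    apply Expo.toInt_injective
    simp only [slope] at a1 a2 a3 b1 b2 b3
    generalize m.toInt = x at *
    generalize m'.toInt = y at *
    rcases hε with rfl | rfl <;> exact Prod.ext (by omega) (by omega)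
  rcases hp with rfl | rfl
  · rw [multAt_lower c hl]; exact hv 1 (Or.inl rfl)
  · rw [multAt_upper c hl]; simpa only [neg_neg] using hv (-1) (Or.inr rfl)

/-- A component contains a vertex of `Λ`, where the multiplicity is positive, or it has a first
point on some arm, where the slope jumps. -/
theorem exists_multAt_pos (hl : 0 < q.2) {K : Set Plane} (hK : K ∈ components c q) :
    ∃ p ∈ K, 0 < multAt c q p := by
  have hll := hl.le
  have hsub := subset_of_mem_components hK
  obtain ⟨p, hp⟩ := nonempty_of_mem_components hK
  have hvert : ∀ x ∈ K, (x = q.1 ∨ x = vertex q 1) → ∃ p ∈ K, 0 < multAt c q p :=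
    fun x hx hx' => ⟨x, hx, multAt_vertex_pos hl hx' (hsub hx).2⟩
  rcases mem_lam_cases hll (hsub hp).1 with rfl | rfl | ⟨a, ha, t, ht, rfl⟩ | ⟨t, h0, h1, rfl⟩
  · exact hvert _ hp (Or.inl rfl)
  · exact hvert _ hp (Or.inr rfl)
  · rcases (isArm_leg hll ha t).exists_width_pos hK ⟨ht.le, le_rfl⟩ hp with h | ⟨s, hs, -, hsK, hw⟩
    · refine hvert _ h ?_
      cases a <;> simp [armBase, hll, vertex_zero]
    · exact ⟨_, hsK, by rwa [multAt_leg c hll ha hs]⟩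
  · rcases (isArm_diag h1.le).exists_width_pos hK ⟨h0.le, le_rfl⟩ hp with h | ⟨s, hs, hst, hsK, hw⟩
    · exact hvert _ h (Or.inl rfl)
    · exact ⟨_, hsK, by rwa [multAt_diag c hs (hst.trans_lt h1)]⟩

theorem mult_pos (hl : 0 < q.2) {K : Set Plane} (hK : K ∈ components c q) : 0 < mult c q K := by
  obtain ⟨p, hp, hpos⟩ := exists_multAt_pos hl hK
  have hsub : K ⊆ lam q := (subset_of_mem_components hK).trans inter_subset_left
  have e : K = {p} ∪ K \ {p} := by rw [union_sdiff_self, union_eq_right.2 (by simpa using hp)]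
  rw [e, mult_union c hl.le (by simpa using hsub hp) (sdiff_subset.trans hsub) disjoint_sdiff_right]
  have h1 : mult c q {p} = multAt c q p := finsum_mem_singleton
  have h2 : 0 ≤ mult c q (K \ {p}) := finsum_nonneg fun x => finsum_nonneg fun hx =>
    multAt_nonneg hl (hsub hx.1)
  omega

theorem mult_inter_curve (hl : 0 < q.2) : mult c q (lam q ∩ curve c) = mult c q (lam q) := by
  unfold mult
  refine finsum_mem_inter_support_eq' _ _ _ fun p h' => ⟨fun h => h.1, fun h => ⟨h, ?_⟩⟩
  by_contra hc
  exact h' (multAt_eq_zero hl h hc)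

/-- The total stable intersection multiplicity is six. -/
theorem mult_lam (hl : 0 < q.2) : mult c q (lam q) = 6 := by
  classical
  have hll := hl.le
  have h0 : q.1 ∈ lam q := by
    have := line_mem_lam_diag (q := q) le_rfl hll
    rwa [line_zero] at this
  have h1 : vertex q 1 ∈ lam q := by
    rw [vertex_one_eq_line hll]; exact line_mem_lam_diag hll le_rfl
  have hleg : ∀ a : Arm, a ≠ .diag → legPart q a (lam q) = Ioi 0 := fun a ha => by
    ext t; exact ⟨fun h => h.1, fun h => ⟨h, line_mem_lam_leg hll ha (le_of_lt h)⟩⟩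
  have hdiag : diagPart q (lam q) = Ioo 0 q.2 := by
    ext t; exact ⟨fun h => h.1, fun h => ⟨h, line_mem_lam_diag h.1.le h.2.le⟩⟩
  rw [mult_eq_sum c hl subset_rfl, finsum_inter_singleton, finsum_inter_singleton, if_pos h0,
    if_pos h1, hleg _ (by simp), hleg _ (by simp), hleg _ (by simp), hleg _ (by simp), hdiag,
    finsum_width_Ioi, finsum_width_Ioi, finsum_width_Ioi, finsum_width_Ioi,
    finsum_width_Ioo c _ _ hl, multAt_lower c hl, multAt_upper c hl, ← vertex_one_eq_line hll]
  simp only [line_zero, Arm.idir]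
  obtain ⟨hW0, hS0, hE3, hN3⟩ := endSlope_values
  rw [hW0, hS0, hE3, hN3]
  have bW : armBase q .west = q.1 := by simp [armBase, hll, vertex_zero]
  have bS : armBase q .south = q.1 := by simp [armBase, vertex_zero]
  have bE : armBase q .east = vertex q 1 := by simp [armBase, hll]
  have bN : armBase q .north = vertex q 1 := by simp [armBase]
  have hneg : topSlope c (vertex q 1) (-1, -1) = -lowSlope c (vertex q 1) (1, 1) :=
    topSlope_neg c (vertex q 1) (1, 1)
  rw [bW, bS, bE, bN, hneg]
  ring

theorem finite_components (hl : 0 < q.2) : (components c q).Finite := by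
  choose! f hf hpos using fun (K : Set Plane) (hK : K ∈ components c q) => exists_multAt_pos hl hK
  refine Set.Finite.of_finite_image ((finite_multAt_ne_zero c hl.le).subset ?_) (f := f) ?_
  · rintro _ ⟨K, hK, rfl⟩
    exact ⟨(subset_of_mem_components hK (hf K hK)).1, (hpos K hK).ne'⟩
  · intro K hK K' hK' h
    by_contra hne
    exact Set.disjoint_left.1 (pairwiseDisjoint_components c q hK hK' hne) (hf K hK)
      (h ▸ hf K' hK')

/-- Every element is at least two, so there are at most three of them; after halving these are the
partitions of three. -/
theorem multiset_even_sum_six {M : Multiset ℤ} (h : ∀ x ∈ M, Even x ∧ 0 < x) (hs : M.sum = 6) :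
    M = {2, 2, 2} ∨ M = {2, 4} ∨ M = {6} := by
  have key : ∀ x ∈ M, ∃ k : ℕ, x = 2 * (k + 1) := by
    intro x hx
    obtain ⟨⟨k, hk⟩, hpos⟩ := h x hx
    exact ⟨(k - 1).toNat, by omega⟩
  have hcard : ∀ M : Multiset ℤ, (∀ x ∈ M, ∃ k : ℕ, x = 2 * (k + 1)) → 2 * (M.card : ℤ) ≤ M.sum := by
    intro M
    induction M using Multiset.induction_on with
    | empty => simp
    | cons a M ih =>
      intro hM
      have := ih fun x hx => hM x (Multiset.mem_cons_of_mem hx)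
      obtain ⟨k, hk⟩ := hM a (Multiset.mem_cons_self a M)
      rw [Multiset.card_cons, Multiset.sum_cons]
      push_cast
      omega
  have h3 := hcard M key
  have hle : M.card ≤ 3 := by omega
  interval_cases hM : M.card
  · rw [Multiset.card_eq_zero] at hM
    subst hM; simp at hs
  · obtain ⟨a, rfl⟩ := Multiset.card_eq_one.1 hM
    right; right; simpa using hs
  · obtain ⟨a, b, rfl⟩ := Multiset.card_eq_two.1 hM
    obtain ⟨k, hk⟩ := key a (by simp)
    obtain ⟨l, hl⟩ := key b (by simp)
    simp at hs
    right; left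
    rcases (by omega : k = 0 ∧ l = 1 ∨ k = 1 ∧ l = 0) with ⟨rfl, rfl⟩ | ⟨rfl, rfl⟩
    · simp [hk, hl]
    · rw [Multiset.pair_comm]; simp [hk, hl]
  · obtain ⟨a, b, d, rfl⟩ := Multiset.card_eq_three.1 hM
    obtain ⟨k, hk⟩ := key a (by simp)
    obtain ⟨l, hl⟩ := key b (by simp)
    obtain ⟨n, hn⟩ := key d (by simp)
    simp at hs
    left
    obtain ⟨rfl, rfl, rfl⟩ : k = 0 ∧ l = 0 ∧ n = 0 := by omega
    simp [hk, hl, hn]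

/-- Tritangency thus becomes a condition on exponents at single points, and its persistence under
movements can be tested locally. -/
theorem Parity.isTritangent (hP : Parity c q) (hl : 0 < q.2) : IsTritangent c q := by
  classical
  have hfin := finite_components (c := c) hl
  refine ⟨hfin.toFinset, hfin.coe_toFinset, multiset_even_sum_six ?_ ?_⟩
  · intro x hx
    obtain ⟨K, hK, rfl⟩ := Multiset.mem_map.1 hx
    have hK' : K ∈ components c q := hfin.mem_toFinset.1 hK
    exact ⟨hP.even_mult hl hK', mult_pos hl hK'⟩
  · have h := mult_biUnion c hl.le hfin.toFinset (fun K hK =>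
      (subset_of_mem_components (hfin.mem_toFinset.1 hK)).trans inter_subset_left) (by
        rw [hfin.coe_toFinset]; exact pairwiseDisjoint_components c q)
    have e : ⋃ K ∈ hfin.toFinset, K = lam q ∩ curve c := by
      rw [← sUnion_components, sUnion_eq_biUnion]
      simp
    rw [e, mult_inter_curve hl, mult_lam hl] at h
    exact h.symm

end Transversal

/-! ### The local combinatorics of a pair of curves -/

/-- All exponents. -/
def expos : List Expo := List.product [0, 1, 2, 3] [0, 1, 2, 3]

/-- The exponents of largest slope. -/
def face (l : List Expo) (u : ℤ × ℤ) : List Expo :=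
  l.filter fun m => l.all fun m' => slope u m' ≤ slope u m

/-- The largest slope. -/
def top (l : List Expo) (r : ℤ × ℤ) : ℤ := (l.map (slope r)).foldr max (-9)

/-- Points, primitive edges and unimodular triangles. -/
def isCell : List Expo → Bool
  | [_] => true
  | [m, m'] => Int.gcd (m'.toInt.1 - m.toInt.1) (m'.toInt.2 - m.toInt.2) == 1
  | [m, m', m''] => ((m'.toInt.1 - m.toInt.1) * (m''.toInt.2 - m.toInt.2) -
        (m'.toInt.2 - m.toInt.2) * (m''.toInt.1 - m.toInt.1)).natAbs == 1
  | _ => false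

/-- Sublists inherit the fixed order of `expos`, so each set of exponents is represented by exactly
one list. Only the conditions on a single cell enter; compatibility with a global triangulation is
not imposed. -/
def allCells : List (List Expo) :=
  (expos.sublistsLen 1 ++ expos.sublistsLen 2 ++ expos.sublistsLen 3).filter isCell

/-- The parity condition in direction `r` at an exponent. -/
def evenSlope (r : ℤ × ℤ) (e : ℤ) (m : Expo) : Bool := (slope r m + e) % 2 == 0

/-- The parity condition near a point, in direction `r`. -/
def startsEven (l : List Expo) (r : ℤ × ℤ) (e : ℤ) : Bool :=
  match face l r with
  | [m] => evenSlope r e m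
  | _ => true

/-- The condition on the cell dual to the lower vertex in the definition of the unbounded part. -/
def unboundedLower (l : List Expo) : Bool :=
  l == [(0, 0)] || (l.contains (1, 0) && l.contains (0, 1) &&
    !(l.contains (0, 2) || l.contains (1, 1) || l.contains (2, 0)))

/-- The condition on the cell dual to the upper vertex in the definition of the unbounded part. -/
def unboundedUpper (l : List Expo) : Bool :=
  l == [(3, 3)] || (l.contains (2, 3) && l.contains (3, 2) &&
    !(l.contains (1, 3) || l.contains (2, 2) || l.contains (3, 1)))

/-- The cells which can be dual to the lower vertex. -/
def lowerCells : List (List Expo) := allCells.filter fun l =>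
  startsEven l (-1, 0) 0 && startsEven l (0, -1) 0 && startsEven l (1, 1) 0 && !unboundedLower l

/-- The cells which can be dual to the upper vertex. -/
def upperCells : List (List Expo) := allCells.filter fun l =>
  startsEven l (1, 0) 3 && startsEven l (0, 1) 3 && startsEven l (-1, -1) 0 && !unboundedUpper l

/-- The possible shapes of a crossing of multiplicity two in the interior of an arm: at a point in
an edge, at a vertex, or along a bounded edge. Crossings at a vertex are distinguished by the side
to which the arm can move. -/
inductive Status
  | none | free | pos | neg | locked
  deriving DecidableEq

def crossings : List Status := [.free, .pos, .neg, .locked]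

/-- The sideways displacement of an arm with direction `r` whose vertex moves by `u`; its sign tells
to which side the arm moves. -/
def cross (r u : ℤ × ℤ) : ℤ := r.1 * u.2 - r.2 * u.1

/-- The condition on the sideways movement of the arm. -/
def Status.allows : Status → ℤ → Bool
  | .none, _ => true
  | .free, _ => true
  | .pos, k => 0 ≤ k
  | .neg, k => k ≤ 0
  | .locked, k => k == 0

/-- Multipliers of pairs of inequalities. -/
def weights : List (ℤ × ℤ) := [(1, 0), (1, 1), (1, 2), (2, 1), (1, 3), (3, 1)]

/-- A criterion for the parity condition in direction `r` after a movement by `u`. -/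
def stays (l : List Expo) (u r : ℤ × ℤ) (e : ℤ) : Bool :=
  l.all fun m => evenSlope r e m ||
    l.any fun m' => m' != m && l.any fun m'' => m'' != m && weights.any fun k =>
      k.1 * (slope u m - slope u m') + k.2 * (slope u m - slope u m'') ≤ 0 &&
      k.1 * (slope r m - slope r m') + k.2 * (slope r m - slope r m'') ≤ 0

/-- The possible crossings in the interior of a leg. -/
def legStatuses (l : List Expo) (r : ℤ × ℤ) (e : ℤ) : List Status :=
  if (face l r).length == 1 then
    if e - top l r == 2 then crossings else [.none]
  else if e - top l r == 3 then crossings else if e - top l r == 2 then [] else [.none]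

/-- If the leg both overlaps an edge at its vertex and carries a crossing farther out, only
movements along the leg are admitted. This is at least as strict as the condition of the crossing,
and only sufficiency is used. -/
def legAllows (l : List Expo) (r : ℤ × ℤ) (s : Status) (u : ℤ × ℤ) : Bool :=
  if (face l r).length == 1 || s == .none then s.allows (cross r u) else cross r u == 0

/-- The possible crossings in the interior of the edge. -/
def diagStatuses (a b : List Expo) : List Status :=
  let f := face a (1, 1)
  let g := face b (-1, -1)
  let d := - top b (-1, -1) - top a (1, 1)
  if d == 0 then if f == g then [.none] else []
  else if d == 1 then
    if (f.length == 1) == (g.length == 1) then [] else [.none]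
  else if d == 2 then
    match f, g with
    | [m], [m'] => if isCell [m, m'] then crossings else [.locked]
    | _, _ => [.none]
  else []

/-- Integer vectors (dx, dy, dℓ) of the parameter space. The same type serves for linear functionals
on movements, paired by `Vec.dot`. -/
abbrev Vec := ℤ × ℤ × ℤ

/-- The movement of the vertices, for an edge of slope one. -/
def Vec.lower (w : Vec) : ℤ × ℤ := (w.1, w.2.1)
def Vec.upper (w : Vec) : ℤ × ℤ := (w.1 + w.2.2, w.2.1 + w.2.2)

def Vec.dot (v w : Vec) : ℤ := v.1 * w.1 + v.2.1 * w.2.1 + v.2.2 * w.2.2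

/-- The cross product serves to test ranks over the integers: nonzero means independent, and it
spans the common kernel of two independent functionals. -/
def Vec.cross (v w : Vec) : Vec :=
  (v.2.1 * w.2.2 - v.2.2 * w.2.1, v.2.2 * w.1 - v.1 * w.2.2, v.1 * w.2.1 - v.2.1 * w.1)

/-- The three directions are those in which `Λ` leaves the lower vertex, each with an even reference
slope. The list `face a u` is the dual cell after a small movement by `u`, so the last factor keeps
the moved vertex out of the unbounded part. -/
def staysLower (a : List Expo) (u : ℤ × ℤ) : Bool :=
  stays a u (-1, 0) 0 && stays a u (0, -1) 0 && stays a u (1, 1) 0 && !unboundedLower (face a u)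

def staysUpper (b : List Expo) (u : ℤ × ℤ) : Bool :=
  stays b u (1, 0) 3 && stays b u (0, 1) 3 && stays b u (-1, -1) 0 && !unboundedUpper (face b u)

/-- Directions which suffice to detect that a curve is not generic in a cell. -/
def testVecs : List Vec :=
  [(0, 0, -1), (1, 1, -1), (0, 0, 1), (-1, -1, 1), (0, 1, -1), (1, 0, -1), (1, 0, 0), (0, -1, 0),
    (0, 1, 0), (-1, 0, 0), (0, 2, -1), (-1, 1, -1), (0, -1, 1), (-1, 0, 1), (2, 0, -1),
    (1, -1, -1), (0, -2, 1), (-2, 0, 1), (-1, 1, 1), (1, -1, 1), (-1, 1, 0), (1, -1, 0),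
    (0, -4, 1), (-1, 3, -2), (3, -1, 1), (-4, 0, 1), (-1, 3, 1)]

def vertexGerms (a b : List Expo) : List Vec :=
  (testVecs.filter fun w => staysLower a w.lower).filter fun w => staysUpper b w.upper

/-- For the edge either vertex may be used, since the movements of the two vertices differ by a
multiple of (1, 1). -/
def allAllow (a b : List Expo) (w s e n d : Status) (v : Vec) : Bool :=
  legAllows a (-1, 0) w v.lower && legAllows a (0, -1) s v.lower &&
  legAllows b (1, 0) e v.upper && legAllows b (0, 1) n v.upper &&
  d.allows (cross (1, 1) v.lower)

/-- Directions in which the curve stays tritangent. -/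
def germs (a b : List Expo) (w s e n d : Status) : List Vec :=
  (vertexGerms a b).filter (allAllow a b w s e n d)

/-- The statuses other than `none` and `free` place a vertex of the curve on the arm. At a generic
curve of the cell the arm then cannot move sideways, so the functional `v` measuring this movement
vanishes. -/
def Status.rows (s : Status) (v : Vec) : List Vec :=
  if s == .none || s == .free then [] else [v]

/-- The differences of the exponents of a cell, as functionals of the movement. -/
def edgeRows (l : List Expo) (k : ℤ) : List Vec :=
  (l.drop 1).map fun m => (m.toInt.1 - (l.headD 0).toInt.1, m.toInt.2 - (l.headD 0).toInt.2,
    k * (m.toInt.1 - (l.headD 0).toInt.1 + (m.toInt.2 - (l.headD 0).toInt.2)))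

/-- Functionals which vanish along the cell of the curve. -/
def rows (a b : List Expo) (w s e n d : Status) : List Vec :=
  edgeRows a 0 ++ edgeRows b 1 ++ w.rows (0, 1, 0) ++ s.rows (1, 0, 0) ++ e.rows (0, 1, 1) ++
    n.rows (1, 0, 1) ++ d.rows (-1, 1, 0)

-- Tangency types read off from dual cells and statuses

deriving instance DecidableEq for Tangency

/-- `Arm.swap` and `Arm.rot` come from the swap of the coordinates and from the point reflection,
which generate the symmetries that preserve edges of slope one. -/
def Arm.swap : Arm → Arm
  | .west => .south | .south => .west | .east => .north | .north => .east | .diag => .diag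

def Arm.rot : Arm → Arm
  | .west => .east | .south => .north | .east => .west | .north => .south | .diag => .diag

/-- The action of symmetries on tangencies. -/
def Tangency.map (f : Arm → Arm) (g : Fin 2 → Fin 2) : Tangency → Tangency
  | .point a => .point (f a)
  | .pointAtVertex a => .pointAtVertex (f a)
  | .interiorEdge a => .interiorEdge (f a)
  | .overhang k a => .overhang (g k) (f a)
  | .wholeEdge => .wholeEdge
  | .crossing k => .crossing (g k)
  | .crossingFour k => .crossingFour (g k)
  | .opposite k => .opposite (g k)
  | .commonRay k a => .commonRay (g k) (f a)
  | .tripod k => .tripod (g k)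
  | .tree => .tree

/-- The two kinds of crossings at a vertex differ in the movements they allow, not in the type of
tangency. -/
def Status.tangencies : Status → Arm → List Tangency
  | .none, _ => []
  | .free, a => [.point a]
  | .pos, a => [.pointAtVertex a]
  | .neg, a => [.pointAtVertex a]
  | .locked, a => [.interiorEdge a]

/-- The common part of an arm with an edge of the curve at its vertex. -/
inductive Overlap
  | none | segment | ray
  deriving DecidableEq

/-- Here `e` is the slope at infinity: an overlap that already has this slope can never end, so it
is the whole leg. -/
def legOverlap (l : List Expo) (r : ℤ × ℤ) (e : ℤ) : Overlap :=
  if (face l r).length == 1 then .none else if top l r == e then .ray else .segment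

def diagOverlap (l : List Expo) (r : ℤ × ℤ) : Overlap :=
  if (face l r).length == 1 then .none else .segment

def hasStep (l : List Expo) : Bool :=
  l.any fun m => l.any fun m' => m'.toInt == m.toInt + (1, 1)

def isOpposite (l : List Expo) (s : ℤ) : Bool :=
  l.any fun m => l.any fun m' => l.any fun m'' =>
    m'.toInt == m.toInt + (s, 0) && m''.toInt == m.toInt + (0, s)

/-- The tangency at a vertex with the legs `x` and `y`, for a cell with local multiplicity `μ` and
overlaps `o` along the arms. -/
def cluster (k : Fin 2) (x y : Arm) (l : List Expo) (s μ : ℤ) (ox oy od : Overlap) :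
    Option (List Tangency) :=
  match l.length, ox, oy, od with
  | 1, _, _, _ => some []
  | 2, .none, .none, .none =>
    if μ == 2 && hasStep l then some [.crossing k]
    else if μ == 4 then some [.crossingFour k] else none
  | 2, .segment, .none, .none => if μ == 1 then some [.overhang k x] else none
  | 2, .none, .segment, .none => if μ == 1 then some [.overhang k y] else none
  | 2, .none, .none, .segment => if μ == 1 then some [.overhang k .diag] else none
  | 3, .none, .none, .none => if μ == 2 && isOpposite l s then some [.opposite k] else none
  | 3, .ray, .none, .none => if μ == 2 && hasStep l then some [.commonRay k x] else none
  | 3, .none, .ray, .none => if μ == 2 && hasStep l then some [.commonRay k y] else none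
  | 3, .segment, .segment, .segment => if μ == 1 then some [.tripod k] else none
  | _, _, _, _ => none

def multLower (a : List Expo) : ℤ := top a (-1, 0) + top a (0, -1) + top a (1, 1)
def multUpper (b : List Expo) : ℤ := top b (1, 0) + top b (0, 1) + top b (-1, -1)

/-- The tangencies which involve a vertex. -/
def vertexTangencies (a b : List Expo) : Option (List Tangency) :=
  if (face a (1, 1)).length != 1 && top a (1, 1) + top b (-1, -1) == 0 then
    match legOverlap a (-1, 0) 0, legOverlap a (0, -1) 0, legOverlap b (1, 0) 3,
      legOverlap b (0, 1) 3 with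
    | .none, .none, .none, .none =>
      if a.length == 2 && b.length == 2 && multLower a + multUpper b == 2 then some [.wholeEdge]
      else none
    | .segment, .segment, .segment, .segment =>
      if a.length == 3 && b.length == 3 && multLower a + multUpper b == 2 then some [.tree]
      else none
    | _, _, _, _ => none
  else
    match cluster 0 .west .south a (-1) (multLower a) (legOverlap a (-1, 0) 0)
        (legOverlap a (0, -1) 0) (diagOverlap a (1, 1)),
      cluster 1 .east .north b 1 (multUpper b) (legOverlap b (1, 0) 3)
        (legOverlap b (0, 1) 3) (diagOverlap b (-1, -1)) with
    | some L, some L' => some (L ++ L')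
    | _, _ => none

/-- All tangencies. -/
def tangencies (a b : List Expo) (w s e n d : Status) : Option (List Tangency) :=
  (vertexTangencies a b).map fun L => L ++ (w.tangencies .west ++ (s.tangencies .south ++
    (e.tangencies .east ++ (n.tangencies .north ++ d.tangencies .diag))))

/-- A list of tangencies is in the table, up to symmetry. -/
def listed (π : Movement) (L : List Tangency) : Bool :=
  let L₁ := L.map (Tangency.map Arm.swap id)
  let L₂ := L.map (Tangency.map Arm.rot Fin.rev)
  let L₃ := L₁.map (Tangency.map Arm.rot Fin.rev)
  (table π).any fun L' => L.isPerm L' || L₁.isPerm L' || L₂.isPerm L' || L₃.isPerm L'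

/-- Rank at least two is witnessed by a nonzero cross product, rank three by a nonzero determinant.
-/
def rankTwo (R : List Vec) : Bool := R.any fun v => R.any fun w => v.cross w != (0, 0, 0)

def rankThree (R : List Vec) : Bool :=
  R.any fun v => R.any fun w => v.cross w != (0, 0, 0) && R.any fun z => (v.cross w).dot z != 0

def kills (R : List Vec) (w : Vec) : Bool := R.all fun v => v.dot w == 0

/-- The movements of one vertex, with the other vertex fixed. -/
def moveUpper : Vec := (0, 0, 1)
def moveLower : Vec := (1, 1, -1)

/-- Either a germ does not lie in the span of the cell, or the tangencies are those of the table for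
all movements which are possible. -/
def isListed (g R : List Vec) (conf : Option (List Tangency)) : Bool :=
  (g.any fun w => R.any fun v => v.dot w != 0) ||
  match conf with
  | none => false
  | some L =>
    (!g.isEmpty || listed .rigid L) &&
    (rankTwo g || rankThree R ||
      (!(kills R moveUpper || kills R moveLower) || listed .oneFixed L) &&
        (g.contains moveUpper || g.contains moveLower || listed .dependent L)) &&
    (rankTwo R || rankThree g ||
      (!(kills R moveUpper && kills R moveLower) || listed .independent L) &&
        (g.contains moveUpper && g.contains moveLower || listed .ball L))

/-- The finite core of the classification for slope one. The enumeration may contain patterns that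
no smooth curve realises; it suffices that every realised pattern occurs. -/
theorem isListed_all : lowerCells.all fun a => upperCells.all fun b =>
    (diagStatuses a b).all fun d => (legStatuses a (-1, 0) 0).all fun w =>
    (legStatuses a (0, -1) 0).all fun s => (legStatuses b (1, 0) 3).all fun e =>
    (legStatuses b (0, 1) 3).all fun n =>
      isListed (germs a b w s e n d) (rows a b w s e n d) (tangencies a b w s e n d) := by
  decide +kernel

/-! Four-valent curves. -/

/-- For a four-valent curve only the four legs impose conditions on the cell at the vertex; nothing
is required in diagonal directions. -/
def fourCells : List (List Expo) := allCells.filter fun l =>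
  startsEven l (-1, 0) 0 && startsEven l (0, -1) 0 && startsEven l (1, 0) 3 && startsEven l (0, 1) 3

/-- The condition on the cell dual to the lower vertex in the definition of the unbounded part, for
an edge of slope minus one. -/
def unboundedLowerNeg (l : List Expo) : Bool :=
  l == [(3, 0)] || (l.contains (2, 0) && l.contains (3, 1) &&
    !(l.contains (1, 0) || l.contains (2, 1) || l.contains (3, 2)))

def unboundedUpperNeg (l : List Expo) : Bool :=
  l == [(0, 3)] || (l.contains (0, 2) && l.contains (1, 3) &&
    !(l.contains (0, 1) || l.contains (1, 2) || l.contains (2, 3)))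

/-- A criterion for the parity condition along a segment of the given length in direction `r` after
a movement by `u`. -/
def staysAlong (l : List Expo) (u r : ℤ × ℤ) (e len : ℤ) : Bool :=
  l.all fun m => evenSlope r e m ||
    l.any fun m' => m' != m && l.any fun m'' => m'' != m && weights.any fun k =>
      k.1 * (slope u m - slope u m') + k.2 * (slope u m - slope u m'') ≤ 0 &&
      k.1 * (slope u m - slope u m' + len * (slope r m - slope r m')) +
        k.2 * (slope u m - slope u m'' + len * (slope r m - slope r m'')) ≤ 0

/-- All these vectors have last coordinate ±1, so each of them opens an edge; the sign decides
whether its slope is one or minus one. -/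
def fourTestVecs : List Vec :=
  [(0, 0, -1), (0, 0, 1), (1, -1, -1), (-1, -1, 1), (1, 0, -1), (0, -1, 1), (-1, 0, 1), (0, -1, -1),
    (3, -1, 1), (-1, 3, 1), (1, 3, -1), (0, -4, 1), (4, 0, -1), (0, -4, -1), (-4, 0, 1),
    (-3, -1, -1), (-1, 1, 1), (1, -1, 1), (2, 0, -1), (0, -2, -1), (1, 1, -1), (-1, -1, -1),
    (0, -2, 1), (-2, 0, 1)]

/-- The movement of the upper vertex when the length becomes negative: there |ℓ| = -ℓ. -/
def Vec.upperNeg (w : Vec) : ℤ × ℤ := (w.1 + w.2.2, w.2.1 - w.2.2)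

/-- A criterion for a movement that creates an edge of slope one to keep the curve tritangent. -/
def fourGermPos (a : List Expo) (w s e n : Status) (v : Vec) : Bool :=
  0 < v.2.2 && legAllows a (-1, 0) w v.lower && legAllows a (0, -1) s v.lower &&
  legAllows a (1, 0) e v.upper && legAllows a (0, 1) n v.upper &&
  stays a v.lower (-1, 0) 0 && stays a v.lower (0, -1) 0 && stays a v.upper (1, 0) 3 &&
  stays a v.upper (0, 1) 3 && staysAlong a v.lower (1, 1) 0 v.2.2 &&
  !unboundedLower (face a v.lower) && !unboundedUpper (face a v.upper)

/-- A criterion for a movement that creates an edge of slope minus one to keep the curve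
tritangent. -/
def fourGermNeg (a : List Expo) (w s e n : Status) (v : Vec) : Bool :=
  v.2.2 < 0 && legAllows a (-1, 0) w v.upperNeg && legAllows a (0, -1) s v.lower &&
  legAllows a (1, 0) e v.lower && legAllows a (0, 1) n v.upperNeg &&
  stays a v.upperNeg (-1, 0) 0 && stays a v.lower (0, -1) 0 && stays a v.lower (1, 0) 3 &&
  stays a v.upperNeg (0, 1) 3 && staysAlong a v.lower (-1, 1) 1 (-v.2.2) &&
  !unboundedLowerNeg (face a v.lower) && !unboundedUpperNeg (face a v.upperNeg)

/-- The tangencies of a rigid four-valent curve: a crossing at the vertex, and edges along the two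
legs on one side of it. -/
def isFourValent : List Expo → Status → Status → Status → Status → Bool
  | [m, m'], w, s, e, n =>
    (m'.toInt == m.toInt + (1, 1) &&
      ((w == .locked && s == .locked && e == .none && n == .none) ||
        (w == .none && s == .none && e == .locked && n == .locked))) ||
    (m'.toInt == m.toInt + (1, -1) &&
      ((w == .locked && s == .none && e == .none && n == .locked) ||
        (w == .none && s == .locked && e == .locked && n == .none)))
  | _, _, _, _, _ => false

/-- The finite core of the four-valent case: a pattern either admits a movement that opens an edge
and keeps the curve tritangent, or it is the one described by `isFourValent`, with multiplicity two
at the vertex. -/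
theorem isFourValent_all : fourCells.all fun a =>
    (legStatuses a (-1, 0) 0).all fun w => (legStatuses a (0, -1) 0).all fun s =>
    (legStatuses a (1, 0) 3).all fun e => (legStatuses a (0, 1) 3).all fun n =>
      (fourTestVecs.any fun v => fourGermPos a w s e n v || fourGermNeg a w s e n v) ||
      isFourValent a w s e n && top a (-1, 0) + top a (0, -1) + top a (1, 0) + top a (0, 1) == 2 := by
  decide +kernel

/-! ### Cells as lists -/

theorem mem_expos (m : Expo) : m ∈ expos := by revert m; decide

theorem nodup_expos : expos.Nodup := by decide

/-- The elements of a set of exponents, in a fixed order. -/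
def toList (s : Finset Expo) : List Expo := expos.filter (· ∈ s)

theorem mem_toList {s : Finset Expo} {m : Expo} : m ∈ toList s ↔ m ∈ s := by
  simp [toList, mem_expos]

theorem nodup_toList (s : Finset Expo) : (toList s).Nodup := nodup_expos.filter _

theorem length_toList (s : Finset Expo) : (toList s).length = s.card := by
  rw [← List.toFinset_card_of_nodup (nodup_toList s)]
  congr 1
  ext m
  simp [mem_toList]

theorem toList_injective : Function.Injective toList := fun s t h => by
  ext m
  rw [← mem_toList, h, mem_toList]

theorem toList_filter (s : Finset Expo) (P : Expo → Prop) [DecidablePred P] :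
    toList (s.filter P) = (toList s).filter P := by
  simp only [toList, List.filter_filter, Finset.mem_filter]
  exact List.filter_congr fun m _ => by simp [and_comm]

theorem toList_singleton (m : Expo) : toList {m} = [m] := by
  have h1 := length_toList {m}
  rw [Finset.card_singleton] at h1
  obtain ⟨n, hn⟩ := List.length_eq_one_iff.1 h1
  have : m ∈ toList {m} := mem_toList.2 (Finset.mem_singleton_self m)
  rw [hn, List.mem_singleton] at this
  rw [hn, this]

/-- The cell dual to a point, as a list. -/
def cell (c : Expo → ℝ) (p : Plane) : List Expo := toList (dualCell c p)

theorem mem_cell {p : Plane} {m : Expo} : m ∈ cell c p ↔ m ∈ dualCell c p :=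
  mem_toList

/-- Together with `top_cell` this connects the computations with lists to the geometry along a line.
-/
theorem face_cell (c : Expo → ℝ) (p : Plane) (r : ℤ × ℤ) :
    face (cell c p) r = toList (rightFace c p r) := by
  rw [rightFace, toList_filter, face]
  refine List.filter_congr fun m hm => ?_
  replace hm := mem_cell.1 hm
  rw [Bool.eq_iff_iff]
  simp only [List.all_eq_true, mem_cell, decide_eq_true_eq]
  constructor
  · intro h
    obtain ⟨n, hn, hs⟩ := exists_slope_eq_topSlope c p r
    exact le_antisymm (slope_le_topSlope hm r) (hs ▸ h n hn)
  · intro h n hn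
    rw [h]
    exact slope_le_topSlope hn r

theorem length_face_cell (c : Expo → ℝ) (p : Plane) (r : ℤ × ℤ) :
    (face (cell c p) r).length = (rightFace c p r).card := by rw [face_cell, length_toList]

/-- The seed -9 of the fold in `top` is harmless as soon as no slope is smaller. -/
theorem top_cell (c : Expo → ℝ) (p : Plane) {r : ℤ × ℤ} (hr : ∀ m, -9 ≤ slope r m) :
    top (cell c p) r = topSlope c p r := by
  have key : ∀ l : List ℤ, (∀ x ∈ l, x ≤ l.foldr max (-9)) ∧
      (l.foldr max (-9) = -9 ∨ l.foldr max (-9) ∈ l) := by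
    intro l
    induction l with
    | nil => simp
    | cons x l ih =>
      simp only [List.foldr_cons, List.mem_cons]
      refine ⟨?_, ?_⟩
      · rintro y (rfl | hy)
        · exact le_max_left _ _
        · exact (ih.1 y hy).trans (le_max_right _ _)
      · rcases le_total x (l.foldr max (-9)) with h | h
        · rw [max_eq_right h]
          exact ih.2.imp id Or.inr
        · rw [max_eq_left h]; exact Or.inr (Or.inl rfl)
  obtain ⟨h1, h2⟩ := key ((cell c p).map (slope r))
  obtain ⟨m, hm, hs⟩ := exists_slope_eq_topSlope c p r
  have h3 := h1 _ (List.mem_map_of_mem (mem_cell.2 hm))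
  apply le_antisymm
  · rcases h2 with h2 | h2
    · rw [top, h2, ← hs]; exact hr m
    · obtain ⟨n, hn, hns⟩ := List.mem_map.1 h2
      rw [top, ← hns]
      exact slope_le_topSlope (mem_cell.1 hn) r
  · rw [← hs]; exact h3

theorem cell_eq_face {p p' : Plane} {r : ℤ × ℤ}
    (h : dualCell c p' = rightFace c p r) : cell c p' = face (cell c p) r := by
  rw [face_cell, cell, h]

theorem isCoprime_of_det {x y : ℤ × ℤ} (h : |x.1 * y.2 - x.2 * y.1| = 1) : IsCoprime x.1 x.2 := by
  rcases (abs_eq zero_le_one).1 h with h | h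
  · exact ⟨y.2, -y.1, by linear_combination h⟩
  · exact ⟨-y.2, y.1, by linear_combination -h⟩

/-- Edges of the Newton subdivision are primitive. -/
theorem isCoprime_of_mem_dualCell (hc : IsSmooth c) {p : Plane} {m m' : Expo}
    (hm : m ∈ dualCell c p) (hm' : m' ∈ dualCell c p) (hne : m ≠ m') :
    IsCoprime (m'.toInt.1 - m.toInt.1) (m'.toInt.2 - m.toInt.2) := by
  have hthree : ∀ p, m ∈ dualCell c p → m' ∈ dualCell c p → (∃ n ∈ dualCell c p, n ≠ m ∧ n ≠ m') →
      IsCoprime (m'.toInt.1 - m.toInt.1) (m'.toInt.2 - m.toInt.2) := by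
    rintro p hm hm' ⟨n, hn, h1, h2⟩
    exact isCoprime_of_det (x := (_, _)) (y := (n.toInt.1 - m.toInt.1, n.toInt.2 - m.toInt.2))
      ((hc p).2 m hm m' hm' n hn hne h1.symm h2.symm)
  -- The direction of the dual edge of the curve. Following this edge to one of its ends leads to a
  -- vertex, where `m` and `m'` belong to a unimodular triangle.
  set r : ℤ × ℤ := (m'.toInt.2 - m.toInt.2, m.toInt.1 - m'.toInt.1) with hr
  have hmm' : slope r m = slope r m' := by simp only [slope, hr]; ring
  by_cases hex : ∃ n ∈ dualCell c p, n ≠ m ∧ n ≠ m'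
  · exact hthree p hm hm' hex
  push Not at hex
  have hall : ∀ n ∈ dualCell c p, slope r n = slope r m := by
    intro n hn
    by_cases h : n = m
    · rw [h]
    · rw [hex n hn h, hmm']
  have htop : topSlope c p r = slope r m := by
    obtain ⟨n, hn, h⟩ := exists_slope_eq_topSlope c p r
    rw [← h, hall n hn]
  have hlow : lowSlope c p r = slope r m := by
    obtain ⟨n, hn, h⟩ := exists_slope_eq_lowSlope c p r
    rw [← h, hall n hn]
  have hjump : ∀ r' : ℤ × ℤ, slope r' m = slope r' m' → topSlope c p r' = slope r' m →
      (∃ n, slope r' m < slope r' n) →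
      IsCoprime (m'.toInt.1 - m.toInt.1) (m'.toInt.2 - m.toInt.2) := by
    rintro r' h1 h2 ⟨n, hn⟩
    obtain ⟨T, hT, htail⟩ := exists_tail c p r'
    have hend : slope r' n ≤ endSlope r' := Finset.le_sup' _ (Finset.mem_univ n)
    obtain ⟨τ, hτ, h0, hw, hl⟩ := exists_first_jump (c := c) (p := p) (r := r') hT (by
      rw [line_zero, h2, (htail T le_rfl).2.2]; omega)
    rw [line_zero, h2] at hl
    have hface := rightFace_subset_of_jump hτ.1 h0
    have hmf : ∀ x ∈ dualCell c p, slope r' x = slope r' m → x ∈ dualCell c (line p r' τ) := by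
      intro x hx hxs
      apply rightFace_subset c _ (-r')
      rw [← hface, line_zero]
      exact mem_rightFace.2 ⟨hx, by rw [hxs, h2]⟩
    obtain ⟨z, hz, hzs⟩ := exists_slope_eq_topSlope c (line p r' τ) r'
    have hw' : 0 < topSlope c (line p r' τ) r' - lowSlope c (line p r' τ) r' := hw
    refine hthree _ (hmf m hm rfl) (hmf m' hm' h1.symm) ⟨z, hz, ?_, ?_⟩
    · rintro rfl; omega
    · rintro rfl; omega
  by_cases hup : ∃ n, slope r m < slope r n
  · exact hjump r hmm' htop hup
  by_cases hdown : ∃ n, slope r n < slope r m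
  · refine hjump (-r) (by rw [slope_neg, slope_neg, hmm']) (by rw [topSlope_neg, hlow, slope_neg]) ?_
    obtain ⟨n, hn⟩ := hdown
    exact ⟨n, by rw [slope_neg, slope_neg]; omega⟩
  -- If neither direction along the edge meets a vertex, no exponent is steeper in either direction,
  -- so all exponents lie on one line; but (0, 0), (1, 0) and (0, 1) do not.
  exfalso
  push Not at hup hdown
  have hconst : ∀ n, slope r n = slope r m := fun n => le_antisymm (hup n) (hdown n)
  have h00 := hconst (0, 0)
  have h10 := hconst (1, 0)
  have h01 := hconst (0, 1)
  rw [← h00] at h10 h01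
  apply hne
  apply Expo.toInt_injective
  have e10 : (Expo.toInt (1, 0)) = (1, 0) := by decide
  have e01 : (Expo.toInt (0, 1)) = (0, 1) := by decide
  have e00 : (Expo.toInt (0, 0)) = (0, 0) := by decide
  simp only [slope, e10, e01, e00, hr] at h10 h01
  generalize m.toInt = x at *
  generalize m'.toInt = y at *
  exact Prod.ext (by omega) (by omega)

theorem cell_mem_allCells (hc : IsSmooth c) (p : Plane) : cell c p ∈ allCells := by
  have hsub : (cell c p).Sublist expos := List.filter_sublist
  have hle := (hc p).1
  have hpos := (dualCell_nonempty c p).card_pos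
  rw [← length_toList] at hle hpos
  change (cell c p).length ≤ 3 at hle
  change 0 < (cell c p).length at hpos
  have hnd : (cell c p).Nodup := nodup_toList _
  have hmem : ∀ m ∈ cell c p, m ∈ dualCell c p := fun m => mem_cell.1
  simp only [allCells, List.mem_filter, List.mem_append, List.mem_sublistsLen]
  match h : cell c p with
  | [] => rw [h] at hpos; simp at hpos
  | [m] =>
    rw [h] at hsub
    exact ⟨Or.inl (Or.inl ⟨hsub, rfl⟩), rfl⟩
  | [m, m'] =>
    rw [h] at hsub hnd hmem
    refine ⟨Or.inl (Or.inr ⟨hsub, rfl⟩), ?_⟩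
    have hne : m ≠ m' := by simpa using hnd
    have := isCoprime_of_mem_dualCell hc (hmem m (by simp)) (hmem m' (by simp)) hne
    simpa [isCell] using Int.isCoprime_iff_gcd_eq_one.1 this
  | [m, m', m''] =>
    rw [h] at hsub hnd hmem
    refine ⟨Or.inr ⟨hsub, rfl⟩, ?_⟩
    simp only [List.nodup_cons, List.mem_cons, not_or] at hnd
    have := (hc p).2 m (hmem m (by simp)) m' (hmem m' (by simp)) m'' (hmem m'' (by simp))
      hnd.1.1 hnd.1.2.1 hnd.2.1.1
    simp only [isCell, beq_iff_eq]
    rw [Int.abs_eq_natAbs] at this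
    exact_mod_cast this
  | _ :: _ :: _ :: _ :: _ => rw [h] at hle; simp only [List.length_cons] at hle; omega

/-! ### Perturbations -/

theorem monomial_sub_line (c : Expo → ℝ) (m m' : Expo) (p : Plane) (u r : ℤ × ℤ) (t σ : ℝ) :
    monomial c m (p + t • (toPlane u + σ • toPlane r)) -
      monomial c m' (p + t • (toPlane u + σ • toPlane r)) =
      monomial c m p - monomial c m' p +
        t * ((slope u m - slope u m' : ℤ) + σ * (slope r m - slope r m' : ℤ)) := by
  simp [monomial, slope, toPlane, Expo.toInt]; ring

/-- Exponents that share the maximum with another one, after a movement. -/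
theorem dualCell_ne_singleton {p : Plane} {m m' : Expo} {u r : ℤ × ℤ} {t σ : ℝ}
    (hm : m ∈ dualCell c p) (hm' : m' ∈ dualCell c p) (hne : m' ≠ m) (ht : 0 ≤ t)
    (h : ((slope u m - slope u m' : ℤ) + σ * (slope r m - slope r m' : ℤ) : ℝ) ≤ 0) :
    dualCell c (p + t • (toPlane u + σ • toPlane r)) ≠ {m} := by
  intro hcon
  have h1 := monomial_sub_line c m m' p u r t σ
  rw [monomial_eq_of_mem hm hm', sub_self, zero_add] at h1
  have hmem : m ∈ dualCell c (p + t • (toPlane u + σ • toPlane r)) := by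
    rw [hcon]; exact Finset.mem_singleton_self m
  have h2 := mem_dualCell.1 hmem m'
  have h3 := mul_nonpos_of_nonneg_of_nonpos ht h
  have : m' ∈ dualCell c (p + t • (toPlane u + σ • toPlane r)) :=
    mem_dualCell_of_eq hmem (by linarith)
  rw [hcon, Finset.mem_singleton] at this
  exact hne this

theorem exists_monomial_lt {p : Plane} {m : Expo} (h : m ∉ dualCell c p) :
    ∃ m', monomial c m p < monomial c m' p := by
  by_contra hcon
  push Not at hcon
  exact h (mem_dualCell.2 hcon)

theorem notMem_dualCell_of_lt {p : Plane} {m m' : Expo}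
    (h : monomial c m p < monomial c m' p) : m ∉ dualCell c p :=
  fun hm => absurd (mem_dualCell.1 hm m') (not_le.2 h)

theorem isOpen_notMem_dualCell (c : Expo → ℝ) (m : Expo) : IsOpen {p | m ∉ dualCell c p} := by
  have e : {p | m ∉ dualCell c p} = ⋃ m', {p | monomial c m p < monomial c m' p} := by
    ext p
    simp only [mem_ofPred_eq, mem_iUnion]
    exact ⟨exists_monomial_lt, fun ⟨_, h⟩ => notMem_dualCell_of_lt h⟩
  rw [e]
  exact isOpen_iUnion fun m' => isOpen_lt (continuous_monomial c m) (continuous_monomial c m')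

/-- An exponent which does not occur along a compact segment does not occur after a small
movement. -/
theorem eventually_notMem_dualCell {m : Expo} {f : ℝ × ℝ → Plane}
    (hf : Continuous f) {I : Set ℝ} (hI : IsCompact I) (h : ∀ s ∈ I, m ∉ dualCell c (f (0, s))) :
    ∀ᶠ t in 𝓝 (0 : ℝ), ∀ s ∈ I, m ∉ dualCell c (f (t, s)) := by
  refine hI.eventually_forall_of_forall_eventually fun s hs => ?_
  exact ((isOpen_notMem_dualCell c m).preimage hf).mem_nhds (h s hs)

/-! ### The shape of the intersection along a leg -/

/-- A vector orthogonal to the primitive vector `r` is an integer multiple of `r` turned by a right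
angle, so its pairing with `u` depends only on the sideways part of `u`. -/
theorem cross_of_slope_eq {r : ℤ × ℤ} (hr : IsUnitDir r) {z : ℤ × ℤ}
    (h : z.1 * r.1 + z.2 * r.2 = 0) : ∃ κ : ℤ, ∀ u : ℤ × ℤ,
      z.1 * u.1 + z.2 * u.2 = κ * cross r u := by
  rcases hr with h1 | h1
  · have h1' : r.1 * r.1 = 1 := Int.isUnit_mul_self h1
    exact ⟨z.2 * r.1, fun u => by
      unfold cross; linear_combination r.1 * u.1 * h - (z.1 * u.1 + z.2 * u.2) * h1'⟩
  · have h1' : r.2 * r.2 = 1 := Int.isUnit_mul_self h1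
    exact ⟨-(z.1 * r.2), fun u => by
      unfold cross; linear_combination r.2 * u.2 * h - (z.1 * u.1 + z.2 * u.2) * h1'⟩

/-- The part `F` of a line is a crossing of the given shape, at which the slope increases from `h`
to `h + 2`. -/
def FarShape (c : Expo → ℝ) (v : Plane) (r : ℤ × ℤ) (h : ℤ) (s : Status) (F : Set ℝ) : Prop :=
  match s with
  | .none => F = ∅
  | .free => ∃ α, F = {α} ∧ lowSlope c (line v r α) r = h ∧ IsEdgePoint c (line v r α) r
  | .locked => ∃ α β, F = Icc α β ∧ IsEdgeSegment c v r h α β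
  | s => ∃ α, F = {α} ∧ ∃ m₁ m₂ m₃, dualCell c (line v r α) = {m₁, m₂, m₃} ∧ m₁ ≠ m₂ ∧ m₁ ≠ m₃ ∧
      m₂ ≠ m₃ ∧ slope r m₁ = h ∧ slope r m₂ = h + 1 ∧ slope r m₃ = h + 2 ∧
      lowSlope c (line v r α) r = h ∧ topSlope c (line v r α) r = h + 2 ∧
      ∀ u, s.allows (cross r u) → 2 * slope u m₂ ≤ slope u m₁ + slope u m₃

/-- The exponents have slopes `h`, `h + 1`, `h + 2`, so 2m₂ - m₁ - m₃ is orthogonal to `r`. The sign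
of the resulting factor `κ` tells on which side of the vertex the middle exponent, which has the
wrong parity, does not dominate alone. -/
theorem exists_farShape_of_isVertexPoint {v : Plane} {r : ℤ × ℤ} (hr : IsUnitDir r)
    {α : ℝ} (h : IsVertexPoint c (line v r α) r) :
    ∃ s : Status, (s = .pos ∨ s = .neg) ∧
      FarShape c v r (lowSlope c (line v r α) r) s {α} := by
  obtain ⟨m₁, m₂, m₃, hd, h12, h13, h23, h1, h2, h3, h4⟩ := h
  obtain ⟨κ, hκ⟩ := cross_of_slope_eq hr (z := (2 * m₂.toInt.1 - m₁.toInt.1 - m₃.toInt.1,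
    2 * m₂.toInt.2 - m₁.toInt.2 - m₃.toInt.2)) (by
      unfold slope at h1 h2 h3
      linear_combination 2 * h2 - h1 - h3)
  have hκ' : ∀ u, 2 * slope u m₂ - slope u m₁ - slope u m₃ = κ * cross r u := by
    intro u
    rw [← hκ]; unfold slope; ring
  rcases le_total κ 0 with h0 | h0
  · refine ⟨.pos, Or.inl rfl, α, rfl, m₁, m₂, m₃, hd, h12, h13, h23, h1, h2, h3, rfl, h4, ?_⟩
    intro u hu
    have hu' : 0 ≤ cross r u := by simpa [Status.allows] using hu
    have := hκ' u
    have := mul_nonpos_of_nonpos_of_nonneg h0 hu'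
    omega
  · refine ⟨.neg, Or.inr rfl, α, rfl, m₁, m₂, m₃, hd, h12, h13, h23, h1, h2, h3, rfl, h4, ?_⟩
    intro u hu
    have hu' : cross r u ≤ 0 := by simpa [Status.allows] using hu
    have := hκ' u
    have := mul_nonpos_of_nonneg_of_nonpos h0 hu'
    omega

/-- A point of the curve at which the exponent `m` is accompanied, after a movement by `u`, by
another exponent. -/
def Accompanied (c : Expo → ℝ) (p : Plane) (u r : ℤ × ℤ) (m : Expo) (σ : ℝ) : Prop :=
  ∃ m' ∈ dualCell c p, m' ≠ m ∧
    ((slope u m - slope u m' : ℤ) + σ * (slope r m - slope r m' : ℤ) : ℝ) ≤ 0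

/-- The exponent `m` has the intermediate slope. Inside an edge no such exponent exists, since the
cell has two elements. At a vertex `m` is the middle exponent; the terms in `σ` are opposite for its
two neighbours, so the two quantities have a sum at most zero and one of them is nonpositive. On a
bounded edge the other exponent of the edge has the same slope and, without sideways movement, the
same displacement. -/
theorem FarShape.accompanied {v : Plane} {r : ℤ × ℤ} (hr : IsUnitDir r) {h : ℤ}
    {s : Status} {F : Set ℝ} (hF : FarShape c v r h s F) {u : ℤ × ℤ} (hs : s.allows (cross r u))
    {m : Expo} (hm : slope r m = h + 1) {x : ℝ} (hx : x ∈ F) (hmx : m ∈ dualCell c (line v r x))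
    (σ : ℝ) : Accompanied c (line v r x) u r m σ := by
  have vertex : ∀ α, F = {α} → (∃ m₁ m₂ m₃, dualCell c (line v r α) = {m₁, m₂, m₃} ∧ m₁ ≠ m₂ ∧
      m₁ ≠ m₃ ∧ m₂ ≠ m₃ ∧ slope r m₁ = h ∧ slope r m₂ = h + 1 ∧ slope r m₃ = h + 2 ∧
      lowSlope c (line v r α) r = h ∧ topSlope c (line v r α) r = h + 2 ∧
      ∀ u, s.allows (cross r u) → 2 * slope u m₂ ≤ slope u m₁ + slope u m₃) →
      Accompanied c (line v r x) u r m σ := by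
    rintro α rfl ⟨m₁, m₂, m₃, hd, h12, h13, h23, h1, h2, h3, -, -, hu⟩
    rw [mem_singleton_iff] at hx
    subst hx
    have hm2 : m = m₂ := by
      rw [hd] at hmx
      simp only [Finset.mem_insert, Finset.mem_singleton] at hmx
      rcases hmx with rfl | rfl | rfl
      · omega
      · rfl
      · omega
    subst hm2
    have hsum := hu u hs
    by_cases hle : ((slope u m - slope u m₁ : ℤ) + σ * (slope r m - slope r m₁ : ℤ) : ℝ) ≤ 0
    · exact ⟨m₁, by rw [hd]; simp, h12, hle⟩
    · refine ⟨m₃, by rw [hd]; simp, h23.symm, ?_⟩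
      rw [h2, h1] at hle
      rw [h2, h3]
      have hsum' : (2 * slope u m : ℝ) ≤ slope u m₁ + slope u m₃ := by exact_mod_cast hsum
      push_cast at hle ⊢
      linarith
  match s with
  | .none => rw [show F = ∅ from hF] at hx; exact absurd hx (Set.notMem_empty x)
  | .free =>
    obtain ⟨α, rfl, hl, hcard, htop⟩ := hF
    rw [mem_singleton_iff] at hx
    subst hx
    obtain ⟨m₁, h1, hs1⟩ := exists_slope_eq_lowSlope c (line v r x) r
    obtain ⟨m₃, h3, hs3⟩ := exists_slope_eq_topSlope c (line v r x) r
    have : 2 < (dualCell c (line v r x)).card :=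
      Finset.two_lt_card.2 ⟨m₁, h1, m, hmx, m₃, h3, by rintro rfl; omega, by rintro rfl; omega,
        by rintro rfl; omega⟩
    omega
  | .pos => obtain ⟨α, hα, h'⟩ := hF; exact vertex α hα h'
  | .neg => obtain ⟨α, hα, h'⟩ := hF; exact vertex α hα h'
  | .locked =>
    obtain ⟨α, β, rfl, -, -, -, -, -, n, n', hne, hn, hn', hmem⟩ := hF
    have hcr : cross r u = 0 := by simpa [Status.allows] using hs
    have key : ∀ n, n ∈ dualCell c (line v r x) → n ≠ m → slope r n = h + 1 →
        Accompanied c (line v r x) u r m σ := by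
      intro n hn hne hns
      refine ⟨n, hn, hne, ?_⟩
      obtain ⟨κ, hκ⟩ := cross_of_slope_eq hr (z := (m.toInt.1 - n.toInt.1, m.toInt.2 - n.toInt.2)) (by
        unfold slope at hns hm
        linear_combination hm - hns)
      have h1 : slope u m - slope u n = 0 := by
        have := hκ u
        rw [hcr] at this
        unfold slope
        linear_combination this
      rw [h1, hm, hns]
      simp
    by_cases hmn : n = m
    · exact key n' (hmem x hx).2 (hmn ▸ hne.symm) hn'
    · exact key n (hmem x hx).1 hmn hn

theorem FarShape.slope_le {v : Plane} {r : ℤ × ℤ} {h : ℤ} {s : Status} {F : Set ℝ}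
    (hF : FarShape c v r h s F) {x : ℝ} (hx : x ∈ F) : topSlope c (line v r x) r ≤ h + 2 := by
  match s with
  | .none => rw [show F = ∅ from hF] at hx; exact absurd hx (Set.notMem_empty x)
  | .free =>
    obtain ⟨α, rfl, hl, -, ht⟩ := hF
    rw [mem_singleton_iff] at hx
    subst hx; omega
  | .pos =>
    obtain ⟨α, rfl, _, _, _, _, _, _, _, _, _, _, _, h', _⟩ := hF
    rw [mem_singleton_iff] at hx
    subst hx; omega
  | .neg =>
    obtain ⟨α, rfl, _, _, _, _, _, _, _, _, _, _, _, h', _⟩ := hF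
    rw [mem_singleton_iff] at hx
    subst hx; omega
  | .locked =>
    obtain ⟨α, β, rfl, -, -, -, -, ht, -⟩ := hF
    rcases hx.2.eq_or_lt with rfl | hlt
    · omega
    · have h1 := topSlope_le_lowSlope c v r hlt
      have h2 := lowSlope_le_topSlope c (line v r β) r
      omega

/-- On the part of a leg with a non-free status there is a vertex of the curve. -/
theorem FarShape.exists_vertex {v : Plane} {r : ℤ × ℤ} {h : ℤ} {s : Status}
    {F : Set ℝ} (hF : FarShape c v r h s F) (h1 : s ≠ .none) (h2 : s ≠ .free) :
    ∃ x, (dualCell c (line v r x)).card = 3 := by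
  match s with
  | .none => exact absurd rfl h1
  | .free => exact absurd rfl h2
  | .pos =>
    obtain ⟨α, -, m₁, m₂, m₃, hd, h12, h13, h23, -⟩ := hF
    exact ⟨α, Finset.card_eq_three.2 ⟨m₁, m₂, m₃, h12, h13, h23, hd⟩⟩
  | .neg =>
    obtain ⟨α, -, m₁, m₂, m₃, hd, h12, h13, h23, -⟩ := hF
    exact ⟨α, Finset.card_eq_three.2 ⟨m₁, m₂, m₃, h12, h13, h23, hd⟩⟩
  | .locked =>
    obtain ⟨α, β, -, -, h', -⟩ := hF
    exact ⟨α, h'⟩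

/-- A version of `crossing_of_slope_add_two`. -/
theorem exists_farShape (hc : IsSmooth c) {v : Plane} {r : ℤ × ℤ}
    (hr : IsUnitDir r) {s t : ℝ} (hst : s < t) (hcard : (rightFace c (line v r s) r).card = 1)
    (h : lowSlope c (line v r t) r = topSlope c (line v r s) r + 2)
    (hpar : ∀ u ∈ Ioo s t, line v r u ∉ curve c →
      Even (topSlope c (line v r u) r - topSlope c (line v r s) r)) :
    ∃ x ∈ crossings, ∃ F, F ⊆ Ioo s t ∧ (∃ y ∈ Ioo s t, ∀ z ∈ F, z < y) ∧
      {u ∈ Ioo s t | line v r u ∈ curve c} = F ∧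
      FarShape c v r (topSlope c (line v r s) r) x F ∧
      (x ≠ .locked → ∃ α, rightFace c (line v r s) r ⊆ dualCell c (line v r α) ∧
        rightFace c (line v r t) (-r) ⊆ dualCell c (line v r α)) := by
  rcases crossing_of_slope_add_two hc hr hst hcard h hpar with
    ⟨α, hα, hset, hlow, h1, h2, h3 | h3⟩ | ⟨α, hα, β, hβ, hset, h3⟩
  · refine ⟨.free, by simp [crossings], {α}, by simpa using hα, ⟨(α + t) / 2, ?_, ?_⟩, hset,
      ⟨α, rfl, hlow, h3⟩, fun _ => ⟨α, h1, h2⟩⟩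
    · exact ⟨by linarith [hα.1, hα.2], by linarith [hα.1, hα.2]⟩
    · rintro z rfl
      linarith [hα.2]
  · obtain ⟨x, hx, hfar⟩ := exists_farShape_of_isVertexPoint hr h3
    rw [hlow] at hfar
    refine ⟨x, by rcases hx with rfl | rfl <;> simp [crossings], {α}, by simpa using hα,
      ⟨(α + t) / 2, ?_, ?_⟩, hset, hfar, fun _ => ⟨α, h1, h2⟩⟩
    · exact ⟨by linarith [hα.1, hα.2], by linarith [hα.1, hα.2]⟩
    · rintro z rfl
      linarith [hα.2]
  · refine ⟨.locked, by simp [crossings], Icc α β, fun z hz => ⟨hα.1.trans_le hz.1,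
      hz.2.trans_lt hβ.2⟩, ⟨(β + t) / 2, ?_, ?_⟩, hset, ⟨α, β, rfl, h3⟩, fun h => absurd rfl h⟩
    · exact ⟨by linarith [hβ.1, hβ.2], by linarith [hβ.1, hβ.2]⟩
    · intro z hz
      linarith [hβ.2, hz.2]

/-- The exponent `m` is parallel along the line to one which is dominant at `p`, so it cannot be
dominant elsewhere without having the same value at `p`. -/
theorem mem_dualCell_of_slope_eq {p : Plane} {r : ℤ × ℤ} {s : ℝ} {m : Expo}
    (hm : m ∈ dualCell c (line p r s)) (h : slope r m = topSlope c p r) : m ∈ dualCell c p := by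
  obtain ⟨n, hn, hns⟩ := exists_slope_eq_topSlope c p r
  have h1 := mem_dualCell.1 hm n
  rw [monomial_line, monomial_line, h, hns] at h1
  exact mem_dualCell_of_eq hn (le_antisymm (by linarith) (mem_dualCell.1 hn m))

/-- Beyond a point outside the curve with maximal slope, the line does not meet the curve. -/
theorem notMem_curve_of_topSlope_eq {p : Plane} {r : ℤ × ℤ} {s : ℝ}
    (hcard : (rightFace c (line p r s) r).card = 1) (h : topSlope c (line p r s) r = endSlope r)
    {u : ℝ} (hu : s < u) : line p r u ∉ curve c := by
  have h1 := topSlope_le_lowSlope c p r (hu.trans (lt_add_one u))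
  have h2 := lowSlope_le_topSlope c (line p r (u + 1)) r
  have h3 := topSlope_le_endSlope c (line p r (u + 1)) r
  exact notMem_curve_of_card_rightFace hcard (t := u + 1) (by omega) u ⟨hu, lt_add_one u⟩

theorem even_topSlope_of_card {v : Plane} {r : ℤ × ℤ} {e : ℤ} {s t : ℝ}
    (hst : s < t)
    (hpar : ∀ u ∈ Ioo s t, ∀ m, dualCell c (line v r u) = {m} → Even (slope r m + e))
    (hcard : (rightFace c (line v r s) r).card = 1) : Even (topSlope c (line v r s) r + e) := by
  obtain ⟨m, hm⟩ := Finset.card_eq_one.1 hcard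
  obtain ⟨ε, hε, hd⟩ := exists_pos_dualCell_eq_rightFace c (line v r s) r
  have hpos : 0 < min (ε / 2) ((t - s) / 2) := lt_min (by linarith) (by linarith)
  have h1 := hd _ ⟨hpos, by linarith [min_le_left (ε / 2) ((t - s) / 2)]⟩
  rw [line_line, hm] at h1
  have h2 : m ∈ rightFace c (line v r s) r := by rw [hm]; exact Finset.mem_singleton_self m
  rw [← (mem_rightFace.1 h2).2]
  exact hpar _ ⟨by linarith, by linarith [min_le_right (ε / 2) ((t - s) / 2)]⟩ m h1

/-- The intersection of the curve with an open leg: an initial segment and a crossing. -/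
structure LegShape (c : Expo → ℝ) (v : Plane) (r : ℤ × ℤ) (s : Status) (τ : ℝ) (F : Set ℝ) :
    Prop where
  nonneg : 0 ≤ τ
  far : FarShape c v r (topSlope c (line v r τ) r) s F
  far_subset : F ⊆ Ioi τ
  set_eq : {u ∈ Ioi 0 | line v r u ∈ curve c} = Ioc 0 τ ∪ F
  even : Even (topSlope c (line v r τ) r + endSlope r)
  eq_zero : (rightFace c v r).card = 1 → τ = 0
  pos : (rightFace c v r).card ≠ 1 → 0 < τ ∧ (dualCell c (line v r τ)).card = 3 ∧
    topSlope c (line v r τ) r = topSlope c v r + 1 ∧ topSlope c v r ≠ endSlope r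

/-- A leg contained in the curve. -/
structure IsRay (c : Expo → ℝ) (v : Plane) (r : ℤ × ℤ) : Prop where
  top : topSlope c v r = endSlope r
  card : (rightFace c v r).card ≠ 1
  subset : ∀ u ≥ 0, line v r u ∈ curve c

/-- The total increase of the slope along the leg is between 0 and 3. If the leg starts off the
curve, parity leaves an increase of 0 or 2, that is, nothing or one crossing. If it starts along an
edge, an increase of 0 means that the whole leg is in the curve. Otherwise the overlap ends with a
jump by one and the rest is again 0 or 2. -/
theorem exists_legShape (hc : IsSmooth c) {v : Plane} {r : ℤ × ℤ}
    (hr : IsUnitDir r) (hr3 : ∀ m, endSlope r ≤ slope r m + 3) (hr9 : ∀ m, -9 ≤ slope r m)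
    (hpar : ∀ t, 0 ≤ t → ∀ m, dualCell c (line v r t) = {m} → Even (slope r m + endSlope r)) :
    ∃ s ∈ legStatuses (cell c v) r (endSlope r),
      (∃ τ F, LegShape c v r s τ F) ∨ (s = .none ∧ IsRay c v r) := by
  obtain ⟨T, hT, htail⟩ := exists_tail c v r
  have hpar' : ∀ s ≥ 0, ∀ t, ∀ u ∈ Ioo s t, ∀ m, dualCell c (line v r u) = {m} →
      Even (slope r m + endSlope r) := fun s hs t u hu m hm => hpar u (hs.trans hu.1.le) m hm
  have hle : topSlope c v r ≤ endSlope r := topSlope_le_endSlope c v r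
  have hge : endSlope r ≤ topSlope c v r + 3 := by
    obtain ⟨m, -, hm⟩ := exists_slope_eq_topSlope c v r
    rw [← hm]; exact hr3 m
  have hcardpos := rightFace_card_pos c v r
  have hstat : legStatuses (cell c v) r (endSlope r) = if (rightFace c v r).card = 1 then
      if endSlope r - topSlope c v r = 2 then crossings else [.none]
      else if endSlope r - topSlope c v r = 3 then crossings
      else if endSlope r - topSlope c v r = 2 then [] else [.none] := by
    simp only [legStatuses, length_face_cell, top_cell c v hr9, beq_iff_eq]
  rw [hstat]
  have hlowT : ∀ s, s < T → lowSlope c (line v r T) r = endSlope r := fun _ _ => (htail T le_rfl).2.2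
  have far : ∀ s ≥ 0, s < T → (rightFace c (line v r s) r).card = 1 →
      topSlope c (line v r s) r + 2 = endSlope r → ∃ x ∈ crossings, ∃ F, F ⊆ Ioi s ∧
        {u ∈ Ioi s | line v r u ∈ curve c} = F ∧
        FarShape c v r (topSlope c (line v r s) r) x F := by
    intro s hs hsT hcard htop
    have heven := even_topSlope_of_card hsT (hpar' s hs T) hcard
    obtain ⟨x, hx, F, hF, ⟨y, hy, hyF⟩, hset, hfar, -⟩ := exists_farShape hc hr hsT hcard
      (by rw [(htail T le_rfl).2.2]; exact htop.symm) (by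
        intro u hu huc
        obtain ⟨m, hm⟩ := notMem_curve_iff.1 huc
        have := hpar' s hs T u hu m hm
        rw [topSlope_of_singleton hm]
        obtain ⟨k, hk⟩ := heven
        obtain ⟨l, hl⟩ := this
        exact ⟨l - k, by omega⟩)
    refine ⟨x, hx, F, fun z hz => (hF hz).1, ?_, hfar⟩
    -- The point at time `y` lies beyond the crossing and already has the slope at infinity. So
    -- nothing follows after it, and the description of the intersection extends from a bounded
    -- interval to the whole leg.
    have hyc : line v r y ∉ curve c := fun hcur => by
      have : y ∈ F := by rw [← hset]; exact ⟨hy, hcur⟩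
      exact lt_irrefl _ (hyF y this)
    obtain ⟨m, hm⟩ := notMem_curve_iff.1 hyc
    have hycard : (rightFace c (line v r y) r).card = 1 := by
      have h1 := rightFace_card_pos c (line v r y) r
      have h2 := Finset.card_le_card (rightFace_subset c (line v r y) r)
      rw [hm, Finset.card_singleton] at h2
      omega
    have hytop : topSlope c (line v r y) r = endSlope r := by
      have hnone := notMem_curve_of_card_rightFace (c := c) (p := v) (r := r) (s := y) (t := T)
      have : lowSlope c (line v r T) r = topSlope c (line v r y) r := by
        refine lowSlope_eq_topSlope hy.2 fun u hu => ?_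
        by_contra hw
        have hmem : u ∈ F := by
          rw [← hset]; exact ⟨⟨hy.1.trans hu.1, hu.2⟩, mem_curve_of_width_ne_zero hw⟩
        exact lt_irrefl _ ((hyF u hmem).trans hu.1)
      rw [← this, (htail T le_rfl).2.2]
    rw [← hset]
    ext u
    constructor
    · rintro ⟨hu, huc⟩
      refine ⟨⟨hu, ?_⟩, huc⟩
      by_contra hcon
      exact notMem_curve_of_topSlope_eq hycard hytop (hy.2.trans_le (not_lt.1 hcon)) huc
    · rintro ⟨hu, huc⟩
      exact ⟨hu.1, huc⟩
  by_cases hcard : (rightFace c v r).card = 1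
  · rw [if_pos hcard]
    have hcard0 : (rightFace c (line v r 0) r).card = 1 := by rwa [line_zero]
    have heven := even_topSlope_of_card hT (hpar' 0 le_rfl T) hcard0
    have htot : endSlope r - topSlope c v r = 0 ∨ endSlope r - topSlope c v r = 2 := by
      obtain ⟨k, hk⟩ := heven
      rw [line_zero] at hk
      omega
    rcases htot with htot | htot
    · rw [if_neg (by omega)]
      refine ⟨.none, by simp, Or.inl ⟨0, ∅, le_rfl, rfl, by simp, ?_, heven, fun _ => rfl,
        fun h => absurd hcard h⟩⟩
      ext u
      simp only [mem_ofPred_eq, Ioc_self, Set.union_empty, mem_empty_iff_false, iff_false, not_and]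
      exact fun hu => notMem_curve_of_topSlope_eq hcard0 (by rw [line_zero]; omega) hu
    · rw [if_pos htot]
      obtain ⟨x, hx, F, hF, hset, hfar⟩ := far 0 le_rfl hT hcard0 (by rw [line_zero]; omega)
      exact ⟨x, hx, Or.inl ⟨0, F, le_rfl, hfar, hF, by simpa using hset, heven, fun _ => rfl,
        fun h => absurd hcard h⟩⟩
  · rw [if_neg hcard]
    by_cases h0 : endSlope r = topSlope c v r
    · rw [if_neg (by omega), if_neg (by omega)]
      refine ⟨.none, by simp, Or.inr ⟨rfl, h0.symm, hcard, fun u hu => ?_⟩⟩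
      have h2 : 2 ≤ (rightFace c v r).card := by omega
      rcases hu.eq_or_lt with rfl | hu
      · rw [line_zero]
        exact h2.trans (Finset.card_le_card (rightFace_subset ..))
      · have h1 := topSlope_le_lowSlope c v r (hu.trans (lt_add_one u))
        have h2' := lowSlope_le_topSlope c (line v r (u + 1)) r
        have h3 := topSlope_le_endSlope c (line v r (u + 1)) r
        have := dualCell_const_of_lowSlope_eq (c := c) (p := v) (r := r) (s := 0) (t := u + 1)
          (by rw [line_zero] at h1 ⊢; omega) u ⟨hu, lt_add_one u⟩
        change 2 ≤ _
        rw [this, line_zero]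
        exact h2
    · obtain ⟨τ, hτ, hmid, hsub, hτ3, hτ1, hτlow, hτtop⟩ := exists_end_of_overlap (p := v) (s := 0)
        hc hr hT (by rw [line_zero]; omega) (by rw [line_zero, (htail T le_rfl).2.2]; omega)
      simp only [line_zero] at hmid hsub hτlow hτtop
      have heven := even_topSlope_of_card hτ.2 (hpar' τ hτ.1.le T) hτ1
      have hIoc : ∀ u ∈ Ioc 0 τ, line v r u ∈ curve c := by
        intro u hu
        change 2 ≤ _
        rcases hu.2.eq_or_lt with rfl | hlt
        · omega
        · rw [hmid u ⟨hu.1, hlt⟩]; omega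
      have hset : ∀ F, {u ∈ Ioi τ | line v r u ∈ curve c} = F →
          {u ∈ Ioi 0 | line v r u ∈ curve c} = Ioc 0 τ ∪ F := by
        rintro F rfl
        ext u
        constructor
        · rintro ⟨hu, huc⟩
          rcases le_or_gt u τ with h | h
          · exact Or.inl ⟨hu, h⟩
          · exact Or.inr ⟨h, huc⟩
        · rintro (hu | ⟨hu, huc⟩)
          · exact ⟨hu.1, hIoc u hu⟩
          · exact ⟨hτ.1.trans hu, huc⟩
      have htot : endSlope r - topSlope c v r = 1 ∨ endSlope r - topSlope c v r = 3 := by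
        obtain ⟨k, hk⟩ := heven
        omega
      rcases htot with htot | htot
      · rw [if_neg (by omega), if_neg (by omega)]
        refine ⟨.none, by simp, Or.inl ⟨τ, ∅, hτ.1.le, rfl, by simp, hset _ ?_, heven,
          fun h => absurd h hcard, fun _ => ⟨hτ.1, hτ3, hτtop, by omega⟩⟩⟩
        ext u
        simp only [mem_ofPred_eq, mem_empty_iff_false, iff_false, not_and]
        exact fun hu => notMem_curve_of_topSlope_eq hτ1 (by omega) hu
      · rw [if_pos htot]
        obtain ⟨x, hx, F, hF, hF', hfar⟩ := far τ hτ.1.le hτ.2 hτ1 (by omega)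
        exact ⟨x, hx, Or.inl ⟨τ, F, hτ.1.le, hfar, hF, hset _ hF', heven,
          fun h => absurd h hcard, fun _ => ⟨hτ.1, hτ3, hτtop, by omega⟩⟩⟩

/-! ### The shape of the intersection along the edge -/

theorem slope_bound_diag : (∀ m, -9 ≤ slope (1, 1) m) ∧ ∀ m, -9 ≤ slope (-1, -1) m := by decide

theorem top_diag (c : Expo → ℝ) (p : Plane) : top (cell c p) (1, 1) = topSlope c p (1, 1) :=
  top_cell c p slope_bound_diag.1

theorem top_neg_diag (c : Expo → ℝ) (p : Plane) :
    top (cell c p) (-1, -1) = -lowSlope c p (1, 1) := by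
  rw [top_cell c p slope_bound_diag.2]; exact topSlope_neg c p (1, 1)

theorem none_mem_diagStatuses_of_eq {p p' : Plane}
    (h : lowSlope c p' (1, 1) = topSlope c p (1, 1))
    (hf : rightFace c p (1, 1) = rightFace c p' (-1, -1)) :
    Status.none ∈ diagStatuses (cell c p) (cell c p') := by
  simp only [diagStatuses, top_diag, top_neg_diag, face_cell, hf, h]
  simp

theorem none_mem_diagStatuses_of_add_one {p p' : Plane}
    (h : lowSlope c p' (1, 1) = topSlope c p (1, 1) + 1)
    (hf : (rightFace c p (1, 1)).card = 1 ↔ ¬ (rightFace c p' (-1, -1)).card = 1) :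
    Status.none ∈ diagStatuses (cell c p) (cell c p') := by
  simp only [diagStatuses, top_diag, top_neg_diag, face_cell, h, length_toList]
  have e : - -(topSlope c p (1, 1) + 1) - topSlope c p (1, 1) = 1 := by ring
  rw [e]
  by_cases h1 : (rightFace c p (1, 1)).card = 1
  · have h2 := hf.1 h1
    simp [h1, h2]
  · have h2 : (rightFace c p' (-1, -1)).card = 1 := by
      by_contra h3; exact h1 (hf.2 h3)
    simp [h1, h2]

theorem none_mem_diagStatuses_of_add_two {p p' : Plane}
    (h : lowSlope c p' (1, 1) = topSlope c p (1, 1) + 2)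
    (hf : (rightFace c p (1, 1)).card ≠ 1) :
    Status.none ∈ diagStatuses (cell c p) (cell c p') := by
  simp only [diagStatuses, top_diag, top_neg_diag, face_cell, h]
  have e : - -(topSlope c p (1, 1) + 2) - topSlope c p (1, 1) = 2 := by ring
  rw [e]
  rw [← length_toList] at hf
  split_ifs <;> simp_all
  split
  · simp_all
  · simp

theorem mem_diagStatuses_of_add_two {p p' : Plane} {m m' : Expo} {x : Status}
    (h : lowSlope c p' (1, 1) = topSlope c p (1, 1) + 2)
    (hf : rightFace c p (1, 1) = {m}) (hf' : rightFace c p' (-1, -1) = {m'}) (hx : x ∈ crossings)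
    (hcop : x ≠ .locked → IsCoprime (m'.toInt.1 - m.toInt.1) (m'.toInt.2 - m.toInt.2)) :
    x ∈ diagStatuses (cell c p) (cell c p') := by
  simp only [diagStatuses, top_diag, top_neg_diag, face_cell, h, hf, hf', toList_singleton]
  have e : - -(topSlope c p (1, 1) + 2) - topSlope c p (1, 1) = 2 := by ring
  rw [e]
  by_cases hl : x = .locked
  · subst hl
    simp only [show ((2 : ℤ) == 0) = false from rfl, show ((2 : ℤ) == 1) = false from rfl,
      show ((2 : ℤ) == 2) = true from rfl, if_true, Bool.false_eq_true, if_false]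
    split_ifs <;> simp [crossings]
  · have := Int.isCoprime_iff_gcd_eq_one.1 (hcop hl)
    have h2 : isCell [m, m'] = true := by simpa [isCell] using this
    simpa [h2] using hx

/-- The intersection of the curve with the open edge: two segments at the vertices and a
crossing. -/
structure DiagShape (c : Expo → ℝ) (v : Plane) (L : ℝ) (s : Status) (τ τ' : ℝ) (F : Set ℝ) :
    Prop where
  nonneg : 0 ≤ τ
  lt : τ < τ'
  le : τ' ≤ L
  far : FarShape c v (1, 1) (topSlope c (line v (1, 1) τ) (1, 1)) s F
  far_subset : F ⊆ Ioo τ τ'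
  set_eq : {u ∈ Ioo 0 L | line v (1, 1) u ∈ curve c} = Ioc 0 τ ∪ F ∪ Ico τ' L
  even : Even (topSlope c (line v (1, 1) τ) (1, 1))
  even' : Even (lowSlope c (line v (1, 1) τ') (1, 1))
  eq_zero : (rightFace c v (1, 1)).card = 1 → τ = 0
  pos : (rightFace c v (1, 1)).card ≠ 1 → 0 < τ ∧ (dualCell c (line v (1, 1) τ)).card = 3 ∧
    topSlope c (line v (1, 1) τ) (1, 1) = topSlope c v (1, 1) + 1
  eq_length : (rightFace c (line v (1, 1) L) (-1, -1)).card = 1 → τ' = L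
  lt_length : (rightFace c (line v (1, 1) L) (-1, -1)).card ≠ 1 → τ' < L ∧
    (dualCell c (line v (1, 1) τ')).card = 3 ∧
    lowSlope c (line v (1, 1) τ') (1, 1) = lowSlope c (line v (1, 1) L) (1, 1) - 1
  ne : (rightFace c v (1, 1)).card ≠ 1 →
    lowSlope c (line v (1, 1) L) (1, 1) ≠ topSlope c v (1, 1)

/-- The edge is contained in an edge of the curve. -/
structure IsBridge (c : Expo → ℝ) (v : Plane) (L : ℝ) : Prop where
  slope_eq : lowSlope c (line v (1, 1) L) (1, 1) = topSlope c v (1, 1)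
  card : (rightFace c v (1, 1)).card ≠ 1
  subset : ∀ u ∈ Icc 0 L, line v (1, 1) u ∈ curve c

theorem isUnitDir_diag : IsUnitDir (1, 1) := Or.inl isUnit_one
theorem isUnitDir_neg_diag : IsUnitDir (-(1, 1)) := Or.inl (by decide)

/-- Overlaps at the two ends of the edge, if they are not one common segment, end with a jump by one
each. The slope between them changes by an even number that is at most two. -/
theorem exists_diagShape (hc : IsSmooth c) {v : Plane} {L : ℝ} (hL : 0 < L)
    (hpar : ∀ t ∈ Icc 0 L, ∀ m, dualCell c (line v (1, 1) t) = {m} → Even (slope (1, 1) m))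
    (hd : lowSlope c (line v (1, 1) L) (1, 1) ≤ topSlope c v (1, 1) + 2) :
    ∃ s ∈ diagStatuses (cell c v) (cell c (line v (1, 1) L)),
      (∃ τ τ' F, DiagShape c v L s τ τ' F) ∨ (s = .none ∧ IsBridge c v L) := by
  set r : ℤ × ℤ := (1, 1) with hr
  have hneg : ((-1, -1) : ℤ × ℤ) = -r := rfl
  have hge := topSlope_le_lowSlope c v r hL
  rw [line_zero] at hge
  have hcardpos := rightFace_card_pos c v r
  have hcardpos' := rightFace_card_pos c (line v r L) (-r)
  by_cases hbridge : lowSlope c (line v r L) r = topSlope c v r ∧ (rightFace c v r).card ≠ 1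
  · obtain ⟨heq, hcard⟩ := hbridge
    have hconst := dualCell_const_of_lowSlope_eq (c := c) (p := v) (r := r) (s := 0) (t := L)
      (by rw [line_zero]; exact heq)
    have hf : rightFace c v r = rightFace c (line v r L) (-r) := by
      have := rightFace_subset_of_jump hL (c := c) (p := v) (r := r)
        (width_eq_zero_of_lowSlope_eq (by rw [line_zero]; exact heq))
      rwa [line_zero] at this
    refine ⟨.none, none_mem_diagStatuses_of_eq heq hf, Or.inr ⟨rfl, heq, hcard, fun u hu => ?_⟩⟩
    have h2 : 2 ≤ (rightFace c v r).card := by omega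
    rcases hu.1.eq_or_lt with rfl | h1
    · rw [line_zero]; exact h2.trans (Finset.card_le_card (rightFace_subset ..))
    rcases hu.2.eq_or_lt with rfl | h3
    · rw [hf] at h2; exact h2.trans (Finset.card_le_card (rightFace_subset ..))
    · change 2 ≤ _
      rw [hconst u ⟨h1, h3⟩, line_zero]; exact h2
  -- the end of the overlap at the lower vertex
  obtain ⟨τ, hτ0, hτL, hτ1, hτcurve, hτzero, hτpos⟩ : ∃ τ, 0 ≤ τ ∧ τ < L ∧
      (rightFace c (line v r τ) r).card = 1 ∧ (∀ u ∈ Ioc 0 τ, line v r u ∈ curve c) ∧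
      ((rightFace c v r).card = 1 → τ = 0) ∧
      ((rightFace c v r).card ≠ 1 → 0 < τ ∧ (dualCell c (line v r τ)).card = 3 ∧
        topSlope c (line v r τ) r = topSlope c v r + 1) := by
    by_cases hcard : (rightFace c v r).card = 1
    · exact ⟨0, le_rfl, hL, by rwa [line_zero], fun u hu => absurd hu.1 (not_lt.2 hu.2),
        fun _ => rfl, fun h => absurd hcard h⟩
    · have hlt : topSlope c v r < lowSlope c (line v r L) r := by
        rcases hge.eq_or_lt with h | h
        · exact absurd ⟨h.symm, hcard⟩ hbridge
        · exact h
      obtain ⟨τ, hτ, hmid, -, hτ3, hτ1, -, hτtop⟩ := exists_end_of_overlap (p := v) (r := r) (s := 0)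
        (t := L) hc isUnitDir_diag hL (by rw [line_zero]; omega) (by rw [line_zero]; exact hlt)
      simp only [line_zero] at hmid hτtop
      refine ⟨τ, hτ.1.le, hτ.2, hτ1, fun u hu => ?_, fun h => absurd h hcard,
        fun _ => ⟨hτ.1, hτ3, hτtop⟩⟩
      change 2 ≤ (dualCell c (line v r u)).card
      rcases hu.2.eq_or_lt with rfl | hlt
      · omega
      · rw [hmid u ⟨hu.1, hlt⟩]; exact show 2 ≤ (rightFace c v r).card by omega
  have hge' := topSlope_le_lowSlope c v r hτL
  -- the end of the overlap at the upper vertex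
  obtain ⟨τ', hττ', hτ'L, hτ'1, hτ'curve, hτ'eq, hτ'lt⟩ : ∃ τ', τ < τ' ∧ τ' ≤ L ∧
      (rightFace c (line v r τ') (-r)).card = 1 ∧ (∀ u ∈ Ico τ' L, line v r u ∈ curve c) ∧
      ((rightFace c (line v r L) (-r)).card = 1 → τ' = L) ∧
      ((rightFace c (line v r L) (-r)).card ≠ 1 → τ' < L ∧ (dualCell c (line v r τ')).card = 3 ∧
        lowSlope c (line v r τ') r = lowSlope c (line v r L) r - 1) := by
    by_cases hcard : (rightFace c (line v r L) (-r)).card = 1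
    · exact ⟨L, hτL, le_rfl, hcard, fun u hu => absurd hu.1 (not_le.2 hu.2), fun _ => rfl,
        fun h => absurd hcard h⟩
    · have hlt : topSlope c (line v r τ) r < lowSlope c (line v r L) r := by
        rcases hge'.eq_or_lt with h | h
        · have := rightFace_subset_of_jump hτL (c := c) (p := v) (r := r)
            (width_eq_zero_of_lowSlope_eq h.symm)
          rw [this] at hτ1
          exact absurd hτ1 hcard
        · exact h
      obtain ⟨σ, hσ, hmid, -, hσ3, hσ1, -, hσtop⟩ := exists_end_of_overlap (p := v) (s := -L)
        (t := -τ) (r := -r) hc isUnitDir_neg_diag (by linarith)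
        (by rw [line_neg, neg_neg]; omega)
        (by rw [line_neg, line_neg, neg_neg, neg_neg, topSlope_neg, lowSlope_neg]; omega)
      simp only [line_neg, neg_neg, topSlope_neg] at hmid hσ3 hσ1 hσtop
      refine ⟨-σ, by linarith [hσ.2], by linarith [hσ.1], hσ1, fun u hu => ?_,
        fun h => absurd h hcard, fun _ => ⟨by linarith [hσ.1], hσ3, by omega⟩⟩
      change 2 ≤ _
      rcases hu.1.eq_or_lt with rfl | hlt
      · omega
      · have := hmid (-u) ⟨by linarith [hu.2], by linarith⟩
        rw [neg_neg] at this
        rw [this]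
        exact show 2 ≤ (rightFace c (line v r L) (-r)).card by omega
  have heven : Even (topSlope c (line v r τ) r) := by
    have := even_topSlope_of_card (e := 0) hττ' (fun u hu m hm => by
      rw [add_zero]
      exact hpar u ⟨hτ0.trans hu.1.le, hu.2.le.trans hτ'L⟩ m hm) hτ1
    rwa [add_zero] at this
  have heven' : Even (lowSlope c (line v r τ') r) := by
    have := even_topSlope_of_card (c := c) (v := v) (r := -r) (e := 0) (s := -τ') (t := -τ)
      (by linarith) (fun u hu m hm => by
        rw [line_neg] at hm
        rw [add_zero, slope_neg, even_neg]
        exact hpar (-u) ⟨by linarith [hu.2], by linarith [hu.1]⟩ m hm)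
      (by rw [line_neg, neg_neg]; exact hτ'1)
    rwa [add_zero, line_neg, neg_neg, topSlope_neg, even_neg] at this
  have hgap := topSlope_le_lowSlope c v r hττ'
  have hset : ∀ F, {u ∈ Ioo τ τ' | line v r u ∈ curve c} = F →
      {u ∈ Ioo 0 L | line v r u ∈ curve c} = Ioc 0 τ ∪ F ∪ Ico τ' L := by
    rintro F rfl
    ext u
    constructor
    · rintro ⟨hu, huc⟩
      rcases le_or_gt u τ with h | h
      · exact Or.inl (Or.inl ⟨hu.1, h⟩)
      rcases lt_or_ge u τ' with h' | h'
      · exact Or.inl (Or.inr ⟨⟨h, h'⟩, huc⟩)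
      · exact Or.inr ⟨h', hu.2⟩
    · rintro ((hu | ⟨hu, huc⟩) | hu)
      · exact ⟨⟨hu.1, hu.2.trans_lt hτL⟩, hτcurve u hu⟩
      · exact ⟨⟨hτ0.trans_lt hu.1, hu.2.trans_le hτ'L⟩, huc⟩
      · exact ⟨⟨(hτ0.trans_lt hττ').trans_le hu.1, hu.2⟩, hτ'curve u hu⟩
  have hne : (rightFace c v r).card ≠ 1 → lowSlope c (line v r L) r ≠ topSlope c v r :=
    fun h h' => hbridge ⟨h', h⟩
  have htop : (rightFace c v r).card = 1 → topSlope c (line v r τ) r = topSlope c v r := fun h => by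
    rw [hτzero h, line_zero]
  have hlow : (rightFace c (line v r L) (-r)).card = 1 →
      lowSlope c (line v r τ') r = lowSlope c (line v r L) r := fun h => by rw [hτ'eq h]
  have htop' : (rightFace c v r).card ≠ 1 → topSlope c (line v r τ) r = topSlope c v r + 1 :=
    fun h => (hτpos h).2.2
  have hlow' : (rightFace c (line v r L) (-r)).card ≠ 1 →
      lowSlope c (line v r τ') r = lowSlope c (line v r L) r - 1 := fun h => (hτ'lt h).2.2
  -- The remaining increase is even and at most two. If it is zero, nothing happens between the
  -- overlaps. If it is two, it exhausts the available increase, so there is no overlap at either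
  -- end.
  by_cases h0 : lowSlope c (line v r τ') r = topSlope c (line v r τ) r
  · refine ⟨.none, ?_, Or.inl ⟨τ, τ', ∅, hτ0, hττ', hτ'L, rfl, by simp, hset _ ?_, heven, heven',
      hτzero, hτpos, hτ'eq, hτ'lt, hne⟩⟩
    · by_cases h1 : (rightFace c v r).card = 1 <;>
        by_cases h2 : (rightFace c (line v r L) (-r)).card = 1
      · have := htop h1
        have := hlow h2
        refine none_mem_diagStatuses_of_eq (show lowSlope c (line v r L) r = topSlope c v r by omega) ?_
        have := rightFace_subset_of_jump hL (c := c) (p := v) (r := r)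
          (width_eq_zero_of_lowSlope_eq (by rw [line_zero]; omega))
        rwa [line_zero] at this
      · have := htop h1
        have := hlow' h2
        exact none_mem_diagStatuses_of_add_one
          (show lowSlope c (line v r L) r = topSlope c v r + 1 by omega) ⟨fun _ => h2, fun _ => h1⟩
      · have := htop' h1
        have := hlow h2
        exact none_mem_diagStatuses_of_add_one
          (show lowSlope c (line v r L) r = topSlope c v r + 1 by omega)
          ⟨fun h => absurd h h1, fun h => absurd h2 h⟩
      · have := htop' h1
        have := hlow' h2
        exact none_mem_diagStatuses_of_add_two
          (show lowSlope c (line v r L) r = topSlope c v r + 2 by omega) h1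
    · ext u
      simp only [mem_ofPred_eq, mem_empty_iff_false, iff_false, not_and]
      exact fun hu => notMem_curve_of_card_rightFace hτ1 h0 u hu
  · have htwo : lowSlope c (line v r τ') r = topSlope c (line v r τ) r + 2 := by
      obtain ⟨k, hk⟩ := heven
      obtain ⟨l, hl⟩ := heven'
      by_cases h1 : (rightFace c v r).card = 1 <;>
        by_cases h2 : (rightFace c (line v r L) (-r)).card = 1
      · have := htop h1; have := hlow h2; omega
      · have := htop h1; have := hlow' h2; omega
      · have := htop' h1; have := hlow h2; omega
      · have := htop' h1; have := hlow' h2; omega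
    have h1 : (rightFace c v r).card = 1 := by
      by_contra h1
      have := htop' h1
      by_cases h2 : (rightFace c (line v r L) (-r)).card = 1
      · have := hlow h2; omega
      · have := hlow' h2; omega
    have h2 : (rightFace c (line v r L) (-r)).card = 1 := by
      by_contra h2
      have := htop h1
      have := hlow' h2; omega
    have htop1 := htop h1
    have hlow1 := hlow h2
    obtain ⟨x, hx, F, hF, -, hFset, hfar, hface⟩ := exists_farShape hc isUnitDir_diag hττ' hτ1 htwo (by
      intro u hu huc
      obtain ⟨m, hm⟩ := notMem_curve_iff.1 huc
      rw [topSlope_of_singleton hm]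
      exact (hpar u ⟨hτ0.trans hu.1.le, hu.2.le.trans hτ'L⟩ m hm).sub heven)
    refine ⟨x, ?_, Or.inl ⟨τ, τ', F, hτ0, hττ', hτ'L, hfar, hF, hset _ hFset, heven, heven',
      hτzero, hτpos, hτ'eq, hτ'lt, hne⟩⟩
    obtain ⟨m, hm⟩ := Finset.card_eq_one.1 h1
    obtain ⟨m', hm'⟩ := Finset.card_eq_one.1 h2
    refine mem_diagStatuses_of_add_two
      (show lowSlope c (line v r L) r = topSlope c v r + 2 by omega) hm hm' hx fun hl => ?_
    -- The exponents before and after an isolated crossing are both dominant at it, so their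
    -- difference is primitive; `diagStatuses` uses this to exclude isolated crossings for
    -- non-primitive pairs.
    obtain ⟨α, hα, hα'⟩ := hface hl
    rw [hτzero h1, line_zero, hm] at hα
    rw [hτ'eq h2, hm'] at hα'
    refine isCoprime_of_mem_dualCell hc (hα (Finset.mem_singleton_self m))
      (hα' (Finset.mem_singleton_self m')) ?_
    rintro rfl
    have e1 : m ∈ rightFace c v r := by rw [hm]; exact Finset.mem_singleton_self m
    have e2 : m ∈ rightFace c (line v r L) (-r) := by rw [hm']; exact Finset.mem_singleton_self m
    have e3 := (mem_rightFace.1 e1).2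
    have e4 := (mem_rightFace.1 e2).2
    rw [slope_neg, topSlope_neg] at e4
    omega

/-! ### Movements that preserve the parity condition -/

theorem even_of_evenSlope {r : ℤ × ℤ} {e : ℤ} {m : Expo} (h : evenSlope r e m = true) :
    Even (slope r m + e) := Int.even_iff.2 (by simpa [evenSlope] using h)

theorem exists_nonpos_of_weights {k : ℤ × ℤ} (hk : k ∈ weights) {x y : ℝ}
    (h : k.1 * x + k.2 * y ≤ 0) : x ≤ 0 ∨ y ≤ 0 := by
  by_contra hcon
  push Not at hcon
  have h1 : 1 ≤ k.1 ∧ 0 ≤ k.2 := (show ∀ k ∈ weights, 1 ≤ k.1 ∧ 0 ≤ k.2 by decide) k hk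
  have h2 : (1 : ℝ) ≤ k.1 := by exact_mod_cast h1.1
  have h3 : (0 : ℝ) ≤ k.2 := by exact_mod_cast h1.2
  nlinarith [mul_nonneg h3 hcon.2.le]

/-- The exponent that keeps up with `m` may depend on `σ`. A combination of two competitors with
nonnegative weights, the first of them positive, which is nonpositive both for `u` and for `r` is
nonpositive at every `σ ≥ 0`, so one of the two competitors works there. -/
theorem stays_accompanied {p : Plane} {u r : ℤ × ℤ} {e : ℤ}
    (h : stays (cell c p) u r e = true) {m : Expo} (hm : m ∈ dualCell c p)
    (hbad : ¬ Even (slope r m + e)) {σ : ℝ} (hσ : 0 ≤ σ) : Accompanied c p u r m σ := by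
  simp only [stays, List.all_eq_true, Bool.or_eq_true, List.any_eq_true, Bool.and_eq_true,
    bne_iff_ne, decide_eq_true_eq] at h
  rcases h m (mem_cell.2 hm) with h | ⟨m', hm', hne, m'', hm'', hne', k, hk, h1, h2⟩
  · exact absurd (even_of_evenSlope h) hbad
  have h1' : ((k.1 * (slope u m - slope u m') + k.2 * (slope u m - slope u m'') : ℤ) : ℝ) ≤ 0 := by
    exact_mod_cast h1
  have h2' : ((k.1 * (slope r m - slope r m') + k.2 * (slope r m - slope r m'') : ℤ) : ℝ) ≤ 0 := by
    exact_mod_cast h2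
  have h3 := mul_nonpos_of_nonneg_of_nonpos hσ h2'
  push_cast at h1' h3
  rcases exists_nonpos_of_weights hk (x := (slope u m - slope u m' : ℤ) +
    σ * (slope r m - slope r m' : ℤ)) (y := (slope u m - slope u m'' : ℤ) +
    σ * (slope r m - slope r m'' : ℤ)) (by push_cast; linarith) with h | h
  · exact ⟨m', mem_cell.1 hm', hne, h⟩
  · exact ⟨m'', mem_cell.1 hm'', hne', h⟩

theorem staysAlong_accompanied {p : Plane} {u r : ℤ × ℤ} {e len : ℤ}
    (h : staysAlong (cell c p) u r e len = true) {m : Expo} (hm : m ∈ dualCell c p)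
    (hbad : ¬ Even (slope r m + e)) {σ : ℝ} (hσ : 0 ≤ σ) (hσ' : σ ≤ len) :
    Accompanied c p u r m σ := by
  simp only [staysAlong, List.all_eq_true, Bool.or_eq_true, List.any_eq_true, Bool.and_eq_true,
    bne_iff_ne, decide_eq_true_eq] at h
  rcases h m (mem_cell.2 hm) with h | ⟨m', hm', hne, m'', hm'', hne', k, hk, h1, h2⟩
  · exact absurd (even_of_evenSlope h) hbad
  have h1' : ((k.1 * (slope u m - slope u m') + k.2 * (slope u m - slope u m'') : ℤ) : ℝ) ≤ 0 := by
    exact_mod_cast h1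
  have h2' : ((k.1 * (slope u m - slope u m' + len * (slope r m - slope r m')) +
      k.2 * (slope u m - slope u m'' + len * (slope r m - slope r m'')) : ℤ) : ℝ) ≤ 0 := by
    exact_mod_cast h2
  push_cast at h1' h2'
  -- The expression is affine in `σ` and nonpositive at both ends 0 and `len` of the range, hence
  -- everywhere in between.
  have key : (k.1 : ℝ) * ((slope u m - slope u m' : ℤ) + σ * (slope r m - slope r m' : ℤ)) +
      k.2 * ((slope u m - slope u m'' : ℤ) + σ * (slope r m - slope r m'' : ℤ)) ≤ 0 := by
    push_cast
    rcases hσ.eq_or_lt with rfl | hpos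
    · linarith
    have hlen : (0 : ℝ) < len := hpos.trans_le hσ'
    have h3 := mul_nonpos_of_nonneg_of_nonpos (sub_nonneg.2 hσ') h1'
    have h4 := mul_nonpos_of_nonneg_of_nonpos hσ h2'
    refine nonpos_of_mul_nonpos_right (a := (len : ℝ)) ?_ hlen
    linarith
  rcases exists_nonpos_of_weights hk key with h | h
  · exact ⟨m', mem_cell.1 hm', hne, h⟩
  · exact ⟨m'', mem_cell.1 hm'', hne', h⟩

/-- Points of the moved arm as seen from a fixed point of the old arm. After rescaling by `t`, the
position along the arm becomes the free parameter `σ` of `Accompanied`. -/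
theorem line_add_smul (v : Plane) (u r : ℤ × ℤ) {t : ℝ} (ht : t ≠ 0) (s s₀ : ℝ) :
    line (v + t • toPlane u) r s = line v r s₀ + t • (toPlane u + ((s - s₀) / t) • toPlane r) := by
  have : t * ((s - s₀) / t) = s - s₀ := by field_simp
  rw [smul_add, smul_smul, this]
  simp only [line]
  module

/-- The parity condition along a leg persists if the exponents violating it are accompanied by
others. -/
theorem eventually_even_leg {v : Plane} {r u : ℤ × ℤ} {e : ℤ}
    (h : ∀ m, ¬ Even (slope r m + e) → ∀ s, 0 ≤ s → m ∈ dualCell c (line v r s) →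
      ∃ s₀ ≥ 0, m ∈ dualCell c (line v r s₀) ∧
        ∀ σ : ℝ, (s₀ = 0 → 0 ≤ σ) → Accompanied c (line v r s₀) u r m σ) :
    ∀ᶠ t in 𝓝[>] (0 : ℝ), ∀ s, 0 ≤ s → ∀ m, dualCell c (line (v + t • toPlane u) r s) = {m} →
      Even (slope r m + e) := by
  suffices hm : ∀ m, ¬ Even (slope r m + e) → ∀ᶠ t in 𝓝[>] (0 : ℝ), ∀ s, 0 ≤ s →
      dualCell c (line (v + t • toPlane u) r s) ≠ {m} by
    have : ∀ m, ∀ᶠ t in 𝓝[>] (0 : ℝ), ¬ Even (slope r m + e) → ∀ s, 0 ≤ s →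
        dualCell c (line (v + t • toPlane u) r s) ≠ {m} := fun m => by
      by_cases he : Even (slope r m + e)
      · exact Eventually.of_forall fun t h => absurd he h
      · filter_upwards [hm m he] with t ht _ using ht
    filter_upwards [eventually_all.2 this] with t ht s hs m hd
    by_contra he
    exact ht m he s hs hd
  intro m hbad
  by_cases hocc : ∃ s, 0 ≤ s ∧ m ∈ dualCell c (line v r s)
  · obtain ⟨s, hs, hms⟩ := hocc
    obtain ⟨s₀, hs₀, hm, hacc⟩ := h m hbad s hs hms
    filter_upwards [self_mem_nhdsWithin] with t (ht : 0 < t) x hx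
    obtain ⟨m', hm', hne, hle⟩ := hacc ((x - s₀) / t) fun h0 => by
      rw [h0, sub_zero]; exact div_nonneg hx ht.le
    rw [line_add_smul v u r ht.ne' x s₀]
    exact dualCell_ne_singleton hm hm' hne ht.le hle
  · push Not at hocc
    -- An exponent absent from the old leg remains absent up to time `T` by compactness. Beyond `T`
    -- an exponent of maximal slope is ahead of it at time `T` and stays ahead.
    obtain ⟨T, hT, htail⟩ := exists_tail c v r
    obtain ⟨n, hn, hns⟩ := exists_slope_eq_topSlope c (line v r T) r
    rw [(htail T le_rfl).2.1] at hns
    have hsl : slope r m ≤ slope r n := by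
      rw [hns]; exact Finset.le_sup' (slope r) (Finset.mem_univ m)
    have hlt : monomial c m (line v r T) < monomial c n (line v r T) := by
      refine lt_of_le_of_ne (mem_dualCell.1 hn m) fun heq => ?_
      exact hocc T hT.le (mem_dualCell_of_eq hn heq.symm)
    have hcont : Continuous fun x : ℝ × ℝ => line (v + x.1 • toPlane u) r x.2 := by
      unfold line; fun_prop
    have h1 := eventually_notMem_dualCell hcont (isCompact_Icc (a := (0 : ℝ)) (b := T))
      (m := m) (c := c) fun s hs => by simpa using hocc s hs.1
    have h2 : ∀ᶠ t in 𝓝 (0 : ℝ), monomial c m (line (v + t • toPlane u) r T) <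
        monomial c n (line (v + t • toPlane u) r T) := by
      have hc1 : Continuous fun t : ℝ => line (v + t • toPlane u) r T := by unfold line; fun_prop
      exact ((isOpen_lt (continuous_monomial c m) (continuous_monomial c n)).preimage hc1).mem_nhds
        (by simpa using hlt)
    filter_upwards [nhdsWithin_le_nhds h1, nhdsWithin_le_nhds h2] with t ht1 ht2 s hs hd
    have hmem : m ∈ dualCell c (line (v + t • toPlane u) r s) := by
      rw [hd]; exact Finset.mem_singleton_self m
    rcases le_or_gt s T with hsT | hsT
    · exact ht1 s ⟨hs, hsT⟩ hmem
    · refine notMem_dualCell_of_lt (m' := n) ?_ hmem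
      have e : ∀ k, monomial c k (line (v + t • toPlane u) r s) =
          monomial c k (line (v + t • toPlane u) r T) + (s - T) * slope r k := fun k => by
        rw [monomial_line, monomial_line]; ring
      rw [e, e]
      have : ((slope r m : ℤ) : ℝ) ≤ slope r n := by exact_mod_cast hsl
      have := mul_le_mul_of_nonneg_left this (sub_pos.2 hsT).le
      linarith

/-- The parity condition along the edge persists if the exponents violating it are accompanied by
others. -/
theorem eventually_even_diag {v : Plane} {r u : ℤ × ℤ} {e l : ℤ} {L : ℝ}
    (hL : 0 ≤ L) (h : ∀ m, ¬ Even (slope r m + e) → ∀ s ∈ Icc 0 L, m ∈ dualCell c (line v r s) →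
      ∃ s₀, m ∈ dualCell c (line v r s₀) ∧
        ∀ σ : ℝ, (s₀ = 0 → 0 ≤ σ) → (s₀ = L → σ ≤ l) → Accompanied c (line v r s₀) u r m σ) :
    ∀ᶠ t in 𝓝[>] (0 : ℝ), ∀ s ∈ Icc 0 (L + t * l), ∀ m,
      dualCell c (line (v + t • toPlane u) r s) = {m} → Even (slope r m + e) := by
  suffices hm : ∀ m, ¬ Even (slope r m + e) → ∀ᶠ t in 𝓝[>] (0 : ℝ), ∀ s ∈ Icc 0 (L + t * l),
      dualCell c (line (v + t • toPlane u) r s) ≠ {m} by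
    have : ∀ m, ∀ᶠ t in 𝓝[>] (0 : ℝ), ¬ Even (slope r m + e) → ∀ s ∈ Icc 0 (L + t * l),
        dualCell c (line (v + t • toPlane u) r s) ≠ {m} := fun m => by
      by_cases he : Even (slope r m + e)
      · exact Eventually.of_forall fun t h => absurd he h
      · filter_upwards [hm m he] with t ht _ using ht
    filter_upwards [eventually_all.2 this] with t ht s hs m hd
    by_contra he
    exact ht m he s hs hd
  intro m hbad
  by_cases hocc : ∃ s ∈ Icc 0 L, m ∈ dualCell c (line v r s)
  · obtain ⟨s, hs, hms⟩ := hocc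
    obtain ⟨s₀, hm, hacc⟩ := h m hbad s hs hms
    filter_upwards [self_mem_nhdsWithin] with t (ht : 0 < t) x hx
    obtain ⟨m', hm', hne, hle⟩ := hacc ((x - s₀) / t) (fun h0 => by
      rw [h0, sub_zero]; exact div_nonneg hx.1 ht.le) (fun h0 => by
      rw [h0, div_le_iff₀ ht]; linarith [hx.2, mul_comm t (l : ℝ)])
    rw [line_add_smul v u r ht.ne' x s₀]
    exact dualCell_ne_singleton hm hm' hne ht.le hle
  · push Not at hocc
    -- The edge changes its length, so it is parametrised by the unit interval to have a fixed
    -- compact set.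
    have hcont : Continuous fun x : ℝ × ℝ => line (v + x.1 • toPlane u) r (x.2 * (L + x.1 * l)) := by
      unfold line; fun_prop
    have h1 := eventually_notMem_dualCell hcont (isCompact_Icc (a := (0 : ℝ)) (b := 1))
      (m := m) (c := c) fun s hs => by
        have := hocc (s * L) ⟨mul_nonneg hs.1 hL, mul_le_of_le_one_left hL hs.2⟩
        simpa using this
    filter_upwards [nhdsWithin_le_nhds h1] with t ht1 s hs hd
    have hmem : m ∈ dualCell c (line (v + t • toPlane u) r s) := by
      rw [hd]; exact Finset.mem_singleton_self m
    rcases (hs.1.trans hs.2).eq_or_lt with h0 | h0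
    · have hs0 : s = 0 := le_antisymm (hs.2.trans_eq h0.symm) hs.1
      have := ht1 0 ⟨le_rfl, zero_le_one⟩
      simp only [zero_mul] at this
      exact this (hs0 ▸ hmem)
    · have := ht1 (s / (L + t * l)) ⟨div_nonneg hs.1 h0.le, (div_le_one h0).2 hs.2⟩
      simp only [div_mul_cancel₀ _ h0.ne'] at this
      exact this hmem

/-- The intersection of the curve with a leg is of the given type. -/
def LegHas (c : Expo → ℝ) (v : Plane) (r : ℤ × ℤ) (s : Status) : Prop :=
  (∃ τ F, LegShape c v r s τ F) ∨ (s = .none ∧ IsRay c v r)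

/-- The intersection of the curve with the edge is of the given type. -/
def DiagHas (c : Expo → ℝ) (v : Plane) (L : ℝ) (s : Status) : Prop :=
  (∃ τ τ' F, DiagShape c v L s τ τ' F) ∨ (s = .none ∧ IsBridge c v L)

theorem Status.allows_zero (s : Status) : s.allows 0 = true := by cases s <;> rfl

/-- An exponent of the wrong parity that occurs on the leg is either dominant at the vertex, where
`stays` applies, or first met at a point of the curve beyond it. On the initial overlap only the
slope at the vertex and the next one, of the right parity, occur; so the exponent belongs to the
crossing and has the intermediate slope. -/
theorem LegHas.accompanied {v : Plane} {r u : ℤ × ℤ} {s : Status}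
    (hr : IsUnitDir r) (h : LegHas c v r s)
    (hpar : ∀ t, 0 ≤ t → ∀ m, dualCell c (line v r t) = {m} → Even (slope r m + endSlope r))
    (hallow : legAllows (cell c v) r s u = true) (hst : stays (cell c v) u r (endSlope r) = true) :
    ∀ m, ¬ Even (slope r m + endSlope r) → ∀ x, 0 ≤ x → m ∈ dualCell c (line v r x) →
      ∃ x₀ ≥ 0, m ∈ dualCell c (line v r x₀) ∧
        ∀ σ : ℝ, (x₀ = 0 → 0 ≤ σ) → Accompanied c (line v r x₀) u r m σ := by
  intro m hbad x hx hm
  by_cases hmv : m ∈ dualCell c v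
  · refine ⟨0, le_rfl, by rwa [line_zero], fun σ hσ => ?_⟩
    rw [line_zero]
    exact stays_accompanied hst hmv hbad (hσ rfl)
  have hx0 : 0 < x := by
    rcases hx.eq_or_lt with rfl | h
    · rw [line_zero] at hm; exact absurd hm hmv
    · exact h
  have hge : topSlope c v r ≤ slope r m := by
    have := topSlope_le_lowSlope c v r hx0
    rw [line_zero] at this
    exact this.trans (lowSlope_le_slope hm r)
  have hxc : line v r x ∈ curve c := by
    by_contra hcon
    obtain ⟨n, hn⟩ := notMem_curve_iff.1 hcon
    rw [hn, Finset.mem_singleton] at hm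
    subst hm
    exact hbad (hpar x hx m hn)
  have hne : slope r m ≠ topSlope c v r := fun h => hmv (mem_dualCell_of_slope_eq hm h)
  rcases h with ⟨τ, F, hF⟩ | ⟨-, hray⟩
  · have hmem : x ∈ Ioc 0 τ ∪ F := by rw [← hF.set_eq]; exact ⟨hx0, hxc⟩
    have hgood : slope r m ≠ topSlope c (line v r τ) r := fun h => hbad (h ▸ hF.even)
    rcases hmem with hmem | hmem
    · exfalso
      have hcard : (rightFace c v r).card ≠ 1 := fun h => by
        have := hF.eq_zero h
        exact absurd (hmem.1.trans_le hmem.2) (by rw [this]; exact lt_irrefl 0)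
      have h1 := (hF.pos hcard).2.2.1
      have h2 : slope r m ≤ topSlope c (line v r τ) r := by
        rcases hmem.2.eq_or_lt with rfl | hlt
        · exact slope_le_topSlope hm r
        · have := topSlope_le_lowSlope c v r hlt
          have := lowSlope_le_topSlope c (line v r τ) r
          have := slope_le_topSlope hm r
          omega
      omega
    · have h1 := topSlope_le_lowSlope c v r (hF.far_subset hmem)
      have h2 := lowSlope_le_slope hm r
      have h3 := hF.far.slope_le hmem
      have h4 := slope_le_topSlope hm r
      have hslope : slope r m = topSlope c (line v r τ) r + 1 := by
        obtain ⟨k, hk⟩ := hF.even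
        have : slope r m ≠ topSlope c (line v r τ) r + 2 := fun h => hbad ⟨k + 1, by omega⟩
        omega
      have hall : s.allows (cross r u) = true := by
        unfold legAllows at hallow
        split_ifs at hallow with h0
        · exact hallow
        · rw [beq_iff_eq.1 hallow]; exact s.allows_zero
      refine ⟨x, hx, hm, fun σ _ => hF.far.accompanied hr hall hslope hmem hm σ⟩
  · exfalso
    have : slope r m ≤ endSlope r := Finset.le_sup' (slope r) (Finset.mem_univ m)
    exact hne (by rw [hray.top] at hge ⊢; omega)

theorem LegHas.eventually {v : Plane} {r u : ℤ × ℤ} {s : Status}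
    (hr : IsUnitDir r) (h : LegHas c v r s)
    (hpar : ∀ t, 0 ≤ t → ∀ m, dualCell c (line v r t) = {m} → Even (slope r m + endSlope r))
    (hallow : legAllows (cell c v) r s u = true) (hst : stays (cell c v) u r (endSlope r) = true) :
    ∀ᶠ t in 𝓝[>] (0 : ℝ), ∀ x, 0 ≤ x → ∀ m, dualCell c (line (v + t • toPlane u) r x) = {m} →
      Even (slope r m + endSlope r) :=
  eventually_even_leg (h.accompanied hr hpar hallow hst)

/-- The same point seen from the other end of the edge: the direction is reversed, and the position
`σ` becomes `l - σ` relative to the movement of that end. -/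
theorem accompanied_of_neg {p : Plane} {u u' r : ℤ × ℤ} {l : ℤ}
    (hu : u' = u + l • r) {m : Expo} {σ : ℝ} (h : Accompanied c p u' (-r) m (l - σ)) :
    Accompanied c p u r m σ := by
  obtain ⟨m', hm', hne, hle⟩ := h
  refine ⟨m', hm', hne, le_trans (le_of_eq ?_) hle⟩
  have : ∀ n, slope u' n = slope u n + l * slope r n := fun n => by
    rw [hu]; simp only [slope, Prod.fst_add, Prod.snd_add, Prod.smul_fst, Prod.smul_snd,
      smul_eq_mul]; ring
  simp only [this, slope_neg]
  push_cast
  ring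

/-- As for legs, with a criterion at each of the two ends. The bounds on `σ` at the ends express
that the moved edge stops at its moved vertices. -/
theorem DiagHas.accompanied {v : Plane} {L : ℝ} {s : Status} (hL : 0 < L)
    (h : DiagHas c v L s)
    (hpar : ∀ t ∈ Icc 0 L, ∀ m, dualCell c (line v (1, 1) t) = {m} → Even (slope (1, 1) m))
    {u u' : ℤ × ℤ} {l : ℤ} (hu : u' = u + l • (1, 1)) (hallow : s.allows (cross (1, 1) u) = true)
    (hst : stays (cell c v) u (1, 1) 0 = true)
    (hst' : stays (cell c (line v (1, 1) L)) u' (-1, -1) 0 = true) :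
    ∀ m, ¬ Even (slope (1, 1) m + 0) → ∀ x ∈ Icc 0 L, m ∈ dualCell c (line v (1, 1) x) →
      ∃ x₀, m ∈ dualCell c (line v (1, 1) x₀) ∧
        ∀ σ : ℝ, (x₀ = 0 → 0 ≤ σ) → (x₀ = L → σ ≤ l) →
          Accompanied c (line v (1, 1) x₀) u (1, 1) m σ := by
  intro m hbad x hx hm
  by_cases hmv : m ∈ dualCell c v
  · refine ⟨0, by rwa [line_zero], fun σ hσ _ => ?_⟩
    rw [line_zero]
    exact stays_accompanied hst hmv hbad (hσ rfl)
  by_cases hmv' : m ∈ dualCell c (line v (1, 1) L)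
  · refine ⟨L, hmv', fun σ _ hσ => accompanied_of_neg hu ?_⟩
    refine stays_accompanied hst' hmv' (fun hev => hbad ?_) (sub_nonneg.2 (hσ rfl))
    rw [add_zero] at hev ⊢
    have := slope_neg (1, 1) m
    rw [← even_neg, ← this]; exact hev
  rw [add_zero] at hbad
  have hx0 : 0 < x := by
    rcases hx.1.eq_or_lt with rfl | h
    · rw [line_zero] at hm; exact absurd hm hmv
    · exact h
  have hxL : x < L := by
    rcases hx.2.eq_or_lt with rfl | h
    · exact absurd hm hmv'
    · exact h
  have hge : topSlope c v (1, 1) ≤ slope (1, 1) m := by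
    have := topSlope_le_lowSlope c v (1, 1) hx0
    rw [line_zero] at this
    exact this.trans (lowSlope_le_slope hm _)
  have hle : slope (1, 1) m ≤ lowSlope c (line v (1, 1) L) (1, 1) :=
    (slope_le_topSlope hm _).trans (topSlope_le_lowSlope c v (1, 1) hxL)
  have hxc : line v (1, 1) x ∈ curve c := by
    by_contra hcon
    obtain ⟨n, hn⟩ := notMem_curve_iff.1 hcon
    rw [hn, Finset.mem_singleton] at hm
    subst hm
    exact hbad (hpar x hx m hn)
  have hne : slope (1, 1) m ≠ topSlope c v (1, 1) := fun h => hmv (mem_dualCell_of_slope_eq hm h)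
  have hne' : slope (1, 1) m ≠ lowSlope c (line v (1, 1) L) (1, 1) := fun h => by
    refine hmv' (mem_dualCell_of_slope_eq (p := line v (1, 1) L) (r := -(1, 1)) (s := L - x) ?_ ?_)
    · rwa [line_neg, line_line, show L + -(L - x) = x by ring]
    · rw [slope_neg, topSlope_neg, h]
  rcases h with ⟨τ, τ', F, hF⟩ | ⟨-, hbr⟩
  · have hmem : x ∈ Ioc 0 τ ∪ F ∪ Ico τ' L := by rw [← hF.set_eq]; exact ⟨⟨hx0, hxL⟩, hxc⟩
    have hgood : slope (1, 1) m ≠ topSlope c (line v (1, 1) τ) (1, 1) := fun h => hbad (h ▸ hF.even)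
    have hgood' : slope (1, 1) m ≠ lowSlope c (line v (1, 1) τ') (1, 1) :=
      fun h => hbad (h ▸ hF.even')
    rcases hmem with (hmem | hmem) | hmem
    · exfalso
      have hcard : (rightFace c v (1, 1)).card ≠ 1 := fun h => by
        have := hF.eq_zero h
        exact absurd (hmem.1.trans_le hmem.2) (by rw [this]; exact lt_irrefl 0)
      have h1 := (hF.pos hcard).2.2
      have h2 : slope (1, 1) m ≤ topSlope c (line v (1, 1) τ) (1, 1) := by
        rcases hmem.2.eq_or_lt with rfl | hlt
        · exact slope_le_topSlope hm _
        · have := topSlope_le_lowSlope c v (1, 1) hlt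
          have := lowSlope_le_topSlope c (line v (1, 1) τ) (1, 1)
          have := slope_le_topSlope hm (1, 1)
          omega
      omega
    · have h1 := topSlope_le_lowSlope c v (1, 1) (hF.far_subset hmem).1
      have h2 := lowSlope_le_slope hm (1, 1)
      have h3 := hF.far.slope_le hmem
      have h4 := slope_le_topSlope hm (1, 1)
      have hslope : slope (1, 1) m = topSlope c (line v (1, 1) τ) (1, 1) + 1 := by
        obtain ⟨k, hk⟩ := hF.even
        have : slope (1, 1) m ≠ topSlope c (line v (1, 1) τ) (1, 1) + 2 :=
          fun h => hbad ⟨k + 1, by omega⟩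
        omega
      exact ⟨x, hm, fun σ _ _ => hF.far.accompanied isUnitDir_diag hallow hslope hmem hm σ⟩
    · exfalso
      have hcard : (rightFace c (line v (1, 1) L) (-1, -1)).card ≠ 1 := fun h => by
        have := hF.eq_length h
        exact absurd (hmem.1.trans_lt hmem.2) (by rw [this]; exact lt_irrefl _)
      have h1 := (hF.lt_length hcard).2.2
      have h2 : lowSlope c (line v (1, 1) τ') (1, 1) ≤ slope (1, 1) m := by
        rcases hmem.1.eq_or_lt with rfl | hlt
        · exact lowSlope_le_slope hm _
        · have := topSlope_le_lowSlope c v (1, 1) hlt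
          have := lowSlope_le_topSlope c (line v (1, 1) τ') (1, 1)
          have := lowSlope_le_slope hm (1, 1)
          omega
      omega
  · exfalso
    have := hbr.slope_eq
    omega

/-! ### The unbounded part in terms of lists -/

theorem unbounded_cell {p : Plane} (m x x' y y' y'' : Expo) : (cell c p == [m] ||
      ((cell c p).contains x && (cell c p).contains x' &&
        !((cell c p).contains y || (cell c p).contains y' || (cell c p).contains y''))) = true ↔
    dualCell c p = {m} ∨ ({x, x'} ⊆ dualCell c p ∧ Disjoint (dualCell c p) {y, y', y''}) := by
  have h : cell c p = [m] ↔ dualCell c p = {m} := by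
    rw [← toList_singleton]; exact toList_injective.eq_iff
  simp only [Bool.or_eq_true, beq_iff_eq, h, Bool.and_eq_true,
    mem_cell, Bool.not_eq_true', Bool.or_eq_false_iff, List.contains_eq_mem, decide_eq_false_iff_not,
    Finset.insert_subset_iff, Finset.singleton_subset_iff, Finset.disjoint_insert_right,
    Finset.disjoint_singleton_right, and_assoc, decide_eq_true_eq]

theorem inUnboundedPart_iff_pos (hl : 0 < q.2) : InUnboundedPart c q ↔
    unboundedLower (cell c (vertex q 0)) = true ∨ unboundedUpper (cell c (vertex q 1)) = true := by
  rw [unboundedLower, unboundedUpper, unbounded_cell, unbounded_cell]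
  simp only [InUnboundedPart, hl, hl.not_gt, true_and, false_and, false_or]
  tauto

theorem inUnboundedPart_iff_neg (hl : q.2 < 0) : InUnboundedPart c q ↔
    unboundedLowerNeg (cell c (vertex q 0)) = true ∨
      unboundedUpperNeg (cell c (vertex q 1)) = true := by
  rw [unboundedLowerNeg, unboundedUpperNeg, unbounded_cell, unbounded_cell]
  simp only [InUnboundedPart, hl, hl.not_gt, true_and, false_and, false_or]
  tauto

/-! ### Symmetries -/

/-- The action of a symmetry on integer vectors. -/
def Sym.onDir (g : Sym) (r : ℤ × ℤ) : ℤ × ℤ :=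
  let r := if g.swap then r.swap else r
  (if g.flipX then -r.1 else r.1, if g.flipY then -r.2 else r.2)

/-- The image of the origin under the action on the square. -/
def Sym.origin (g : Sym) : ℤ × ℤ := (if g.flipX then 3 else 0, if g.flipY then 3 else 0)

theorem Sym.toPlane_onDir (g : Sym) (r : ℤ × ℤ) : toPlane (g.onDir r) = g.onPlane (toPlane r) := by
  obtain ⟨a, b, d⟩ := g
  cases a <;> cases b <;> cases d <;> simp [Sym.onDir, Sym.onPlane, toPlane]

theorem Sym.toInt_onExpo (g : Sym) (m : Expo) :
    (g.onExpo m).toInt = g.onDir m.toInt + g.origin := by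
  obtain ⟨a, b, d⟩ := g
  revert a b d m
  decide

theorem Sym.onExpo_injective (g : Sym) : Function.Injective g.onExpo := by
  obtain ⟨a, b, d⟩ := g
  revert a b d
  decide

theorem Sym.onExpo_surjective (g : Sym) : Function.Surjective g.onExpo :=
  Finite.surjective_of_injective g.onExpo_injective

theorem Sym.onPlane_add_smul (g : Sym) (p v : Plane) (t : ℝ) :
    g.onPlane (p + t • v) = g.onPlane p + t • g.onPlane v := by
  obtain ⟨a, b, d⟩ := g
  cases a <;> cases b <;> cases d <;> ext <;>
    simp [Sym.onPlane] <;> ring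

theorem Sym.continuous_onPlane (g : Sym) : Continuous g.onPlane := by
  obtain ⟨a, b, d⟩ := g
  unfold Sym.onPlane
  cases a <;> cases b <;> cases d <;>
    simp only [Bool.false_eq_true, if_true, if_false, Prod.fst_swap, Prod.snd_swap] <;> fun_prop

/-- The action on the plane as a homeomorphism. -/
def Sym.homeo (g : Sym) : Plane ≃ₜ Plane where
  toFun := g.onPlane
  invFun p :=
    let r : Plane := (if g.flipX then -p.1 else p.1, if g.flipY then -p.2 else p.2)
    if g.swap then r.swap else r
  left_inv p := by
    obtain ⟨a, b, d⟩ := g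
    cases a <;> cases b <;> cases d <;> simp [Sym.onPlane]
  right_inv p := by
    obtain ⟨a, b, d⟩ := g
    cases a <;> cases b <;> cases d <;> simp [Sym.onPlane]
  continuous_toFun := g.continuous_onPlane
  continuous_invFun := by
    obtain ⟨a, b, d⟩ := g
    cases a <;> cases b <;> cases d <;>
      simp only [Bool.false_eq_true, if_true, if_false, Prod.swap_prod_mk] <;> fun_prop

theorem Sym.onPlane_injective (g : Sym) : Function.Injective g.onPlane := g.homeo.injective

theorem slope_onExpo (g : Sym) (r : ℤ × ℤ) (m : Expo) :
    slope (g.onDir r) (g.onExpo m) = slope r m +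
      (g.origin.1 * (g.onDir r).1 + g.origin.2 * (g.onDir r).2) := by
  unfold slope
  rw [g.toInt_onExpo]
  obtain ⟨a, b, d⟩ := g
  cases a <;> cases b <;> cases d <;> simp [Sym.onDir, Sym.origin] <;> ring

theorem monomial_onExpo {g : Sym} {c c' : Expo → ℝ} (hc : ∀ m, c' (g.onExpo m) = c m) (m : Expo)
    (p : Plane) : monomial c' (g.onExpo m) (g.onPlane p) = monomial c m p +
      (g.origin.1 * (g.onPlane p).1 + g.origin.2 * (g.onPlane p).2) := by
  have h := g.toInt_onExpo m
  have e : ∀ (c : Expo → ℝ) m p, monomial c m p =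
      c m + (m.toInt.1 : ℝ) * p.1 + (m.toInt.2 : ℝ) * p.2 := fun c m p => by
    simp [monomial, Expo.toInt]
  rw [e, e, h, hc]
  obtain ⟨a, b, d⟩ := g
  cases a <;> cases b <;> cases d <;> simp [Sym.onDir, Sym.origin, Sym.onPlane] <;> ring

theorem mem_dualCell_onExpo {g : Sym} {c c' : Expo → ℝ} (hc : ∀ m, c' (g.onExpo m) = c m) {m : Expo}
    {p : Plane} : g.onExpo m ∈ dualCell c' (g.onPlane p) ↔ m ∈ dualCell c p := by
  rw [mem_dualCell, mem_dualCell]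
  constructor
  · intro h n
    have := h (g.onExpo n)
    rw [monomial_onExpo hc, monomial_onExpo hc] at this
    linarith
  · intro h n
    obtain ⟨n, rfl⟩ := g.onExpo_surjective n
    rw [monomial_onExpo hc, monomial_onExpo hc]
    linarith [h n]

theorem dualCell_onPlane {g : Sym} {c c' : Expo → ℝ} (hc : ∀ m, c' (g.onExpo m) = c m) (p : Plane) :
    dualCell c' (g.onPlane p) = (dualCell c p).map ⟨g.onExpo, g.onExpo_injective⟩ := by
  ext n
  obtain ⟨m, rfl⟩ := g.onExpo_surjective n
  rw [mem_dualCell_onExpo hc]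
  exact (Finset.mem_map' ⟨g.onExpo, g.onExpo_injective⟩).symm

theorem card_dualCell_onPlane {g : Sym} {c c' : Expo → ℝ} (hc : ∀ m, c' (g.onExpo m) = c m)
    (p : Plane) : (dualCell c' (g.onPlane p)).card = (dualCell c p).card := by
  rw [dualCell_onPlane hc, Finset.card_map]

theorem mem_curve_onPlane {g : Sym} {c c' : Expo → ℝ} (hc : ∀ m, c' (g.onExpo m) = c m)
    {p : Plane} : g.onPlane p ∈ curve c' ↔ p ∈ curve c := by
  simp only [curve, mem_ofPred_eq, card_dualCell_onPlane hc]

theorem topSlope_onPlane {g : Sym} {c c' : Expo → ℝ} (hc : ∀ m, c' (g.onExpo m) = c m) (p : Plane)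
    (r : ℤ × ℤ) : topSlope c' (g.onPlane p) (g.onDir r) = topSlope c p r +
      (g.origin.1 * (g.onDir r).1 + g.origin.2 * (g.onDir r).2) := by
  obtain ⟨m, hm, h⟩ := exists_slope_eq_topSlope c p r
  obtain ⟨n, hn, h'⟩ := exists_slope_eq_topSlope c' (g.onPlane p) (g.onDir r)
  obtain ⟨n, rfl⟩ := g.onExpo_surjective n
  have h1 := slope_le_topSlope ((mem_dualCell_onExpo hc).1 hn) r
  have h2 := slope_le_topSlope ((mem_dualCell_onExpo hc).2 hm) (g.onDir r)
  rw [slope_onExpo] at h' h2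
  omega

theorem IsSmooth.onPlane {g : Sym} {c c' : Expo → ℝ} (hc : ∀ m, c' (g.onExpo m) = c m)
    (h : IsSmooth c) : IsSmooth c' := by
  intro p
  obtain ⟨p, rfl⟩ := g.homeo.surjective p
  change (dualCell c' (g.onPlane p)).card ≤ 3 ∧ ∀ m ∈ dualCell c' (g.onPlane p),
    ∀ m' ∈ dualCell c' (g.onPlane p), ∀ m'' ∈ dualCell c' (g.onPlane p), _
  refine ⟨by rw [card_dualCell_onPlane hc]; exact (h p).1, ?_⟩
  intro m hm m' hm' m'' hm'' h1 h2 h3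
  obtain ⟨m, rfl⟩ := g.onExpo_surjective m
  obtain ⟨m', rfl⟩ := g.onExpo_surjective m'
  obtain ⟨m'', rfl⟩ := g.onExpo_surjective m''
  rw [mem_dualCell_onExpo hc] at hm hm' hm''
  have := (h p).2 m hm m' hm' m'' hm'' (fun e => h1 (e ▸ rfl)) (fun e => h2 (e ▸ rfl))
    (fun e => h3 (e ▸ rfl))
  simp only [g.toInt_onExpo]
  generalize m.toInt = x at *
  generalize m'.toInt = y at *
  generalize m''.toInt = z at *
  rw [← this]
  obtain ⟨a, b, d⟩ := g
  cases a <;> cases b <;> cases d <;> simp [Sym.onDir, Sym.origin] <;>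
    first
    | (congr 1; ring1)
    | (rw [← abs_neg]; congr 1; ring)

/-- The pair `(c', q')` is the image of `(c, q)` under a symmetry. -/
structure Sym.Maps (g : Sym) (c c' : Expo → ℝ) (q q' : Param) : Prop where
  coeff : ∀ m, c' (g.onExpo m) = c m
  lam_eq : lam q' = g.onPlane '' lam q
  balanced : ∀ p ∈ lam q, ∑ r ∈ outDirs q p, r = 0

section Maps

variable {g : Sym} {c c' : Expo → ℝ} {q q' : Param}

theorem Sym.onDir_mem_directions (g : Sym) {r : ℤ × ℤ} : g.onDir r ∈ directions ↔ r ∈ directions := by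
  have h : ∀ r ∈ directions, ∀ a b d, (Sym.mk a b d).onDir r ∈ directions := by decide
  refine ⟨fun hr => ?_, fun hr => h r hr g.swap g.flipX g.flipY⟩
  -- The inverse symmetry: moving the reflections past the swap exchanges them.
  have h1 := h _ hr g.swap (if g.swap then g.flipY else g.flipX) (if g.swap then g.flipX else g.flipY)
  have e : (Sym.mk g.swap (if g.swap then g.flipY else g.flipX)
      (if g.swap then g.flipX else g.flipY)).onDir (g.onDir r) = r := by
    obtain ⟨a, b, d⟩ := g
    cases a <;> cases b <;> cases d <;> simp [Sym.onDir]
  rwa [e] at h1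

theorem Sym.onDir_injective (g : Sym) : Function.Injective g.onDir := by
  intro r s h
  obtain ⟨a, b, d⟩ := g
  cases a <;> cases b <;> cases d <;> simp [Sym.onDir] at h <;> ext <;> simp_all

theorem Sym.Maps.onPlane_mem (h : g.Maps c c' q q') {p : Plane} :
    g.onPlane p ∈ lam q' ↔ p ∈ lam q := by
  rw [h.lam_eq, g.onPlane_injective.mem_set_image]

theorem Sym.Maps.outDirs_eq (h : g.Maps c c' q q') (p : Plane) :
    outDirs q' (g.onPlane p) = (outDirs q p).map ⟨g.onDir, g.onDir_injective⟩ := by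
  classical
  have key : ∀ r, g.onDir r ∈ outDirs q' (g.onPlane p) ↔ r ∈ outDirs q p := by
    intro r
    simp only [outDirs, Finset.mem_filter, g.onDir_mem_directions]
    have : ∀ t : ℝ, g.onPlane p + t • toPlane (g.onDir r) ∈ lam q' ↔ p + t • toPlane r ∈ lam q := by
      intro t
      rw [g.toPlane_onDir, ← g.onPlane_add_smul, h.onPlane_mem]
    simp only [this]
  ext r
  have hr : ∃ s, g.onDir s = r := by
    refine ⟨(Sym.mk g.swap (if g.swap then g.flipY else g.flipX)
      (if g.swap then g.flipX else g.flipY)).onDir r, ?_⟩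
    obtain ⟨a, b, d⟩ := g
    cases a <;> cases b <;> cases d <;> simp [Sym.onDir]
  obtain ⟨s, rfl⟩ := hr
  rw [key]
  exact (Finset.mem_map' ⟨g.onDir, g.onDir_injective⟩).symm

theorem Sym.sum_onDir (g : Sym) (S : Finset (ℤ × ℤ)) : ∑ r ∈ S, g.onDir r = g.onDir (∑ r ∈ S, r) := by
  obtain ⟨a, b, d⟩ := g
  cases a <;> cases b <;> cases d <;> ext <;>
    simp [Sym.onDir, Prod.fst_sum, Prod.snd_sum]

theorem Sym.Maps.balanced' (h : g.Maps c c' q q') : ∀ p ∈ lam q', ∑ r ∈ outDirs q' p, r = 0 := by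
  intro p hp
  rw [h.lam_eq] at hp
  obtain ⟨p, hp, rfl⟩ := hp
  rw [h.outDirs_eq, Finset.sum_map]
  change ∑ r ∈ outDirs q p, g.onDir r = 0
  rw [g.sum_onDir, h.balanced p hp]
  obtain ⟨a, b, d⟩ := g
  cases a <;> cases b <;> cases d <;> rfl

/-- The action on the square is affine, so it changes the tropical polynomial by a linear form. The
contribution of this form to the multiplicity vanishes because the outgoing directions add up to
zero. -/
theorem Sym.Maps.multAt_eq (h : g.Maps c c' q q') {p : Plane} (hp : p ∈ lam q) :
    multAt c' q' (g.onPlane p) = multAt c q p := by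
  rw [TropTritangent.multAt_eq, TropTritangent.multAt_eq, h.outDirs_eq, Finset.sum_map]
  change ∑ r ∈ outDirs q p, topSlope c' (g.onPlane p) (g.onDir r) = _
  simp only [topSlope_onPlane h.coeff, Finset.sum_add_distrib]
  have h1 := g.sum_onDir (outDirs q p)
  rw [h.balanced p hp] at h1
  have h2 : g.onDir 0 = 0 := by
    obtain ⟨a, b, d⟩ := g
    cases a <;> cases b <;> cases d <;> rfl
  rw [h2] at h1
  have e1 := congrArg Prod.fst h1
  have e2 := congrArg Prod.snd h1
  rw [Prod.fst_sum] at e1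
  rw [Prod.snd_sum] at e2
  simp only [← Finset.mul_sum, e1, e2]
  simp

theorem Sym.Maps.inter_eq (h : g.Maps c c' q q') :
    lam q' ∩ curve c' = g.onPlane '' (lam q ∩ curve c) := by
  ext p
  obtain ⟨p, rfl⟩ := g.homeo.surjective p
  change g.onPlane p ∈ _ ↔ g.onPlane p ∈ _
  rw [g.onPlane_injective.mem_set_image, mem_inter_iff, h.onPlane_mem, mem_curve_onPlane h.coeff]
  rfl

theorem Sym.Maps.components_eq (h : g.Maps c c' q q') :
    components c' q' = (fun K => g.onPlane '' K) '' components c q := by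
  ext K
  constructor
  · rintro ⟨p', hp', rfl⟩
    rw [h.inter_eq] at hp' ⊢
    obtain ⟨p, hp, rfl⟩ := hp'
    exact ⟨_, ⟨p, hp, rfl⟩, g.homeo.image_connectedComponentIn hp⟩
  · rintro ⟨_, ⟨p, hp, rfl⟩, rfl⟩
    refine ⟨g.onPlane p, by rw [h.inter_eq]; exact mem_image_of_mem _ hp, ?_⟩
    rw [h.inter_eq]
    exact g.homeo.image_connectedComponentIn hp

theorem Sym.Maps.mult_eq (h : g.Maps c c' q q') {K : Set Plane} (hK : K ⊆ lam q) :
    mult c' q' (g.onPlane '' K) = mult c q K := by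
  rw [mult, finsum_mem_image g.onPlane_injective.injOn]
  exact finsum_mem_congr rfl fun p hp => h.multAt_eq (hK hp)

theorem Sym.Maps.isTritangent (h : g.Maps c c' q q') (ht : IsTritangent c q) :
    IsTritangent c' q' := by
  classical
  obtain ⟨S, hS, hm⟩ := ht
  have hinj : Function.Injective fun K : Set Plane => g.onPlane '' K :=
    g.onPlane_injective.image_injective
  refine ⟨S.map ⟨_, hinj⟩, ?_, ?_⟩
  · rw [h.components_eq, ← hS, Finset.coe_map]; rfl
  · have e : (S.map ⟨_, hinj⟩).val.map (mult c' q') = S.val.map (mult c q) := by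
      rw [Finset.map_val, Multiset.map_map]
      refine Multiset.map_congr rfl fun K hK => ?_
      have hK' : K ∈ components c q := by rw [← hS]; exact hK
      exact h.mult_eq ((subset_of_mem_components hK').trans inter_subset_left)
    rw [e]; exact hm

end Maps

theorem balanced_of_nonneg (hl : 0 ≤ q.2) : ∀ p ∈ lam q, ∑ r ∈ outDirs q p, r = 0 := by
  intro p hp
  rcases hl.eq_or_lt with h0 | h0
  · rcases mem_lam_cases hl hp with rfl | rfl | ⟨a, ha, t, ht, rfl⟩ | ⟨t, h1, h2, rfl⟩
    · rw [outDirs_fourValent h0.symm]; decide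
    · have : vertex q 1 = q.1 := by ext <;> simp [vertex_one, ← h0]
      rw [this, outDirs_fourValent h0.symm]; decide
    · rw [outDirs_leg hl ha ht]; cases a <;> decide
    · exact absurd (h1.trans h2) (by rw [← h0]; exact lt_irrefl 0)
  · rcases mem_lam_cases hl hp with rfl | rfl | ⟨a, ha, t, ht, rfl⟩ | ⟨t, h1, h2, rfl⟩
    · rw [outDirs_lower h0]; decide
    · rw [outDirs_upper h0]; decide
    · rw [outDirs_leg hl ha ht]; cases a <;> decide
    · rw [outDirs_diag h1 h2]; decide

/-! ### The reflection that exchanges the two signs of the edge -/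

/-- The reflection `x ↦ -x`. -/
def flipX : Sym := ⟨false, true, false⟩

/-- The image of the coefficients under the reflection. -/
def flipCoeff (c : Expo → ℝ) (m : Expo) : ℝ := c (flipX.onExpo m)

/-- The image of a (1,1)-curve under the reflection. -/
def flipParam : Param →ₗ[ℝ] Param where
  toFun q := ((-q.1.1, q.1.2), -q.2)
  map_add' q q' := by ext <;> simp <;> ring
  map_smul' t q := by ext <;> simp

theorem flipParam_apply (q : Param) : flipParam q = ((-q.1.1, q.1.2), -q.2) := rfl

theorem flipParam_flipParam (q : Param) : flipParam (flipParam q) = q := by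
  simp [flipParam_apply]

theorem flipX_onPlane (p : Plane) : flipX.onPlane p = (-p.1, p.2) := rfl

theorem flipX_onExpo_onExpo (m : Expo) : flipX.onExpo (flipX.onExpo m) = m := by
  revert m; decide

theorem flipCoeff_onExpo (c : Expo → ℝ) (m : Expo) : flipCoeff c (flipX.onExpo m) = c m := by
  rw [flipCoeff, flipX_onExpo_onExpo]

theorem flipCoeff_flipCoeff (c : Expo → ℝ) : flipCoeff (flipCoeff c) = c :=
  funext fun m => flipCoeff_onExpo c m

theorem vertex_flipParam (q : Param) (k : Fin 2) :
    vertex (flipParam q) k = flipX.onPlane (vertex q k) := by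
  fin_cases k
  · rfl
  · change ((-q.1.1 + -q.2, q.1.2 + |-q.2|) : Plane) = (-(q.1.1 + q.2), q.1.2 + |q.2|)
    rw [abs_neg]; ext <;> simp; ring

theorem onPlane_mem_lam_flipParam {p : Plane} (hp : p ∈ lam q) :
    flipX.onPlane p ∈ lam (flipParam q) := by
  have h0 : vertex (flipParam q) 0 = flipX.onPlane (vertex q 0) := vertex_flipParam q 0
  have h1 : vertex (flipParam q) 1 = flipX.onPlane (vertex q 1) := vertex_flipParam q 1
  have hv : q.2 = 0 → vertex q 0 = vertex q 1 := fun h => by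
    ext <;> simp [vertex_zero, vertex_one, h]
  have base : ∀ a b : Arm, armBase (flipParam q) b = flipX.onPlane (armBase q a) →
      b.dir = flipX.onPlane a.dir → p ∈ leg q a → flipX.onPlane p ∈ leg (flipParam q) b := by
    rintro a b h h' ⟨t, ht, rfl⟩
    exact ⟨t, ht, by rw [flipX.onPlane_add_smul, h, h']⟩
  have hs : (flipParam q).2 = -q.2 := rfl
  rcases hp with (((hp | hp) | hp) | hp) | ⟨a, b, ha, hb, hab, rfl⟩
  · refine Or.inl (Or.inl (Or.inr (base .west .east ?_ (by simp [Arm.dir, flipX_onPlane]) hp)))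
    simp only [armBase, hs, Left.nonneg_neg_iff]
    rcases lt_trichotomy q.2 0 with h | h | h
    · rw [if_pos h.le, if_neg h.not_ge, h1]
    · rw [if_pos h.le, if_pos h.ge, h1, hv h]
    · rw [if_neg h.not_ge, if_pos h.le, h0]
  · exact Or.inl (Or.inl (Or.inl (Or.inr (base .south .south h0
      (by simp [Arm.dir, flipX_onPlane]) hp))))
  · refine Or.inl (Or.inl (Or.inl (Or.inl (base .east .west ?_
      (by simp [Arm.dir, flipX_onPlane]) hp))))
    simp only [armBase, hs, Left.nonneg_neg_iff]
    rcases lt_trichotomy q.2 0 with h | h | h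
    · rw [if_pos h.le, if_neg h.not_ge, h0]
    · rw [if_pos h.le, if_pos h.ge, h0, hv h]
    · rw [if_neg h.not_ge, if_pos h.le, h1]
  · exact Or.inl (Or.inr (base .north .north h1 (by simp [Arm.dir, flipX_onPlane]) hp))
  · refine Or.inr ⟨a, b, ha, hb, hab, ?_⟩
    rw [h0, h1]
    ext <;> simp [flipX_onPlane]; ring

theorem lam_flipParam (q : Param) : lam (flipParam q) = flipX.onPlane '' lam q := by
  ext p
  constructor
  · intro hp
    have := onPlane_mem_lam_flipParam hp
    rw [flipParam_flipParam] at this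
    exact ⟨_, this, by simp [flipX_onPlane]⟩
  · rintro ⟨p, hp, rfl⟩
    exact onPlane_mem_lam_flipParam hp

theorem balanced (q : Param) : ∀ p ∈ lam q, ∑ r ∈ outDirs q p, r = 0 := by
  rcases le_total 0 q.2 with h | h
  · exact balanced_of_nonneg h
  -- Balancing does not involve the coefficients, so zero coefficients serve to reflect the case of
  -- nonnegative length.
  · have := Sym.Maps.balanced' (g := flipX) (c := 0) (c' := 0) (q := flipParam q) (q' := q)
      ⟨fun m => rfl, by rw [lam_flipParam, image_image]; simp [flipX_onPlane],
        balanced_of_nonneg (by rw [flipParam_apply]; simpa using h)⟩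
    exact this

theorem maps_flipX (c : Expo → ℝ) (q : Param) :
    flipX.Maps c (flipCoeff c) q (flipParam q) :=
  ⟨flipCoeff_onExpo c, lam_flipParam q, balanced q⟩

theorem isTritangent_flip :
    IsTritangent (flipCoeff c) (flipParam q) ↔ IsTritangent c q := by
  refine ⟨fun h => ?_, (maps_flipX c q).isTritangent⟩
  have := (maps_flipX (flipCoeff c) (flipParam q)).isTritangent h
  rwa [flipCoeff_flipCoeff, flipParam_flipParam] at this

theorem dualCell_flip (c : Expo → ℝ) (q : Param) (k : Fin 2) :
    dualCell (flipCoeff c) (vertex (flipParam q) k) =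
      (dualCell c (vertex q k)).map ⟨flipX.onExpo, flipX.onExpo_injective⟩ := by
  rw [vertex_flipParam, dualCell_onPlane (flipCoeff_onExpo c)]

theorem InUnboundedPart.flip (h : InUnboundedPart c q) :
    InUnboundedPart (flipCoeff c) (flipParam q) := by
  let e : Expo ↪ Expo := ⟨flipX.onExpo, flipX.onExpo_injective⟩
  have hneg : (flipParam q).2 = -q.2 := rfl
  have hs : ∀ {s t t' : Finset Expo}, t ⊆ s → Finset.map e t = t' → t' ⊆ s.map e :=
    fun h h' => h' ▸ Finset.map_subset_map.2 h
  have hd : ∀ {s t t' : Finset Expo}, Disjoint s t → Finset.map e t = t' → Disjoint (s.map e) t' :=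
    fun h h' => h' ▸ (Finset.disjoint_map e).2 h
  unfold InUnboundedPart at h ⊢
  rw [dualCell_flip, dualCell_flip, hneg, neg_pos, neg_lt_zero]
  rcases h with ⟨hl, h⟩ | ⟨hl, h⟩ | ⟨hl, h⟩ | ⟨hl, h⟩ | ⟨hl, h, h'⟩ | ⟨hl, h, h'⟩ | ⟨hl, h, h'⟩ |
    ⟨hl, h, h'⟩
  · exact Or.inr (Or.inr (Or.inl ⟨hl, by rw [h]; rfl⟩))
  · exact Or.inr (Or.inr (Or.inr (Or.inl ⟨hl, by rw [h]; rfl⟩)))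
  · exact Or.inl ⟨hl, by rw [h]; rfl⟩
  · exact Or.inr (Or.inl ⟨hl, by rw [h]; rfl⟩)
  · exact Or.inr (Or.inr (Or.inr (Or.inr (Or.inr (Or.inr (Or.inl
      ⟨hl, hs h (by decide), hd h' (by decide)⟩))))))
  · exact Or.inr (Or.inr (Or.inr (Or.inr (Or.inr (Or.inr (Or.inr
      ⟨hl, hs h (by decide), hd h' (by decide)⟩))))))
  · exact Or.inr (Or.inr (Or.inr (Or.inr (Or.inl ⟨hl, hs h (by decide), hd h' (by decide)⟩))))
  · exact Or.inr (Or.inr (Or.inr (Or.inr (Or.inr (Or.inl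
      ⟨hl, hs h (by decide), hd h' (by decide)⟩)))))

theorem inUnboundedPart_flip :
    InUnboundedPart (flipCoeff c) (flipParam q) ↔ InUnboundedPart c q := by
  refine ⟨fun h => ?_, InUnboundedPart.flip⟩
  have := h.flip
  rwa [flipCoeff_flipCoeff, flipParam_flipParam] at this

/-! ### Generic members of a cell -/

/-- The properties of a generic member `q` of a maximal cell with tangent space `V` which determine
its configuration. -/
structure Local (c : Expo → ℝ) (q : Param) (V : Submodule ℝ Param) : Prop where
  smooth : IsSmooth c
  tritangent : IsTritangent c q
  bounded : ¬ InUnboundedPart c q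
  extend : ∀ w : Param, (∀ᶠ t in 𝓝[>] (0 : ℝ), IsTritangent c (q + t • w) ∧
    ¬ InUnboundedPart c (q + t • w) ∧ (q + t • w).2 ≠ 0) → w ∈ V
  const : ∀ w ∈ V, ∀ᶠ t in 𝓝[>] (0 : ℝ), ∀ k,
    dualCell c (vertex (q + t • w) k) = dualCell c (vertex q k)
  generic : ∀ i j k : SignType,
    (∀ w ∈ V, (i : ℝ) * w.1.1 + (j : ℝ) * w.1.2 + (k : ℝ) * w.2 = 0) ∨
    ∀ P, (dualCell c P).card = 3 →
      (i : ℝ) * q.1.1 + (j : ℝ) * q.1.2 + (k : ℝ) * q.2 ≠ (i : ℝ) * P.1 + (j : ℝ) * P.2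

theorem Local.flip {V : Submodule ℝ Param} (h : Local c q V) :
    Local (flipCoeff c) (flipParam q) (V.comap flipParam) where
  smooth := h.smooth.onPlane (flipCoeff_onExpo c)
  tritangent := isTritangent_flip.2 h.tritangent
  bounded := fun hU => h.bounded (inUnboundedPart_flip.1 hU)
  extend w hw := by
    refine h.extend (flipParam w) ?_
    filter_upwards [hw] with t ⟨h1, h2, h3⟩
    have e : flipParam q + t • w = flipParam (q + t • flipParam w) := by
      rw [map_add, map_smul, flipParam_flipParam]
    rw [e] at h1 h2 h3
    refine ⟨isTritangent_flip.1 h1, fun hU => h2 hU.flip, fun h0 => h3 ?_⟩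
    rw [flipParam_apply]; simp only; rw [h0, neg_zero]
  const w hw := by
    filter_upwards [h.const _ hw] with t ht k
    have e : flipParam q + t • w = flipParam (q + t • flipParam w) := by
      rw [map_add, map_smul, flipParam_flipParam]
    rw [e, dualCell_flip, dualCell_flip, ht]
  generic i j k := by
    rcases h.generic (-i) j (-k) with h | h
    · refine Or.inl fun w hw => ?_
      have := h _ hw
      simp only [flipParam_apply, SignType.coe_neg] at this
      linarith
    · refine Or.inr fun P hP heq => h (flipX.onPlane P) ?_ ?_
      · rw [← hP, ← card_dualCell_onPlane (flipCoeff_onExpo c), flipX_onPlane, flipX_onPlane]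
        simp
      · simp only [flipParam_apply, flipX_onPlane, SignType.coe_neg] at heq ⊢
        linarith

/-! ### The statuses of the arms of a curve with an edge of slope one -/

/-- The intersection of the curve with the arms is of the given types. -/
structure HasStatuses (c : Expo → ℝ) (q : Param) (w s e n d : Status) : Prop where
  west : LegHas c (vertex q 0) (-1, 0) w
  south : LegHas c (vertex q 0) (0, -1) s
  east : LegHas c (vertex q 1) (1, 0) e
  north : LegHas c (vertex q 1) (0, 1) n
  diag : DiagHas c (vertex q 0) q.2 d

theorem startsEven_cell {v : Plane} {r : ℤ × ℤ} {e : ℤ} {t : ℝ} (ht : 0 < t)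
    (hpar : ∀ u ∈ Ioo 0 t, ∀ m, dualCell c (line v r u) = {m} → Even (slope r m + e)) :
    startsEven (cell c v) r e = true := by
  unfold startsEven
  rw [face_cell]
  split
  · next m hm =>
    have hcard : (rightFace c (line v r 0) r).card = 1 := by
      rw [line_zero, ← length_toList, hm]; rfl
    have h := even_topSlope_of_card ht hpar hcard
    have hmem : m ∈ rightFace c v r := by rw [← mem_toList, hm]; exact List.mem_singleton_self m
    rw [line_zero, ← (mem_rightFace.1 hmem).2] at h
    simpa [evenSlope] using Int.even_iff.1 h
  · rfl

/-- Along the edge the slope thus grows from at least 2 to at most 4, which is the bound required by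
`exists_diagShape`. Removing the cells of the unbounded part is essential here. -/
theorem top_bounds : (∀ a ∈ lowerCells, 2 ≤ top a (1, 1)) ∧
    ∀ b ∈ upperCells, -4 ≤ top b (-1, -1) := by
  decide +kernel

theorem Parity.west (hP : Parity c q) (hl : 0 ≤ q.2) :
    ∀ t, 0 ≤ t → ∀ m, dualCell c (line (vertex q 0) (-1, 0) t) = {m} →
      Even (slope (-1, 0) m + endSlope (-1, 0)) := by
  have := hP.leg .west (by decide)
  simpa only [armBase, if_pos hl, Arm.idir] using this

theorem Parity.south (hP : Parity c q) :
    ∀ t, 0 ≤ t → ∀ m, dualCell c (line (vertex q 0) (0, -1) t) = {m} →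
      Even (slope (0, -1) m + endSlope (0, -1)) :=
  hP.leg .south (by decide)

theorem Parity.east (hP : Parity c q) (hl : 0 ≤ q.2) :
    ∀ t, 0 ≤ t → ∀ m, dualCell c (line (vertex q 1) (1, 0) t) = {m} →
      Even (slope (1, 0) m + endSlope (1, 0)) := by
  have := hP.leg .east (by decide)
  simpa only [armBase, if_pos hl, Arm.idir] using this

theorem Parity.north (hP : Parity c q) :
    ∀ t, 0 ≤ t → ∀ m, dualCell c (line (vertex q 1) (0, 1) t) = {m} →
      Even (slope (0, 1) m + endSlope (0, 1)) :=
  hP.leg .north (by decide)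

theorem isUnitDir_leg : IsUnitDir (-1, 0) ∧ IsUnitDir (0, -1) ∧ IsUnitDir (1, 0) ∧
    IsUnitDir (0, 1) :=
  ⟨Or.inl (by decide), Or.inr (by decide), Or.inl (by decide), Or.inr (by decide)⟩

theorem exists_legHas (hc : IsSmooth c) {v : Plane} {r : ℤ × ℤ}
    (hr : r = (-1, 0) ∨ r = (0, -1) ∨ r = (1, 0) ∨ r = (0, 1))
    (hpar : ∀ t, 0 ≤ t → ∀ m, dualCell c (line v r t) = {m} → Even (slope r m + endSlope r)) :
    ∃ s ∈ legStatuses (cell c v) r (endSlope r), LegHas c v r s := by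
  rcases hr with rfl | rfl | rfl | rfl
  · exact exists_legShape hc isUnitDir_leg.1 (by decide) (by decide) hpar
  · exact exists_legShape hc isUnitDir_leg.2.1 (by decide) (by decide) hpar
  · exact exists_legShape hc isUnitDir_leg.2.2.1 (by decide) (by decide) hpar
  · exact exists_legShape hc isUnitDir_leg.2.2.2 (by decide) (by decide) hpar

theorem cell_mem_lowerCells (hc : IsSmooth c) (hl : 0 < q.2)
    (hP : Parity c q) (hU : ¬ InUnboundedPart c q) : cell c (vertex q 0) ∈ lowerCells := by
  rw [inUnboundedPart_iff_pos hl, not_or, Bool.not_eq_true] at hU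
  obtain ⟨e1, e2, -, -⟩ := endSlope_values
  have h1 := startsEven_cell one_pos fun u hu => hP.west hl.le u hu.1.le
  have h2 := startsEven_cell one_pos fun u hu => hP.south u hu.1.le
  have h3 := startsEven_cell (r := (1, 1)) (e := 0) hl fun u hu m hm => by
    rw [add_zero]; exact hP.diag_pos hl u ⟨hu.1.le, hu.2.le⟩ m hm
  rw [e1] at h1
  rw [e2] at h2
  rw [lowerCells, List.mem_filter]
  refine ⟨cell_mem_allCells hc _, ?_⟩
  rw [vertex_zero] at *
  rw [h1, h2, h3, hU.1]; rfl

theorem cell_mem_upperCells (hc : IsSmooth c) (hl : 0 < q.2)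
    (hP : Parity c q) (hU : ¬ InUnboundedPart c q) : cell c (vertex q 1) ∈ upperCells := by
  rw [inUnboundedPart_iff_pos hl, not_or, Bool.not_eq_true, Bool.not_eq_true] at hU
  obtain ⟨-, -, e1, e2⟩ := endSlope_values
  have h1 := startsEven_cell one_pos fun u hu => hP.east hl.le u hu.1.le
  have h2 := startsEven_cell one_pos fun u hu => hP.north u hu.1.le
  have h3 := startsEven_cell (v := vertex q 1) (r := (-1, -1)) (e := 0) hl fun u hu m hm => by
    have e : line (vertex q 1) (-1, -1) u = line q.1 (1, 1) (q.2 - u) := by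
      rw [vertex_one_eq_line hl.le, show ((-1, -1) : ℤ × ℤ) = -(1, 1) from rfl, line_neg, line_line,
        sub_eq_add_neg]
    have := hP.diag_pos hl (q.2 - u) ⟨by linarith [hu.2], by linarith [hu.1]⟩ m (e ▸ hm)
    rw [add_zero, show ((-1, -1) : ℤ × ℤ) = -(1, 1) from rfl, slope_neg]
    exact this.neg
  rw [e1] at h1
  rw [e2] at h2
  rw [upperCells, List.mem_filter]
  refine ⟨cell_mem_allCells hc _, ?_⟩
  rw [h1, h2, h3, hU.2]; rfl

theorem exists_hasStatuses (hc : IsSmooth c) (hl : 0 < q.2)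
    (hP : Parity c q) (hU : ¬ InUnboundedPart c q) :
    ∃ w ∈ legStatuses (cell c (vertex q 0)) (-1, 0) 0,
    ∃ s ∈ legStatuses (cell c (vertex q 0)) (0, -1) 0,
    ∃ e ∈ legStatuses (cell c (vertex q 1)) (1, 0) 3,
    ∃ n ∈ legStatuses (cell c (vertex q 1)) (0, 1) 3,
    ∃ d ∈ diagStatuses (cell c (vertex q 0)) (cell c (vertex q 1)), HasStatuses c q w s e n d := by
  obtain ⟨w, hw, hw'⟩ := exists_legHas hc (Or.inl rfl) (hP.west hl.le)
  obtain ⟨s, hs, hs'⟩ := exists_legHas hc (Or.inr (Or.inl rfl)) hP.south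
  obtain ⟨e, he, he'⟩ := exists_legHas hc (Or.inr (Or.inr (Or.inl rfl))) (hP.east hl.le)
  obtain ⟨n, hn, hn'⟩ := exists_legHas hc (Or.inr (Or.inr (Or.inr rfl))) hP.north
  have h1 := top_bounds.1 _ (cell_mem_lowerCells hc hl hP hU)
  have h2 := top_bounds.2 _ (cell_mem_upperCells hc hl hP hU)
  rw [top_diag] at h1
  rw [top_neg_diag, vertex_one_eq_line hl.le] at h2
  obtain ⟨d, hd, hd'⟩ := exists_diagShape hc hl (hP.diag_pos hl) (by rw [vertex_zero] at h1; omega)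
  obtain ⟨e1, e2, e3, e4⟩ := endSlope_values
  rw [e1] at hw
  rw [e2] at hs
  rw [e3] at he
  rw [e4] at hn
  rw [← vertex_one_eq_line hl.le] at hd
  exact ⟨w, hw, s, hs, e, he, n, hn, d, hd, hw', hs', he', hn', hd'⟩

/-! ### Movements in which the curve stays tritangent -/

/-- An integer vector as a movement. -/
def Vec.toParam (v : Vec) : Param := ((v.1, v.2.1), v.2.2)

theorem vertex_zero_add (q : Param) (v : Vec) (t : ℝ) :
    vertex (q + t • v.toParam) 0 = vertex q 0 + t • toPlane v.lower := rfl

theorem vertex_one_add {v : Vec} {t : ℝ} (h : 0 ≤ q.2)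
    (h' : 0 ≤ (q + t • v.toParam).2) :
    vertex (q + t • v.toParam) 1 = vertex q 1 + t • toPlane v.upper := by
  rw [vertex_one, vertex_one, abs_of_nonneg h, abs_of_nonneg h']
  ext <;> simp [Vec.toParam, toPlane, Vec.upper] <;> ring

theorem eventually_cell_eq_face (c : Expo → ℝ) (p : Plane) (u : ℤ × ℤ) :
    ∀ᶠ t in 𝓝[>] (0 : ℝ), cell c (p + t • toPlane u) = face (cell c p) u := by
  obtain ⟨ε, hε, h⟩ := exists_pos_dualCell_eq_rightFace c p u
  filter_upwards [Ioo_mem_nhdsGT hε] with t ht using cell_eq_face (h t ht)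

/-- For a germ every exponent of the wrong parity is accompanied on each arm, so the parity
condition holds for all small times; the faces of the two cells keep the curve out of the unbounded
part. -/
theorem HasStatuses.eventually {w s e n d : Status}
    (h : HasStatuses c q w s e n d) (hl : 0 < q.2) (hP : Parity c q) {v : Vec}
    (hv : v ∈ germs (cell c (vertex q 0)) (cell c (vertex q 1)) w s e n d) :
    ∀ᶠ t in 𝓝[>] (0 : ℝ), 0 < (q + t • v.toParam).2 ∧ Parity c (q + t • v.toParam) ∧
      ¬ InUnboundedPart c (q + t • v.toParam) := by
  simp only [germs, vertexGerms, List.mem_filter, allAllow, staysLower, staysUpper,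
    Bool.and_eq_true, Bool.not_eq_true'] at hv
  obtain ⟨⟨⟨-, ⟨⟨hw1, hs1⟩, hd1⟩, hU1⟩, ⟨⟨he1, hn1⟩, hd2⟩, hU2⟩, ⟨⟨⟨hw2, hs2⟩, he2⟩, hn2⟩, hd3⟩ := hv
  obtain ⟨e1, e2, e3, e4⟩ := endSlope_values
  have hlen : ∀ᶠ t in 𝓝[>] (0 : ℝ), 0 < (q + t • v.toParam).2 := by
    have hc : Continuous fun t : ℝ => (q + t • v.toParam).2 := by fun_prop
    exact nhdsWithin_le_nhds (hc.continuousAt.eventually (lt_mem_nhds (by simpa using hl)))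
  have hw := h.west.eventually isUnitDir_leg.1 (hP.west hl.le) hw2 (by rwa [e1])
  have hs := h.south.eventually isUnitDir_leg.2.1 hP.south hs2 (by rwa [e2])
  have he := h.east.eventually isUnitDir_leg.2.2.1 (hP.east hl.le) he2 (by rwa [e3])
  have hn := h.north.eventually isUnitDir_leg.2.2.2 hP.north hn2 (by rwa [e4])
  have hd := eventually_even_diag (e := 0) hl.le (h.diag.accompanied hl (hP.diag_pos hl)
    (u := v.lower) (u' := v.upper) (l := v.2.2)
    (by ext <;> simp [Vec.lower, Vec.upper]) hd3 hd1
    (by rwa [vertex_zero, ← vertex_one_eq_line hl.le]))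
  filter_upwards [hlen, hw, hs, he, hn, hd, eventually_cell_eq_face c (vertex q 0) v.lower,
    eventually_cell_eq_face c (vertex q 1) v.upper] with t ht hw hs he hn hd hc0 hc1
  have v0 := vertex_zero_add q v t
  have v1 := vertex_one_add hl.le ht.le
  refine ⟨ht, ⟨?_, fun _ x hx m hm => ?_, fun h' => absurd h' ht.not_gt⟩, ?_⟩
  · rintro (_ | _ | _ | _ | _) ha
    · simpa only [armBase, if_pos ht.le, v0, Arm.idir] using hw
    · simpa only [armBase, v0, Arm.idir] using hs
    · simpa only [armBase, if_pos ht.le, v1, Arm.idir] using he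
    · simpa only [armBase, v1, Arm.idir] using hn
    · exact absurd rfl ha
  · rw [← add_zero (slope _ m)]
    exact hd x hx m hm
  · rw [inUnboundedPart_iff_pos ht, v0, v1, hc0, hc1, hU1, hU2]
    simp

/-! ### Constraints on the tangent space of a cell -/

/-- An integer vector as a functional. -/
def Vec.eval (v : Vec) (x : Param) : ℝ := v.1 * x.1.1 + v.2.1 * x.1.2 + v.2.2 * x.2

theorem Vec.eval_toParam (v w : Vec) : v.eval w.toParam = (v.dot w : ℤ) := by
  simp [Vec.eval, Vec.toParam, Vec.dot]

theorem LegHas.exists_vertex {v : Plane} {r : ℤ × ℤ} {s : Status}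
    (h : LegHas c v r s) (h1 : s ≠ .none) (h2 : s ≠ .free) :
    ∃ x, (dualCell c (line v r x)).card = 3 := by
  rcases h with ⟨τ, F, h⟩ | ⟨h, -⟩
  · exact h.far.exists_vertex h1 h2
  · exact absurd h h1

theorem DiagHas.exists_vertex {v : Plane} {L : ℝ} {s : Status}
    (h : DiagHas c v L s) (h1 : s ≠ .none) (h2 : s ≠ .free) :
    ∃ x, (dualCell c (line v (1, 1) x)).card = 3 := by
  rcases h with ⟨τ, τ', F, h⟩ | ⟨h, -⟩
  · exact h.far.exists_vertex h1 h2
  · exact absurd h h1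

theorem Status.eq_of_mem_rows {s : Status} {v ρ : Vec} (h : ρ ∈ s.rows v) :
    ρ = v ∧ s ≠ .none ∧ s ≠ .free := by
  cases s <;> simp_all [Status.rows]

section Local

variable {V : Submodule ℝ Param}

/-- Two exponents dominant before and after the movement have equal values both times, so their
difference is orthogonal to the displacement `u`. The factor `k` is 0 for the lower vertex and 1 for
the upper vertex, which also moves with the length. -/
theorem eval_eq_zero_of_mem_edgeRows {v u : Plane} {k : ℤ} {ρ : Vec} {x : Param}
    (hρ : ρ ∈ edgeRows (cell c v) k) (hu : u = x.1 + (k * x.2) • toPlane (1, 1))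
    (h : ∀ᶠ t in 𝓝[>] (0 : ℝ), dualCell c (v + t • u) = dualCell c v) : ρ.eval x = 0 := by
  obtain ⟨t, ht, ht0 : 0 < t⟩ := (h.and self_mem_nhdsWithin).exists
  rw [edgeRows, List.mem_map] at hρ
  obtain ⟨m, hm, rfl⟩ := hρ
  have hm1 : m ∈ dualCell c v := mem_cell.1 (List.mem_of_mem_drop hm)
  have hm2 : (cell c v).headD 0 ∈ dualCell c v := by
    refine mem_cell.1 ?_
    cases hcell : cell c v with
    | nil => rw [hcell] at hm; simp at hm
    | cons a l => exact List.mem_cons_self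
  generalize (cell c v).headD 0 = n at *
  have h1 := monomial_eq_of_mem hm1 hm2
  have h2 := monomial_eq_of_mem (ht.symm ▸ hm1) (ht.symm ▸ hm2)
  rw [hu] at h2
  simp only [monomial, toPlane, Prod.fst_add, Prod.snd_add, Prod.smul_fst, Prod.smul_snd,
    smul_eq_mul, Int.cast_one, mul_one] at h1 h2
  refine (mul_eq_zero.1 (?_ : t * _ = 0)).resolve_left ht0.ne'
  simp only [Vec.eval, Expo.toInt]
  push_cast
  linarith

/-- The rows from the cells vanish because the dual cells of the vertices are constant. A row from
an arm takes the same value at the arm and at a vertex of the curve lying on it; since `q` is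
generic, this is only possible if the functional vanishes on `V`. -/
theorem Local.eval_eq_zero (h : Local c q V) (hl : 0 < q.2) {w s e n d : Status}
    (hs : HasStatuses c q w s e n d) {ρ : Vec}
    (hρ : ρ ∈ rows (cell c (vertex q 0)) (cell c (vertex q 1)) w s e n d) {x : Param} (hx : x ∈ V) :
    ρ.eval x = 0 := by
  have hlen : ∀ᶠ t in 𝓝[>] (0 : ℝ), 0 < (q + t • x).2 := by
    have hc : Continuous fun t : ℝ => (q + t • x).2 := by fun_prop
    exact nhdsWithin_le_nhds (hc.continuousAt.eventually (lt_mem_nhds (by simpa using hl)))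
  have hconst := h.const x hx
  simp only [rows, List.mem_append] at hρ
  have v1 : vertex q 1 = (q.1.1 + q.2, q.1.2 + q.2) := by rw [vertex_one, abs_of_pos hl]
  rcases hρ with (((((hρ | hρ) | hρ) | hρ) | hρ) | hρ) | hρ
  · exact eval_eq_zero_of_mem_edgeRows hρ (by simp) (hconst.mono fun t ht => ht 0)
  · refine eval_eq_zero_of_mem_edgeRows hρ rfl ?_
    filter_upwards [hconst, hlen] with t ht ht'
    rw [← ht 1, vertex_one, vertex_one, abs_of_pos ht', abs_of_pos hl]
    congr 1
    ext <;> simp [toPlane] <;> ring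
  · obtain ⟨rfl, h1, h2⟩ := Status.eq_of_mem_rows hρ
    obtain ⟨y, hy⟩ := hs.west.exists_vertex h1 h2
    rcases h.generic 0 1 0 with h | h
    · simpa [Vec.eval] using h x hx
    · exact absurd (by simp [line, toPlane, vertex_zero]) (h _ hy)
  · obtain ⟨rfl, h1, h2⟩ := Status.eq_of_mem_rows hρ
    obtain ⟨y, hy⟩ := hs.south.exists_vertex h1 h2
    rcases h.generic 1 0 0 with h | h
    · simpa [Vec.eval] using h x hx
    · exact absurd (by simp [line, toPlane, vertex_zero]) (h _ hy)
  · obtain ⟨rfl, h1, h2⟩ := Status.eq_of_mem_rows hρ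
    obtain ⟨y, hy⟩ := hs.east.exists_vertex h1 h2
    rcases h.generic 0 1 1 with h | h
    · simpa [Vec.eval] using h x hx
    · exact absurd (by simp [line, toPlane, v1]) (h _ hy)
  · obtain ⟨rfl, h1, h2⟩ := Status.eq_of_mem_rows hρ
    obtain ⟨y, hy⟩ := hs.north.exists_vertex h1 h2
    rcases h.generic 1 0 1 with h | h
    · simpa [Vec.eval] using h x hx
    · exact absurd (by simp [line, toPlane, v1]) (h _ hy)
  · obtain ⟨rfl, h1, h2⟩ := Status.eq_of_mem_rows hρ
    obtain ⟨y, hy⟩ := hs.diag.exists_vertex h1 h2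
    rcases h.generic (-1) 1 0 with h | h
    · simpa [Vec.eval] using h x hx
    · exact absurd (by simp [line, toPlane, vertex_zero]; ring) (h _ hy)

theorem Local.toParam_mem (h : Local c q V) (hl : 0 < q.2) {w s e n d : Status}
    (hs : HasStatuses c q w s e n d) {v : Vec}
    (hv : v ∈ germs (cell c (vertex q 0)) (cell c (vertex q 1)) w s e n d) : v.toParam ∈ V := by
  refine h.extend _ ((hs.eventually hl (h.tritangent.parity hl.le) hv).mono ?_)
  rintro t ⟨h1, h2, h3⟩
  exact ⟨h2.isTritangent h1, h3, h1.ne'⟩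

end Local

/-- The vectors that span the cell act on the vertices by the given movement. -/
def Moves (V : Submodule ℝ Param) : Movement → Prop
  | .ball => Module.finrank ℝ V = 2 ∧ ¬ (moveUpper.toParam ∈ V ∧ moveLower.toParam ∈ V)
  | .independent => Module.finrank ℝ V = 2 ∧ moveUpper.toParam ∈ V ∧ moveLower.toParam ∈ V
  | .dependent => Module.finrank ℝ V = 1 ∧ moveUpper.toParam ∉ V ∧ moveLower.toParam ∉ V
  | .oneFixed => Module.finrank ℝ V = 1 ∧ (moveUpper.toParam ∈ V ∨ moveLower.toParam ∈ V)
  | .rigid => Module.finrank ℝ V = 0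

theorem exists_moves {V : Submodule ℝ Param} (h : Module.finrank ℝ V ≤ 2) : ∃ π, Moves V π := by
  by_cases h1 : moveUpper.toParam ∈ V <;> by_cases h2 : moveLower.toParam ∈ V <;>
    interval_cases hf : Module.finrank ℝ V <;>
    first
    | exact ⟨.rigid, hf⟩
    | exact ⟨.oneFixed, hf, Or.inl h1⟩
    | exact ⟨.oneFixed, hf, Or.inr h2⟩
    | exact ⟨.dependent, hf, h1, h2⟩
    | exact ⟨.independent, hf, h1, h2⟩
    | exact ⟨.ball, hf, fun h => h1 h.1⟩
    | exact ⟨.ball, hf, fun h => h2 h.2⟩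

/-! ### Dimension bounds from integer vectors and functionals -/

theorem Vec.cross_eq_zero {v w : Vec} {x : Param} {a b : ℝ} (hv : v.toParam = a • x)
    (hw : w.toParam = b • x) : v.cross w = (0, 0, 0) := by
  simp only [Vec.toParam, Prod.ext_iff, Prod.smul_fst, Prod.smul_snd, smul_eq_mul] at hv hw
  obtain ⟨⟨h1, h2⟩, h3⟩ := hv
  obtain ⟨⟨h4, h5⟩, h6⟩ := hw
  have e1 : (v.2.1 : ℝ) * w.2.2 - v.2.2 * w.2.1 = 0 := by rw [h2, h3, h5, h6]; ring
  have e2 : (v.2.2 : ℝ) * w.1 - v.1 * w.2.2 = 0 := by rw [h1, h3, h4, h6]; ring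
  have e3 : (v.1 : ℝ) * w.2.1 - v.2.1 * w.1 = 0 := by rw [h1, h2, h4, h5]; ring
  simp only [Vec.cross]
  exact Prod.ext (by exact_mod_cast e1) (Prod.ext (by exact_mod_cast e2) (by exact_mod_cast e3))

theorem rankTwo_le {V : Submodule ℝ Param} {g : List Vec} (hg : ∀ v ∈ g, v.toParam ∈ V)
    (h : rankTwo g = true) : 2 ≤ Module.finrank ℝ V := by
  simp only [rankTwo, List.any_eq_true, bne_iff_ne] at h
  obtain ⟨v, hv, w, hw, hne⟩ := h
  by_contra hlt
  obtain ⟨x, hx⟩ := finrank_le_one_iff.1 (show Module.finrank ℝ V ≤ 1 by omega)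
  obtain ⟨a, ha⟩ := hx ⟨_, hg v hv⟩
  obtain ⟨b, hb⟩ := hx ⟨_, hg w hw⟩
  exact hne (Vec.cross_eq_zero (congrArg Subtype.val ha).symm (congrArg Subtype.val hb).symm)

theorem finrank_param : Module.finrank ℝ Param = 3 := by simp

theorem rankThree_le {V : Submodule ℝ Param} {g : List Vec} (hg : ∀ v ∈ g, v.toParam ∈ V)
    (h : rankThree g = true) : 3 ≤ Module.finrank ℝ V := by
  simp only [rankThree, List.any_eq_true, bne_iff_ne, Bool.and_eq_true] at h
  obtain ⟨v, hv, w, hw, -, z, hz, hne⟩ := h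
  have htop : V = ⊤ := by
    refine eq_top_iff.2 fun p _ => ?_
    have hD : (((v.cross w).dot z : ℤ) : ℝ) ≠ 0 := by exact_mod_cast hne
    -- Cramer's rule: the coordinates of `p` in the basis `v`, `w`, `z`.
    have e : p = (((v.cross w).dot z : ℤ) : ℝ)⁻¹ • ((w.cross z).eval p • v.toParam +
        (z.cross v).eval p • w.toParam + (v.cross w).eval p • z.toParam) := by
      rw [eq_inv_smul_iff₀ hD]
      ext <;> simp [Vec.eval, Vec.toParam, Vec.cross, Vec.dot] <;> ring
    rw [e]
    exact V.smul_mem _ (V.add_mem (V.add_mem (V.smul_mem _ (hg v hv)) (V.smul_mem _ (hg w hw)))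
      (V.smul_mem _ (hg z hz)))
  rw [htop, finrank_top, finrank_param]

theorem exists_smul_cross {v w : Vec} (h : v.cross w ≠ (0, 0, 0)) {x : Param} (hv : v.eval x = 0)
    (hw : w.eval x = 0) : ∃ a : ℝ, x = a • (v.cross w).toParam := by
  have hpos : (((v.cross w).dot (v.cross w) : ℤ) : ℝ) ≠ 0 := by
    intro h0
    have h0' : (v.cross w).dot (v.cross w) = 0 := by exact_mod_cast h0
    generalize v.cross w = z at *
    refine h ?_
    obtain ⟨z1, z2, z3⟩ := z
    simp only [Vec.dot] at h0'
    have h1 : z1 = 0 := by nlinarith [mul_self_nonneg z1, mul_self_nonneg z2, mul_self_nonneg z3]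
    have h2 : z2 = 0 := by nlinarith [mul_self_nonneg z1, mul_self_nonneg z2, mul_self_nonneg z3]
    have h3 : z3 = 0 := by nlinarith [mul_self_nonneg z1, mul_self_nonneg z2, mul_self_nonneg z3]
    rw [h1, h2, h3]
  -- The coefficient of the orthogonal projection to the line of the cross product; `x` already lies
  -- on this line, being orthogonal to both factors.
  refine ⟨(((v.cross w).dot (v.cross w) : ℤ) : ℝ)⁻¹ * (v.cross w).eval x, ?_⟩
  rw [mul_smul, eq_inv_smul_iff₀ hpos]
  simp only [Vec.eval] at hv hw
  ext <;> simp [Vec.eval, Vec.toParam, Vec.cross, Vec.dot]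
  · linear_combination (((v.1 : ℝ) * w.2.1 - v.2.1 * w.1) * w.2.1 -
      (v.2.2 * w.1 - v.1 * w.2.2) * w.2.2) * hv - (((v.1 : ℝ) * w.2.1 - v.2.1 * w.1) * v.2.1 -
      (v.2.2 * w.1 - v.1 * w.2.2) * v.2.2) * hw
  · linear_combination (((v.2.1 : ℝ) * w.2.2 - v.2.2 * w.2.1) * w.2.2 -
      (v.1 * w.2.1 - v.2.1 * w.1) * w.1) * hv - (((v.2.1 : ℝ) * w.2.2 - v.2.2 * w.2.1) * v.2.2 -
      (v.1 * w.2.1 - v.2.1 * w.1) * v.1) * hw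
  · linear_combination (((v.2.2 : ℝ) * w.1 - v.1 * w.2.2) * w.1 -
      (v.2.1 * w.2.2 - v.2.2 * w.2.1) * w.2.1) * hv - (((v.2.2 : ℝ) * w.1 - v.1 * w.2.2) * v.1 -
      (v.2.1 * w.2.2 - v.2.2 * w.2.1) * v.2.1) * hw

theorem le_one_of_rankTwo {V : Submodule ℝ Param} {R : List Vec}
    (hR : ∀ ρ ∈ R, ∀ x ∈ V, ρ.eval x = 0) (h : rankTwo R = true) : Module.finrank ℝ V ≤ 1 := by
  simp only [rankTwo, List.any_eq_true, bne_iff_ne] at h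
  obtain ⟨v, hv, w, hw, hne⟩ := h
  have : V ≤ ℝ ∙ (v.cross w).toParam := fun x hx => by
    obtain ⟨a, ha⟩ := exists_smul_cross hne (hR v hv x hx) (hR w hw x hx)
    exact Submodule.mem_span_singleton.2 ⟨a, ha.symm⟩
  exact (Submodule.finrank_mono this).trans ((finrank_span_le_card _).trans (by simp))

theorem eq_zero_of_rankThree {V : Submodule ℝ Param} {R : List Vec}
    (hR : ∀ ρ ∈ R, ∀ x ∈ V, ρ.eval x = 0) (h : rankThree R = true) : Module.finrank ℝ V = 0 := by
  simp only [rankThree, List.any_eq_true, bne_iff_ne, Bool.and_eq_true] at h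
  obtain ⟨v, hv, w, hw, hne, z, hz, hne'⟩ := h
  rw [Submodule.finrank_eq_zero, eq_bot_iff]
  intro x hx
  obtain ⟨a, rfl⟩ := exists_smul_cross hne (hR v hv x hx) (hR w hw x hx)
  have h1 := hR z hz _ hx
  have h2 : a * (((v.cross w).dot z : ℤ) : ℝ) = 0 := by
    rw [← h1]; simp [Vec.eval, Vec.toParam, Vec.dot]; ring
  have h3 : (((v.cross w).dot z : ℤ) : ℝ) ≠ 0 := by exact_mod_cast hne'
  rw [(mul_eq_zero.1 h2).resolve_right h3, zero_smul]
  exact Submodule.zero_mem _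

/-- The germs span a subspace of `V`, and the rows vanish on `V`. Hence no germ is detected by a
row, and the dimension of `V` bounds the ranks of both lists, so the clause of `isListed` for this
dimension is active. A movement of a single vertex that lies in `V` is killed by all rows, and one
outside `V` is not a germ; this selects the entry of the table. -/
theorem listed_of_isListed {V : Submodule ℝ Param} {g R : List Vec}
    {conf : Option (List Tangency)} (hg : ∀ v ∈ g, v.toParam ∈ V) (hg0 : ∀ v ∈ g, v ≠ (0, 0, 0))
    (hR : ∀ ρ ∈ R, ∀ x ∈ V, ρ.eval x = 0) (h : isListed g R conf = true) {π : Movement}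
    (hπ : Moves V π) : ∃ L, conf = some L ∧ listed π L = true := by
  have hkill : ∀ v : Vec, v.toParam ∈ V → kills R v = true := fun v hv => by
    rw [kills, List.all_eq_true]
    intro ρ hρ
    have := hR ρ hρ _ hv
    rw [Vec.eval_toParam] at this
    exact beq_iff_eq.2 (by exact_mod_cast this)
  have hcont : ∀ v : Vec, v.toParam ∉ V → g.contains v = false := fun v hv => by
    rw [List.contains_eq_mem, decide_eq_false_iff_not]
    exact fun h => hv (hg v h)
  have hno : (g.any fun w => R.any fun v => v.dot w != 0) = false := by
    rw [Bool.eq_false_iff]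
    intro hany
    simp only [List.any_eq_true, bne_iff_ne] at hany
    obtain ⟨w, hw, v, hv, hne⟩ := hany
    have := hR v hv _ (hg w hw)
    rw [Vec.eval_toParam] at this
    exact hne (by exact_mod_cast this)
  unfold isListed at h
  rw [hno, Bool.false_or] at h
  cases conf with
  | none => exact absurd h Bool.false_ne_true
  | some L =>
    refine ⟨L, rfl, ?_⟩
    simp only [Bool.and_eq_true] at h
    obtain ⟨⟨h0, h1⟩, h2⟩ := h
    have r2 := rankTwo_le hg
    have r3 := rankThree_le hg
    have s2 := le_one_of_rankTwo hR
    have s3 := eq_zero_of_rankThree hR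
    cases π with
    | rigid =>
      -- Germs are nonzero vectors of `V`, and here `V` is zero.
      have hempty : g = [] := by
        rw [List.eq_nil_iff_forall_not_mem]
        intro v hv
        have h3 := hg v hv
        rw [Submodule.finrank_eq_zero.1 hπ, Submodule.mem_bot] at h3
        simp only [Vec.toParam, Prod.ext_iff, Prod.fst_zero, Prod.snd_zero, Int.cast_eq_zero] at h3
        exact hg0 v hv (Prod.ext h3.1.1 (Prod.ext h3.1.2 h3.2))
      simpa [hempty] using h0
    | oneFixed =>
      have f1 : rankTwo g = false := Bool.eq_false_iff.2 fun h => by have := r2 h; have := hπ.1; omega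
      have f2 : rankThree R = false :=
        Bool.eq_false_iff.2 fun h => by have := s3 h; have := hπ.1; omega
      rw [f1, f2] at h1
      rcases hπ.2 with hm | hm <;> rw [hkill _ hm] at h1 <;> simp at h1 <;> exact h1.1
    | dependent =>
      have f1 : rankTwo g = false := Bool.eq_false_iff.2 fun h => by have := r2 h; have := hπ.1; omega
      have f2 : rankThree R = false :=
        Bool.eq_false_iff.2 fun h => by have := s3 h; have := hπ.1; omega
      rw [f1, f2, hcont _ hπ.2.1, hcont _ hπ.2.2] at h1
      simp only [Bool.false_or, Bool.and_eq_true] at h1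
      exact h1.2
    | independent =>
      have f1 : rankTwo R = false := Bool.eq_false_iff.2 fun h => by have := s2 h; have := hπ.1; omega
      have f2 : rankThree g = false :=
        Bool.eq_false_iff.2 fun h => by have := r3 h; have := hπ.1; omega
      rw [f1, f2, hkill _ hπ.2.1, hkill _ hπ.2.2] at h2
      simp at h2; exact h2.1
    | ball =>
      have f1 : rankTwo R = false := Bool.eq_false_iff.2 fun h => by have := s2 h; have := hπ.1; omega
      have f2 : rankThree g = false :=
        Bool.eq_false_iff.2 fun h => by have := r3 h; have := hπ.1; omega
      have f3 : (g.contains moveUpper && g.contains moveLower) = false := by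
        by_cases hm : moveUpper.toParam ∈ V
        · rw [hcont moveLower fun h => hπ.2 ⟨hm, h⟩, Bool.and_false]
        · rw [hcont _ hm, Bool.false_and]
      rw [f1, f2, f3] at h2
      simp only [Bool.false_or, Bool.and_eq_true] at h2
      exact h2.2

/-- The tangencies of a generic member of a maximal cell are in the table. -/
theorem Local.exists_listed {V : Submodule ℝ Param} (h : Local c q V)
    (hl : 0 < q.2) {π : Movement} (hπ : Moves V π) :
    ∃ w s e n d, HasStatuses c q w s e n d ∧
      ∃ L, tangencies (cell c (vertex q 0)) (cell c (vertex q 1)) w s e n d = some L ∧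
        listed π L = true := by
  have hP := h.tritangent.parity hl.le
  obtain ⟨w, hw, s, hs, e, he, n, hn, d, hd, hst⟩ := exists_hasStatuses h.smooth hl hP h.bounded
  have h1 := List.all_eq_true.1 isListed_all _ (cell_mem_lowerCells h.smooth hl hP h.bounded)
  have h2 := List.all_eq_true.1 h1 _ (cell_mem_upperCells h.smooth hl hP h.bounded)
  have h3 := List.all_eq_true.1 (List.all_eq_true.1 (List.all_eq_true.1 (List.all_eq_true.1
    (List.all_eq_true.1 h2 d hd) w hw) s hs) e he) n hn
  refine ⟨w, s, e, n, d, hst, listed_of_isListed (fun v hv => h.toParam_mem hl hst hv)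
    (fun v hv => ?_) (fun ρ hρ x hx => h.eval_eq_zero hl hst hρ hx) h3 hπ⟩
  have hmem : v ∈ testVecs := by
    simp only [germs, vertexGerms, List.mem_filter] at hv
    exact hv.1.1.1
  exact (show ∀ v ∈ testVecs, v ≠ (0, 0, 0) by decide) v hmem

/-! ### The arms of a curve -/

/-- The parameters of the points in the relative interior of an arm. -/
def armRange (q : Param) : Arm → Set ℝ
  | .diag => Ioo 0 q.2
  | _ => Ioi 0

theorem armRange_of_ne {a : Arm} (ha : a ≠ .diag) : armRange q a = Ioi 0 := by
  cases a <;> simp_all [armRange]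

theorem image_line_Icc (v : Plane) (r : ℤ × ℤ) {α β : ℝ} (h : α ≤ β) :
    line v r '' Icc α β = segment ℝ (line v r α) (line v r β) := by
  have e : ∀ t, line v r t = AffineMap.lineMap (k := ℝ) v (v + toPlane r) t := fun t => by
    simp [line, AffineMap.lineMap_apply, add_comm]
  rw [← segment_eq_Icc h, e α, e β, ← image_segment]
  exact image_congr fun t _ => e t

section Arms

variable {a b : Arm}

theorem mem_armInterior (hl : 0 ≤ q.2) (ha : a = .diag → 0 < q.2) {p : Plane} :
    p ∈ armInterior q a ↔ match a with
      | .west => p.2 = q.1.2 ∧ p.1 < q.1.1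
      | .south => p.1 = q.1.1 ∧ p.2 < q.1.2
      | .east => p.2 = q.1.2 + q.2 ∧ q.1.1 + q.2 < p.1
      | .north => p.1 = q.1.1 + q.2 ∧ q.1.2 + q.2 < p.2
      | .diag => p.2 - p.1 = q.1.2 - q.1.1 ∧ q.1.1 < p.1 ∧ p.1 < q.1.1 + q.2 := by
  cases a
  case diag =>
    have hpos := ha rfl
    have e : vertex q 1 = q.1 + q.2 • (1, 1) := by
      ext <;> simp [vertex_one, abs_of_nonneg hl]
    simp only [armInterior, vertex_zero, e]
    rw [openSegment_eq_image']
    constructor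
    · rintro ⟨t, ⟨h0, h1⟩, rfl⟩
      refine ⟨by simp, ?_, ?_⟩
      · simp; positivity
      · simp; nlinarith
    · rintro ⟨h0, h1, h2⟩
      refine ⟨(p.1 - q.1.1) / q.2, ⟨div_pos (by linarith) hpos,
        (div_lt_one hpos).2 (by linarith)⟩, ?_⟩
      ext <;> simp [hpos.ne']
      linarith
  all_goals
    simp only [armInterior, armBase, if_pos hl, Arm.dir, vertex_zero, vertex_one,
      abs_of_nonneg hl]
    constructor
    · rintro ⟨t, ht, rfl⟩
      simp [ht]
  · rintro ⟨h0, h1⟩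
    exact ⟨q.1.1 - p.1, by linarith, by ext <;> simp [h0]⟩
  · rintro ⟨h0, h1⟩
    exact ⟨q.1.2 - p.2, by linarith, by ext <;> simp [h0]⟩
  · rintro ⟨h0, h1⟩
    exact ⟨p.1 - (q.1.1 + q.2), by linarith, by ext <;> simp [h0]⟩
  · rintro ⟨h0, h1⟩
    exact ⟨p.2 - (q.1.2 + q.2), by linarith, by ext <;> simp [h0]⟩

theorem image_armRange (hl : 0 ≤ q.2) (ha : a = .diag → 0 < q.2) :
    line (armBase q a) a.idir '' armRange q a = armInterior q a := by
  by_cases h : a = .diag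
  · subst h
    ext p
    rw [mem_armInterior hl ha]
    simp only [armRange, mem_image, armBase, vertex_zero, Arm.idir]
    constructor
    · rintro ⟨t, ht, rfl⟩
      simp [line, toPlane, ht.1, ht.2]
    · rintro ⟨h0, h1, h2⟩
      exact ⟨p.1 - q.1.1, ⟨by linarith, by linarith⟩, by ext <;> simp [line, toPlane]; linarith⟩
  · rw [armRange_of_ne h]
    have e : armInterior q a = {p | ∃ t : ℝ, 0 < t ∧ p = armBase q a + t • a.dir} := by
      cases a <;> first | rfl | exact absurd rfl h
    rw [e]
    ext p
    constructor
    · rintro ⟨t, ht, rfl⟩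
      exact ⟨t, ht, by rw [← Arm.toPlane_idir h]; rfl⟩
    · rintro ⟨t, ht, rfl⟩
      exact ⟨t, ht, by rw [← Arm.toPlane_idir h]; rfl⟩

theorem leg_eq_insert (ha : a ≠ .diag) : leg q a = insert (armBase q a) (armInterior q a) := by
  have e : armInterior q a = {p | ∃ t : ℝ, 0 < t ∧ p = armBase q a + t • a.dir} := by
    cases a <;> first | rfl | exact absurd rfl ha
  rw [e]
  ext p
  constructor
  · rintro ⟨t, ht, rfl⟩
    rcases ht.eq_or_lt with rfl | ht
    · left; simp
    · exact Or.inr ⟨t, ht, rfl⟩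
  · rintro (rfl | ⟨t, ht, rfl⟩)
    · exact ⟨0, le_rfl, by simp⟩
    · exact ⟨t, ht.le, rfl⟩

theorem armInterior_subset_lam (hl : 0 ≤ q.2) (ha : a = .diag → 0 < q.2) :
    armInterior q a ⊆ lam q := by
  intro p hp
  rw [mem_armInterior hl ha] at hp
  rw [mem_lam hl]
  cases a <;> simp only at hp <;> grind

theorem armInterior_disjoint (hl : 0 ≤ q.2) (ha : a = .diag → 0 < q.2) (hb : b = .diag → 0 < q.2)
    (hab : a ≠ b) : Disjoint (armInterior q a) (armInterior q b) := by
  rw [Set.disjoint_left]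
  intro p hp hp'
  rw [mem_armInterior hl ha] at hp
  rw [mem_armInterior hl hb] at hp'
  cases a <;> cases b <;> first | exact hab rfl | (simp only at hp hp'; grind)

theorem vertex_notMem_armInterior (hl : 0 ≤ q.2) (ha : a = .diag → 0 < q.2) (k : Fin 2) :
    vertex q k ∉ armInterior q a := by
  intro hp
  rw [mem_armInterior hl ha] at hp
  fin_cases k
  · simp only [Fin.zero_eta, vertex_zero] at hp
    cases a <;> simp only at hp <;> grind
  · simp only [Fin.mk_one, vertex_one, abs_of_nonneg hl] at hp
    cases a <;> simp only at hp <;> grind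

theorem mult_arm (hl : 0 ≤ q.2) {I : Set ℝ} (hI : I ⊆ armRange q a) :
    mult c q (line (armBase q a) a.idir '' I) =
      ∑ᶠ t ∈ I, width c (line (armBase q a) a.idir t) a.idir := by
  by_cases h : a = .diag
  · subst h; exact mult_diag c hI
  · exact mult_leg c hl h (by rwa [armRange_of_ne h] at hI)

theorem vertex_mem_lam (hl : 0 ≤ q.2) (k : Fin 2) : vertex q k ∈ lam q := by
  rw [mem_lam hl]
  fin_cases k
  · simp [vertex_zero]
  · simp [vertex_one, abs_of_nonneg hl]

theorem mult_singleton (c : Expo → ℝ) (q : Param) (p : Plane) : mult c q {p} = multAt c q p :=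
  finsum_mem_singleton

theorem mult_insert (hl : 0 ≤ q.2) {p : Plane} {Y : Set Plane} (hp : p ∈ lam q) (hY : Y ⊆ lam q)
    (h : p ∉ Y) : mult c q (insert p Y) = multAt c q p + mult c q Y := by
  rw [← singleton_union, mult_union c hl (singleton_subset_iff.2 hp) hY
    (disjoint_singleton_left.2 h), mult_singleton]

theorem isClosed_leg (hl : 0 ≤ q.2) (ha : a ≠ .diag) : IsClosed (leg q a) := by
  have e : leg q a = line (armBase q a) a.idir '' Ici 0 := by
    rw [leg_eq_insert ha, ← image_armRange hl fun h => absurd h ha, armRange_of_ne ha,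
      ← Ioi_insert (a := (0 : ℝ)), image_insert_eq, line_zero]
  have hinv : ∃ f : Plane → ℝ, Continuous f ∧ ∀ t, f (line (armBase q a) a.idir t) = t := by
    cases a
    case diag => exact absurd rfl ha
    · exact ⟨fun p => (armBase q .west).1 - p.1, by fun_prop, fun t => by
        simp [line, toPlane, Arm.idir]⟩
    · exact ⟨fun p => (armBase q .south).2 - p.2, by fun_prop, fun t => by
        simp [line, toPlane, Arm.idir]⟩
    · exact ⟨fun p => p.1 - (armBase q .east).1, by fun_prop, fun t => by
        simp [line, toPlane, Arm.idir]⟩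
    · exact ⟨fun p => p.2 - (armBase q .north).2, by fun_prop, fun t => by
        simp [line, toPlane, Arm.idir]⟩
  obtain ⟨f, hf, hinv⟩ := hinv
  have : Topology.IsClosedEmbedding (line (armBase q a) a.idir) :=
    Function.LeftInverse.isClosedEmbedding hinv hf (continuous_line _ _)
  rw [e]
  exact this.isClosedMap _ isClosed_Ici

theorem isConnected_leg (q : Param) (a : Arm) : IsConnected (leg q a) := by
  have : Convex ℝ (leg q a) := by
    rintro _ ⟨s, hs, rfl⟩ _ ⟨t, ht, rfl⟩ x y hx hy hxy
    refine ⟨x * s + y * t, by positivity, ?_⟩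
    rw [smul_add, smul_add, add_add_add_comm, ← add_smul, hxy, one_smul, add_smul, smul_smul,
      smul_smul]
  exact this.isConnected ⟨_, 0, le_rfl, rfl⟩

end Arms

theorem isClosed_segment (p p' : Plane) : IsClosed (segment ℝ p p') := by
  rw [segment_eq_image_lineMap]
  exact (isCompact_Icc.image (by fun_prop)).isClosed

theorem isConnected_segment (p p' : Plane) : IsConnected (segment ℝ p p') :=
  (convex_segment p p').isConnected ⟨p, left_mem_segment ℝ p p'⟩

/-! ### Lists of tangencies -/

/-- The set `X` is the disjoint union of closed connected sets which are local tangencies of the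
types listed in `L`. -/
def Configured (c : Expo → ℝ) (q : Param) (X : Set Plane) (L : List Tangency) : Prop :=
  ∃ Ks : List (Set Plane), List.Forall₂ (Realizes c q) L Ks ∧ Ks.Pairwise Disjoint ∧
    (∀ K ∈ Ks, IsClosed K ∧ IsConnected K) ∧ ∀ p, p ∈ X ↔ ∃ K ∈ Ks, p ∈ K

section Configured

variable {X Y : Set Plane} {L L' : List Tangency}

theorem configured_empty (c : Expo → ℝ) (q : Param) : Configured c q ∅ [] :=
  ⟨[], .nil, .nil, by simp, by simp⟩

theorem configured_singleton {K : Set Plane} {t : Tangency} (h : Realizes c q t K)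
    (h1 : IsClosed K) (h2 : IsConnected K) : Configured c q K [t] :=
  ⟨[K], .cons h .nil, List.pairwise_singleton _ _, by simp [h1, h2], by simp⟩

theorem Configured.union (h : Configured c q X L) (h' : Configured c q Y L') (hd : Disjoint X Y) :
    Configured c q (X ∪ Y) (L ++ L') := by
  obtain ⟨Ks, h1, h2, h3, h4⟩ := h
  obtain ⟨Ks', h1', h2', h3', h4'⟩ := h'
  refine ⟨Ks ++ Ks', List.rel_append h1 h1', List.pairwise_append.2 ⟨h2, h2', ?_⟩, ?_, ?_⟩
  · intro K hK K' hK'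
    exact hd.mono (fun p hp => (h4 p).2 ⟨K, hK, hp⟩) fun p hp => (h4' p).2 ⟨K', hK', hp⟩
  · intro K hK
    rcases List.mem_append.1 hK with hK | hK
    · exact h3 K hK
    · exact h3' K hK
  · intro p
    rw [mem_union, h4, h4']
    simp only [List.mem_append]
    grind

theorem isClosed_biUnion_list {Ks : List (Set Plane)} (h : ∀ K ∈ Ks, IsClosed K) :
    IsClosed {p | ∃ K ∈ Ks, p ∈ K} := by
  have e : {p : Plane | ∃ K ∈ Ks, p ∈ K} = ⋃ K ∈ {K | K ∈ Ks}, K := by ext; simp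
  rw [e]
  exact (List.finite_toSet Ks).isClosed_biUnion h

/-- Induction on the list: a preconnected set covered by two disjoint closed sets lies in one of
them, and finite unions of closed sets are closed. -/
theorem subset_of_pairwise_disjoint {Ks : List (Set Plane)} (hd : Ks.Pairwise Disjoint)
    (hc : ∀ K ∈ Ks, IsClosed K) {S : Set Plane} (hS : IsPreconnected S)
    (hsub : ∀ p ∈ S, ∃ K ∈ Ks, p ∈ K) {K : Set Plane} (hK : K ∈ Ks) (hne : (S ∩ K).Nonempty) :
    S ⊆ K := by
  induction Ks with
  | nil => exact absurd hK List.not_mem_nil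
  | cons K' Ks ih =>
    rw [List.pairwise_cons] at hd
    have hcl := isClosed_biUnion_list fun K hK => hc K (List.mem_cons_of_mem _ hK)
    have hcl' := hc K' List.mem_cons_self
    have hsub' : S ⊆ K' ∪ {p | ∃ K ∈ Ks, p ∈ K} := by
      intro p hp
      obtain ⟨K, hK, hpK⟩ := hsub p hp
      rcases List.mem_cons.1 hK with rfl | hK
      · exact Or.inl hpK
      · exact Or.inr ⟨K, hK, hpK⟩
    have hdisj : S ∩ (K' ∩ {p | ∃ K ∈ Ks, p ∈ K}) = ∅ := by
      ext p
      simp only [mem_inter_iff, mem_empty_iff_false, iff_false]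
      rintro ⟨-, h1, K, hK, h2⟩
      exact Set.disjoint_left.1 (hd.1 K hK) h1 h2
    rcases isPreconnected_iff_subset_of_disjoint_closed.1 hS _ _ hcl' hcl hsub' hdisj with h | h
    · rcases List.mem_cons.1 hK with rfl | hK
      · exact h
      · obtain ⟨p, hp, hpK⟩ := hne
        exact absurd hpK (Set.disjoint_left.1 (hd.1 K hK) (h hp))
    · rcases List.mem_cons.1 hK with rfl | hK
      · obtain ⟨p, hp, hpK⟩ := hne
        obtain ⟨K', hK', hpK'⟩ := h hp
        exact absurd hpK' (Set.disjoint_left.1 (hd.1 K' hK') hpK)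
      · exact ih hd.2 (fun K hK => hc K (List.mem_cons_of_mem _ hK)) h hK

/-- A partition into closed connected sets is the set of components. -/
theorem nodup_and_mem_components {Ks : List (Set Plane)} (h2 : Ks.Pairwise Disjoint)
    (h3 : ∀ K ∈ Ks, IsClosed K ∧ IsConnected K) (h4 : ∀ p, p ∈ lam q ∩ curve c ↔ ∃ K ∈ Ks, p ∈ K) :
    Ks.Nodup ∧ ∀ K, K ∈ Ks ↔ K ∈ components c q := by
  have hsub : ∀ K ∈ Ks, K ⊆ lam q ∩ curve c := fun K hK p hp => (h4 p).2 ⟨K, hK, hp⟩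
  have key : ∀ K ∈ Ks, ∀ p ∈ K, connectedComponentIn (lam q ∩ curve c) p = K := by
    intro K hK p hp
    refine subset_antisymm ?_ ?_
    · refine subset_of_pairwise_disjoint h2 (fun K hK => (h3 K hK).1)
        isPreconnected_connectedComponentIn (fun p' hp' => ?_) hK
        ⟨p, mem_connectedComponentIn (hsub K hK hp), hp⟩
      exact (h4 p').1 (connectedComponentIn_subset _ _ hp')
    · exact (h3 K hK).2.isPreconnected.subset_connectedComponentIn hp (hsub K hK)
  refine ⟨?_, fun K => ⟨fun hK => ?_, ?_⟩⟩
  · refine h2.imp_of_mem fun {K K'} hK _ hd hne => ?_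
    rw [← hne, disjoint_self] at hd
    exact (h3 K hK).2.nonempty.ne_empty hd
  · obtain ⟨p, hp⟩ := (h3 K hK).2.nonempty
    exact ⟨p, hsub K hK hp, (key K hK p hp).symm⟩
  · rintro ⟨p, hp, rfl⟩
    obtain ⟨K, hK, hpK⟩ := (h4 p).1 hp
    rwa [key K hK p hpK]

theorem Configured.hasConfiguration (h : Configured c q (lam q ∩ curve c) L) :
    HasConfiguration c q L := by
  obtain ⟨Ks, h1, h2, h3, h4⟩ := h
  obtain ⟨h5, h6⟩ := nodup_and_mem_components h2 h3 h4
  exact ⟨Ks, h5, h6, h1⟩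

theorem HasConfiguration.perm (h : HasConfiguration c q L) (hL : L.Perm L') :
    HasConfiguration c q L' := by
  obtain ⟨Ks, h1, h2, h3⟩ := h
  obtain ⟨Ks', h4, h5⟩ := List.perm_comp_forall₂ hL.symm h3
  exact ⟨Ks', h5.nodup_iff.2 h1, fun K => by rw [← h2, h5.mem_iff], h4⟩

/-- In each nonempty case the slope increases by two along `F`, which is its stable multiplicity. -/
theorem FarShape.configured {a : Arm} (hl : 0 ≤ q.2) (ha : a = .diag → 0 < q.2) {h : ℤ}
    {s : Status} {F : Set ℝ} (hF : FarShape c (armBase q a) a.idir h s F)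
    (hsub : F ⊆ armRange q a) :
    Configured c q (line (armBase q a) a.idir '' F) (s.tangencies a) := by
  have hmem : ∀ t ∈ F, line (armBase q a) a.idir t ∈ armInterior q a := fun t ht => by
    rw [← image_armRange hl ha]; exact mem_image_of_mem _ (hsub ht)
  have hmult := mult_arm (c := c) hl hsub
  cases s
  case none =>
    have hF : F = ∅ := hF
    rw [hF, image_empty]; exact configured_empty c q
  case free =>
    obtain ⟨α, rfl, h1, h2, h3⟩ := hF
    rw [finsum_mem_singleton, image_singleton] at hmult
    rw [image_singleton]
    refine configured_singleton ⟨?_, _, hmem α rfl, rfl, h2⟩ isClosed_singleton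
      isConnected_singleton
    rw [hmult, width]; omega
  case locked =>
    obtain ⟨α, β, rfl, h0, h1, h2, h3, h4, -⟩ := hF
    rw [finsum_width_Icc _ _ _ h0.le, image_line_Icc _ _ h0.le] at hmult
    rw [image_line_Icc _ _ h0.le]
    refine configured_singleton ⟨by rw [hmult]; omega, _, hmem α ⟨le_rfl, h0.le⟩, _,
      hmem β ⟨h0.le, le_rfl⟩, fun h => h0.ne ((line_injective _ a.idir_ne_zero) h), h1, h2, rfl⟩
      (isClosed_segment _ _) (isConnected_segment _ _)
  all_goals
    obtain ⟨α, rfl, m₁, m₂, m₃, hd, h1, h2, h3, -, -, -, h4, h5, -⟩ := hF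
    rw [finsum_mem_singleton, image_singleton] at hmult
    rw [image_singleton]
    refine configured_singleton ⟨?_, _, hmem α rfl, rfl, ?_⟩ isClosed_singleton
      isConnected_singleton
    · rw [hmult, width]; omega
    · rw [hd]; exact Finset.card_eq_three.2 ⟨m₁, m₂, m₃, h1, h2, h3, rfl⟩

end Configured

/-! ### The configuration from the local combinatorics -/

/-- The set `Y` is the common part of the open arm `a` with the edge of the curve at the vertex `v`
along the arm. -/
def OverlapHas (c : Expo → ℝ) (q : Param) (v : Plane) (a : Arm) : Overlap → Set Plane → Prop
  | .none, Y => Y = ∅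
  | .segment, Y => ∃ A ∈ armInterior q a, (dualCell c A).card = 3 ∧
      insert v Y = segment ℝ v A ∧ mult c q Y = 1
  | .ray, Y => insert v Y = leg q a ∧ mult c q Y = 0

section Pieces


theorem card_rightFace_of_notMem {v : Plane} (hv : v ∉ curve c) (r : ℤ × ℤ) :
    (rightFace c v r).card = 1 := by
  obtain ⟨m, hm⟩ := notMem_curve_iff.1 hv
  have h1 := Finset.card_le_card (rightFace_subset c v r)
  have h2 := rightFace_card_pos c v r
  rw [hm, Finset.card_singleton] at h1
  omega

theorem legOverlap_of_notMem {v : Plane} (hv : v ∉ curve c) (r : ℤ × ℤ) (e : ℤ) :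
    legOverlap (cell c v) r e = .none := by
  rw [legOverlap, length_face_cell, card_rightFace_of_notMem hv]; rfl

theorem diagOverlap_of_notMem {v : Plane} (hv : v ∉ curve c) (r : ℤ × ℤ) :
    diagOverlap (cell c v) r = .none := by
  rw [diagOverlap, length_face_cell, card_rightFace_of_notMem hv]; rfl

/-- Here `Y` is the overlap at the vertex and `Z` the crossing. A bounded overlap carries
multiplicity one, from the jump at its end; a leg contained in the curve carries none. -/
theorem LegHas.pieces (hl : 0 ≤ q.2) {a : Arm} (ha : a ≠ .diag) {s : Status}
    (h : LegHas c (armBase q a) a.idir s) : ∃ Y Z, armInterior q a ∩ curve c = Y ∪ Z ∧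
      Disjoint Y Z ∧ OverlapHas c q (armBase q a) a
        (legOverlap (cell c (armBase q a)) a.idir (endSlope a.idir)) Y ∧
      Configured c q Z (s.tangencies a) := by
  have hd : a = .diag → 0 < q.2 := fun h => absurd h ha
  have hr := armRange_of_ne (q := q) ha
  have hinj := line_injective (armBase q a) a.idir_ne_zero
  have htop : top (cell c (armBase q a)) a.idir = topSlope c (armBase q a) a.idir :=
    top_cell _ _ (by cases a <;> decide)
  have hint : armInterior q a ∩ curve c =
      line (armBase q a) a.idir '' {u ∈ Ioi 0 | line (armBase q a) a.idir u ∈ curve c} := by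
    rw [← image_armRange hl hd, hr, ← image_inter_preimage]; rfl
  rcases h with ⟨τ, F, h⟩ | ⟨rfl, h⟩
  · have hF : F ⊆ Ioi 0 := h.far_subset.trans (Ioi_subset_Ioi h.nonneg)
    refine ⟨line (armBase q a) a.idir '' Ioc 0 τ, line (armBase q a) a.idir '' F, ?_, ?_, ?_,
      h.far.configured hl hd (by rwa [hr])⟩
    · rw [hint, h.set_eq, image_union]
    · refine (disjoint_image_iff hinj).2 (Set.disjoint_left.2 fun t ht ht' => ?_)
      exact absurd (h.far_subset ht') (not_lt.2 ht.2)
    · by_cases hcard : (rightFace c (armBase q a) a.idir).card = 1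
      · rw [legOverlap, length_face_cell, hcard, h.eq_zero hcard]
        change line _ _ '' Ioc 0 0 = ∅
        rw [Ioc_self, image_empty]
      · obtain ⟨h1, h2, h3, h4⟩ := h.pos hcard
        rw [legOverlap, length_face_cell, htop, if_neg (by simpa using hcard),
          if_neg (by simpa using h4)]
        refine ⟨line (armBase q a) a.idir τ, ?_, h2, ?_, ?_⟩
        · rw [← image_armRange hl hd, hr]; exact mem_image_of_mem _ h1
        · have : insert (armBase q a) (line (armBase q a) a.idir '' Ioc 0 τ) =
              line (armBase q a) a.idir '' Icc 0 τ := by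
            rw [← Ioc_insert_left h1.le, image_insert_eq, line_zero]
          rw [this, image_line_Icc _ _ h1.le, line_zero]
        · rw [mult_arm hl (by rw [hr]; exact fun t ht => ht.1), finsum_width_Ioc _ _ _ h1,
            line_zero]
          omega
  · refine ⟨armInterior q a, ∅, ?_, disjoint_empty _, ?_, configured_empty c q⟩
    · rw [union_empty, inter_eq_left, ← image_armRange hl hd, hr]
      rintro _ ⟨t, ht, rfl⟩
      exact h.subset t (le_of_lt ht)
    · rw [legOverlap, length_face_cell, htop, if_neg (by simpa using h.card),
        if_pos (by simpa using h.top)]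
      refine ⟨(leg_eq_insert ha).symm, ?_⟩
      rw [← image_armRange hl hd, mult_arm hl subset_rfl, hr, finsum_width_Ioi, line_zero, h.top,
        sub_self]

theorem hint_diag (hl : 0 < q.2) : armInterior q .diag ∩ curve c =
    line (vertex q 0) (1, 1) '' {u ∈ Ioo 0 q.2 | line (vertex q 0) (1, 1) u ∈ curve c} := by
  rw [← image_armRange hl.le fun _ => hl]
  change line (vertex q 0) (1, 1) '' Ioo 0 q.2 ∩ curve c = _
  rw [← image_inter_preimage]; rfl

theorem DiagShape.pieces (hl : 0 < q.2) {s : Status} {τ τ' : ℝ} {F : Set ℝ}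
    (h : DiagShape c (vertex q 0) q.2 s τ τ' F) : ∃ Y Y' Z,
      armInterior q .diag ∩ curve c = Y ∪ Y' ∪ Z ∧ Disjoint Y Y' ∧ Disjoint Y Z ∧ Disjoint Y' Z ∧
      OverlapHas c q (vertex q 0) .diag (diagOverlap (cell c (vertex q 0)) (1, 1)) Y ∧
      OverlapHas c q (vertex q 1) .diag (diagOverlap (cell c (vertex q 1)) (-1, -1)) Y' ∧
      Configured c q Z (s.tangencies .diag) := by
  have hd : Arm.diag = .diag → 0 < q.2 := fun _ => hl
  have hinj := line_injective (vertex q 0) Arm.diag.idir_ne_zero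
  have hmem : ∀ t ∈ Ioo 0 q.2, line (vertex q 0) (1, 1) t ∈ armInterior q .diag := fun t ht => by
    rw [← image_armRange hl.le hd]; exact mem_image_of_mem _ ht
  have hmult : ∀ {I : Set ℝ}, I ⊆ Ioo 0 q.2 → mult c q (line (vertex q 0) (1, 1) '' I) =
      ∑ᶠ t ∈ I, width c (line (vertex q 0) (1, 1) t) (1, 1) := fun hI =>
    mult_arm (a := .diag) hl.le hI
  have hv1 : vertex q 1 = line (vertex q 0) (1, 1) q.2 := vertex_one_eq_line hl.le
  have hlt := h.lt
  have hle := h.le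
  have hnn := h.nonneg
  refine ⟨line (vertex q 0) (1, 1) '' Ioc 0 τ, line (vertex q 0) (1, 1) '' Ico τ' q.2,
    line (vertex q 0) (1, 1) '' F, ?_, ?_, ?_, ?_, ?_, ?_,
    h.far.configured (a := .diag) hl.le hd
      (h.far_subset.trans (Ioo_subset_Ioo h.nonneg h.le))⟩
  · rw [hint_diag hl, h.set_eq, image_union, image_union, union_right_comm]
  · refine (disjoint_image_iff hinj).2 (Set.disjoint_left.2 fun t ht ht' => ?_)
    linarith [ht.2, ht'.1]
  · refine (disjoint_image_iff hinj).2 (Set.disjoint_left.2 fun t ht ht' => ?_)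
    linarith [ht.2, (h.far_subset ht').1]
  · refine (disjoint_image_iff hinj).2 (Set.disjoint_left.2 fun t ht ht' => ?_)
    linarith [ht.1, (h.far_subset ht').2]
  · by_cases hcard : (rightFace c (vertex q 0) (1, 1)).card = 1
    · rw [diagOverlap, length_face_cell, hcard, h.eq_zero hcard]
      change line _ _ '' Ioc 0 0 = ∅
      rw [Ioc_self, image_empty]
    · obtain ⟨h1, h2, h3⟩ := h.pos hcard
      rw [diagOverlap, length_face_cell, if_neg (by simpa using hcard)]
      refine ⟨_, hmem τ ⟨h1, by linarith⟩, h2, ?_, ?_⟩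
      · have : insert (vertex q 0) (line (vertex q 0) (1, 1) '' Ioc 0 τ) =
            line (vertex q 0) (1, 1) '' Icc 0 τ := by
          rw [← Ioc_insert_left h1.le, image_insert_eq, line_zero]
        rw [this, image_line_Icc _ _ h1.le, line_zero]
      · rw [hmult fun t ht => ⟨ht.1, by linarith [ht.2]⟩, finsum_width_Ioc _ _ _ h1, line_zero]
        omega
  · by_cases hcard : (rightFace c (vertex q 1) (-1, -1)).card = 1
    · rw [diagOverlap, length_face_cell, hcard]
      rw [hv1] at hcard
      rw [h.eq_length hcard, Ico_self, image_empty]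
      rfl
    · rw [diagOverlap, length_face_cell, if_neg (by simpa using hcard)]
      rw [hv1] at hcard
      obtain ⟨h1, h2, h3⟩ := h.lt_length hcard
      refine ⟨_, hmem τ' ⟨by linarith, h1⟩, h2, ?_, ?_⟩
      · have : insert (vertex q 1) (line (vertex q 0) (1, 1) '' Ico τ' q.2) =
            line (vertex q 0) (1, 1) '' Icc τ' q.2 := by
          rw [hv1, ← Ico_insert_right h1.le, image_insert_eq]
        rw [this, image_line_Icc _ _ h1.le, hv1, segment_symm]
      · rw [hmult fun t ht => ⟨by linarith [ht.1], ht.2⟩, finsum_width_Ico _ _ _ h1]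
        omega

theorem dualCell_eq_pair {p : Plane} {m m' : Expo} (hcard : (dualCell c p).card = 2)
    (hm : m ∈ dualCell c p) (hm' : m' ∈ dualCell c p) (h : m ≠ m') : dualCell c p = {m, m'} :=
  (Finset.eq_of_subset_of_card_le (by simp [Finset.insert_subset_iff, hm, hm'])
    (by rw [hcard, Finset.card_pair h])).symm

theorem exists_hasStep {p : Plane} (h : hasStep (cell c p) = true) :
    ∃ m ∈ dualCell c p, ∃ m' ∈ dualCell c p, m'.toInt = m.toInt + (1, 1) := by
  simp only [hasStep, List.any_eq_true, beq_iff_eq, mem_cell] at h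
  exact h

theorem exists_isOpposite {p : Plane} {s : ℤ} (hcard : (dualCell c p).card = 3) (hs : s ≠ 0)
    (h : isOpposite (cell c p) s = true) : ∃ m m' m'' : Expo, dualCell c p = {m, m', m''} ∧
      m'.toInt = m.toInt + (s, 0) ∧ m''.toInt = m.toInt + (0, s) := by
  simp only [isOpposite, List.any_eq_true, beq_iff_eq, mem_cell, Bool.and_eq_true] at h
  obtain ⟨m, hm, m', hm', m'', hm'', h1, h2⟩ := h
  refine ⟨m, m', m'', (Finset.eq_of_subset_of_card_le
    (by simp [Finset.insert_subset_iff, hm, hm', hm'']) ?_).symm, h1, h2⟩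
  rw [hcard, Finset.card_eq_three.2 ⟨m, m', m'', ?_, ?_, ?_, rfl⟩]
  · rintro rfl; exact hs (by simpa [Prod.ext_iff] using h1)
  · rintro rfl; exact hs (by simpa [Prod.ext_iff] using h2)
  · rintro rfl
    rw [h1] at h2
    simp only [Prod.ext_iff, Prod.fst_add, Prod.snd_add] at h2
    exact hs (by omega)

theorem length_cell (c : Expo → ℝ) (p : Plane) : (cell c p).length = (dualCell c p).card :=
  length_toList _

/-- The multiplicity of the component is that of the vertex plus one for each bounded overlap: 1 + 1
for an overhang and 1 + 3 for a tripod. Overlaps in the form of rays add nothing. -/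
theorem configured_cluster (hl : 0 < q.2) {k : Fin 2} {x y : Arm} {s : ℤ}
    (harms : armsAt k = {x, y, .diag}) (hx : x ≠ .diag) (hy : y ≠ .diag) (hxy : x ≠ y)
    (hs : s ≠ 0) (hs1 : (![(-1, 0), (1, 0)] : Fin 2 → ℤ × ℤ) k = (s, 0))
    (hs2 : (![(0, -1), (0, 1)] : Fin 2 → ℤ × ℤ) k = (0, s)) {ox oy od : Overlap}
    {X Y D : Set Plane} (hX : OverlapHas c q (vertex q k) x ox X)
    (hY : OverlapHas c q (vertex q k) y oy Y) (hD : OverlapHas c q (vertex q k) .diag od D)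
    (hXs : X ⊆ armInterior q x) (hYs : Y ⊆ armInterior q y) (hDs : D ⊆ armInterior q .diag)
    (hoff : vertex q k ∉ curve c → ox = .none ∧ oy = .none ∧ od = .none) {L : List Tangency}
    (h : cluster k x y (cell c (vertex q k)) s (multAt c q (vertex q k)) ox oy od = some L) :
    Configured c q ({vertex q k} ∩ curve c ∪ X ∪ Y ∪ D) L := by
  have hlx := armInterior_subset_lam hl.le (fun h => absurd h hx : x = .diag → 0 < q.2)
  have hly := armInterior_subset_lam hl.le (fun h => absurd h hy : y = .diag → 0 < q.2)
  have hld := armInterior_subset_lam hl.le (fun _ => hl : Arm.diag = .diag → 0 < q.2)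
  have hv := vertex_mem_lam hl.le k
  have hvx := vertex_notMem_armInterior hl.le (fun h => absurd h hx : x = .diag → 0 < q.2) k
  have hvy := vertex_notMem_armInterior hl.le (fun h => absurd h hy : y = .diag → 0 < q.2) k
  have hvd := vertex_notMem_armInterior hl.le (fun _ => hl : Arm.diag = .diag → 0 < q.2) k
  have mx := mult_insert (c := c) hl.le hv (hXs.trans hlx) fun h => hvx (hXs h)
  have my := mult_insert (c := c) hl.le hv (hYs.trans hly) fun h => hvy (hYs h)
  have md := mult_insert (c := c) hl.le hv (hDs.trans hld) fun h => hvd (hDs h)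
  have hcurve : 2 ≤ (dualCell c (vertex q k)).card →
      {vertex q k} ∩ curve c = {vertex q k} := fun h =>
    inter_eq_left.2 (singleton_subset_iff.2 h)
  rw [show (cell c (vertex q k)) = toList (dualCell c (vertex q k)) from rfl] at h
  unfold cluster at h
  rw [show toList (dualCell c (vertex q k)) = cell c (vertex q k) from rfl, length_cell] at h
  split at h
  · next hcard =>
    have hnot : vertex q k ∉ curve c := fun h => by
      have := two_le_card_of_mem_curve h; omega
    obtain ⟨rfl, rfl, rfl⟩ := hoff hnot
    obtain rfl : L = [] := by simpa using h.symm
    have e : {vertex q k} ∩ curve c = ∅ := by simpa using hnot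
    change X = ∅ at hX
    change Y = ∅ at hY
    change D = ∅ at hD
    rw [hX, hY, hD, e]
    simpa using configured_empty c q
  · next hcard =>
    change X = ∅ at hX
    change Y = ∅ at hY
    change D = ∅ at hD
    rw [hX, hY, hD, hcurve (by omega), union_empty, union_empty, union_empty]
    split_ifs at h with h1 h2
    · obtain rfl := Option.some_injective _ h
      simp only [Bool.and_eq_true, beq_iff_eq] at h1
      obtain ⟨m, hm, m', hm', hstep⟩ := exists_hasStep h1.2
      refine configured_singleton ⟨by rw [mult_singleton, h1.1], rfl, m, m',
        dualCell_eq_pair hcard hm hm' ?_, hstep⟩ isClosed_singleton isConnected_singleton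
      rintro rfl
      simp [Prod.ext_iff] at hstep
    · obtain rfl := Option.some_injective _ h
      exact configured_singleton ⟨by rw [mult_singleton]; simpa using h2, rfl, hcard⟩
        isClosed_singleton isConnected_singleton
  · next hcard =>
    obtain ⟨A, hA, hA3, hAX, hA1⟩ := hX
    change Y = ∅ at hY
    change D = ∅ at hD
    rw [hY, hD, hcurve (by omega), union_empty, union_empty, singleton_union, hAX]
    split_ifs at h with h1
    obtain rfl := Option.some_injective _ h
    rw [beq_iff_eq] at h1
    exact configured_singleton ⟨by rw [← hAX, mx]; omega, by rw [harms]; simp, hcard, A, hA, hA3,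
      rfl⟩ (isClosed_segment _ _) (isConnected_segment _ _)
  · next hcard =>
    obtain ⟨A, hA, hA3, hAX, hA1⟩ := hY
    change X = ∅ at hX
    change D = ∅ at hD
    rw [hX, hD, hcurve (by omega), union_empty, union_empty, singleton_union, hAX]
    split_ifs at h with h1
    obtain rfl := Option.some_injective _ h
    rw [beq_iff_eq] at h1
    exact configured_singleton ⟨by rw [← hAX, my]; omega, by rw [harms]; simp, hcard, A, hA, hA3,
      rfl⟩ (isClosed_segment _ _) (isConnected_segment _ _)
  · next hcard =>
    obtain ⟨A, hA, hA3, hAX, hA1⟩ := hD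
    change X = ∅ at hX
    change Y = ∅ at hY
    rw [hX, hY, hcurve (by omega), union_empty, union_empty, singleton_union, hAX]
    split_ifs at h with h1
    obtain rfl := Option.some_injective _ h
    rw [beq_iff_eq] at h1
    exact configured_singleton ⟨by rw [← hAX, md]; omega, by rw [harms]; simp, hcard, A, hA, hA3,
      rfl⟩ (isClosed_segment _ _) (isConnected_segment _ _)
  · next hcard =>
    change X = ∅ at hX
    change Y = ∅ at hY
    change D = ∅ at hD
    rw [hX, hY, hD, hcurve (by omega), union_empty, union_empty, union_empty]
    split_ifs at h with h1
    obtain rfl := Option.some_injective _ h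
    simp only [Bool.and_eq_true, beq_iff_eq] at h1
    obtain ⟨m, m', m'', hm, hm', hm''⟩ := exists_isOpposite hcard hs h1.2
    exact configured_singleton ⟨by rw [mult_singleton, h1.1], rfl, m, m', m'', hm,
      by rw [hs1, hm'], by rw [hs2, hm'']⟩ isClosed_singleton isConnected_singleton
  · next hcard =>
    obtain ⟨hX1, hX2⟩ := hX
    change Y = ∅ at hY
    change D = ∅ at hD
    rw [hY, hD, hcurve (by omega), union_empty, union_empty, singleton_union, hX1]
    split_ifs at h with h1
    obtain rfl := Option.some_injective _ h
    simp only [Bool.and_eq_true, beq_iff_eq] at h1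
    exact configured_singleton ⟨by rw [← hX1, mx]; omega, by rw [harms]; simp, hx, hcard, rfl,
      exists_hasStep h1.2⟩ (isClosed_leg hl.le hx) (isConnected_leg q x)
  · next hcard =>
    obtain ⟨hY1, hY2⟩ := hY
    change X = ∅ at hX
    change D = ∅ at hD
    rw [hX, hD, hcurve (by omega), union_empty, union_empty, singleton_union, hY1]
    split_ifs at h with h1
    obtain rfl := Option.some_injective _ h
    simp only [Bool.and_eq_true, beq_iff_eq] at h1
    exact configured_singleton ⟨by rw [← hY1, my]; omega, by rw [harms]; simp, hy, hcard, rfl,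
      exists_hasStep h1.2⟩ (isClosed_leg hl.le hy) (isConnected_leg q y)
  · next hcard =>
    obtain ⟨A, hA, hA3, hAX, hA1⟩ := hX
    obtain ⟨B, hB, hB3, hBY, hB1⟩ := hY
    obtain ⟨C, hC, hC3, hCD, hC1⟩ := hD
    split_ifs at h with h1
    obtain rfl := Option.some_injective _ h
    rw [beq_iff_eq] at h1
    rw [hcurve (by omega)]
    have e : {vertex q k} ∪ X ∪ Y ∪ D = segment ℝ (vertex q k) A ∪ segment ℝ (vertex q k) B ∪
        segment ℝ (vertex q k) C := by
      rw [← hAX, ← hBY, ← hCD]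
      ext p; simp only [mem_union, mem_insert_iff, mem_singleton_iff]; tauto
    have hm : mult c q ({vertex q k} ∪ X ∪ Y ∪ D) = 4 := by
      rw [mult_union c hl.le _ (hDs.trans hld), mult_union c hl.le _ (hYs.trans hly),
        singleton_union, mx]
      · omega
      · exact Set.disjoint_left.2 fun p hp hp' => hp.elim
          (fun h => hvy (h ▸ hYs hp')) fun h => Set.disjoint_left.1 (armInterior_disjoint hl.le
            (fun h => absurd h hx) (fun h => absurd h hy) hxy) (hXs h) (hYs hp')
      · exact union_subset (singleton_subset_iff.2 hv) (hXs.trans hlx)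
      · exact Set.disjoint_left.2 fun p hp hp' => hp.elim (fun h => h.elim
          (fun h => hvd (h ▸ hDs hp')) fun h => Set.disjoint_left.1 (armInterior_disjoint hl.le
            (fun h => absurd h hx) (fun _ => hl) hx) (hXs h) (hDs hp'))
          fun h => Set.disjoint_left.1 (armInterior_disjoint hl.le
            (fun h => absurd h hy) (fun _ => hl) hy) (hYs h) (hDs hp')
      · exact union_subset (union_subset (singleton_subset_iff.2 hv) (hXs.trans hlx))
          (hYs.trans hly)
    rw [e] at hm ⊢
    refine configured_singleton ⟨hm, hcard,
      fun a => if a = x then A else if a = y then B else C, ?_, ?_⟩ ?_ ?_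
    · intro a ha
      rw [harms] at ha
      simp only [Finset.mem_insert, Finset.mem_singleton] at ha
      rcases ha with rfl | rfl | rfl
      · simp [hA, hA3]
      · simp [hB, hB3, hxy.symm]
      · simp [hC, hC3, hx.symm, hy.symm]
    · rw [harms]
      ext p
      simp [hxy.symm, hx.symm, hy.symm, or_assoc]
    · exact ((isClosed_segment _ _).union (isClosed_segment _ _)).union (isClosed_segment _ _)
    · refine IsConnected.union ⟨vertex q k, Or.inl (left_mem_segment ℝ _ _),
        left_mem_segment ℝ _ _⟩ (IsConnected.union ⟨vertex q k, left_mem_segment ℝ _ _,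
        left_mem_segment ℝ _ _⟩ (isConnected_segment _ _) (isConnected_segment _ _))
        (isConnected_segment _ _)
  · exact absurd h (by simp)

end Pieces

/-! ### Assembly of all components of the intersection -/

section Assembly


theorem multLower_cell (hl : 0 < q.2) : multLower (cell c (vertex q 0)) = multAt c q (vertex q 0) := by
  rw [vertex_zero, multAt_lower c hl, multLower, top_cell _ _ (by decide), top_cell _ _ (by decide),
    top_cell _ _ (by decide)]

theorem multUpper_cell (hl : 0 < q.2) : multUpper (cell c (vertex q 1)) = multAt c q (vertex q 1) := by
  rw [multAt_upper c hl, multUpper, top_cell _ _ (by decide), top_cell _ _ (by decide),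
    top_cell _ _ (by decide)]

theorem vertex_ne (hl : 0 < q.2) : vertex q 0 ≠ vertex q 1 := fun h => by
  have := congrArg Prod.fst h
  rw [vertex_zero, vertex_one] at this
  simp only at this
  linarith

theorem lam_inter_curve (hl : 0 ≤ q.2) : lam q ∩ curve c = {vertex q 0} ∩ curve c ∪
    {vertex q 1} ∩ curve c ∪ armInterior q .west ∩ curve c ∪ armInterior q .south ∩ curve c ∪
    armInterior q .east ∩ curve c ∪ armInterior q .north ∩ curve c ∪
    line (vertex q 0) (1, 1) '' Ioo 0 q.2 ∩ curve c := by
  simp only [← union_inter_distrib_right]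
  congr 1
  ext p
  constructor
  · intro hp
    rcases mem_lam_cases hl hp with rfl | rfl | ⟨a, ha, t, ht, rfl⟩ | ⟨t, h1, h2, rfl⟩
    · simp [vertex_zero]
    · simp
    · have : line (armBase q a) a.idir t ∈ armInterior q a := by
        rw [← image_armRange hl fun h => absurd h ha, armRange_of_ne ha]
        exact mem_image_of_mem _ ht
      cases a <;> simp_all
    · exact Or.inr (mem_image_of_mem _ ⟨h1, h2⟩)
  · rintro ((((((rfl | rfl) | hp) | hp) | hp) | hp) | ⟨t, ht, rfl⟩)
    · exact vertex_mem_lam hl 0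
    · exact vertex_mem_lam hl 1
    · exact armInterior_subset_lam hl (by simp) hp
    · exact armInterior_subset_lam hl (by simp) hp
    · exact armInterior_subset_lam hl (by simp) hp
    · exact armInterior_subset_lam hl (by simp) hp
    · exact line_mem_lam_diag ht.1.le ht.2.le

theorem subset_of_inter_eq_left {A B X Y : Set Plane} (h : A ∩ B = X ∪ Y) : X ⊆ A :=
  subset_union_left.trans (h.symm.subset.trans inter_subset_left)

theorem subset_of_inter_eq_right {A B X Y : Set Plane} (h : A ∩ B = X ∪ Y) : Y ⊆ A :=
  subset_union_right.trans (h.symm.subset.trans inter_subset_left)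

theorem disjoint_of_subset_arms (hl : 0 < q.2) {a b : Arm} {X Y : Set Plane}
    (hX : X ⊆ armInterior q a) (hY : Y ⊆ armInterior q b) (hab : a ≠ b) : Disjoint X Y :=
  (armInterior_disjoint hl.le (fun _ => hl) (fun _ => hl) hab).mono hX hY

theorem disjoint_vertex (hl : 0 < q.2) {a : Arm} {X : Set Plane} (k : Fin 2)
    (hX : X ⊆ armInterior q a) : Disjoint ({vertex q k} ∩ curve c) X :=
  Set.disjoint_left.2 fun _ hp hp' =>
    vertex_notMem_armInterior hl.le (fun _ => hl) k (hp.1 ▸ hX hp')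

theorem DiagShape.not_bridge {w : Status} {τ τ' : ℝ} {F : Set ℝ} (hl : 0 < q.2)
    (h : DiagShape c (vertex q 0) q.2 w τ τ' F) :
    ((face (cell c (vertex q 0)) (1, 1)).length != 1 &&
      top (cell c (vertex q 0)) (1, 1) + top (cell c (vertex q 1)) (-1, -1) == 0) = false := by
  rw [length_face_cell, top_diag, top_neg_diag, vertex_one_eq_line hl.le, ← vertex_zero,
    Bool.and_eq_false_iff]
  by_cases hcard : (rightFace c (vertex q 0) (1, 1)).card = 1
  · left; simp [hcard]
  · right
    have := h.ne hcard
    rw [beq_eq_false_iff_ne]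
    omega

theorem IsBridge.bridge (hl : 0 < q.2) (h : IsBridge c (vertex q 0) q.2) :
    ((face (cell c (vertex q 0)) (1, 1)).length != 1 &&
      top (cell c (vertex q 0)) (1, 1) + top (cell c (vertex q 1)) (-1, -1) == 0) = true := by
  rw [length_face_cell, top_diag, top_neg_diag, vertex_one_eq_line hl.le, ← vertex_zero,
    h.slope_eq]
  simpa using h.card

theorem IsBridge.mult_eq (hl : 0 < q.2) (h : IsBridge c (vertex q 0) q.2) :
    mult c q (armInterior q .diag) = 0 := by
  rw [← image_armRange hl.le fun _ => hl, mult_arm hl.le subset_rfl]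
  change ∑ᶠ t ∈ Ioo 0 q.2, width c (line (vertex q 0) (1, 1) t) (1, 1) = 0
  rw [finsum_width_Ioo _ _ _ hl, line_zero, h.slope_eq, sub_self]

theorem insert_insert_armInterior_diag (q : Param) :
    segment ℝ (vertex q 0) (vertex q 1) =
      {vertex q 0} ∪ {vertex q 1} ∪ armInterior q .diag := by
  rw [segment_eq_image_lineMap]
  ext p
  constructor
  · intro hp
    rw [← segment_eq_image_lineMap, ← insert_endpoints_openSegment] at hp
    rcases hp with rfl | rfl | hp
    · simp
    · simp
    · exact Or.inr hp
  · rintro ((rfl | rfl) | hp)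
    · rw [← segment_eq_image_lineMap]; exact left_mem_segment ℝ _ _
    · rw [← segment_eq_image_lineMap]; exact right_mem_segment ℝ _ _
    · rw [← segment_eq_image_lineMap]; exact openSegment_subset_segment ℝ _ _ hp

/-- The slope is constant along the edge, so its interior contributes nothing and the two vertices
contribute two together. Four bounded overlaps on the legs raise this to six. -/
theorem configured_bridge (hl : 0 < q.2) (hb : IsBridge c (vertex q 0) q.2)
    {ow os oe on : Overlap} {W S E N : Set Plane} {L : List Tangency}
    (h : (match ow, os, oe, on with
      | .none, .none, .none, .none =>
        if (cell c (vertex q 0)).length == 2 && (cell c (vertex q 1)).length == 2 &&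
          multLower (cell c (vertex q 0)) + multUpper (cell c (vertex q 1)) == 2 then
          some [.wholeEdge] else none
      | .segment, .segment, .segment, .segment =>
        if (cell c (vertex q 0)).length == 3 && (cell c (vertex q 1)).length == 3 &&
          multLower (cell c (vertex q 0)) + multUpper (cell c (vertex q 1)) == 2 then
          some [.tree] else none
      | _, _, _, _ => none) = some L)
    (hW : OverlapHas c q (vertex q 0) .west ow W)
    (hS : OverlapHas c q (vertex q 0) .south os S) (hE : OverlapHas c q (vertex q 1) .east oe E)
    (hN : OverlapHas c q (vertex q 1) .north on N) (hWs : W ⊆ armInterior q .west)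
    (hSs : S ⊆ armInterior q .south) (hEs : E ⊆ armInterior q .east)
    (hNs : N ⊆ armInterior q .north) :
    Configured c q ({vertex q 0} ∪ {vertex q 1} ∪ armInterior q .diag ∪ W ∪ S ∪ E ∪ N) L := by
  have hsub : ∀ a, armInterior q a ⊆ lam q := fun a => armInterior_subset_lam hl.le fun _ => hl
  have hbase : mult c q ({vertex q 0} ∪ {vertex q 1} ∪ armInterior q .diag) =
      multAt c q (vertex q 0) + multAt c q (vertex q 1) := by
    have h0 := vertex_notMem_armInterior (q := q) hl.le (fun _ => hl : Arm.diag = .diag → _)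
    rw [union_assoc, singleton_union, singleton_union, mult_insert hl.le (vertex_mem_lam hl.le 0)
      (insert_subset (vertex_mem_lam hl.le 1) (hsub _)), mult_insert hl.le (vertex_mem_lam hl.le 1)
      (hsub _) (h0 1), hb.mult_eq hl, add_zero]
    rintro (h | h)
    · exact vertex_ne hl h
    · exact h0 0 h
  rw [multLower_cell hl, multUpper_cell hl, length_cell, length_cell] at h
  split at h
  · change W = ∅ at hW
    change S = ∅ at hS
    change E = ∅ at hE
    change N = ∅ at hN
    split_ifs at h with h1
    obtain rfl := Option.some_injective _ h
    simp only [Bool.and_eq_true, beq_iff_eq] at h1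
    rw [hW, hS, hE, hN, union_empty, union_empty, union_empty, union_empty]
    rw [h1.2, ← insert_insert_armInterior_diag q] at hbase
    rw [← insert_insert_armInterior_diag q]
    refine configured_singleton ⟨hbase, fun k => ?_, rfl⟩ (isClosed_segment _ _)
      (isConnected_segment _ _)
    fin_cases k
    · exact h1.1.1
    · exact h1.1.2
  · obtain ⟨A, hA, hA3, hAW, hA1⟩ := hW
    obtain ⟨B, hB, hB3, hBS, hB1⟩ := hS
    obtain ⟨C, hC, hC3, hCE, hC1⟩ := hE
    obtain ⟨D, hD, hD3, hDN, hD1⟩ := hN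
    split_ifs at h with h1
    obtain rfl := Option.some_injective _ h
    simp only [Bool.and_eq_true, beq_iff_eq] at h1
    have hv : ∀ k, {vertex q k} ⊆ lam q := fun k =>
      singleton_subset_iff.2 (vertex_mem_lam hl.le k)
    have hdv : ∀ (k) {a : Arm} {X : Set Plane}, X ⊆ armInterior q a → Disjoint {vertex q k} X :=
      fun k a X hX => disjoint_singleton_left.2 fun h =>
        vertex_notMem_armInterior hl.le (fun _ => hl) k (hX h)
    have hda : ∀ {a b : Arm} {X Y : Set Plane}, X ⊆ armInterior q a → Y ⊆ armInterior q b →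
      a ≠ b → Disjoint X Y := fun h h' h'' => disjoint_of_subset_arms hl h h' h''
    have hm : mult c q ({vertex q 0} ∪ {vertex q 1} ∪ armInterior q .diag ∪ W ∪ S ∪ E ∪ N) = 6 := by
      have s1 := union_subset (union_subset (hv 0) (hv 1)) (hsub .diag)
      have s2 := union_subset s1 (hWs.trans (hsub _))
      have s3 := union_subset s2 (hSs.trans (hsub _))
      have s4 := union_subset s3 (hEs.trans (hsub _))
      rw [mult_union c hl.le s4 (hNs.trans (hsub _)), mult_union c hl.le s3 (hEs.trans (hsub _)),
        mult_union c hl.le s2 (hSs.trans (hsub _)), mult_union c hl.le s1 (hWs.trans (hsub _)),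
        hbase]
      · omega
      all_goals simp only [disjoint_union_left]
      · exact ⟨⟨hdv 0 hWs, hdv 1 hWs⟩, hda subset_rfl hWs (by decide)⟩
      · exact ⟨⟨⟨hdv 0 hSs, hdv 1 hSs⟩, hda subset_rfl hSs (by decide)⟩, hda hWs hSs (by decide)⟩
      · exact ⟨⟨⟨⟨hdv 0 hEs, hdv 1 hEs⟩, hda subset_rfl hEs (by decide)⟩, hda hWs hEs (by decide)⟩,
          hda hSs hEs (by decide)⟩
      · exact ⟨⟨⟨⟨⟨hdv 0 hNs, hdv 1 hNs⟩, hda subset_rfl hNs (by decide)⟩,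
          hda hWs hNs (by decide)⟩, hda hSs hNs (by decide)⟩, hda hEs hNs (by decide)⟩
    have e : {vertex q 0} ∪ {vertex q 1} ∪ armInterior q .diag ∪ W ∪ S ∪ E ∪ N =
        segment ℝ (vertex q 0) (vertex q 1) ∪ segment ℝ (vertex q 0) A ∪ segment ℝ (vertex q 0) B ∪
        segment ℝ (vertex q 1) C ∪ segment ℝ (vertex q 1) D := by
      rw [← hAW, ← hBS, ← hCE, ← hDN, insert_insert_armInterior_diag q]
      ext p; simp only [mem_union, mem_insert_iff, mem_singleton_iff]; tauto
    rw [e] at hm ⊢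
    have hbW : armBase q .west = vertex q 0 := if_pos hl.le
    have hbE : armBase q .east = vertex q 1 := if_pos hl.le
    have hbS : armBase q .south = vertex q 0 := rfl
    have hbN : armBase q .north = vertex q 1 := rfl
    refine configured_singleton ⟨hm, fun k => ?_, fun a => match a with
      | .west => A | .south => B | .east => C | .north => D | .diag => A, ?_, ?_⟩ ?_ ?_
    · fin_cases k
      · exact h1.1.1
      · exact h1.1.2
    · intro a ha
      cases a
      · exact ⟨hA, hA3⟩
      · exact ⟨hB, hB3⟩
      · exact ⟨hC, hC3⟩
      · exact ⟨hD, hD3⟩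
      · exact absurd rfl ha
    · ext p
      simp only [mem_union, mem_iUnion, Subtype.exists]
      constructor
      · rintro ((((h | h) | h) | h) | h)
        · exact Or.inl h
        · exact Or.inr ⟨.west, by decide, by rw [hbW]; exact h⟩
        · exact Or.inr ⟨.south, by decide, h⟩
        · exact Or.inr ⟨.east, by decide, by rw [hbE]; exact h⟩
        · exact Or.inr ⟨.north, by decide, h⟩
      · rintro (h | ⟨a, ha, h⟩)
        · tauto
        · cases a
          · rw [hbW] at h; tauto
          · rw [hbS] at h; tauto
          · rw [hbE] at h; tauto
          · rw [hbN] at h; tauto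
          · exact absurd rfl ha
    · exact ((((isClosed_segment _ _).union (isClosed_segment _ _)).union
        (isClosed_segment _ _)).union (isClosed_segment _ _)).union (isClosed_segment _ _)
    · have hl' := left_mem_segment ℝ (vertex q 0) (vertex q 1)
      have hr' := right_mem_segment ℝ (vertex q 0) (vertex q 1)
      refine IsConnected.union ⟨vertex q 1, Or.inl (Or.inl (Or.inl hr')), left_mem_segment ℝ _ _⟩
        (IsConnected.union ⟨vertex q 1, Or.inl (Or.inl hr'), left_mem_segment ℝ _ _⟩
        (IsConnected.union ⟨vertex q 0, Or.inl hl', left_mem_segment ℝ _ _⟩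
        (IsConnected.union ⟨vertex q 0, hl', left_mem_segment ℝ _ _⟩ ?_ ?_) ?_) ?_) ?_ <;>
      exact isConnected_segment _ _
  · exact absurd h (by simp)

/-- The intersection is the disjoint union of the clusters at the vertices and the crossings in the
arms. All pieces are closed and connected, so they are the components. -/
theorem HasStatuses.hasConfiguration (hl : 0 < q.2) {w s e n d : Status}
    (h : HasStatuses c q w s e n d) {L : List Tangency}
    (hL : tangencies (cell c (vertex q 0)) (cell c (vertex q 1)) w s e n d = some L) :
    HasConfiguration c q L := by
  refine Configured.hasConfiguration ?_
  obtain ⟨e1, e2, e3, e4⟩ := endSlope_values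
  have hbW : armBase q .west = vertex q 0 := if_pos hl.le
  have hbE : armBase q .east = vertex q 1 := if_pos hl.le
  have hbS : armBase q .south = vertex q 0 := rfl
  have hbN : armBase q .north = vertex q 1 := rfl
  obtain ⟨Yw, Zw, iw, dw, ow, cw⟩ := LegHas.pieces (a := .west) hl.le (by decide)
    (by rw [hbW]; exact h.west)
  obtain ⟨Ys, Zs, is, ds, os, cs⟩ := LegHas.pieces (a := .south) hl.le (by decide) h.south
  obtain ⟨Ye, Ze, ie, de, oe, ce⟩ := LegHas.pieces (a := .east) hl.le (by decide)
    (by rw [hbE]; exact h.east)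
  obtain ⟨Yn, Zn, iN, dn, on, cn⟩ := LegHas.pieces (a := .north) hl.le (by decide) h.north
  simp only [hbW, hbE, hbS, hbN, Arm.idir, e1, e2, e3, e4] at ow os oe on
  have yw := subset_of_inter_eq_left iw
  have ys := subset_of_inter_eq_left is
  have ye := subset_of_inter_eq_left ie
  have yn := subset_of_inter_eq_left iN
  have zw := subset_of_inter_eq_right iw
  have zs := subset_of_inter_eq_right is
  have ze := subset_of_inter_eq_right ie
  have zn := subset_of_inter_eq_right iN
  have hlam := lam_inter_curve (c := c) hl.le
  have hD : line (vertex q 0) (1, 1) '' Ioo 0 q.2 = armInterior q .diag :=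
    image_armRange (a := .diag) hl.le fun _ => hl
  rw [hD, iw, is, ie, iN] at hlam
  have hvv : Disjoint ({vertex q 0} ∩ curve c) ({vertex q 1} ∩ curve c) :=
    Set.disjoint_left.2 fun p hp hp' => vertex_ne hl (hp.1.symm.trans hp'.1)
  rw [tangencies, Option.map_eq_some_iff] at hL
  obtain ⟨L₀, hL₀, rfl⟩ := hL
  unfold vertexTangencies at hL₀
  rcases h.diag with ⟨τ, τ', F, hd⟩ | ⟨rfl, hb⟩
  · rw [hd.not_bridge hl] at hL₀
    obtain ⟨Yd, Yd', Zd, iD, d1, d2, d3, od, od', cd⟩ := hd.pieces hl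
    have zd := subset_of_inter_eq_right iD
    have yd := subset_union_left.trans (subset_of_inter_eq_left iD)
    have yd' := subset_union_right.trans (subset_of_inter_eq_left iD)
    rw [multLower_cell hl, multUpper_cell hl] at hL₀
    simp only [Bool.false_eq_true, if_false] at hL₀
    split at hL₀
    · next L L' h0 h1 =>
      obtain rfl := Option.some_injective _ hL₀
      have c0 := configured_cluster hl (k := 0) rfl (by decide) (by decide) (by decide) (by decide)
        rfl rfl ow os od yw ys yd (fun hv => ⟨legOverlap_of_notMem hv _ _,
          legOverlap_of_notMem hv _ _, diagOverlap_of_notMem hv _⟩) h0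
      have c1 := configured_cluster hl (k := 1) rfl (by decide) (by decide) (by decide) (by decide)
        rfl rfl oe on od' ye yn yd' (fun hv => ⟨legOverlap_of_notMem hv _ _,
          legOverlap_of_notMem hv _ _, diagOverlap_of_notMem hv _⟩) h1
      have key := (c0.union c1 ?_).union (cw.union (cs.union (ce.union (cn.union cd ?_) ?_) ?_) ?_)
        ?_
      · rw [hlam, iD]
        convert key using 1
        ac_rfl
      all_goals
        try simp only [disjoint_union_left, disjoint_union_right]
        and_intros
        all_goals first
          | with_reducible assumption
          | with_reducible exact disjoint_vertex hl _ (by assumption)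
          | with_reducible exact (disjoint_vertex hl _ (by assumption)).symm
          | exact disjoint_of_subset_arms hl (by with_reducible assumption)
              (by with_reducible assumption) (by decide)
    · exact absurd hL₀ (by simp)
  · rw [hb.bridge hl] at hL₀
    simp only [if_true] at hL₀
    have cb := configured_bridge hl hb hL₀ ow os oe on yw ys ye yn
    have hcv : ∀ k, {vertex q k} ∩ curve c = {vertex q k} := fun k => by
      refine inter_eq_left.2 (singleton_subset_iff.2 ?_)
      fin_cases k
      · have := hb.subset 0 ⟨le_rfl, hl.le⟩
        rwa [line_zero] at this
      · have := hb.subset q.2 ⟨hl.le, le_rfl⟩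
        rw [vertex_zero, ← vertex_one_eq_line hl.le] at this
        exact this
    have hcd : armInterior q .diag ∩ curve c = armInterior q .diag := by
      refine inter_eq_left.2 ?_
      rw [← hD]
      rintro _ ⟨t, ht, rfl⟩
      exact hb.subset t ⟨ht.1.le, ht.2.le⟩
    have hv : ∀ (k) {a : Arm} {X : Set Plane}, X ⊆ armInterior q a → Disjoint {vertex q k} X :=
      fun k a X hX => by rw [← hcv]; exact disjoint_vertex hl k hX
    have yd := subset_refl (armInterior q .diag)
    have key := cb.union (cw.union (cs.union (ce.union cn ?_) ?_) ?_) ?_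
    · rw [hlam, hcv, hcv, hcd]
      rw [show Status.none.tangencies .diag = [] from rfl, List.append_nil]
      convert key using 1
      ac_rfl
    all_goals
      try simp only [disjoint_union_left, disjoint_union_right]
      and_intros
      all_goals first
        | with_reducible assumption
        | with_reducible exact hv _ (by assumption)
        | exact disjoint_of_subset_arms hl (by with_reducible assumption)
            (by with_reducible assumption) (by decide)

end Assembly

/-! ### Symmetries and configurations -/

/-- The action on the plane as a linear map. -/
def Sym.linear (g : Sym) : Plane →ₗ[ℝ] Plane where
  toFun := g.onPlane
  map_add' p p' := by simpa using g.onPlane_add_smul p p' 1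
  map_smul' t p := by
    have h0 : g.onPlane 0 = 0 := by
      obtain ⟨a, b, d⟩ := g
      cases a <;> cases b <;> cases d <;> simp [Sym.onPlane]
    simpa [h0] using g.onPlane_add_smul 0 p t

theorem Sym.image_segment (g : Sym) (p p' : Plane) :
    g.onPlane '' segment ℝ p p' = segment ℝ (g.onPlane p) (g.onPlane p') :=
  _root_.image_segment ℝ g.linear.toAffineMap p p'

theorem Sym.image_openSegment (g : Sym) (p p' : Plane) :
    g.onPlane '' openSegment ℝ p p' = openSegment ℝ (g.onPlane p) (g.onPlane p') :=
  _root_.image_openSegment ℝ g.linear.toAffineMap p p'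

theorem Sym.onDir_add (g : Sym) (r s : ℤ × ℤ) : g.onDir (r + s) = g.onDir r + g.onDir s := by
  obtain ⟨a, b, d⟩ := g
  cases a <;> cases b <;> cases d <;> ext <;> simp [Sym.onDir] <;> ring

theorem Sym.exists_comp (g h : Sym) : ∃ k : Sym, (∀ m, k.onExpo m = h.onExpo (g.onExpo m)) ∧
    ∀ p, k.onPlane p = h.onPlane (g.onPlane p) := by
  -- In the composition the reflections of `g` are moved past the swap of `h`, which exchanges them.
  refine ⟨⟨g.swap ^^ h.swap, h.flipX ^^ (if h.swap then g.flipY else g.flipX),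
    h.flipY ^^ (if h.swap then g.flipX else g.flipY)⟩, fun m => ?_, fun p => ?_⟩
  · obtain ⟨a, b, d⟩ := g
    obtain ⟨a', b', d'⟩ := h
    cases a <;> cases b <;> cases d <;> cases a' <;> cases b' <;> cases d' <;> simp [Sym.onExpo]
  · obtain ⟨a, b, d⟩ := g
    obtain ⟨a', b', d'⟩ := h
    cases a <;> cases b <;> cases d <;> cases a' <;> cases b' <;> cases d' <;> simp [Sym.onPlane]

theorem InTableUpToSymmetry.of_maps {g : Sym} {c c' : Expo → ℝ} {q q' : Param} {π : Movement}
    (h : g.Maps c c' q q') (ht : InTableUpToSymmetry c' q' π) : InTableUpToSymmetry c q π := by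
  obtain ⟨g', c'', q'', h1, h2, h3⟩ := ht
  obtain ⟨k, hk, hk'⟩ := g.exists_comp g'
  refine ⟨k, c'', q'', fun m => by rw [hk, h1, h.coeff], ?_, h3⟩
  rw [h2, h.lam_eq, image_image]
  exact image_congr fun p _ => (hk' p).symm

theorem InTable.upToSymmetry {π : Movement} (h : InTable c q π) :
    InTableUpToSymmetry c q π :=
  ⟨⟨false, false, false⟩, c, q, fun _ => rfl,
    by rw [show (Sym.mk false false false).onPlane = id from rfl, image_id], h⟩

/-- The actions of a symmetry on arms and vertices, for curves with an edge of slope one. -/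
structure Sym.Compatible (g : Sym) (f : Arm → Arm) (φ : Fin 2 → Fin 2) : Prop where
  involutive : ∀ a, f (f a) = a
  involutive' : ∀ k, φ (φ k) = k
  arms : ∀ k a, f a ∈ armsAt (φ k) ↔ a ∈ armsAt k
  diag : ∀ a, f a = .diag ↔ a = .diag
  step : g.onDir (1, 1) = (1, 1) ∨ g.onDir (1, 1) = (-1, -1)
  opposite : ∀ k, (g.onDir ((![(-1, 0), (1, 0)] : Fin 2 → ℤ × ℤ) k) =
      (![(-1, 0), (1, 0)] : Fin 2 → ℤ × ℤ) (φ k) ∧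
      g.onDir ((![(0, -1), (0, 1)] : Fin 2 → ℤ × ℤ) k) =
        (![(0, -1), (0, 1)] : Fin 2 → ℤ × ℤ) (φ k)) ∨
    (g.onDir ((![(-1, 0), (1, 0)] : Fin 2 → ℤ × ℤ) k) =
      (![(0, -1), (0, 1)] : Fin 2 → ℤ × ℤ) (φ k) ∧
      g.onDir ((![(0, -1), (0, 1)] : Fin 2 → ℤ × ℤ) k) =
        (![(-1, 0), (1, 0)] : Fin 2 → ℤ × ℤ) (φ k))

/-- The pair `(c', q')` is the image of `(c, q)`, with the given action on arms and vertices. -/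
structure Sym.MapsArms (g : Sym) (f : Arm → Arm) (φ : Fin 2 → Fin 2) (c c' : Expo → ℝ)
    (q q' : Param) : Prop extends g.Maps c c' q q', g.Compatible f φ where
  vertex_eq : ∀ k, vertex q' (φ k) = g.onPlane (vertex q k)
  base_eq : ∀ a, a ≠ .diag → armBase q' (f a) = g.onPlane (armBase q a)
  dir_eq : ∀ a, (f a).dir = g.onPlane a.dir
  diag_eq : armInterior q' .diag = g.onPlane '' armInterior q .diag

/-! ### Transport of tangency types along symmetries -/

section Transport

variable {g : Sym} {f : Arm → Arm} {φ : Fin 2 → Fin 2} {c c' : Expo → ℝ} {q q' : Param}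

theorem armInterior_of_ne {a : Arm} (ha : a ≠ .diag) :
    armInterior q a = {p | ∃ t : ℝ, 0 < t ∧ p = armBase q a + t • a.dir} := by
  cases a <;> first | rfl | exact absurd rfl ha

theorem Sym.MapsArms.interior_eq (h : g.MapsArms f φ c c' q q') (a : Arm) :
    armInterior q' (f a) = g.onPlane '' armInterior q a := by
  by_cases ha : a = .diag
  · rw [ha, (h.diag .diag).2 rfl, h.diag_eq]
  · rw [armInterior_of_ne ha, armInterior_of_ne (mt (h.diag a).1 ha), h.base_eq a ha, h.dir_eq]
    ext p
    constructor
    · rintro ⟨t, ht, rfl⟩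
      exact ⟨_, ⟨t, ht, rfl⟩, g.onPlane_add_smul _ _ _⟩
    · rintro ⟨_, ⟨t, ht, rfl⟩, rfl⟩
      exact ⟨t, ht, g.onPlane_add_smul _ _ _⟩

theorem Sym.MapsArms.leg_eq (h : g.MapsArms f φ c c' q q') {a : Arm} (ha : a ≠ .diag) :
    leg q' (f a) = g.onPlane '' leg q a := by
  rw [leg_eq_insert ha, leg_eq_insert (mt (h.diag a).1 ha), h.interior_eq, h.base_eq a ha,
    image_insert_eq]

theorem dualCell_onPlane_pair (hc : ∀ m, c' (g.onExpo m) = c m) {p : Plane} {m m' : Expo}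
    (h : dualCell c p = {m, m'}) : dualCell c' (g.onPlane p) = {g.onExpo m, g.onExpo m'} := by
  rw [dualCell_onPlane hc, h]; simp [Finset.map_insert]

theorem Sym.Compatible.exists_step (h : g.Compatible f φ) {m m' : Expo}
    (hm : m'.toInt = m.toInt + (1, 1)) :
    (g.onExpo m').toInt = (g.onExpo m).toInt + (1, 1) ∨
      (g.onExpo m).toInt = (g.onExpo m').toInt + (1, 1) := by
  rw [g.toInt_onExpo, g.toInt_onExpo, hm, g.onDir_add]
  generalize g.onDir m.toInt = z
  generalize g.origin = w
  rcases h.step with h | h <;> rw [h]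
  · left; ext <;> simp <;> ring
  · right; ext <;> simp <;> ring

theorem Realizes.interiorEdge (h : g.Maps c c' q q') {a b : Arm} {K : Set Plane}
    (hab : armInterior q' b = g.onPlane '' armInterior q a) (hK : K ⊆ lam q)
    (hr : Realizes c q (.interiorEdge a) K) :
    Realizes c' q' (.interiorEdge b) (g.onPlane '' K) := by
  obtain ⟨h1, A, hA, B, hB, hne, hA3, hB3, rfl⟩ := hr
  refine ⟨by rw [h.mult_eq hK, h1], g.onPlane A, ?_, g.onPlane B, ?_,
    fun h => hne (g.onPlane_injective h), ?_, ?_, g.image_segment A B⟩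
  · rw [hab]; exact mem_image_of_mem _ hA
  · rw [hab]; exact mem_image_of_mem _ hB
  · rw [card_dualCell_onPlane h.coeff, hA3]
  · rw [card_dualCell_onPlane h.coeff, hB3]

theorem Sym.MapsArms.image_segment_vertex (h : g.MapsArms f φ c c' q q') :
    g.onPlane '' segment ℝ (vertex q 0) (vertex q 1) =
      segment ℝ (vertex q' 0) (vertex q' 1) := by
  have hf : φ 0 = 0 ∧ φ 1 = 1 ∨ φ 0 = 1 ∧ φ 1 = 0 := by
    have h0 := h.involutive' 0
    have h1 := h.involutive' 1
    revert h0 h1; generalize φ 0 = x; generalize hy : φ 1 = y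
    have := hy
    intro h0 h1
    fin_cases x <;> fin_cases y <;> simp_all
  rw [g.image_segment, ← h.vertex_eq, ← h.vertex_eq]
  rcases hf with ⟨e1, e2⟩ | ⟨e1, e2⟩
  · rw [e1, e2]
  · rw [e1, e2, segment_symm]

theorem Realizes.map (h : g.MapsArms f φ c c' q q') {t : Tangency} {K : Set Plane}
    (hK : K ⊆ lam q) (hr : Realizes c q t K) :
    Realizes c' q' (t.map f φ) (g.onPlane '' K) := by
  have hm := h.mult_eq hK
  have hcard := card_dualCell_onPlane h.coeff
  have hint : ∀ {a p}, p ∈ armInterior q a → g.onPlane p ∈ armInterior q' (f a) := fun hp => by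
    rw [h.interior_eq]; exact mem_image_of_mem _ hp
  have hall : ∀ {P : Fin 2 → Prop}, (∀ k, P (φ k)) → ∀ k, P k := fun hP k => by
    rw [← h.involutive' k]; exact hP _
  cases t with
  | point a =>
    obtain ⟨h1, P, hP, rfl, hP2⟩ := hr
    exact ⟨by rw [hm, h1], _, hint hP, image_singleton, by rw [hcard, hP2]⟩
  | pointAtVertex a =>
    obtain ⟨h1, P, hP, rfl, hP2⟩ := hr
    exact ⟨by rw [hm, h1], _, hint hP, image_singleton, by rw [hcard, hP2]⟩
  | interiorEdge a => exact hr.interiorEdge h.toMaps (h.interior_eq a) hK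
  | overhang k a =>
    obtain ⟨h1, h2, h3, A, hA, hA3, rfl⟩ := hr
    exact ⟨by rw [hm, h1], (h.arms k a).2 h2, by rw [h.vertex_eq, hcard, h3], _, hint hA,
      by rw [hcard, hA3], by rw [h.vertex_eq, g.image_segment]⟩
  | wholeEdge =>
    obtain ⟨h1, h2, rfl⟩ := hr
    exact ⟨by rw [hm, h1], hall fun k => by rw [h.vertex_eq, hcard, h2], h.image_segment_vertex⟩
  | crossing k =>
    obtain ⟨h1, rfl, m, m', h2, h3⟩ := hr
    refine ⟨by rw [hm, h1], by rw [h.vertex_eq, image_singleton], ?_⟩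
    have h4 := dualCell_onPlane_pair h.coeff h2
    rw [h.vertex_eq]
    rcases h.exists_step h3 with h5 | h5
    · exact ⟨_, _, h4, h5⟩
    · exact ⟨_, _, by rw [h4, Finset.pair_comm], h5⟩
  | crossingFour k =>
    obtain ⟨h1, rfl, h2⟩ := hr
    exact ⟨by rw [hm, h1], by rw [h.vertex_eq, image_singleton], by rw [h.vertex_eq, hcard, h2]⟩
  | opposite k =>
    obtain ⟨h1, rfl, m, m', m'', h2, h3, h4⟩ := hr
    refine ⟨by rw [hm, h1], by rw [h.vertex_eq, image_singleton], ?_⟩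
    have h5 : dualCell c' (vertex q' (φ k)) = {g.onExpo m, g.onExpo m', g.onExpo m''} := by
      rw [h.vertex_eq, dualCell_onPlane h.coeff, h2]; simp [Finset.map_insert]
    have e3 : (g.onExpo m').toInt = (g.onExpo m).toInt +
        g.onDir ((![(-1, 0), (1, 0)] : Fin 2 → ℤ × ℤ) k) := by
      rw [g.toInt_onExpo, g.toInt_onExpo, h3, g.onDir_add, add_right_comm]
    have e4 : (g.onExpo m'').toInt = (g.onExpo m).toInt +
        g.onDir ((![(0, -1), (0, 1)] : Fin 2 → ℤ × ℤ) k) := by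
      rw [g.toInt_onExpo, g.toInt_onExpo, h4, g.onDir_add, add_right_comm]
    rcases h.opposite k with ⟨e1, e2⟩ | ⟨e1, e2⟩
    · exact ⟨_, _, _, h5, by rw [e3, e1], by rw [e4, e2]⟩
    · exact ⟨g.onExpo m, g.onExpo m'', g.onExpo m', by rw [h5, Finset.pair_comm (g.onExpo m')],
        by rw [e4, e2], by rw [e3, e1]⟩
  | commonRay k a =>
    obtain ⟨h1, h2, h3, h4, rfl, m, hm1, m', hm2, h5⟩ := hr
    refine ⟨by rw [hm, h1], (h.arms k a).2 h2, mt (h.diag a).1 h3, by rw [h.vertex_eq, hcard, h4],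
      (h.leg_eq h3).symm, ?_⟩
    rw [h.vertex_eq]
    rcases h.exists_step h5 with h6 | h6
    · exact ⟨_, (mem_dualCell_onExpo h.coeff).2 hm1, _, (mem_dualCell_onExpo h.coeff).2 hm2, h6⟩
    · exact ⟨_, (mem_dualCell_onExpo h.coeff).2 hm2, _, (mem_dualCell_onExpo h.coeff).2 hm1, h6⟩
  | tripod k =>
    obtain ⟨h1, h2, A, hA, rfl⟩ := hr
    -- The end points are relabelled by the inverse of `f`, which is `f` itself.
    refine ⟨by rw [hm, h1], by rw [h.vertex_eq, hcard, h2], fun a => g.onPlane (A (f a)),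
      fun a ha => ?_, ?_⟩
    · have ha' : f a ∈ armsAt k := by rwa [← h.arms, h.involutive]
      have := hint (hA _ ha').1
      rw [h.involutive] at this
      exact ⟨this, by rw [hcard, (hA _ ha').2]⟩
    · rw [h.vertex_eq]
      simp only [image_iUnion, g.image_segment]
      ext p
      simp only [mem_iUnion]
      constructor
      · rintro ⟨a, ha, hp⟩
        exact ⟨f a, (h.arms k a).2 ha, by rwa [h.involutive]⟩
      · rintro ⟨a, ha, hp⟩
        exact ⟨f a, by rwa [← h.arms, h.involutive], hp⟩
  | tree =>
    obtain ⟨h1, h2, A, hA, rfl⟩ := hr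
    refine ⟨by rw [hm, h1], hall fun k => by rw [h.vertex_eq, hcard, h2],
      fun a => g.onPlane (A (f a)), fun a ha => ?_, ?_⟩
    · have ha' : f a ≠ .diag := mt (h.diag a).1 ha
      have := hint (hA _ ha').1
      rw [h.involutive] at this
      exact ⟨this, by rw [hcard, (hA _ ha').2]⟩
    · rw [image_union, h.image_segment_vertex]
      congr 1
      simp only [image_iUnion, g.image_segment]
      ext p
      simp only [mem_iUnion, Subtype.exists]
      constructor
      · rintro ⟨a, ha, hp⟩
        exact ⟨f a, mt (h.diag a).1 ha, by rwa [h.involutive, h.base_eq a ha]⟩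
      · rintro ⟨a, ha, hp⟩
        have ha' : f a ≠ .diag := mt (h.diag a).1 ha
        refine ⟨f a, ha', ?_⟩
        rwa [← h.base_eq _ ha', h.involutive]

theorem HasConfiguration.map (h : g.MapsArms f φ c c' q q') {L : List Tangency}
    (hL : HasConfiguration c q L) : HasConfiguration c' q' (L.map (Tangency.map f φ)) := by
  obtain ⟨Ks, h1, h2, h3⟩ := hL
  refine ⟨Ks.map fun K => g.onPlane '' K, h1.map g.onPlane_injective.image_injective, fun K => ?_,
    ?_⟩
  · rw [h.components_eq, List.mem_map, mem_image]
    simp only [h2]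
  · rw [List.forall₂_map_left_iff, List.forall₂_map_right_iff]
    have h4 : ∀ K ∈ Ks, K ⊆ lam q := fun K hK =>
      (subset_of_mem_components ((h2 K).1 hK)).trans inter_subset_left
    clear h1 h2
    induction h3 with
    | nil => exact .nil
    | cons hr _ ih =>
      exact .cons (hr.map h (h4 _ List.mem_cons_self))
        (ih fun K hK => h4 K (List.mem_cons_of_mem _ hK))

end Transport

/-- The coefficients of the image of the curve. -/
theorem Sym.exists_coeff (g : Sym) (c : Expo → ℝ) :
    ∃ c' : Expo → ℝ, ∀ m, c' (g.onExpo m) = c m := by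
  obtain ⟨f, hf⟩ := g.onExpo_injective.hasLeftInverse
  exact ⟨fun m => c (f m), fun m => congrArg c (hf m)⟩

theorem mapsArms_swap {c c' : Expo → ℝ} (hc : ∀ m, c' ((Sym.mk true false false).onExpo m) = c m)
    (hl : 0 ≤ q.2) :
    (Sym.mk true false false).MapsArms Arm.swap id c c' q (q.1.swap, q.2) := by
  have hv : ∀ k, vertex (q.1.swap, q.2) k = (Sym.mk true false false).onPlane (vertex q k) := by
    intro k
    fin_cases k
    · rfl
    · simp [vertex_one, Sym.onPlane, abs_of_nonneg hl]
  refine ⟨⟨hc, ?_, balanced q⟩, ⟨fun a => by cases a <;> rfl, by decide,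
      fun k a => by revert k; cases a <;> decide, fun a => by cases a <;> decide, by decide,
      by decide⟩,
    hv, ?_, ?_, ?_⟩
  · ext p
    obtain ⟨p, rfl⟩ := (Sym.mk true false false).homeo.surjective p
    change (Sym.mk true false false).onPlane p ∈ _ ↔ (Sym.mk true false false).onPlane p ∈ _
    rw [(Sym.mk true false false).onPlane_injective.mem_set_image, mem_lam hl,
      mem_lam (q := (q.1.swap, q.2)) hl]
    simp only [Sym.onPlane, Bool.false_eq_true, if_true, if_false, Prod.fst_swap, Prod.snd_swap]
    grind
  · rintro (_ | _ | _ | _ | _) ha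
    · simpa [armBase, Arm.swap, hl] using hv 0
    · simpa [armBase, Arm.swap, hl] using hv 0
    · simpa [armBase, Arm.swap, hl] using hv 1
    · simpa [armBase, Arm.swap, hl] using hv 1
    · exact absurd rfl ha
  · intro a; cases a <;> simp [Arm.dir, Arm.swap, Sym.onPlane]
  · rw [armInterior, armInterior, Sym.image_openSegment, hv, hv]

theorem mapsArms_rot {c c' : Expo → ℝ} (hc : ∀ m, c' ((Sym.mk false true true).onExpo m) = c m)
    (hl : 0 ≤ q.2) :
    (Sym.mk false true true).MapsArms Arm.rot Fin.rev c c' q ((-q.1.1 - q.2, -q.1.2 - q.2), q.2) := by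
  have hv : ∀ k, vertex ((-q.1.1 - q.2, -q.1.2 - q.2), q.2) (Fin.rev k) =
      (Sym.mk false true true).onPlane (vertex q k) := by
    intro k
    fin_cases k
    · change vertex _ 1 = _
      simp [vertex_zero, vertex_one, Sym.onPlane, abs_of_nonneg hl]
    · change vertex _ 0 = _
      simp only [vertex_zero, Fin.mk_one, vertex_one, Sym.onPlane, abs_of_nonneg hl,
        Bool.false_eq_true, if_true, if_false]
      ext <;> simp <;> ring
  have h0 : vertex ((-q.1.1 - q.2, -q.1.2 - q.2), q.2) 1 = _ := hv 0
  have h1 : vertex ((-q.1.1 - q.2, -q.1.2 - q.2), q.2) 0 = _ := hv 1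
  refine ⟨⟨hc, ?_, balanced q⟩, ⟨fun a => by cases a <;> rfl, by decide,
      fun k a => by revert k; cases a <;> decide, fun a => by cases a <;> decide, by decide,
      by decide⟩,
    hv, ?_, ?_, ?_⟩
  · ext p
    obtain ⟨p, rfl⟩ := (Sym.mk false true true).homeo.surjective p
    change (Sym.mk false true true).onPlane p ∈ _ ↔ (Sym.mk false true true).onPlane p ∈ _
    rw [(Sym.mk false true true).onPlane_injective.mem_set_image, mem_lam hl,
      mem_lam (q := ((-q.1.1 - q.2, -q.1.2 - q.2), q.2)) hl]
    simp only [Sym.onPlane, Bool.false_eq_true, if_true, if_false]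
    grind
  · rintro (_ | _ | _ | _ | _) ha
    · simpa [armBase, Arm.rot, hl] using h0
    · simpa [armBase, Arm.rot, hl] using h0
    · simpa [armBase, Arm.rot, hl] using h1
    · simpa [armBase, Arm.rot, hl] using h1
    · exact absurd rfl ha
  · intro a; cases a <;> simp [Arm.dir, Arm.rot, Sym.onPlane]
  · rw [armInterior, armInterior, Sym.image_openSegment, h0, h1, openSegment_symm]

/-- The four alternatives of `listed` correspond to the four symmetries which preserve slope one. -/
theorem inTableUpToSymmetry_of_listed (hl : 0 < q.2) {π : Movement}
    {L : List Tangency} (h : HasConfiguration c q L) (hL : listed π L = true) :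
    InTableUpToSymmetry c q π := by
  simp only [listed, List.any_eq_true, Bool.or_eq_true, List.isPerm_iff] at hL
  obtain ⟨L', hL', hL⟩ := hL
  obtain ⟨c₁, hc₁⟩ := (Sym.mk true false false).exists_coeff c
  obtain ⟨c₂, hc₂⟩ := (Sym.mk false true true).exists_coeff c
  obtain ⟨c₃, hc₃⟩ := (Sym.mk false true true).exists_coeff c₁
  have hs := mapsArms_swap hc₁ hl.le
  have hr := mapsArms_rot hc₂ hl.le
  have hsr := mapsArms_rot (q := (q.1.swap, q.2)) hc₃ hl.le
  rcases hL with ((hL | hL) | hL) | hL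
  · exact InTable.upToSymmetry (Or.inl ⟨hl, L', hL', h.perm hL⟩)
  · exact .of_maps hs.toMaps (InTable.upToSymmetry (Or.inl ⟨hl, L', hL', (h.map hs).perm hL⟩))
  · exact .of_maps hr.toMaps (InTable.upToSymmetry (Or.inl ⟨hl, L', hL', (h.map hr).perm hL⟩))
  · exact .of_maps hs.toMaps (.of_maps hsr.toMaps
      (InTable.upToSymmetry (Or.inl ⟨hl, L', hL', ((h.map hs).map hsr).perm hL⟩)))

/-- A generic member of a maximal cell whose edge has slope one is in the table. -/
theorem Local.inTable_of_pos {V : Submodule ℝ Param} (h : Local c q V)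
    (hl : 0 < q.2) {π : Movement} (hπ : Moves V π) : InTableUpToSymmetry c q π := by
  obtain ⟨w, s, e, n, d, hst, L, hL, hlist⟩ := h.exists_listed hl hπ
  exact inTableUpToSymmetry_of_listed hl (hst.hasConfiguration hl hL) hlist

theorem Local.inTable_of_neg {V : Submodule ℝ Param} (h : Local c q V)
    (hl : q.2 < 0) {π : Movement} (hπ : Moves (V.comap flipParam) π) :
    InTableUpToSymmetry c q π :=
  .of_maps (maps_flipX c q) (h.flip.inTable_of_pos (by rw [flipParam_apply]; simpa using hl) hπ)

/-! ### Movements of four-valent curves -/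

theorem slope_flipX (r : ℤ × ℤ) (m : Expo) :
    slope r (flipX.onExpo m) = slope (-r.1, r.2) m + 3 * r.1 := by
  have h : (flipX.onExpo m).toInt = (3 - m.toInt.1, m.toInt.2) := by revert m; decide
  simp only [slope, h]
  ring

theorem flipX_onPlane_line (p : Plane) (r : ℤ × ℤ) (t : ℝ) :
    flipX.onPlane (line p r t) = line (flipX.onPlane p) (-r.1, r.2) t := by
  ext <;> simp [line, flipX_onPlane, toPlane]; ring

theorem dualCell_flipCoeff_eq_singleton {p : Plane} {m : Expo}
    (h : dualCell (flipCoeff c) (flipX.onPlane p) = {m}) :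
    dualCell c p = {flipX.onExpo m} := by
  have h1 := dualCell_onPlane (flipCoeff_onExpo (flipCoeff c)) (flipX.onPlane p)
  rw [h, flipCoeff_flipCoeff, flipX_onPlane, flipX_onPlane, neg_neg] at h1
  exact h1

/-- The reflection of the square shifts slopes by three times the horizontal component of the
direction. On horizontal legs this matches the change of the slope at infinity; along the edge it
exchanges odd and even slopes. -/
theorem Parity.flip (hP : Parity c q) (hl : q.2 < 0) :
    Parity (flipCoeff c) (flipParam q) := by
  have hl' : 0 < (flipParam q).2 := by rw [flipParam_apply]; simpa using hl
  obtain ⟨e1, e2, e3, e4⟩ := endSlope_values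
  have key : ∀ a b : Arm, armBase (flipParam q) b = flipX.onPlane (armBase q a) →
      b.idir = (-a.idir.1, a.idir.2) → Even (3 * a.idir.1 + endSlope a.idir + endSlope b.idir) →
      a ≠ .diag → ∀ t : ℝ, 0 ≤ t → ∀ m,
        dualCell (flipCoeff c) (line (armBase (flipParam q) b) b.idir t) = {m} →
          Even (slope b.idir m + endSlope b.idir) := by
    intro a b h h' hev ha t ht m hm
    rw [h, h', ← flipX_onPlane_line] at hm
    have h1 := hP.leg a ha t ht _ (dualCell_flipCoeff_eq_singleton hm)
    rw [slope_flipX, ← h'] at h1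
    obtain ⟨x, hx⟩ := h1
    obtain ⟨y, hy⟩ := hev
    exact ⟨x + y - 3 * a.idir.1 - endSlope a.idir, by omega⟩
  have h0 : vertex (flipParam q) 0 = flipX.onPlane (vertex q 0) := vertex_flipParam q 0
  have h1 : vertex (flipParam q) 1 = flipX.onPlane (vertex q 1) := vertex_flipParam q 1
  refine ⟨?_, fun _ t ht m hm => ?_, fun h => absurd h hl'.not_gt⟩
  · rintro (_ | _ | _ | _ | _) ha
    · refine key .east .west ?_ rfl ?_ (by decide)
      · simp only [armBase, if_pos hl'.le, if_neg hl.not_ge, h0]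
      · simp only [Arm.idir, e1, e3]; decide
    · refine key .south .south h0 rfl ?_ (by decide)
      simp only [Arm.idir, e2]; decide
    · refine key .west .east ?_ rfl ?_ (by decide)
      · simp only [armBase, if_pos hl'.le, if_neg hl.not_ge, h1]
      · simp only [Arm.idir, e1, e3]; decide
    · refine key .north .north h1 rfl ?_ (by decide)
      simp only [Arm.idir, e4]; decide
    · exact absurd rfl ha
  · have e : line (flipParam q).1 (1, 1) t = flipX.onPlane (line q.1 (-1, 1) t) := by
      rw [flipX_onPlane_line]; rfl
    rw [e] at hm
    have := hP.diag_neg hl t ht _ (dualCell_flipCoeff_eq_singleton hm)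
    rw [slope_flipX] at this
    obtain ⟨k, hk⟩ := this
    simp only [neg_neg] at hk
    exact ⟨k + 2, by omega⟩

theorem Parity.isTritangent_of_neg (hP : Parity c q) (hl : q.2 < 0) :
    IsTritangent c q :=
  isTritangent_flip.1 ((hP.flip hl).isTritangent (by rw [flipParam_apply]; simpa using hl))

theorem vertex_one_add_neg {v : Vec} {t : ℝ} (h : q.2 = 0)
    (h' : (q + t • v.toParam).2 < 0) :
    vertex (q + t • v.toParam) 1 = q.1 + t • toPlane v.upperNeg := by
  rw [vertex_one, abs_of_neg h']
  ext <;> simp [Vec.toParam, toPlane, Vec.upperNeg, h] <;> ring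

section FourValent

variable {w s e n : Status}

/-- The intersection of the curve with the legs is of the given types. -/
structure HasLegStatuses (c : Expo → ℝ) (v : Plane) (w s e n : Status) : Prop where
  west : LegHas c v (-1, 0) w
  south : LegHas c v (0, -1) s
  east : LegHas c v (1, 0) e
  north : LegHas c v (0, 1) n

theorem vertex_one_of_eq_zero (h0 : q.2 = 0) : vertex q 1 = q.1 := by
  rw [vertex_one, h0]; simp

/-- The legs are treated as in the trivalent case, two of them moving with the lower and two with
the upper vertex. The new edge grows out of the single vertex. -/
theorem HasLegStatuses.eventually_pos (h : HasLegStatuses c q.1 w s e n) (h0 : q.2 = 0)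
    (hP : Parity c q) {v : Vec} (hv : fourGermPos (cell c q.1) w s e n v = true) :
    ∀ᶠ t in 𝓝[>] (0 : ℝ), 0 < (q + t • v.toParam).2 ∧ Parity c (q + t • v.toParam) ∧
      ¬ InUnboundedPart c (q + t • v.toParam) := by
  simp only [fourGermPos, Bool.and_eq_true, Bool.not_eq_true', decide_eq_true_eq] at hv
  obtain ⟨⟨⟨⟨⟨⟨⟨⟨⟨⟨⟨hl, aw⟩, as⟩, ae⟩, an⟩, sw⟩, ss⟩, se⟩, sn⟩, sd⟩, hU1⟩, hU2⟩ := hv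
  obtain ⟨e1, e2, e3, e4⟩ := endSlope_values
  have pe := hP.east h0.ge
  have pn := hP.north
  rw [vertex_one_of_eq_zero h0] at pe pn
  have hw := h.west.eventually isUnitDir_leg.1 (hP.west h0.ge) aw (by rwa [e1])
  have hs := h.south.eventually isUnitDir_leg.2.1 hP.south as (by rwa [e2])
  have he := h.east.eventually isUnitDir_leg.2.2.1 pe ae (by rwa [e3])
  have hn := h.north.eventually isUnitDir_leg.2.2.2 pn an (by rwa [e4])
  -- With `L = 0` the edge has length `t` times `v.2.2`, so both restrictions on `σ` apply at the
  -- same point and leave exactly the range treated by `staysAlong`.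
  have hd := eventually_even_diag (c := c) (v := q.1) (r := (1, 1)) (u := v.lower) (e := 0)
    (l := v.2.2) (L := 0) le_rfl fun m hbad x hx hm => by
      obtain rfl : x = 0 := le_antisymm hx.2 hx.1
      rw [line_zero] at hm
      refine ⟨0, by rwa [line_zero], fun σ h1 h2 => ?_⟩
      rw [line_zero]
      exact staysAlong_accompanied sd hm hbad (h1 rfl) (h2 rfl)
  filter_upwards [hw, hs, he, hn, hd, eventually_cell_eq_face c q.1 v.lower,
    eventually_cell_eq_face c q.1 v.upper, self_mem_nhdsWithin] with t hw hs he hn hd hc0 hc1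
    (ht0 : 0 < t)
  have hlen : (q + t • v.toParam).2 = t * v.2.2 := by simp [Vec.toParam, h0]
  have ht : 0 < (q + t • v.toParam).2 := by
    rw [hlen]; exact mul_pos ht0 (by exact_mod_cast hl)
  have v0 := vertex_zero_add q v t
  have v1 := vertex_one_add h0.ge ht.le
  rw [vertex_one_of_eq_zero h0] at v1
  rw [vertex_zero q] at v0
  refine ⟨ht, ⟨?_, fun _ x hx m hm => ?_, fun h' => absurd h' ht.not_gt⟩, ?_⟩
  · rintro (_ | _ | _ | _ | _) ha
    · simpa only [armBase, if_pos ht.le, v0, Arm.idir] using hw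
    · simpa only [armBase, v0, Arm.idir] using hs
    · simpa only [armBase, if_pos ht.le, v1, Arm.idir] using he
    · simpa only [armBase, v1, Arm.idir] using hn
    · exact absurd rfl ha
  · rw [← add_zero (slope _ m)]
    exact hd x (by rwa [zero_add, ← hlen]) m hm
  · rw [inUnboundedPart_iff_pos ht, v0, v1, hc0, hc1, hU1, hU2]
    simp

theorem HasLegStatuses.eventually_neg (h : HasLegStatuses c q.1 w s e n) (h0 : q.2 = 0)
    (hP : Parity c q) {v : Vec} (hv : fourGermNeg (cell c q.1) w s e n v = true) :
    ∀ᶠ t in 𝓝[>] (0 : ℝ), (q + t • v.toParam).2 < 0 ∧ Parity c (q + t • v.toParam) ∧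
      ¬ InUnboundedPart c (q + t • v.toParam) := by
  simp only [fourGermNeg, Bool.and_eq_true, Bool.not_eq_true', decide_eq_true_eq] at hv
  obtain ⟨⟨⟨⟨⟨⟨⟨⟨⟨⟨⟨hl, aw⟩, as⟩, ae⟩, an⟩, sw⟩, ss⟩, se⟩, sn⟩, sd⟩, hU1⟩, hU2⟩ := hv
  obtain ⟨e1, e2, e3, e4⟩ := endSlope_values
  have pe := hP.east h0.ge
  have pn := hP.north
  rw [vertex_one_of_eq_zero h0] at pe pn
  have hw := h.west.eventually isUnitDir_leg.1 (hP.west h0.ge) aw (by rwa [e1])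
  have hs := h.south.eventually isUnitDir_leg.2.1 hP.south as (by rwa [e2])
  have he := h.east.eventually isUnitDir_leg.2.2.1 pe ae (by rwa [e3])
  have hn := h.north.eventually isUnitDir_leg.2.2.2 pn an (by rwa [e4])
  have hd := eventually_even_diag (c := c) (v := q.1) (r := (-1, 1)) (u := v.lower) (e := 1)
    (l := -v.2.2) (L := 0) le_rfl fun m hbad x hx hm => by
      obtain rfl : x = 0 := le_antisymm hx.2 hx.1
      rw [line_zero] at hm
      refine ⟨0, by rwa [line_zero], fun σ h1 h2 => ?_⟩
      rw [line_zero]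
      exact staysAlong_accompanied sd hm hbad (h1 rfl) (h2 rfl)
  filter_upwards [hw, hs, he, hn, hd, eventually_cell_eq_face c q.1 v.lower,
    eventually_cell_eq_face c q.1 v.upperNeg, self_mem_nhdsWithin] with t hw hs he hn hd hc0 hc1
    (ht0 : 0 < t)
  have hlen : (q + t • v.toParam).2 = t * v.2.2 := by simp [Vec.toParam, h0]
  have ht : (q + t • v.toParam).2 < 0 := by
    rw [hlen]; exact mul_neg_of_pos_of_neg ht0 (by exact_mod_cast hl)
  have v0 := vertex_zero_add q v t
  have v1 := vertex_one_add_neg h0 ht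
  rw [vertex_zero q] at v0
  refine ⟨ht, ⟨?_, fun h' => absurd h' ht.not_gt, fun _ x hx m hm => ?_⟩, ?_⟩
  · rintro (_ | _ | _ | _ | _) ha
    · simpa only [armBase, if_neg ht.not_ge, v1, Arm.idir] using hw
    · simpa only [armBase, v0, Arm.idir] using hs
    · simpa only [armBase, if_neg ht.not_ge, v0, Arm.idir] using he
    · simpa only [armBase, v1, Arm.idir] using hn
    · exact absurd rfl ha
  · have := hd x (by rw [zero_add]; push_cast; rwa [mul_neg, ← hlen]) m hm
    obtain ⟨k, hk⟩ := this
    exact ⟨k - 1, by omega⟩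
  · rw [inUnboundedPart_iff_neg ht, v0, v1, hc0, hc1, hU1, hU2]
    simp

theorem cell_mem_fourCells (hc : IsSmooth c) (h0 : q.2 = 0) (hP : Parity c q) :
    cell c q.1 ∈ fourCells := by
  obtain ⟨e1, e2, e3, e4⟩ := endSlope_values
  have pe := hP.east h0.ge
  have pn := hP.north
  rw [vertex_one_of_eq_zero h0] at pe pn
  have h1 := startsEven_cell one_pos fun u hu => hP.west h0.ge u hu.1.le
  have h2 := startsEven_cell one_pos fun u hu => hP.south u hu.1.le
  have h3 := startsEven_cell one_pos fun u hu => pe u hu.1.le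
  have h4 := startsEven_cell one_pos fun u hu => pn u hu.1.le
  rw [e1, vertex_zero] at h1
  rw [e2, vertex_zero] at h2
  rw [e3] at h3
  rw [e4] at h4
  rw [fourCells, List.mem_filter]
  exact ⟨cell_mem_allCells hc _, by rw [h1, h2, h3, h4]; rfl⟩

/-- A four-valent tritangent curve which is not a limit of trivalent ones is rigid. -/
theorem exists_isFourValent (hc : IsSmooth c) (ht : IsTritangent c q) (h0 : q.2 = 0)
    (hV : ∀ x : Param, (∀ᶠ t in 𝓝[>] (0 : ℝ), IsTritangent c (q + t • x) ∧
      ¬ InUnboundedPart c (q + t • x) ∧ (q + t • x).2 ≠ 0) → x.2 = 0) : ∃ w s e n, HasLegStatuses c q.1 w s e n ∧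
      isFourValent (cell c q.1) w s e n = true ∧ multAt c q q.1 = 2 := by
  have hP := ht.parity h0.ge
  obtain ⟨e1, e2, e3, e4⟩ := endSlope_values
  have pe := hP.east h0.ge
  have pn := hP.north
  rw [vertex_one_of_eq_zero h0] at pe pn
  obtain ⟨w, hw, hw'⟩ := exists_legHas hc (Or.inl rfl) (hP.west h0.ge)
  obtain ⟨s, hs, hs'⟩ := exists_legHas hc (Or.inr (Or.inl rfl)) hP.south
  obtain ⟨e, he, he'⟩ := exists_legHas hc (Or.inr (Or.inr (Or.inl rfl))) pe
  obtain ⟨n, hn, hn'⟩ := exists_legHas hc (Or.inr (Or.inr (Or.inr rfl))) pn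
  rw [e1, vertex_zero] at hw
  rw [e2, vertex_zero] at hs
  rw [e3] at he
  rw [e4] at hn
  have hst : HasLegStatuses c q.1 w s e n := ⟨hw', hs', he', hn'⟩
  have h1 := List.all_eq_true.1 isFourValent_all _ (cell_mem_fourCells hc h0 hP)
  have h2 := List.all_eq_true.1 (List.all_eq_true.1 (List.all_eq_true.1 (List.all_eq_true.1 h1
    w hw) s hs) e he) n hn
  rw [Bool.or_eq_true, Bool.and_eq_true, beq_iff_eq, List.any_eq_true] at h2
  rcases h2 with ⟨v, -, hv⟩ | ⟨h2, h3⟩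
  · exfalso
    have hne : v.2.2 ≠ 0 := by
      rcases Bool.or_eq_true_iff.1 hv with hv | hv
      · simp only [fourGermPos, Bool.and_eq_true, decide_eq_true_eq] at hv
        omega
      · simp only [fourGermNeg, Bool.and_eq_true, decide_eq_true_eq] at hv
        omega
    refine hne (Int.cast_eq_zero (α := ℝ) |>.1 (hV v.toParam ?_))
    rcases Bool.or_eq_true_iff.1 hv with hv | hv
    · refine (hst.eventually_pos h0 hP hv).mono ?_
      rintro t ⟨h1, h2, h3⟩
      exact ⟨h2.isTritangent h1, h3, h1.ne'⟩
    · refine (hst.eventually_neg h0 hP hv).mono ?_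
      rintro t ⟨h1, h2, h3⟩
      exact ⟨h2.isTritangent_of_neg h1, h3, h1.ne⟩
  · refine ⟨w, s, e, n, hst, h2, ?_⟩
    rw [multAt_fourValent c h0, ← h3, top_cell _ _ (by decide), top_cell _ _ (by decide),
      top_cell _ _ (by decide), top_cell _ _ (by decide)]

end FourValent

/-! ### The configuration of a rigid four-valent curve -/

section FourValent


/-- The data of a rigid four-valent curve: the two legs `a` and `b` contain an edge of `Γ`, and the
vertex lies on an edge of `Γ` of slope `±1`. -/
structure IsRigidFourValent (c : Expo → ℝ) (q : Param) (a b : Arm) : Prop where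
  eq_zero : q.2 = 0
  left : a = .west ∨ a = .east
  right : b = .south ∨ b = .north
  dual : ∃ m m' : Expo, dualCell c q.1 = {m, m'} ∧ m'.toInt = m.toInt + (a.idir + b.idir)
  mult : multAt c q q.1 = 2
  legs : ∀ x ≠ .diag, LegHas c q.1 x.idir (if x = a ∨ x = b then .locked else .none)

theorem HasLegStatuses.isRigidFourValent {w s e n : Status} (h : HasLegStatuses c q.1 w s e n)
    (h0 : q.2 = 0) (hf : isFourValent (cell c q.1) w s e n = true) (hm : multAt c q q.1 = 2) :
    ∃ a b, IsRigidFourValent c q a b := by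
  have hcard := length_cell c q.1
  have hmem : ∀ {m}, m ∈ cell c q.1 → m ∈ dualCell c q.1 := mem_cell.1
  have hnd : (cell c q.1).Nodup := nodup_toList _
  rcases hc : cell c q.1 with _ | ⟨m, _ | ⟨m', _ | _⟩⟩ <;> rw [hc] at hf hcard hnd
  · exact absurd hf (by simp [isFourValent])
  · exact absurd hf (by simp [isFourValent])
  · have hne : m ≠ m' := by simpa using hnd
    have hd : dualCell c q.1 = {m, m'} :=
      dualCell_eq_pair hcard.symm (hmem (by simp [hc])) (hmem (by simp [hc])) hne
    have hd' : dualCell c q.1 = {m', m} := by rw [hd, Finset.pair_comm]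
    simp only [isFourValent, Bool.or_eq_true, Bool.and_eq_true, beq_iff_eq] at hf
    have legs : ∀ f : Arm → Status, f .west = w → f .south = s → f .east = e → f .north = n →
        ∀ x ≠ .diag, LegHas c q.1 x.idir (f x) := by
      rintro f rfl rfl rfl rfl (_ | _ | _ | _ | _) hx
      · exact h.west
      · exact h.south
      · exact h.east
      · exact h.north
      · exact absurd rfl hx
    rcases hf with ⟨h1, ⟨⟨⟨rfl, rfl⟩, rfl⟩, rfl⟩ | ⟨⟨⟨rfl, rfl⟩, rfl⟩, rfl⟩⟩ |
      ⟨h1, ⟨⟨⟨rfl, rfl⟩, rfl⟩, rfl⟩ | ⟨⟨⟨rfl, rfl⟩, rfl⟩, rfl⟩⟩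
    · exact ⟨.west, .south, h0, Or.inl rfl, Or.inl rfl, ⟨m', m, hd', by
        rw [h1]; ext <;> simp [Arm.idir]⟩, hm, legs _ rfl rfl rfl rfl⟩
    · exact ⟨.east, .north, h0, Or.inr rfl, Or.inr rfl, ⟨m, m', hd, by
        rw [h1]; ext <;> simp [Arm.idir]⟩, hm, legs _ rfl rfl rfl rfl⟩
    · exact ⟨.west, .north, h0, Or.inl rfl, Or.inr rfl, ⟨m', m, hd', by
        rw [h1]; ext <;> simp [Arm.idir]⟩, hm, legs _ rfl rfl rfl rfl⟩
    · exact ⟨.east, .south, h0, Or.inr rfl, Or.inl rfl, ⟨m, m', hd, by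
        rw [h1]; ext <;> simp [Arm.idir]⟩, hm, legs _ rfl rfl rfl rfl⟩
  · exact absurd hf (by simp [isFourValent])

variable {a b : Arm}

theorem IsRigidFourValent.armBase (h : IsRigidFourValent c q a b) (x : Arm) :
    armBase q x = q.1 := by
  have := vertex_one_of_eq_zero h.eq_zero
  cases x <;> simp [TropTritangent.armBase, this, vertex_zero]

theorem IsRigidFourValent.card (h : IsRigidFourValent c q a b) : (dualCell c q.1).card = 2 := by
  obtain ⟨m, m', hd, hs⟩ := h.dual
  rw [hd, Finset.card_pair]
  rintro rfl
  rcases h.left with rfl | rfl <;> rcases h.right with rfl | rfl <;>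
    simp [Arm.idir, Prod.ext_iff] at hs

/-- An edge of slope ±1 is parallel to no leg, so its two exponents have different slopes along each
leg. -/
theorem IsRigidFourValent.legOverlap (h : IsRigidFourValent c q a b) {x : Arm} (hx : x ≠ .diag)
    (e : ℤ) : legOverlap (cell c q.1) x.idir e = .none := by
  have hcard : (rightFace c q.1 x.idir).card = 1 := by
    obtain ⟨m, m', hd, hs⟩ := h.dual
    have hne : slope x.idir m' ≠ slope x.idir m := by
      simp only [slope, hs]
      generalize m.toInt = z
      rcases h.left with rfl | rfl <;> rcases h.right with rfl | rfl <;> cases x <;>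
        simp [Arm.idir] at hx ⊢
    refine le_antisymm (Finset.card_le_one.2 fun y hy z hz => ?_) (Finset.card_pos.2 ?_)
    · obtain ⟨hy1, hy2⟩ := mem_rightFace.1 hy
      obtain ⟨hz1, hz2⟩ := mem_rightFace.1 hz
      rw [hd, Finset.mem_insert, Finset.mem_singleton] at hy1 hz1
      rcases hy1 with rfl | rfl <;> rcases hz1 with rfl | rfl
      · rfl
      · exact absurd (hz2.trans hy2.symm) hne
      · exact absurd (hy2.trans hz2.symm) hne
      · rfl
    · obtain ⟨n, hn, hs⟩ := exists_slope_eq_topSlope c q.1 x.idir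
      exact ⟨n, mem_rightFace.2 ⟨hn, hs⟩⟩
  rw [TropTritangent.legOverlap, length_face_cell, hcard]; rfl

theorem IsRigidFourValent.configured (h : IsRigidFourValent c q a b) {x : Arm} (hx : x ≠ .diag) :
    Configured c q (armInterior q x ∩ curve c)
      ((if x = a ∨ x = b then Status.locked else .none).tangencies x) := by
  have hleg := h.legs x hx
  rw [← h.armBase x] at hleg
  obtain ⟨Y, Z, hYZ, -, hY, hZ⟩ := hleg.pieces h.eq_zero.ge hx
  rw [h.armBase, h.legOverlap hx] at hY
  change Y = ∅ at hY
  rwa [hYZ, hY, empty_union]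

theorem Configured.realizes {X : Set Plane} {t : Tangency} (h : Configured c q X [t]) :
    Realizes c q t X ∧ IsClosed X ∧ IsConnected X := by
  obtain ⟨Ks, h1, -, h3, h4⟩ := h
  cases h1 with
  | @cons _ K _ _ h1 h2 =>
    cases h2
    obtain rfl : X = K := by ext p; simp [h4]
    exact ⟨h1, h3 _ (by simp)⟩

theorem Configured.eq_empty {X : Set Plane} (h : Configured c q X []) : X = ∅ := by
  obtain ⟨Ks, h1, -, -, h4⟩ := h
  cases h1
  ext p
  simp [h4]

theorem IsRigidFourValent.left_ne (h : IsRigidFourValent c q a b) : a ≠ .diag ∧ b ≠ .diag ∧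
    a ≠ b := by
  rcases h.left with rfl | rfl <;> rcases h.right with rfl | rfl <;> decide

theorem IsRigidFourValent.realizes (h : IsRigidFourValent c q a b) {x : Arm}
    (hx : x = a ∨ x = b) : Realizes c q (.interiorEdge x) (armInterior q x ∩ curve c) ∧
      IsClosed (armInterior q x ∩ curve c) ∧ IsConnected (armInterior q x ∩ curve c) := by
  have hd : x ≠ .diag := by
    rcases hx with rfl | rfl
    · exact h.left_ne.1
    · exact h.left_ne.2.1
  have := h.configured hd
  rw [if_pos hx] at this
  exact this.realizes

theorem IsRigidFourValent.components (h : IsRigidFourValent c q a b) :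
    [{q.1}, armInterior q a ∩ curve c, armInterior q b ∩ curve c].Nodup ∧
      ∀ K, K ∈ [{q.1}, armInterior q a ∩ curve c, armInterior q b ∩ curve c] ↔
        K ∈ components c q := by
  obtain ⟨ha, hb, hab⟩ := h.left_ne
  have hl := h.eq_zero.ge
  have hv := h.armBase
  have hcv : q.1 ∈ curve c := h.card.ge
  have hnv : ∀ {x}, x ≠ .diag → q.1 ∉ armInterior q x := fun hx =>
    vertex_notMem_armInterior hl (fun h => absurd h hx) 0
  apply nodup_and_mem_components
  · simp only [List.pairwise_cons, List.mem_cons, List.not_mem_nil, or_false, forall_eq_or_imp,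
      forall_eq, IsEmpty.forall_iff, implies_true, List.Pairwise.nil, and_true,
      disjoint_singleton_left]
    exact ⟨⟨fun h => hnv ha h.1, fun h => hnv hb h.1⟩,
      (armInterior_disjoint hl (fun h => absurd h ha) (fun h => absurd h hb) hab).mono
        inter_subset_left inter_subset_left⟩
  · intro K hK
    simp only [List.mem_cons, List.not_mem_nil, or_false] at hK
    rcases hK with rfl | rfl | rfl
    · exact ⟨isClosed_singleton, isConnected_singleton⟩
    · exact (h.realizes (Or.inl rfl)).2
    · exact (h.realizes (Or.inr rfl)).2
  · intro p
    have hempty : ∀ x ≠ .diag, x ≠ a → x ≠ b → armInterior q x ∩ curve c = ∅ :=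
      fun x hx h1 h2 => by
        have := h.configured hx
        rw [if_neg (by tauto)] at this
        exact this.eq_empty
    rw [lam_inter_curve hl, vertex_one_of_eq_zero h.eq_zero, vertex_zero, h.eq_zero, Ioo_self,
      image_empty, empty_inter, union_empty, inter_eq_left.2 (singleton_subset_iff.2 hcv)]
    simp only [List.mem_cons, List.not_mem_nil, or_false, exists_eq_or_imp, exists_eq_left,
      union_self]
    rcases h.left with rfl | rfl <;> rcases h.right with rfl | rfl
    · rw [hempty .east, hempty .north] <;> simp [or_assoc]
    · rw [hempty .east, hempty .south] <;> simp [or_assoc]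
    · rw [hempty .west, hempty .north] <;> simp [or_comm, or_left_comm]
    · rw [hempty .west, hempty .south] <;> simp [or_assoc]

theorem IsRigidFourValent.fourValentConfiguration (h : IsRigidFourValent c q a b) :
    FourValentConfiguration c q := by
  obtain ⟨ha, hb, hab⟩ := h.left_ne
  obtain ⟨m, m', hd, hs⟩ := h.dual
  refine ⟨_, _, a, b, ha, hb, hab, ?_, ?_, (h.realizes (Or.inl rfl)).1,
    (h.realizes (Or.inr rfl)).1, m, m', hd, ?_, ?_, ?_⟩
  · ext K
    rw [← h.components.2 K]
    simp [vertex_zero]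
  · rw [mult_singleton, vertex_zero, h.mult]
  · rw [hs]
    rcases h.left with rfl | rfl <;> rcases h.right with rfl | rfl <;> simp [Arm.idir]
  · rw [hs]
    rcases h.left with rfl | rfl <;> rcases h.right with rfl | rfl <;> simp [Arm.idir]
  · intro p hp
    have hp' : p ∈ armInterior q a ∨ p ∈ armInterior q b := hp.imp And.left And.left
    rw [mem_armInterior h.eq_zero.ge fun h => absurd h ha,
      mem_armInterior h.eq_zero.ge fun h => absurd h hb] at hp'
    rw [hs, vertex_zero]
    have h0 := h.eq_zero
    rcases h.left with rfl | rfl <;> rcases h.right with rfl | rfl <;>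
      simp only [Arm.idir, Prod.fst_add, Prod.snd_add, add_sub_cancel_left] at hp' ⊢ <;>
      norm_num <;> rcases hp' with hp' | hp' <;> linarith [hp'.1, hp'.2]

theorem mem_lam_fourValent (h0 : q.2 = 0) {p : Plane} :
    p ∈ lam q ↔ p.1 = q.1.1 ∨ p.2 = q.1.2 := by
  rw [mem_lam h0.ge, h0]
  grind

/-- Reflections of a four-valent curve. -/
theorem maps_fourValent {c' : Expo → ℝ} {f f' : Bool}
    (hc : ∀ m, c' ((Sym.mk false f f').onExpo m) = c m) (h0 : q.2 = 0) :
    (Sym.mk false f f').Maps c c' q ((Sym.mk false f f').onPlane q.1, 0) := by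
  refine ⟨hc, ?_, balanced q⟩
  ext p
  obtain ⟨p, rfl⟩ := (Sym.mk false f f').homeo.surjective p
  change (Sym.mk false f f').onPlane p ∈ _ ↔ (Sym.mk false f f').onPlane p ∈ _
  rw [(Sym.mk false f f').onPlane_injective.mem_set_image, mem_lam_fourValent h0,
    mem_lam_fourValent (q := ((Sym.mk false f f').onPlane q.1, 0)) rfl]
  cases f <;> cases f' <;> simp [Sym.onPlane]

theorem armInterior_fourValent {g : Sym} (h0 : q.2 = 0) {x y : Arm} (hx : x ≠ .diag)
    (hy : y ≠ .diag) (h : y.dir = g.onPlane x.dir) :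
    armInterior (g.onPlane q.1, 0) y = g.onPlane '' armInterior q x := by
  have hb : ∀ {q : Param} (z : Arm), q.2 = 0 → armBase q z = q.1 := fun z h => by
    have := vertex_one_of_eq_zero h
    cases z <;> simp [armBase, this, vertex_zero]
  rw [armInterior_of_ne hx, armInterior_of_ne hy, hb _ h0, hb _ rfl, h]
  ext p
  constructor
  · rintro ⟨t, ht, rfl⟩
    exact ⟨_, ⟨t, ht, rfl⟩, Sym.onPlane_add_smul _ _ _ _⟩
  · rintro ⟨_, ⟨t, ht, rfl⟩, rfl⟩
    exact ⟨t, ht, Sym.onPlane_add_smul _ _ _ _⟩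

theorem IsRigidFourValent.inTable (h : IsRigidFourValent c q a b) :
    InTableUpToSymmetry c q .rigid := by
  obtain ⟨ha, hb, hab⟩ := h.left_ne
  obtain ⟨m, m', hd, hs⟩ := h.dual
  have h0 := h.eq_zero
  -- The reflections are chosen so that the two distinguished legs become west and south; the edge
  -- through the vertex then has slope minus one.
  obtain ⟨f, hf⟩ : ∃ f, f = decide (a = .east) := ⟨_, rfl⟩
  obtain ⟨f', hf'⟩ : ∃ f', f' = decide (b = .north) := ⟨_, rfl⟩
  obtain ⟨c', hc'⟩ := (Sym.mk false f f').exists_coeff c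
  have hg := maps_fourValent hc' h0
  have hwest : Arm.west.dir = (Sym.mk false f f').onPlane a.dir := by
    rcases h.left with rfl | rfl <;> rcases h.right with rfl | rfl <;>
      simp [hf, hf', Sym.onPlane, Arm.dir]
  have hsouth : Arm.south.dir = (Sym.mk false f f').onPlane b.dir := by
    rcases h.left with rfl | rfl <;> rcases h.right with rfl | rfl <;>
      simp [hf, hf', Sym.onPlane, Arm.dir]
  have hdir : (Sym.mk false f f').onDir (a.idir + b.idir) = (-1, -1) := by
    rcases h.left with rfl | rfl <;> rcases h.right with rfl | rfl <;>
      simp [hf, hf', Sym.onDir, Arm.idir]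
  have hsub : ∀ {x : Arm}, x ≠ .diag → armInterior q x ∩ curve c ⊆ lam q := fun hx =>
    inter_subset_left.trans (armInterior_subset_lam h0.ge fun h => absurd h hx)
  have hv : q.1 ∈ lam q := vertex_mem_lam h0.ge 0
  generalize Sym.mk false f f' = g at *
  have hW := (h.realizes (Or.inl rfl)).1.interiorEdge hg
    (armInterior_fourValent h0 ha (by decide : Arm.west ≠ .diag) hwest) (hsub ha)
  have hS := (h.realizes (Or.inr rfl)).1.interiorEdge hg
    (armInterior_fourValent h0 hb (by decide : Arm.south ≠ .diag) hsouth) (hsub hb)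
  have hstep : (g.onExpo m).toInt = (g.onExpo m').toInt + (1, 1) := by
    rw [g.toInt_onExpo m', hs, g.onDir_add, hdir, g.toInt_onExpo m]
    ext <;> simp <;> ring
  have hX : Realizes c' (g.onPlane q.1, 0) (.crossing 0) (g.onPlane '' {q.1}) := by
    refine ⟨?_, image_singleton, g.onExpo m', g.onExpo m, ?_, hstep⟩
    · rw [hg.mult_eq (singleton_subset_iff.2 hv), mult_singleton, h.mult]
    · rw [vertex_zero, dualCell_onPlane_pair hc' hd, Finset.pair_comm]
  refine ⟨g, c', _, hc', hg.lam_eq, Or.inr ⟨rfl, rfl, ?_⟩⟩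
  obtain ⟨h1, h2⟩ := h.components
  refine HasConfiguration.perm (L := [.crossing 0, .interiorEdge .west, .interiorEdge .south])
    ⟨_, h1.map g.onPlane_injective.image_injective, fun K => ?_,
      .cons hX (.cons hW (.cons hS .nil))⟩ (.cons _ (.swap _ _ _))
  rw [hg.components_eq, List.mem_map, mem_image]
  simp only [h2]

/-- A vertex of the curve on the vertical leg prescribes the first coordinate of the vertex of `Λ`,
one on the horizontal leg the second. This makes four-valent cells of maximal dimension rigid. -/
theorem IsRigidFourValent.exists_vertex (h : IsRigidFourValent c q a b) :
    (∃ P, (dualCell c P).card = 3 ∧ P.1 = q.1.1) ∧ ∃ P, (dualCell c P).card = 3 ∧ P.2 = q.1.2 := by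
  obtain ⟨ha, hb, -⟩ := h.left_ne
  have hA := h.legs a ha
  have hB := h.legs b hb
  rw [if_pos (Or.inl rfl)] at hA
  rw [if_pos (Or.inr rfl)] at hB
  obtain ⟨x, hx⟩ := hA.exists_vertex (by decide) (by decide)
  obtain ⟨y, hy⟩ := hB.exists_vertex (by decide) (by decide)
  refine ⟨⟨_, hy, ?_⟩, _, hx, ?_⟩
  · rcases h.right with rfl | rfl <;> simp [line, toPlane, Arm.idir]
  · rcases h.left with rfl | rfl <;> simp [line, toPlane, Arm.idir]

end FourValent

/-! ### Relative interiors of polyhedra -/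

section Relint

variable {C D : Set Param}

theorem eventually_add_mem_intrinsicInterior (hq : q ∈ intrinsicInterior ℝ C) :
    ∀ᶠ w : vectorSpan ℝ C in 𝓝 0, q + (w : Param) ∈ intrinsicInterior ℝ C := by
  obtain ⟨y, hy, rfl⟩ := mem_intrinsicInterior.1 hq
  have hmem : ∀ w : vectorSpan ℝ C, (w : Param) + y ∈ affineSpan ℝ C := fun w =>
    AffineSubspace.vadd_mem_of_mem_direction (by rw [direction_affineSpan]; exact w.2) y.2
  have hf : Continuous fun w : vectorSpan ℝ C => (⟨(w : Param) + y, hmem w⟩ : affineSpan ℝ C) := by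
    fun_prop
  have h0 : (⟨((0 : vectorSpan ℝ C) : Param) + y, hmem 0⟩ : affineSpan ℝ C) = y := by
    ext1; simp
  filter_upwards [hf.continuousAt.preimage_mem_nhds (isOpen_interior.mem_nhds (h0 ▸ hy))] with w hw
  exact mem_intrinsicInterior.2 ⟨_, hw, add_comm _ _⟩

theorem eventually_add_smul_mem_intrinsicInterior (hq : q ∈ intrinsicInterior ℝ C) {w : Param}
    (hw : w ∈ vectorSpan ℝ C) : ∀ᶠ t in 𝓝 (0 : ℝ), q + t • w ∈ intrinsicInterior ℝ C := by
  have hf : Continuous fun t : ℝ => t • (⟨w, hw⟩ : vectorSpan ℝ C) := by fun_prop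
  have := hf.tendsto 0
  rw [zero_smul] at this
  exact this.eventually (eventually_add_mem_intrinsicInterior hq)

theorem mem_intrinsicInterior_of_eventually (hq : q ∈ C)
    (h : ∀ᶠ w : vectorSpan ℝ C in 𝓝 0, q + (w : Param) ∈ C) : q ∈ intrinsicInterior ℝ C := by
  refine mem_intrinsicInterior.2 ⟨⟨q, subset_affineSpan ℝ C hq⟩, ?_, rfl⟩
  have hmem : ∀ z : affineSpan ℝ C, (z : Param) - q ∈ vectorSpan ℝ C := fun z => by
    rw [← direction_affineSpan]
    exact AffineSubspace.vsub_mem_direction z.2 (subset_affineSpan ℝ C hq)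
  have hf : Continuous fun z : affineSpan ℝ C => (⟨(z : Param) - q, hmem z⟩ : vectorSpan ℝ C) := by
    fun_prop
  have h0 := hf.tendsto ⟨q, subset_affineSpan ℝ C hq⟩
  have e : (⟨((⟨q, subset_affineSpan ℝ C hq⟩ : affineSpan ℝ C) : Param) - q, hmem _⟩ :
      vectorSpan ℝ C) = 0 := by ext1; simp
  rw [e] at h0
  rw [mem_interior_iff_mem_nhds]
  filter_upwards [h0.eventually h] with z hz
  simpa using hz

theorem sub_mem_vectorSpan {q' : Param} (hq : q ∈ C) (hq' : q' ∈ C) : q' - q ∈ vectorSpan ℝ C :=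
  vsub_mem_vectorSpan ℝ hq' hq

theorem eq_zero_of_mem_vectorSpan {f : Param →ₗ[ℝ] ℝ} {b : ℝ} (h : ∀ x ∈ C, f x = b) {w : Param}
    (hw : w ∈ vectorSpan ℝ C) : f w = 0 := by
  have : vectorSpan ℝ C ≤ LinearMap.ker f := by
    refine Submodule.span_le.2 ?_
    rintro _ ⟨x, hx, y, hy, rfl⟩
    simp [h x hx, h y hy]
  exact this hw

/-- Linear forms which are maximal at a relatively interior point are constant. -/
theorem eq_of_intrinsicInterior {f : Param →ₗ[ℝ] ℝ} (hq : q ∈ intrinsicInterior ℝ C)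
    (h : ∀ x ∈ C, f x ≤ f q) {x : Param} (hx : x ∈ C) : f x = f q := by
  have hw := sub_mem_vectorSpan (intrinsicInterior_subset hq) hx
  obtain ⟨t, ht, ht0 : t < 0⟩ := (((eventually_add_smul_mem_intrinsicInterior hq
    hw).filter_mono nhdsWithin_le_nhds).and (self_mem_nhdsWithin : Iio (0 : ℝ) ∈ 𝓝[<] 0)).exists
  have h1 := h _ (intrinsicInterior_subset ht)
  have h2 := h x hx
  simp only [map_add, map_smul, map_sub, smul_eq_mul] at h1
  nlinarith

theorem IsPolyhedron.isClosed (h : IsPolyhedron C) : IsClosed C := by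
  obtain ⟨S, rfl⟩ := h
  have : {x | ∀ s ∈ S, s.1 x ≤ s.2} = ⋂ s ∈ S, {x : Param | s.1 x ≤ s.2} := by ext; simp
  rw [this]
  exact isClosed_biInter fun s _ =>
    isClosed_le s.1.continuous_of_finiteDimensional continuous_const

theorem IsPolyhedron.convex (h : IsPolyhedron C) : Convex ℝ C := by
  obtain ⟨S, rfl⟩ := h
  have : {x | ∀ s ∈ S, s.1 x ≤ s.2} = ⋂ s ∈ S, {x : Param | s.1 x ≤ s.2} := by ext; simp
  rw [this]
  exact convex_iInter₂ fun s _ => convex_halfSpace_le s.1.isLinear s.2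

/-- Inequalities that are strict at `q` stay strict nearby, and those that are equalities on all of
`C` persist in the directions of `C`. Conversely, a linear form that is maximal at a relatively
interior point is constant on `C`. -/
theorem mem_intrinsicInterior_iff {S : Finset ((Param →ₗ[ℝ] ℝ) × ℝ)}
    (hC : C = {x | ∀ s ∈ S, s.1 x ≤ s.2}) : q ∈ intrinsicInterior ℝ C ↔
      q ∈ C ∧ ∀ s ∈ S, s.1 q = s.2 → ∀ x ∈ C, s.1 x = s.2 := by
  constructor
  · intro hq
    have hqC := intrinsicInterior_subset hq
    refine ⟨hqC, fun s hs hsq x hx => ?_⟩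
    rw [← hsq]
    refine eq_of_intrinsicInterior hq (fun y hy => ?_) hx
    rw [hC] at hy
    rw [hsq]; exact hy s hs
  · rintro ⟨hq, h⟩
    refine mem_intrinsicInterior_of_eventually hq ?_
    have : ∀ s ∈ S, ∀ᶠ w : vectorSpan ℝ C in 𝓝 0, s.1 (q + (w : Param)) ≤ s.2 := by
      intro s hs
      have hle : s.1 q ≤ s.2 := by rw [hC] at hq; exact hq s hs
      rcases hle.eq_or_lt with heq | hlt
      · refine Eventually.of_forall fun w => ?_
        rw [map_add, eq_zero_of_mem_vectorSpan (h s hs heq) w.2, heq, add_zero]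
      · have hf : Continuous fun w : vectorSpan ℝ C => s.1 (q + (w : Param)) :=
          s.1.continuous_of_finiteDimensional.comp (by fun_prop)
        exact (hf.continuousAt.eventually (gt_mem_nhds (by simpa using hlt))).mono
          fun w hw => hw.le
    filter_upwards [(Finset.eventually_all S).2 this] with w hw
    exact hC.symm.subset hw

theorem IsPolyhedron.convex_intrinsicInterior (h : IsPolyhedron C) :
    Convex ℝ (intrinsicInterior ℝ C) := by
  have hconv := h.convex
  obtain ⟨S, hC⟩ := h
  intro x hx y hy a b ha hb hab
  rw [mem_intrinsicInterior_iff hC] at hx hy ⊢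
  refine ⟨hconv hx.1 hy.1 ha hb hab, fun s hs heq => ?_⟩
  have h1 : s.1 x ≤ s.2 := by have := hx.1; rw [hC] at this; exact this s hs
  have h2 : s.1 y ≤ s.2 := by have := hy.1; rw [hC] at this; exact this s hs
  simp only [map_add, map_smul, smul_eq_mul] at heq
  rcases ha.eq_or_lt with rfl | ha
  · exact hy.2 s hs (by rw [zero_add] at hab; subst hab; linarith)
  · refine hx.2 s hs (le_antisymm h1 ?_)
    by_contra hcon
    push Not at hcon
    have e : s.2 = a * s.2 + b * s.2 := by rw [← add_mul, hab, one_mul]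
    have h3 := mul_lt_mul_of_pos_left hcon ha
    have h4 := mul_le_mul_of_nonneg_left h2 hb
    linarith

end Relint

/-! ### Cells of a polyhedral structure on a tritangent class -/

section Cells

variable {Ω : Set Param} (X : PolyStructure c Ω) {C D : Set Param}

/-- Every point is in the relative interior of a cell. -/
theorem PolyStructure.exists_mem_intrinsicInterior (hq : q ∈ Ω) :
    ∃ D ∈ X.cells, q ∈ intrinsicInterior ℝ D := by
  have hne : {D ∈ X.cells | q ∈ D}.Nonempty := by
    rw [← X.union_eq] at hq
    obtain ⟨D, hD, h⟩ := hq
    exact ⟨D, hD, h⟩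
  -- A minimal cell containing `q` has `q` in its relative interior: an inequality that is tight at
  -- `q` but not on all of `D` would cut out a smaller face through `q`.
  obtain ⟨D, hD⟩ := (X.finite.subset (sep_subset _ _)).exists_minimal hne
  obtain ⟨⟨hDc, hqD⟩, hmin⟩ := hD
  refine ⟨D, hDc, ?_⟩
  obtain ⟨S, hS⟩ := X.polyhedron D hDc
  rw [mem_intrinsicInterior_iff hS]
  refine ⟨hqD, fun s hs hsq x hx => ?_⟩
  have hF : IsExposed ℝ D {x ∈ D | s.1 x = s.2} := by
    intro _
    refine ⟨LinearMap.toContinuousLinearMap s.1, ?_⟩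
    ext x
    simp only [mem_ofPred_eq, LinearMap.coe_toContinuousLinearMap']
    refine and_congr_right fun hx => ⟨fun h y hy => ?_, fun h => ?_⟩
    · rw [h]; rw [hS] at hy; exact hy s hs
    · have h1 := h q hqD
      rw [hS] at hx
      exact le_antisymm (hx s hs) (hsq ▸ h1)
  have hF' := X.face_mem D hDc {x ∈ D | s.1 x = s.2} ⟨q, hqD, hsq⟩ hF
  have hmem : {x ∈ D | s.1 x = s.2} ∈ {D ∈ X.cells | q ∈ D} := ⟨hF', hqD, hsq⟩
  exact (hmin hmem (sep_subset _ _) hx).2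

/-- A cell which meets the relative interior of another cell contains it. -/
theorem PolyStructure.subset_of_mem (hC : C ∈ X.cells) (hD : D ∈ X.cells)
    (hq : q ∈ intrinsicInterior ℝ C) (hqD : q ∈ D) : C ⊆ D := by
  have hqC := intrinsicInterior_subset hq
  obtain ⟨l, hl⟩ := (X.inter_face C hC D hD ⟨q, hqC, hqD⟩).1 ⟨q, hqC, hqD⟩
  have hq2 : q ∈ C ∩ D := ⟨hqC, hqD⟩
  rw [hl] at hq2
  intro x hx
  have h1 := eq_of_intrinsicInterior (f := l.toLinearMap) hq hq2.2 hx
  have : x ∈ C ∩ D := by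
    rw [hl]
    exact ⟨hx, fun y hy => (hq2.2 y hy).trans h1.ge⟩
  exact this.2

theorem PolyStructure.subset (hC : C ∈ X.cells) : C ⊆ Ω := by
  rw [← X.union_eq]; exact subset_sUnion_of_mem hC

/-- If a curve in the relative interior of a cell is four-valent, then all of them are. -/
theorem PolyStructure.eq_zero_of_eq_zero (hΩ : ∀ q ∈ Ω, IsTritangent c q) (hD : D ∈ X.cells)
    (hq : q ∈ intrinsicInterior ℝ D) (h0 : q.2 = 0) {q' : Param}
    (hq' : q' ∈ intrinsicInterior ℝ D) : q'.2 = 0 := by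
  by_contra hne
  set w := q' - q with hw
  have hw2 : w.2 ≠ 0 := by rw [hw, Prod.snd_sub, h0, sub_zero]; exact hne
  have hev := eventually_add_smul_mem_intrinsicInterior hq
    (sub_mem_vectorSpan (intrinsicInterior_subset hq) (intrinsicInterior_subset hq'))
  have hev' := (continuous_neg.tendsto' (0 : ℝ) 0 neg_zero).eventually hev
  obtain ⟨t, ⟨ht1, ht2⟩, ht0 : 0 < t⟩ := (((hev.and hev').filter_mono nhdsWithin_le_nhds).and
    (self_mem_nhdsWithin : Ioi (0 : ℝ) ∈ 𝓝[>] 0)).exists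
  have hP := (hΩ q (X.subset hD (intrinsicInterior_subset hq))).parity h0.ge
  have hcell : ∀ p ∈ intrinsicInterior ℝ D, ∀ k, dualCell c (vertex p k) = dualCell c q.1 := by
    intro p hp k
    rw [X.compatible D hD p hp q hq k]
    fin_cases k
    · rfl
    · exact congrArg _ (vertex_one_of_eq_zero h0)
  -- Off the curve the west leg would require an even first coordinate of the dominant exponent and
  -- the east leg an odd one.
  by_cases hcard : (dualCell c q.1).card = 1
  · obtain ⟨m, hm⟩ := Finset.card_eq_one.1 hcard
    have h1 := hP.west h0.ge 0 le_rfl m (by rw [line_zero, vertex_zero, hm])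
    have h2 := hP.east h0.ge 0 le_rfl m (by rw [line_zero, vertex_one_of_eq_zero h0, hm])
    obtain ⟨e1, -, e3, -⟩ := endSlope_values
    rw [e1] at h1
    rw [e3] at h2
    obtain ⟨x, hx⟩ := h1
    obtain ⟨y, hy⟩ := h2
    simp only [slope] at hx hy
    omega
  · have hpos := (dualCell_nonempty c q.1).card_pos
    obtain ⟨m, m', hm, hm', hmm⟩ := Finset.one_lt_card_iff.1 (by omega : 1 < (dualCell c q.1).card)
    -- The dual cells are constant and coincide for the two vertices, so `m' - m` is orthogonal to
    -- the edge of every curve in the relative interior. Edges of both slopes occur near `q`, which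
    -- forces `m = m'`.
    have key : ∀ p ∈ intrinsicInterior ℝ D,
        ((m'.toInt.1 - m.toInt.1 : ℤ) : ℝ) * p.2 + ((m'.toInt.2 - m.toInt.2 : ℤ) : ℝ) * |p.2| = 0 := by
      intro p hp
      have h1 := monomial_eq_of_mem ((hcell p hp 0).symm ▸ hm) ((hcell p hp 0).symm ▸ hm')
      have h2 := monomial_eq_of_mem ((hcell p hp 1).symm ▸ hm) ((hcell p hp 1).symm ▸ hm')
      simp only [monomial, vertex_zero, vertex_one] at h1 h2
      simp only [Expo.toInt]
      push_cast
      linarith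
    have h1 := key _ ht1
    have h2 := key _ ht2
    have e1 : (q + t • (q' - q)).2 = t * w.2 := by simp [hw, h0]
    have e2 : (q + -t • (q' - q)).2 = -(t * w.2) := by simp [hw, h0]
    rw [e1] at h1
    rw [e2, abs_neg] at h2
    have hne' : t * w.2 ≠ 0 := mul_ne_zero ht0.ne' hw2
    have h3 : ((m'.toInt.1 - m.toInt.1 : ℤ) : ℝ) = 0 := by
      refine (mul_eq_zero.1 (?_ : _ * (t * w.2) = 0)).resolve_right hne'
      linarith
    have h4 : ((m'.toInt.2 - m.toInt.2 : ℤ) : ℝ) = 0 := by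
      refine (mul_eq_zero.1 (?_ : _ * |t * w.2| = 0)).resolve_right (abs_ne_zero.2 hne')
      linarith
    refine hmm (Expo.toInt_injective (Prod.ext ?_ ?_))
    · have := Int.cast_eq_zero.1 h3; omega
    · have := Int.cast_eq_zero.1 h4; omega

/-- The relative interior is convex, so a change of sign would produce a four-valent curve, and then
all curves of the relative interior would be four-valent. -/
theorem PolyStructure.pos_of_pos (hΩ : ∀ q ∈ Ω, IsTritangent c q) (hD : D ∈ X.cells)
    (hq : q ∈ intrinsicInterior ℝ D) {σ : ℝ} (hσ : 0 < σ * q.2) {q' : Param}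
    (hq' : q' ∈ intrinsicInterior ℝ D) : 0 < σ * q'.2 := by
  have hσ0 : σ ≠ 0 := by rintro rfl; simp at hσ
  by_contra hcon
  push Not at hcon
  have hconv := (X.polyhedron D hD).convex_intrinsicInterior.isPreconnected
  have hcont : ContinuousOn (fun p : Param => σ * p.2) (intrinsicInterior ℝ D) := by fun_prop
  obtain ⟨p, hp, hp0⟩ := hconv.intermediate_value hq' hq hcont ⟨hcon, hσ.le⟩
  have := X.eq_zero_of_eq_zero hΩ hD hp ((mul_eq_zero.1 hp0).resolve_left hσ0) hq
  rw [this, mul_zero] at hσ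
  exact lt_irrefl _ hσ

/-- Membership in the unbounded part depends only on the dual cells of the vertices and on the sign
of the length, which are constant along the relative interior. -/
theorem PolyStructure.mem_bounded (hΩ : ∀ q ∈ Ω, IsTritangent c q) (hD : D ∈ X.cells)
    (hq : q ∈ intrinsicInterior ℝ D) (hU : ¬ InUnboundedPart c q) : D ∈ X.bounded := by
  refine ⟨hD, ?_⟩
  rintro ⟨p, hp, hpU⟩
  refine hU ?_
  have h0 := X.compatible D hD q hq p hp
  have hpos : 0 < p.2 → 0 < q.2 := fun h => by
    simpa using X.pos_of_pos hΩ hD hp (σ := 1) (by simpa using h) hq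
  have hneg : p.2 < 0 → q.2 < 0 := fun h => by
    simpa using X.pos_of_pos hΩ hD hp (σ := -1) (by simpa using h) hq
  unfold InUnboundedPart at hpU ⊢
  rw [h0, h0]
  exact hpU.imp (And.imp_left hpos) (Or.imp (And.imp_left hpos) (Or.imp (And.imp_left hneg)
    (Or.imp (And.imp_left hneg) (Or.imp (And.imp_left hpos) (Or.imp (And.imp_left hpos)
      (Or.imp (And.imp_left hneg) (And.imp_left hneg)))))))

theorem PolyStructure.cellDim_le (hD : D ∈ X.bounded) : cellDim D ≤ X.boundedDim :=
  le_csSup ((X.finite.subset (sep_subset _ _)).image _).bddAbove (mem_image_of_mem _ hD)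

theorem tritangentClass_eq {q₀ : Param} (hq : q ∈ tritangentClass c q₀) :
    tritangentClass c q₀ = tritangentClass c q :=
  connectedComponentIn_eq hq

theorem isTritangent_of_mem {q₀ : Param} (hq : q ∈ tritangentClass c q₀) : IsTritangent c q :=
  connectedComponentIn_subset {q | IsTritangent c q} q₀ hq

/-- The short segment from `q` in direction `w` is connected and consists of tritangents. -/
theorem eventually_mem_tritangentClass {q₀ w : Param} (hq : q ∈ tritangentClass c q₀)
    (h : ∀ᶠ t in 𝓝[>] (0 : ℝ), IsTritangent c (q + t • w)) :
    ∀ᶠ t in 𝓝[>] (0 : ℝ), q + t • w ∈ tritangentClass c q₀ := by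
  obtain ⟨ε, hε : 0 < ε, hsub⟩ := mem_nhdsGT_iff_exists_Ioo_subset.1 h
  filter_upwards [Ioo_mem_nhdsGT hε] with t ht
  rw [tritangentClass_eq hq]
  have hS : (fun s : ℝ => q + s • w) '' Icc 0 t ⊆ {q | IsTritangent c q} := by
    rintro _ ⟨s, hs, rfl⟩
    rcases hs.1.eq_or_lt with rfl | h0
    · simpa using isTritangent_of_mem hq
    · exact hsub ⟨h0, hs.2.trans_lt ht.2⟩
  have hpre : IsPreconnected ((fun s : ℝ => q + s • w) '' Icc 0 t) :=
    isPreconnected_Icc.image _ (by fun_prop)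
  exact hpre.subset_connectedComponentIn ⟨0, ⟨le_rfl, ht.1.le⟩, by simp⟩ hS
    ⟨t, ⟨ht.1.le, le_rfl⟩, rfl⟩

end Cells

/-! ### Tangent spaces of bounded cells of maximal dimension -/

section MaximalCells

variable {q₀ : Param} (X : PolyStructure c (tritangentClass c q₀)) {C : Set Param}


/-- Directions in which the curve stays tritangent are tangent to a maximal cell. -/
theorem PolyStructure.mem_vectorSpan (hC : C ∈ X.bounded) (hdim : cellDim C = X.boundedDim)
    (hq : q ∈ intrinsicInterior ℝ C) {w : Param} (hw : ∀ᶠ t in 𝓝[>] (0 : ℝ),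
      IsTritangent c (q + t • w) ∧ ¬ InUnboundedPart c (q + t • w)) : w ∈ vectorSpan ℝ C := by
  have hΩ : ∀ q ∈ tritangentClass c q₀, IsTritangent c q := fun q => isTritangent_of_mem
  have hqΩ := X.subset hC.1 (intrinsicInterior_subset hq)
  have hev := eventually_mem_tritangentClass hqΩ (hw.mono fun t h => h.1)
  -- There are finitely many cells, so the relative interior of one of them contains `q + t • w` for
  -- arbitrarily small `t`; this cell is bounded and, being closed, contains `q`.
  obtain ⟨D, hD, hfreq⟩ : ∃ D ∈ X.cells, ∃ᶠ t in 𝓝[>] (0 : ℝ),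
      q + t • w ∈ intrinsicInterior ℝ D ∧ ¬ InUnboundedPart c (q + t • w) := by
    by_contra hcon
    push Not at hcon
    have h1 := (eventually_all_finite X.finite).2 hcon
    obtain ⟨t, h1, h2, h3⟩ := (h1.and (hev.and hw)).exists
    obtain ⟨D, hD, h⟩ := X.exists_mem_intrinsicInterior h2
    exact h3.2 (h1 D hD h)
  obtain ⟨t₀, h1, h2⟩ := hfreq.exists
  have hDb := X.mem_bounded hΩ hD h1 h2
  have hqD : q ∈ D := by
    have hcont : Tendsto (fun t : ℝ => q + t • w) (𝓝[>] 0) (𝓝 q) := by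
      have : Continuous fun t : ℝ => q + t • w := by fun_prop
      exact (this.tendsto' 0 q (by simp)).mono_left nhdsWithin_le_nhds
    rw [← (X.polyhedron D hD).isClosed.closure_eq]
    exact mem_closure_of_frequently_of_tendsto
      (hfreq.mono fun t h => intrinsicInterior_subset h.1) hcont
  have hsub := X.subset_of_mem hC.1 hD hq hqD
  -- The cell `D` contains `C` and its dimension is at most that of `C`, by maximality.
  have hV : vectorSpan ℝ C = vectorSpan ℝ D :=
    Submodule.eq_of_le_of_finrank_le (vectorSpan_mono ℝ hsub)
      ((X.cellDim_le hDb).trans hdim.ge)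
  obtain ⟨t, ⟨ht, -⟩, ht0 : 0 < t⟩ := (hfreq.and_eventually self_mem_nhdsWithin).exists
  have := sub_mem_vectorSpan hqD (intrinsicInterior_subset ht)
  rw [add_sub_cancel_left, ← hV] at this
  exact (Submodule.smul_mem_iff _ ht0.ne').1 this

end MaximalCells

/-! ### Genericity -/

/-- A linear form with coefficients in `{-1, 0, 1}`. -/
def signForm (i j k : SignType) : Param →ₗ[ℝ] ℝ where
  toFun w := (i : ℝ) * w.1.1 + (j : ℝ) * w.1.2 + (k : ℝ) * w.2
  map_add' w w' := by simp only [Prod.fst_add, Prod.snd_add]; ring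
  map_smul' t w := by simp only [Prod.smul_fst, Prod.smul_snd, smul_eq_mul, RingHom.id_apply]; ring

/-- A level set of a linear form. -/
def levelSet (f : Param →ₗ[ℝ] ℝ) (b : ℝ) : AffineSubspace ℝ Param where
  carrier := {x | f x = b}
  smul_vsub_vadd_mem' t x y z hx hy hz := by
    simp only [mem_ofPred_eq] at hx hy hz
    simp [hx, hy, hz]

/-- A vertex is the solution of two independent linear equations given by its dual triangle, so it
is determined by its dual cell, and there are finitely many sets of exponents. -/
theorem finite_vertices (hc : IsSmooth c) :
    {P | (dualCell c P).card = 3}.Finite := by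
  refine Set.Finite.of_finite_image (Set.toFinite (dualCell c '' _)) ?_
  intro P hP Q hQ hPQ
  obtain ⟨m, m', m'', h1, h2, h3, hd⟩ := Finset.card_eq_three.1 (show (dualCell c P).card = 3 from hP)
  have hm : m ∈ dualCell c P := by simp [hd]
  have hm' : m' ∈ dualCell c P := by simp [hd]
  have hm'' : m'' ∈ dualCell c P := by simp [hd]
  have hdet := (hc P).2 m hm m' hm' m'' hm'' h1 h2 h3
  have hdet' : ((((m'.toInt.1 - m.toInt.1) * (m''.toInt.2 - m.toInt.2) -
        (m'.toInt.2 - m.toInt.2) * (m''.toInt.1 - m.toInt.1) : ℤ)) : ℝ) ≠ 0 := by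
    rw [Int.cast_ne_zero, ← abs_pos, hdet]
    exact one_pos
  have e1 := monomial_eq_of_mem hm hm'
  have e2 := monomial_eq_of_mem hm hm''
  have e3 := monomial_eq_of_mem (hPQ ▸ hm) (hPQ ▸ hm')
  have e4 := monomial_eq_of_mem (hPQ ▸ hm) (hPQ ▸ hm'')
  simp only [monomial, Expo.toInt] at e1 e2 e3 e4 hdet'
  push_cast at hdet'
  refine Prod.ext (sub_eq_zero.1 ((mul_eq_zero.1 ?_).resolve_left hdet'))
    (sub_eq_zero.1 ((mul_eq_zero.1 ?_).resolve_left hdet'))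
  · linear_combination (-((m''.2 : ℝ) - m.2)) * (e1 - e3) + ((m'.2 : ℝ) - m.2) * (e2 - e4)
  · linear_combination ((m''.1 : ℝ) - m.1) * (e1 - e3) - ((m'.1 : ℝ) - m.1) * (e2 - e4)

section Generic

variable {q₀ : Param} (X : PolyStructure c (tritangentClass c q₀)) {C : Set Param}


/-- The exceptional subspaces are the level sets of forms with coefficients in {-1, 0, 1} on which
an arm may pass through a vertex of the curve, as far as they do not contain the cell. -/
theorem PolyStructure.generically (hc : IsSmooth c) (hC : C ∈ X.bounded)
    (hdim : cellDim C = X.boundedDim) {P : Param → Prop}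
    (h : ∀ q ∈ intrinsicInterior ℝ C, Local c q (vectorSpan ℝ C) → P q) : Generically C P := by
  refine ⟨{A | (∃ i j k, ∃ P ∈ {P | (dualCell c P).card = 3},
    levelSet (signForm i j k) (i * P.1 + j * P.2) = A) ∧ ¬ C ⊆ A}, ?_, fun A hA => hA.2, ?_⟩
  · refine Set.Finite.subset (s := ⋃ i, ⋃ j, ⋃ k,
      (fun P : Plane => levelSet (signForm i j k) (i * P.1 + j * P.2)) ''
        {P | (dualCell c P).card = 3}) ?_ ?_
    · exact finite_iUnion fun i => finite_iUnion fun j => finite_iUnion fun k =>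
        (finite_vertices hc).image _
    · rintro A ⟨⟨i, j, k, P, hP, hA⟩, -⟩
      simp only [mem_iUnion]
      exact ⟨i, j, k, P, hP, hA⟩
  · intro q hq hA
    have hqC := intrinsicInterior_subset hq
    refine h q hq ⟨hc, isTritangent_of_mem (X.subset hC.1 hqC), fun hU => hC.2 ⟨q, hq, hU⟩,
      fun w hw => X.mem_vectorSpan hC hdim hq (hw.mono fun t h => ⟨h.1, h.2.1⟩), fun w hw => ?_,
      fun i j k => ?_⟩
    · filter_upwards [(eventually_add_smul_mem_intrinsicInterior hq hw).filter_mono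
        nhdsWithin_le_nhds] with t ht k
      exact X.compatible C hC.1 _ ht _ hq k
    · by_contra hcon
      push Not at hcon
      obtain ⟨⟨w, hw, hne⟩, P, hP, heq⟩ := hcon
      refine hA (levelSet (signForm i j k) (i * P.1 + j * P.2)) ⟨⟨i, j, k, P, hP, rfl⟩, ?_⟩ heq
      intro hsub
      exact hne (eq_zero_of_mem_vectorSpan (f := signForm i j k) (fun x hx => hsub hx) hw)

end Generic

/-! ### Movements of the vertices -/

section Movements

variable {C : Set Param} {σ : ℝ}

/-- The vertices as functions of the parameter, for edges with slope of a given sign. -/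
def vertexMap (σ : ℝ) : Fin 2 → Param →ₗ[ℝ] Plane :=
  ![LinearMap.fst ℝ Plane ℝ,
    LinearMap.fst ℝ Plane ℝ + (LinearMap.snd ℝ Plane ℝ).smulRight ((1, σ) : Plane)]

theorem vertex_eq_vertexMap {p : Param} (h : |p.2| = σ * p.2) (k : Fin 2) :
    vertex p k = vertexMap σ k p := by
  fin_cases k
  · rfl
  · ext <;> simp [vertex, vertexMap, h, mul_comm]

/-- The kernel of each vertex map is the line of movements that fix this vertex and slide the other
one along the edge. -/
theorem vertexMap_injective {V : Submodule ℝ Param} (σ : ℝ) :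
    ((((0, 0), 1) : Param) ∉ V → ∀ w ∈ V, vertexMap σ 0 w = 0 → w = 0) ∧
    ((((1, σ), -1) : Param) ∉ V → ∀ w ∈ V, vertexMap σ 1 w = 0 → w = 0) := by
  refine ⟨fun h w hw h0 => ?_, fun h w hw h0 => ?_⟩
  · have h1 : w.1 = 0 := h0
    by_contra hne
    have h2 : w.2 ≠ 0 := fun h2 => hne (Prod.ext h1 h2)
    refine h ?_
    have e : (((0, 0), 1) : Param) = w.2⁻¹ • w := by
      ext <;> simp [h1, h2]
    rw [e]; exact V.smul_mem _ hw
  · have h1 : w.1 + w.2 • ((1, σ) : Plane) = 0 := h0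
    have h3 : w.1.1 = -w.2 := by
      have := congrArg Prod.fst h1; simp at this; linarith
    have h4 : w.1.2 = -(w.2 * σ) := by
      have := congrArg Prod.snd h1; simp at this; linarith
    by_contra hne
    have h2 : w.2 ≠ 0 := fun h2 =>
      hne (Prod.ext (Prod.ext (by simp [h3, h2]) (by simp [h4, h2])) h2)
    refine h ?_
    have e : (((1, σ), -1) : Param) = -w.2⁻¹ • w := by
      ext <;> simp [h3, h4, h2]
    rw [e]; exact V.smul_mem _ hw

theorem injOn_of_injective {f : Param →ₗ[ℝ] Plane} (h : ∀ w ∈ vectorSpan ℝ C, f w = 0 → w = 0) :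
    InjOn f (intrinsicInterior ℝ C) := fun p hp p' hp' heq =>
  sub_eq_zero.1 (h _ (sub_mem_vectorSpan (intrinsicInterior_subset hp')
    (intrinsicInterior_subset hp)) (by rw [map_sub, heq, sub_self]))

theorem isOpen_image_of_injective {f : Param →ₗ[ℝ] Plane} (hdim : cellDim C = 2)
    (h : ∀ w ∈ vectorSpan ℝ C, f w = 0 → w = 0) : IsOpen (f '' intrinsicInterior ℝ C) := by
  have hinj : Function.Injective (f.domRestrict (vectorSpan ℝ C)) := by
    rw [← LinearMap.ker_eq_bot, LinearMap.ker_eq_bot']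
    intro w hw
    exact Subtype.ext (h w w.2 hw)
  let e := LinearEquiv.ofInjectiveOfFinrankEq (f.domRestrict (vectorSpan ℝ C)) hinj
    (by rw [← cellDim, hdim]; simp)
  have he : ∀ w, f (e.symm w) = w := fun w => e.apply_symm_apply w
  rw [isOpen_iff_mem_nhds]
  rintro _ ⟨q, hq, rfl⟩
  have hcont : Continuous fun z : Plane => e.symm (z - f q) :=
    e.symm.toLinearMap.continuous_of_finiteDimensional.comp (by fun_prop)
  have h0 := hcont.tendsto (f q)
  rw [sub_self, map_zero] at h0
  filter_upwards [h0.eventually (eventually_add_mem_intrinsicInterior hq)] with z hz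
  exact ⟨_, hz, by rw [map_add, he]; abel⟩

/-- The space `W` is the tangent space of the cell, or its reflection when the edge has slope minus
one. On the relative interior the vertices are linear functions of the parameter, because the length
has constant sign. -/
theorem movesBy_of_moves (hσ : σ = 1 ∨ σ = -1)
    (habs : ∀ p ∈ intrinsicInterior ℝ C, |p.2| = σ * p.2) {W : Submodule ℝ Param}
    (hW : Module.finrank ℝ W = cellDim C)
    (hU : moveUpper.toParam ∈ W ↔ (((0, 0), 1) : Param) ∈ vectorSpan ℝ C)
    (hL : moveLower.toParam ∈ W ↔ (((1, σ), -1) : Param) ∈ vectorSpan ℝ C) {π : Movement}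
    (hπ : Moves W π) : MovesBy C π := by
  have hv : ∀ k, ∀ p ∈ intrinsicInterior ℝ C, vertex p k = vertexMap σ k p := fun k p hp =>
    vertex_eq_vertexMap (habs p hp) k
  have hu : ((1, σ) : Plane) = (1, 1) ∨ ((1, σ) : Plane) = (1, -1) := by
    rcases hσ with rfl | rfl
    · exact Or.inl rfl
    · exact Or.inr rfl
  have hinj0 := (vertexMap_injective (V := vectorSpan ℝ C) σ).1
  have hinj1 := (vertexMap_injective (V := vectorSpan ℝ C) σ).2
  have hInj : ∀ k, (∀ w ∈ vectorSpan ℝ C, vertexMap σ k w = 0 → w = 0) →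
      InjOn (fun q => vertex q k) (intrinsicInterior ℝ C) := fun k h =>
    (injOn_of_injective h).congr fun p hp => (hv k p hp).symm
  have f0 : ∀ a b : ℝ, vertexMap σ 0 (a • ((1, σ), -1) + b • ((0, 0), 1)) = a • (1, σ) := by
    intro a b; ext <;> simp [vertexMap]
  have f1 : ∀ a b : ℝ, vertexMap σ 1 (a • ((1, σ), -1) + b • ((0, 0), 1)) = b • (1, σ) := by
    intro a b; ext <;> simp [vertexMap]; ring
  have hsub : ∀ {q q'}, q ∈ intrinsicInterior ℝ C → q' ∈ intrinsicInterior ℝ C → ∀ k,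
      vertex q' k = vertex q k + vertexMap σ k (q' - q) := fun hq hq' k => by
    rw [hv k _ hq, hv k _ hq', map_sub]; abel
  have hmem : ∀ {q q'}, q ∈ intrinsicInterior ℝ C → q' ∈ intrinsicInterior ℝ C →
      q' - q ∈ vectorSpan ℝ C := fun hq hq' =>
    sub_mem_vectorSpan (intrinsicInterior_subset hq) (intrinsicInterior_subset hq')
  cases π with
  | ball =>
    obtain ⟨h1, h2⟩ := hπ
    rw [hU, hL] at h2
    have hdim : cellDim C = 2 := hW.symm.trans h1
    obtain ⟨k, hk⟩ : ∃ k, ∀ w ∈ vectorSpan ℝ C, vertexMap σ k w = 0 → w = 0 := by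
      by_cases h : (((0, 0), 1) : Param) ∈ vectorSpan ℝ C
      · exact ⟨1, hinj1 fun h' => h2 ⟨h, h'⟩⟩
      · exact ⟨0, hinj0 h⟩
    refine ⟨hdim, k, hInj k hk, ?_⟩
    rw [image_congr (hv k)]
    exact isOpen_image_of_injective hdim hk
  | independent =>
    obtain ⟨h1, h2, h3⟩ := hπ
    rw [hU] at h2
    rw [hL] at h3
    have hdim : cellDim C = 2 := hW.symm.trans h1
    have hspan : ∀ w ∈ vectorSpan ℝ C,
        ∃ a b : ℝ, w = a • (((1, σ), -1) : Param) + b • (((0, 0), 1) : Param) := by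
      intro w hw
      have hli : LinearIndependent ℝ ![(((1, σ), -1) : Param), (((0, 0), 1) : Param)] := by
        rw [LinearIndependent.pair_iff]
        intro s t hst
        have e1 := congrArg (fun x : Param => x.1.1) hst
        have e2 := congrArg (fun x : Param => x.2) hst
        simp at e1 e2
        exact ⟨e1, by rw [e1] at e2; simpa using e2⟩
      have hle : Submodule.span ℝ (range ![(((1, σ), -1) : Param), (((0, 0), 1) : Param)]) ≤
          vectorSpan ℝ C := by
        rw [Submodule.span_le, range_subset_iff]
        intro i
        fin_cases i
        · exact h3
        · exact h2
      have heq := Submodule.eq_of_le_of_finrank_le hle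
        (by rw [finrank_span_eq_card hli, Fintype.card_fin]; exact hdim.le)
      rw [← heq, Matrix.range_cons, Matrix.range_cons, Matrix.range_empty, union_empty,
        singleton_union, Submodule.mem_span_pair] at hw
      obtain ⟨a, b, h⟩ := hw
      exact ⟨a, b, h.symm⟩
    refine ⟨hdim, (1, σ), hu, ?_, ?_⟩
    · intro q hq q' hq' k
      obtain ⟨a, b, hab⟩ := hspan _ (hmem hq hq')
      rw [hsub hq hq' k, hab]
      fin_cases k
      · exact ⟨a, congrArg _ (f0 a b)⟩
      · exact ⟨b, congrArg _ (f1 a b)⟩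
    · intro q hq
      have hcont : Continuous fun x : ℝ × ℝ => x.1 • (⟨_, h3⟩ : vectorSpan ℝ C) +
          x.2 • (⟨_, h2⟩ : vectorSpan ℝ C) := by fun_prop
      have h0 := hcont.tendsto 0
      simp only [Prod.fst_zero, Prod.snd_zero, zero_smul, add_zero] at h0
      obtain ⟨ε, hε, h⟩ := Metric.eventually_nhds_iff.1
        (h0.eventually (eventually_add_mem_intrinsicInterior hq))
      refine ⟨ε, hε, fun a b ha hb => ?_⟩
      have hq' := h (y := (a, b)) (by simpa [Prod.dist_eq] using ⟨ha, hb⟩)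
      refine ⟨_, hq', ?_, ?_⟩
      · rw [hsub hq hq', add_sub_cancel_left]
        exact congrArg _ (f0 a b)
      · rw [hsub hq hq', add_sub_cancel_left]
        exact congrArg _ (f1 a b)
  | dependent =>
    obtain ⟨h1, h2, h3⟩ := hπ
    rw [hU] at h2
    rw [hL] at h3
    refine ⟨hW ▸ h1, fun k => ?_⟩
    fin_cases k
    · exact hInj 0 (hinj0 h2)
    · exact hInj 1 (hinj1 h3)
  | oneFixed =>
    obtain ⟨h1, h2⟩ := hπ
    rw [hU, hL] at h2
    have hdim : Module.finrank ℝ (vectorSpan ℝ C) = 1 := hW.symm.trans h1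
    have hspan : ∀ {v : Param}, v ∈ vectorSpan ℝ C → v.2 ≠ 0 → ∀ w ∈ vectorSpan ℝ C,
        ∃ t : ℝ, w = t • v := fun {v} hv h0 w hw => by
      have hne : (⟨v, hv⟩ : vectorSpan ℝ C) ≠ 0 := fun h =>
        h0 (by rw [show v = 0 from congrArg Subtype.val h]; rfl)
      obtain ⟨t, ht⟩ := (finrank_eq_one_iff_of_nonzero' _ hne).1 hdim ⟨w, hw⟩
      exact ⟨t, (congrArg Subtype.val ht).symm⟩
    refine ⟨hdim, (1, σ), hu, ?_⟩
    rcases h2 with h2 | h2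
    · refine ⟨0, 1, by decide, fun q hq q' hq' => ?_⟩
      obtain ⟨t, ht⟩ := hspan h2 (by simp) _ (hmem hq hq')
      rw [hsub hq hq', hsub hq hq', ht]
      refine ⟨?_, t, ?_⟩
      · have := f0 0 t
        rw [zero_smul, zero_add, zero_smul] at this
        rw [this, add_zero]
      · have := f1 0 t
        rw [zero_smul, zero_add] at this
        rw [this]
    · refine ⟨1, 0, by decide, fun q hq q' hq' => ?_⟩
      obtain ⟨t, ht⟩ := hspan h2 (by simp) _ (hmem hq hq')
      rw [hsub hq hq', hsub hq hq', ht]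
      refine ⟨?_, t, ?_⟩
      · have := f1 t 0
        rw [zero_smul, add_zero, zero_smul] at this
        rw [this, add_zero]
      · have := f0 t 0
        rw [zero_smul, add_zero] at this
        rw [this]
  | rigid => exact hW.symm.trans hπ

end Movements

/-! ### The classification -/

theorem eq_zero_of_eventually_mem {S : Set ℝ} (hS : S.Finite) {a b : ℝ}
    (h : ∀ᶠ t in 𝓝 (0 : ℝ), a + t * b ∈ S) : b = 0 := by
  by_contra hb
  refine (infinite_of_mem_nhds (0 : ℝ) h) (hS.preimage (f := fun t => a + t * b) ?_)
  intro x _ y _ hxy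
  simpa [hb] using hxy

section Main

variable {q₀ : Param} (X : PolyStructure c (tritangentClass c q₀)) {C : Set Param}


theorem PolyStructure.snd_eq_zero (hC : C ∈ X.cells) (hq : q ∈ intrinsicInterior ℝ C)
    (h0 : q.2 = 0) {w : Param} (hw : w ∈ vectorSpan ℝ C) : w.2 = 0 := by
  obtain ⟨t, ht, ht0 : 0 < t⟩ := (((eventually_add_smul_mem_intrinsicInterior hq
    hw).filter_mono nhdsWithin_le_nhds).and (self_mem_nhdsWithin : Ioi (0 : ℝ) ∈ 𝓝[>] 0)).exists
  have := X.eq_zero_of_eq_zero (fun q => isTritangent_of_mem) hC hq h0 ht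
  simpa [h0, ht0.ne'] using this

theorem PolyStructure.exists_isRigidFourValent (hc : IsSmooth c) (hC : C ∈ X.bounded)
    (hdim : cellDim C = X.boundedDim) (hq : q ∈ intrinsicInterior ℝ C) (h0 : q.2 = 0) :
    ∃ a b, IsRigidFourValent c q a b := by
  obtain ⟨w, s, e, n, hst, hf, hm⟩ := exists_isFourValent hc
    (isTritangent_of_mem (X.subset hC.1 (intrinsicInterior_subset hq))) h0 fun x hx =>
      X.snd_eq_zero hC.1 hq h0 (X.mem_vectorSpan hC hdim hq (hx.mono fun t h => ⟨h.1, h.2.1⟩))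
  exact hst.isRigidFourValent h0 hf hm

/-- Each curve in the relative interior is a rigid four-valent one, so the coordinates of its vertex
belong to the finite set of coordinates of vertices of `Γ` and cannot vary. -/
theorem PolyStructure.cellDim_eq_zero (hc : IsSmooth c) (hC : C ∈ X.bounded)
    (hdim : cellDim C = X.boundedDim) (hq : q ∈ intrinsicInterior ℝ C) (h0 : q.2 = 0) :
    cellDim C = 0 := by
  rw [cellDim, Submodule.finrank_eq_zero, eq_bot_iff]
  intro w hw
  have hev : ∀ᶠ t in 𝓝 (0 : ℝ), (∃ P, (dualCell c P).card = 3 ∧ P.1 = (q + t • w).1.1) ∧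
      ∃ P, (dualCell c P).card = 3 ∧ P.2 = (q + t • w).1.2 := by
    filter_upwards [eventually_add_smul_mem_intrinsicInterior hq hw] with t ht
    have h0' := X.eq_zero_of_eq_zero (fun q => isTritangent_of_mem) hC.1 hq h0 ht
    obtain ⟨a, b, hab⟩ := X.exists_isRigidFourValent hc hC hdim ht h0'
    exact hab.exists_vertex
  have h1 : w.1.1 = 0 := eq_zero_of_eventually_mem ((finite_vertices hc).image Prod.fst)
    (hev.mono fun t h => h.1)
  have h2 : w.1.2 = 0 := eq_zero_of_eventually_mem ((finite_vertices hc).image Prod.snd)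
    (hev.mono fun t h => h.2)
  exact (Submodule.mem_bot ℝ).2 (Prod.ext (Prod.ext h1 h2) (X.snd_eq_zero hC.1 hq h0 hw))

theorem finrank_comap_flipParam (V : Submodule ℝ Param) :
    Module.finrank ℝ (V.comap flipParam) = Module.finrank ℝ V := by
  let e : Param ≃ₗ[ℝ] Param := LinearEquiv.ofInvolutive flipParam flipParam_flipParam
  exact LinearEquiv.finrank_eq (e.ofSubmodule' V)

theorem PolyStructure.classification (hc : IsSmooth c) (hX : X.boundedDim ≤ 2) (hC : C ∈ X.bounded)
    (hdim : cellDim C = X.boundedDim) : ∃ π, MovesBy C π ∧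
      Generically C (fun q => InTableUpToSymmetry c q π) := by
  obtain ⟨q, hq⟩ := Set.Nonempty.intrinsicInterior (X.polyhedron C hC.1).convex
    (X.nonempty C hC.1)
  have hΩ : ∀ q ∈ tritangentClass c q₀, IsTritangent c q := fun q => isTritangent_of_mem
  have hrank : Module.finrank ℝ (vectorSpan ℝ C) ≤ 2 := hdim.trans_le hX
  rcases lt_trichotomy q.2 0 with hl | hl | hl
  · have hneg : ∀ p ∈ intrinsicInterior ℝ C, p.2 < 0 := fun p hp => by
      simpa using X.pos_of_pos hΩ hC.1 hq (σ := -1) (by simpa using hl) hp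
    obtain ⟨π, hπ⟩ := exists_moves ((finrank_comap_flipParam _).trans_le hrank)
    refine ⟨π, movesBy_of_moves (σ := -1) (Or.inr rfl) (fun p hp => ?_)
      (finrank_comap_flipParam _) ?_ ?_ hπ, X.generically hc hC hdim fun p hp h =>
        h.inTable_of_neg (hneg p hp) hπ⟩
    · rw [abs_of_neg (hneg p hp), neg_one_mul]
    · rw [Submodule.mem_comap, ← Submodule.neg_mem_iff]
      simp [flipParam_apply, Vec.toParam, moveUpper]
    · rw [Submodule.mem_comap, ← Submodule.neg_mem_iff]
      simp [flipParam_apply, Vec.toParam, moveLower]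
  · have hzero : ∀ p ∈ intrinsicInterior ℝ C, p.2 = 0 := fun p hp =>
      X.eq_zero_of_eq_zero hΩ hC.1 hq hl hp
    refine ⟨.rigid, X.cellDim_eq_zero hc hC hdim hq hl, X.generically hc hC hdim fun p hp _ => ?_⟩
    obtain ⟨a, b, hab⟩ := X.exists_isRigidFourValent hc hC hdim hp (hzero p hp)
    exact hab.inTable
  · have hpos : ∀ p ∈ intrinsicInterior ℝ C, 0 < p.2 := fun p hp => by
      simpa using X.pos_of_pos hΩ hC.1 hq (σ := 1) (by simpa using hl) hp
    obtain ⟨π, hπ⟩ := exists_moves hrank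
    refine ⟨π, movesBy_of_moves (σ := 1) (Or.inl rfl) (fun p hp => ?_) rfl ?_ ?_ hπ,
      X.generically hc hC hdim fun p hp h => h.inTable_of_pos (hpos p hp) hπ⟩
    · rw [abs_of_pos (hpos p hp), one_mul]
    · simp [Vec.toParam, moveUpper]
    · simp [Vec.toParam, moveLower]

/-- In dimension zero every bounded cell is a single point of maximal dimension, so the analysis of
maximal cells applies to each four-valent member. -/
theorem PolyStructure.fourValent (hc : IsSmooth c) (hX : X.boundedDim = 0) (hC : C ∈ X.bounded)
    (hq : q ∈ C) (h0 : q.2 = 0) : FourValentConfiguration c q := by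
  have hdim : cellDim C = 0 := Nat.le_zero.1 ((X.cellDim_le hC).trans hX.le)
  obtain ⟨p, hp⟩ := Set.Nonempty.intrinsicInterior (X.polyhedron C hC.1).convex ⟨q, hq⟩
  have hpq := sub_mem_vectorSpan (intrinsicInterior_subset hp) hq
  rw [Submodule.finrank_eq_zero.1 hdim, Submodule.mem_bot, sub_eq_zero] at hpq
  subst hpq
  obtain ⟨a, b, hab⟩ := X.exists_isRigidFourValent hc hC (hdim.trans hX.symm) hp h0
  exact hab.fourValentConfiguration

end Main

end TropTritangent

end

theorem mainTheorem9
    (c : TropTritangent.Expo → ℝ) (hc : TropTritangent.IsSmooth c)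
    (q₀ : TropTritangent.Param) (hq₀ : TropTritangent.IsTritangent c q₀)
    (X : TropTritangent.PolyStructure c (TropTritangent.tritangentClass c q₀))
    (hX : X.boundedDim ≤ 2) :
    (∀ C ∈ X.bounded, TropTritangent.cellDim C = X.boundedDim →
      ∃ π : TropTritangent.Movement, TropTritangent.MovesBy C π ∧
        TropTritangent.Generically C
          (fun q => TropTritangent.InTableUpToSymmetry c q π)) ∧
    (X.boundedDim = 0 → ∀ C ∈ X.bounded, ∀ q ∈ C, q.2 = 0 →
      TropTritangent.FourValentConfiguration c q) := by
  exact ⟨fun C hC hdim => X.classification hc hX hC hdim,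
    fun h0 C hC q hq hl => X.fourValent hc h0 hC hq hl⟩
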